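/- Consider eight unit masses at $(\pm q_1,\pm q_2,\pm q_3)\in\mathbb R^3$ under Newtonian attraction with $G=1$. In the coordinates $q_i=Q_i^2$, $p_i=P_i/(2Q_i)$, with the time change $dt=Q_1^2Q_2^2Q_3^2\,ds$ and energy $E=-1$, the collisions in the planes $q_i=0$ are regularized and the motion is governed by the Hamiltonian $$\Gamma=P_1^2Q_2^2Q_3^2+Q_1^2P_2^2Q_3^2+Q_1^2Q_2^2P_3^2-2Q_1^2Q_2^2Q_3^2\Big(\tfrac1{\sqrt{Q_1^4+Q_2^4+Q_3^4}}+\tfrac1{\sqrt{Q_1^4+Q_2^4}}+\tfrac1{\sqrt{Q_1^4+Q_3^4}}+\tfrac1{\sqrt{Q_2^4+Q_3^4}}\Big)-2Q_2^2Q_3^2-2Q_1^2Q_3^2-2Q_1^2Q_2^2-E\,Q_1^2Q_2^2Q_3^2 .$$ **Theorem.** Let $E=-1$. There are $\alpha,\beta,\tau>0$ with $|\alpha-3.100685|<5\cdot10^{-4}$, $|\beta-0.668162|<5\cdot10^{-4}$, $|12\tau-0.124736|<5\cdot10^{-6}$ and a solution $\gamma=(Q_1,Q_2,Q_3,P_1,P_2,P_3)$,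 $s\in\mathbb R$, of $\gamma'=J\nabla\Gamma(\gamma)$, $J=\begin{bmatrix}0&I\\-I&0\end{bmatrix}$, along which no two of the $Q_i$ vanish at the same time, such that $$\gamma(0)=(0,\alpha,\alpha,\sqrt2,-\beta,\beta),\qquad \gamma(2\tau)=(\alpha,0,\alpha,\beta,-\sqrt2,-\beta),$$ $6\tau$ is the first positive zero of $Q_1$, and $\gamma$ is periodic with least period $12\tau$ (the cubic collision orbit). This orbit is linearly stable: if $X$ solves $X'=J\,D^2\Gamma(\gamma(s))X$, $X(0)=I$, then all eigenvalues of the monodromy matrix $X(12\tau)$ have modulus $1$, the eigenvalue $1$ has algebraic multiplicity exactly two (the one pair that comes from the conserved Hamiltonian), and all other eigenvalues are simple. Moreover, put $\delta=\sqrt2/2$, $$Y_0=\begin{bmatrix}1&0&0&0&0&0\\0&0&-\delta&0&\delta&0\\0&0&\delta&0&\delta&0\\0&0&0&1&0&0\\0&-\delta&0&0&0&-\delta\\0&-\delta&0&0&0&\delta\end{bmatrix},\quad A_f=\begin{bmatrix}0&0&1\\-1&0&0\\0&1&0\end{bmatrix},\quad A_r=\begin{bmatrix}0&1&0\\1&0&0\\0&0&1\end{bmatrix},$$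 $S_f=\operatorname{diag}(A_f,A_f)$, $S_r=\operatorname{diag}(A_r,-A_r)$, $B=X(\tau)Y_0$ and $W=Y_0^{-1}S_f^TS_rY_0B^{-1}S_rB$ (the matrices $Y_0$ and $B$ are invertible). Then $X(12\tau)=Y_0W^6Y_0^{-1}$ and $\tfrac12(W+W^{-1})=\operatorname{diag}(K^T,K)$ for a real $3\times3$ matrix $K$ with first row $(1,0,0)$, whose lower-right $2\times2$ block has real eigenvalues $\lambda_1,\lambda_2$ with $|\lambda_1-0.1836|<10^{-3}$ and $|\lambda_2+0.959|<10^{-3}$. -/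

import Mathlib

open Matrix

noncomputable section

namespace CubicOrbit

/-! ### Phase space and Hamiltonian systems with three degrees of freedom -/

/-- Indices of the six coordinates: `Sum.inl i` is the position coordinate `Q_{i+1}`,
`Sum.inr i` is the momentum coordinate `P_{i+1}`. -/
abbrev Idx : Type := Fin 3 ⊕ Fin 3

/-- The phase space `ℝ⁶`, with points `(Q₁, Q₂, Q₃, P₁, P₂, P₃)`. -/
abbrev Phase : Type := Idx → ℝ

/-- The point `(Q₁, Q₂, Q₃, P₁, P₂, P₃)`. -/
def point (Q₁ Q₂ Q₃ P₁ P₂ P₃ : ℝ) : Phase := Sum.elim ![Q₁, Q₂, Q₃] ![P₁, P₂, P₃]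

/-- The symplectic matrix `J = [[0, I], [-I, 0]]`. -/
def symJ : Matrix Idx Idx ℝ := fromBlocks 0 1 (-1) 0

/-- The gradient of `H`. -/
def grad (H : Phase → ℝ) (x : Phase) : Phase :=
  fun i => fderiv ℝ H x (Pi.single i 1)

/-- The Hessian matrix `D²H`. -/
def hess (H : Phase → ℝ) (x : Phase) : Matrix Idx Idx ℝ :=
  Matrix.of fun i j => fderiv ℝ (fun y => grad H y i) x (Pi.single j 1)

/-- `γ` is a solution, defined for all times, of the Hamiltonian system
`Q' = ∂H/∂P`, `P' = -∂H/∂Q` (that is, `γ' = J ∇H(γ)`), which stays in the region `D`. -/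
def IsHamSolution (H : Phase → ℝ) (D : Set Phase) (γ : ℝ → Phase) : Prop :=
  ∀ s : ℝ, γ s ∈ D ∧ HasDerivAt γ (symJ *ᵥ grad H (γ s)) s

/-- `X` is the fundamental matrix solution of the linearization along `γ`:
`X' = J D²H(γ(s)) X` with `X(0) = I` (the derivative is taken entry by entry). -/
def IsFundamentalSolution (H : Phase → ℝ) (γ : ℝ → Phase) (X : ℝ → Matrix Idx Idx ℝ) : Prop :=
  X 0 = 1 ∧ ∀ (s : ℝ) (i j : Idx),
    HasDerivAt (fun t => X t i j) ((symJ * hess H (γ s) * X s) i j) s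

/-- The spectral condition of linear stability for a monodromy matrix `M`, when `k` first integrals
are left in the system: all complex eigenvalues have modulus one, all eigenvalues different from `1`
are simple (as roots of the characteristic polynomial), and the eigenvalue `1` occurs in exactly
`k` pairs. -/
def LinearlyStable (k : ℕ) (M : Matrix Idx Idx ℝ) : Prop :=
  (∀ μ : ℂ, (M.map (algebraMap ℝ ℂ)).charpoly.IsRoot μ →
    ‖μ‖ = 1 ∧ (μ ≠ 1 → (M.map (algebraMap ℝ ℂ)).charpoly.rootMultiplicity μ = 1)) ∧
  (M.map (algebraMap ℝ ℂ)).charpoly.rootMultiplicity 1 = 2 * k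

/-! ### The regularized Hamiltonian of the cubic configuration -/

/-- The regularized Hamiltonian `Γ` at energy `E`. -/
def regHam (E : ℝ) (x : Phase) : ℝ :=
  let Q₁ := x (Sum.inl 0)
  let Q₂ := x (Sum.inl 1)
  let Q₃ := x (Sum.inl 2)
  let P₁ := x (Sum.inr 0)
  let P₂ := x (Sum.inr 1)
  let P₃ := x (Sum.inr 2)
  P₁ ^ 2 * Q₂ ^ 2 * Q₃ ^ 2 + Q₁ ^ 2 * P₂ ^ 2 * Q₃ ^ 2 + Q₁ ^ 2 * Q₂ ^ 2 * P₃ ^ 2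
    - 2 * Q₁ ^ 2 * Q₂ ^ 2 * Q₃ ^ 2 / √(Q₁ ^ 4 + Q₂ ^ 4 + Q₃ ^ 4)
    - 2 * Q₁ ^ 2 * Q₂ ^ 2 * Q₃ ^ 2 / √(Q₁ ^ 4 + Q₂ ^ 4)
    - 2 * Q₁ ^ 2 * Q₂ ^ 2 * Q₃ ^ 2 / √(Q₁ ^ 4 + Q₃ ^ 4)
    - 2 * Q₁ ^ 2 * Q₂ ^ 2 * Q₃ ^ 2 / √(Q₂ ^ 4 + Q₃ ^ 4)
    - 2 * Q₂ ^ 2 * Q₃ ^ 2 - 2 * Q₁ ^ 2 * Q₃ ^ 2 - 2 * Q₁ ^ 2 * Q₂ ^ 2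
    - E * Q₁ ^ 2 * Q₂ ^ 2 * Q₃ ^ 2

/-- The points of phase space where at most one `Q_i` vanishes (collisions are at most
simultaneous binary collisions in one coordinate plane). Here `Γ` is smooth. -/
def regDomain : Set Phase :=
  {x | ∀ i j : Fin 3, i ≠ j → x (Sum.inl i) ≠ 0 ∨ x (Sum.inl j) ≠ 0}

/-- The eight bodies, indexed by the signs of their coordinates. -/
abbrev Body : Type := ℤˣ × ℤˣ × ℤˣ

/-- The distance between the bodies `a` and `b` placed at `(±q₁, ±q₂, ±q₃)`. -/
def bodyDist (q₁ q₂ q₃ : ℝ) (a b : Body) : ℝ :=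
  √((((a.1 : ℤ) : ℝ) * q₁ - ((b.1 : ℤ) : ℝ) * q₁) ^ 2
    + (((a.2.1 : ℤ) : ℝ) * q₂ - ((b.2.1 : ℤ) : ℝ) * q₂) ^ 2
    + (((a.2.2 : ℤ) : ℝ) * q₃ - ((b.2.2 : ℤ) : ℝ) * q₃) ^ 2)

/-- The Newtonian potential `U` of eight unit masses at `(±q₁, ±q₂, ±q₃)`: the sum over the
28 unordered pairs of the inverse distances. -/
def newtonU (q₁ q₂ q₃ : ℝ) : ℝ :=
  (1 / 2) * ∑ a : Body, ∑ b : Body, if a = b then 0 else 1 / bodyDist q₁ q₂ q₃ a b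

lemma newtonU_eq (q₁ q₂ q₃ : ℝ) (h₁ : 0 < q₁) (h₂ : 0 < q₂) (h₃ : 0 < q₃) :
    newtonU q₁ q₂ q₃ = 2 / √(q₁ ^ 2 + q₂ ^ 2 + q₃ ^ 2) + 2 / √(q₁ ^ 2 + q₂ ^ 2)
      + 2 / √(q₁ ^ 2 + q₃ ^ 2) + 2 / √(q₂ ^ 2 + q₃ ^ 2) + 2 / q₁ + 2 / q₂ + 2 / q₃ := by
  have e4 : ∀ y : ℝ, √(4 * y) = 2 * √y := by
    intro y
    rw [Real.sqrt_mul (by norm_num), show (4 : ℝ) = 2 ^ 2 by norm_num,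
      Real.sqrt_sq (by norm_num)]
  have s1 : √(q₁ ^ 2) = q₁ := Real.sqrt_sq h₁.le
  have s2 : √(q₂ ^ 2) = q₂ := Real.sqrt_sq h₂.le
  have s3 : √(q₃ ^ 2) = q₃ := Real.sqrt_sq h₃.le
  have hu : (Finset.univ : Finset ℤˣ) = {1, -1} := by decide
  have hd : ((1 : ℤˣ) = -1) = False := by simp
  have hd' : ((-1 : ℤˣ) = 1) = False := by simp
  have hn : (1 : ℤˣ) ∉ ({-1} : Finset ℤˣ) := by decide
  have sq2 : ∀ y : ℝ, (y - -y) ^ 2 = 4 * y ^ 2 := by intro y; ring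
  have sq2' : ∀ y : ℝ, (-y - y) ^ 2 = 4 * y ^ 2 := by intro y; ring
  simp only [newtonU, bodyDist, Fintype.sum_prod_type, hu, Finset.sum_insert hn,
    Finset.sum_singleton, Prod.mk.injEq, hd, hd', and_true, and_false,
    if_true, if_false, Units.val_one, Units.val_neg, Int.cast_one, Int.cast_neg,
    one_mul, neg_mul, sub_self, sq2, sq2', ne_eq, OfNat.ofNat_ne_zero, not_false_eq_true,
    zero_pow, zero_add, add_zero, ← mul_add, e4, s1, s2, s3]
  field_simp
  ring

/-- Where no `Q_i` vanishes, `Γ = Q₁²Q₂²Q₃² (K - U - E)`, with `K = 4(p₁² + p₂² + p₃²)` the kinetic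
energy of the eight bodies, `q_i = Q_i²` and `p_i = P_i / (2 Q_i)`. -/
lemma regHam_eq (E Q₁ Q₂ Q₃ P₁ P₂ P₃ : ℝ) (h₁ : Q₁ ≠ 0) (h₂ : Q₂ ≠ 0) (h₃ : Q₃ ≠ 0) :
    regHam E (point Q₁ Q₂ Q₃ P₁ P₂ P₃) = Q₁ ^ 2 * Q₂ ^ 2 * Q₃ ^ 2 *
      (4 * ((P₁ / (2 * Q₁)) ^ 2 + (P₂ / (2 * Q₂)) ^ 2 + (P₃ / (2 * Q₃)) ^ 2)
        - newtonU (Q₁ ^ 2) (Q₂ ^ 2) (Q₃ ^ 2) - E) := by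
  rw [newtonU_eq _ _ _ (by positivity) (by positivity) (by positivity)]
  simp only [regHam, point, Sum.elim_inl, Sum.elim_inr, Matrix.cons_val_zero,
    Matrix.cons_val_one, Matrix.cons_val, ← pow_mul, Nat.reduceMul]
  field_simp
  ring

/-! ### The cubic orbit -/

/-- `γ` is a cubic orbit at energy `E` with parameters `α, β, τ > 0`: it solves the regularized
system for all times, starts at the collision `(0, α, α, √2, -β, β)`, reaches the collision
`(α, 0, α, β, -√2, -β)` at time `2τ`, and `6τ` is the first positive time with `Q₁ = 0`. -/
def IsCubicOrbit (E α β τ : ℝ) (γ : ℝ → Phase) : Prop :=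
  0 < α ∧ 0 < β ∧ 0 < τ ∧
  IsHamSolution (regHam E) regDomain γ ∧
  γ 0 = point 0 α α (√2) (-β) β ∧
  γ (2 * τ) = point α 0 α β (-√2) (-β) ∧
  IsLeast {s : ℝ | 0 < s ∧ γ s (Sum.inl 0) = 0} (6 * τ)

/-! ### The matrices of the symmetry reduction -/

/-- The time-preserving symmetry `S_f`. -/
def Sf : Matrix Idx Idx ℝ :=
  fromBlocks !![0, 0, 1; -1, 0, 0; 0, 1, 0] 0 0 !![0, 0, 1; -1, 0, 0; 0, 1, 0]

/-- The time-reversing symmetry `S_r`. -/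
def Sr : Matrix Idx Idx ℝ :=
  fromBlocks !![0, 1, 0; 1, 0, 0; 0, 0, 1] 0 0 !![0, -1, 0; -1, 0, 0; 0, 0, -1]

/-- The initial matrix `Y₀`, with `δ = √2 / 2`. -/
def Y₀ : Matrix Idx Idx ℝ :=
  let δ : ℝ := √2 / 2
  fromBlocks
    !![1, 0, 0; 0, 0, -δ; 0, 0, δ] !![0, 0, 0; 0, δ, 0; 0, δ, 0]
    !![0, 0, 0; 0, -δ, 0; 0, -δ, 0] !![1, 0, 0; 0, 0, -δ; 0, 0, δ]

/-- `W = Y₀⁻¹ S_fᵀ S_r Y₀ B⁻¹ S_r B`. -/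
def reducedMatrix (B : Matrix Idx Idx ℝ) : Matrix Idx Idx ℝ :=
  Y₀⁻¹ * Sfᵀ * Sr * Y₀ * B⁻¹ * Sr * B

end CubicOrbit

end

/-! The symmetries reduce everything to a twelfth of the orbit. Suppose the solution from `(0, α, α,
√2, -β, β)` reaches the fixed space of the reversing symmetry `S_r` at time `τ`, that is, `Q₁ = Q₂`,
`P₁ = -P₂`, `P₃ = 0`. Reflecting it by `S_r` extends it to `[0, 2τ]`, where it arrives at `S_r γ(0)
= S_f γ(0)`; from there `S_f` continues it. Since `S_f³ = -1` and `S_f⁶ = 1`, the result has period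
`12τ`. Signs of the coordinates on the first twelfth give the first zero of `Q₁` and the minimality
of the period.

Existence of the twelfth is a shooting problem: three equations for `α`, `β` and the time scale `σ`,
an additional constant unknown that makes the twelfth the fixed interval of four pieces `[-1, 1]` in
the local time. Stored polynomials approximate the orbit and five of its variations on each piece.
With the reciprocal distances as extra variables `R`, which satisfy `∂R = -2 Q³ R³`, the vector
field and its derivative are polynomials, so the defects of the approximations are polynomials in
the local time. Their coefficients are bounded by exact integer arithmetic, each polynomial being
packed into one integer (`Packed.Rep.abs_le`, `PieceData.isApprox_of_check`). Grönwall's inequality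
turns small defects into true solutions nearby (`exists_solution_near`, `exists_tracks`), into
control of the dependence on the initial value (`norm_final_sub_le`) and into control of the
linearized flow (`norm_variation_sub_le`). A simplified Newton map is then a contraction on a tiny
ball, and its fixed point is the orbit (`exists_shooting`, `exists_twelfthOrbit`,
`TwelfthOrbit.exists_orbit`).

For stability, the same symmetries applied to the linearized flow give `X(12τ) = Y₀ W⁶ Y₀⁻¹`. The
columns of `Y₀` form a symplectic eigenbasis of the involution `S_fᵀ S_r`, so `W = D C` with the
involutions `D = diag(-1, 1)` and `C = B⁻¹ S_r B`. Hence `W⁻¹ = D W D`, the sum `W + W⁻¹` commutes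
with `D` and is block diagonal, and since `B` is symplectic and `S_r` antisymplectic its blocks are
transposes of each other (`half_reducedMatrix_add_inv`). The flow direction at the collision is the
first column of `Y₀`, and at time `τ` it is reversed by `S_r`; this makes the first row of `K`
exactly `(1, 0, 0)` (`TwelfthOrbit.kMat_zero`). The remaining block is known numerically and has
eigenvalues `cos φ` near `0.183` and `-0.959`.

The characteristic polynomial of `W⁶` is therefore the product of `X² - c X + 1` over the three
values `c = 2 cos 6φ`, obtained by `c ↦ c² - 2` followed by `c ↦ c³ - 3c` (`charpoly_pow_six`). One
value is exactly `2`, which accounts for the double eigenvalue `1`; the others are distinct and lie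
in `(-2, 2)`, which gives four simple eigenvalues on the unit circle (`linearlyStable_of_charpoly`).
-/

noncomputable section

namespace CubicOrbit

/-! ### Differential polynomials -/

/-- Polynomials with integer coefficients in countably many variables, as lists of terms: a
coefficient and a word of variables. -/
abbrev WPoly : Type := List (ℤ × List ℕ)

namespace WPoly

/-- Evaluation at real numbers. -/
def evalR (v : ℕ → ℝ) (p : WPoly) : ℝ := (p.map fun m => (m.1 : ℝ) * (m.2.map v).prod).sum

/-- Evaluation in a type with addition and multiplication; `c` embeds the coefficients. -/
def eval {R : Type*} [Mul R] [Add R] (c : ℤ → R) (v : ℕ → R) (p : WPoly) : R :=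
  p.foldr (fun m acc => c m.1 * m.2.foldr (fun k a => v k * a) (c 1) + acc) (c 0)

lemma evalR_nil (v : ℕ → ℝ) : evalR v [] = 0 := rfl

lemma evalR_cons (v : ℕ → ℝ) (m : ℤ × List ℕ) (p : WPoly) :
    evalR v (m :: p) = m.1 * (m.2.map v).prod + evalR v p := by
  simp [evalR]

lemma evalR_append (v : ℕ → ℝ) (p q : WPoly) : evalR v (p ++ q) = evalR v p + evalR v q := by
  simp [evalR]

/-- Evaluation is compatible with every relation that the operations preserve. -/
lemma rel_eval {R : Type*} [Mul R] [Add R] {c : ℤ → R} {V : ℕ → R} {v v' : ℕ → ℝ}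
    (r : ℝ → ℝ → R → Prop) (hc : ∀ n : ℤ, r n n (c n))
    (hadd : ∀ x x' y y' a b, r x x' a → r y y' b → r (x + y) (x' + y') (a + b))
    (hmul : ∀ x x' y y' a b, r x x' a → r y y' b → r (x * y) (x' * y') (a * b))
    {n : ℕ} (hv : ∀ k < n, r (v k) (v' k) (V k)) (p : WPoly)
    (hp : p.all fun m => m.2.all fun k => k.blt n) :
    r (evalR v p) (evalR v' p) (eval c V p) := by
  induction p with
  | nil => simpa [evalR, eval] using hc 0
  | cons m p ih =>
    rw [List.all_cons, Bool.and_eq_true] at hp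
    rw [evalR_cons, evalR_cons]
    refine hadd _ _ _ _ _ _ (hmul _ _ _ _ _ _ (hc m.1) ?_) (ih hp.2)
    have hm : m.2.all fun k => k.blt n := hp.1
    generalize m.2 = w at hm
    induction w with
    | nil => simpa using hc 1
    | cons k w ihw =>
      rw [List.all_cons, Bool.and_eq_true] at hm
      exact hmul _ _ _ _ _ _ (hv k (by simpa using hm.1)) (ihw hm.2)

/-- Merging a term into a polynomial. -/
def insertTerm (m : ℤ × List ℕ) : WPoly → WPoly
  | [] => [m]
  | a :: p => bif m.2 == a.2 then (m.1 + a.1, a.2) :: p else a :: insertTerm m p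

/-- Insertion into a sorted word. -/
def insertVar (k : ℕ) : List ℕ → List ℕ
  | [] => [k]
  | a :: w => bif k.ble a then k :: a :: w else a :: insertVar k w

/-- The normal form: words sorted, terms with the same word merged. -/
def norm (p : WPoly) : WPoly :=
  p.foldr (fun m acc => insertTerm (m.1, m.2.foldr insertVar []) acc) []

lemma evalR_insertTerm (v : ℕ → ℝ) (m : ℤ × List ℕ) (p : WPoly) :
    evalR v (insertTerm m p) = m.1 * (m.2.map v).prod + evalR v p := by
  induction p with
  | nil => simp [insertTerm, evalR]
  | cons a p ih =>
    unfold insertTerm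
    by_cases h : m.2 = a.2
    · simp only [h, beq_self_eq_true, cond_true, evalR_cons]
      push_cast
      ring
    · have h' : (m.2 == a.2) = false := by simpa using h
      simp only [h', cond_false, evalR_cons, ih]
      ring

lemma prod_insertVar (v : ℕ → ℝ) (k : ℕ) (w : List ℕ) :
    ((insertVar k w).map v).prod = v k * (w.map v).prod := by
  induction w with
  | nil => simp [insertVar]
  | cons a w ih =>
    unfold insertVar
    cases k.ble a
    · simp only [cond_false, List.map_cons, List.prod_cons, ih]; ring
    · simp

lemma evalR_norm (v : ℕ → ℝ) (p : WPoly) : evalR v (norm p) = evalR v p := by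
  induction p with
  | nil => rfl
  | cons m p ih =>
    have hw : ∀ w : List ℕ, ((w.foldr insertVar []).map v).prod = (w.map v).prod := by
      intro w
      induction w with
      | nil => rfl
      | cons k w ihw => simp [prod_insertVar, ihw]
    have : norm (m :: p) = insertTerm (m.1, m.2.foldr insertVar []) (norm p) := rfl
    rw [this, evalR_insertTerm, ih, evalR_cons, hw]

end WPoly

/-! ### The variables `Q₁, Q₂, Q₃, P₁, P₂, P₃, σ, R₁₂₃, R₁₂, R₁₃, R₂₃` -/

/-- Whether the reciprocal distance with index `k` depends on `Q_{i+1}`. -/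
def dependsOn (k i : ℕ) : Bool :=
  match k with
  | 7 => i.ble 2
  | 8 => i == 0 || i == 1
  | 9 => i == 0 || i == 2
  | 10 => i == 1 || i == 2
  | _ => false

/-- The derivative of the variable `k` in the direction `i`. -/
def dVar (i k : ℕ) : WPoly :=
  bif k.ble 6 then (bif k == i then [(1, [])] else [])
  else bif dependsOn k i then [(-2, [i, i, i, k, k, k])] else []

namespace WPoly

/-- The derivative of a word. -/
def dWord (i : ℕ) : List ℕ → WPoly
  | [] => []
  | k :: w => (dVar i k).map (fun m => (m.1, m.2 ++ w)) ++ (dWord i w).map (fun m => (m.1, k :: m.2))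

/-- The derivative in the direction `i`. -/
def deriv (i : ℕ) (p : WPoly) : WPoly :=
  p.flatMap fun m => (dWord i m.2).map fun n => (m.1 * n.1, n.2)

lemma evalR_map_append (v : ℕ → ℝ) (p : WPoly) (w : List ℕ) :
    evalR v (p.map fun m => (m.1, m.2 ++ w)) = evalR v p * (w.map v).prod := by
  induction p with
  | nil => simp [evalR]
  | cons m p ih => simp only [List.map_cons, evalR_cons, ih, List.map_append, List.prod_append]; ring

lemma evalR_map_cons (v : ℕ → ℝ) (p : WPoly) (k : ℕ) :
    evalR v (p.map fun m => (m.1, k :: m.2)) = v k * evalR v p := by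
  induction p with
  | nil => simp [evalR]
  | cons m p ih => simp only [List.map_cons, evalR_cons, ih, List.prod_cons]; ring

lemma evalR_map_mul (v : ℕ → ℝ) (p : WPoly) (c : ℤ) :
    evalR v (p.map fun n => (c * n.1, n.2)) = c * evalR v p := by
  induction p with
  | nil => simp [evalR]
  | cons m p ih => simp only [List.map_cons, evalR_cons, ih]; push_cast; ring

lemma evalR_dWord_cons (v : ℕ → ℝ) (i k : ℕ) (w : List ℕ) :
    evalR v (dWord i (k :: w)) = evalR v (dVar i k) * (w.map v).prod + v k * evalR v (dWord i w) := by
  rw [dWord, evalR_append, evalR_map_append, evalR_map_cons]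

lemma evalR_deriv_cons (v : ℕ → ℝ) (i : ℕ) (m : ℤ × List ℕ) (p : WPoly) :
    evalR v (deriv i (m :: p)) = m.1 * evalR v (dWord i m.2) + evalR v (deriv i p) := by
  rw [deriv, List.flatMap_cons, evalR_append, evalR_map_mul]; rfl

/-- Multiplication by an integer and a variable. -/
def mulVar (c : ℤ) (k : ℕ) (p : WPoly) : WPoly := p.map fun m => (c * m.1, k :: m.2)

lemma evalR_mulVar (v : ℕ → ℝ) (c : ℤ) (k : ℕ) (p : WPoly) :
    evalR v (mulVar c k p) = c * v k * evalR v p := by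
  induction p with
  | nil => simp [mulVar, evalR]
  | cons m p ih =>
    have h : mulVar c k (m :: p) = (c * m.1, k :: m.2) :: mulVar c k p := rfl
    rw [h, evalR_cons, evalR_cons, ih, List.map_cons, List.prod_cons]
    push_cast
    ring

/-- When variable `k` is constant in the direction `i`, Leibniz's rule leaves one term. This is used
with `k = 6`, the time scale, so that the phase space derivatives of the field are `σ` times second
derivatives of the Hamiltonian. -/
lemma evalR_deriv_mulVar (v : ℕ → ℝ) (c : ℤ) (i k : ℕ) (p : WPoly) (h : dVar i k = []) :
    evalR v (deriv i (mulVar c k p)) = c * v k * evalR v (deriv i p) := by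
  induction p with
  | nil => simp [deriv, evalR, mulVar]
  | cons m p ih =>
    have h' : mulVar c k (m :: p) = (c * m.1, k :: m.2) :: mulVar c k p := rfl
    rw [h', evalR_deriv_cons, ih, evalR_dWord_cons, h, evalR_deriv_cons]
    simp only [evalR_nil]
    push_cast
    ring

end WPoly

/-- The linear form with the given coefficients. -/
def linForm (g : Fin 7 → ℝ) : (Fin 7 → ℝ) →L[ℝ] ℝ :=
  ∑ j, g j • ContinuousLinearMap.proj (R := ℝ) (φ := fun _ : Fin 7 => ℝ) j

lemma linForm_apply (g x : Fin 7 → ℝ) : linForm g x = ∑ j, g j * x j := by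
  simp [linForm]

/-- If the variables are differentiable with the derivatives `dVar`, then `WPoly.deriv` computes the
partial derivatives. -/
lemma WPoly.hasFDerivAt_evalR {v : (Fin 7 → ℝ) → ℕ → ℝ} {x : Fin 7 → ℝ}
    (hv : ∀ k, HasFDerivAt (fun y => v y k) (linForm fun j => evalR (v x) (dVar j k)) x)
    (p : WPoly) :
    HasFDerivAt (fun y => evalR (v y) p) (linForm fun j => evalR (v x) (deriv j p)) x := by
  have hw : ∀ w : List ℕ, HasFDerivAt (fun y => (w.map (v y)).prod)
      (linForm fun j => evalR (v x) (dWord j w)) x := by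
    intro w
    induction w with
    | nil =>
      have : (linForm fun j : Fin 7 => evalR (v x) (dWord j [])) = 0 := by
        ext y; simp [linForm_apply, dWord, evalR]
      rw [this]
      simpa using hasFDerivAt_const (1 : ℝ) x
    | cons k w ih =>
      have h := (hv k).mul ih
      simp only [List.map_cons, List.prod_cons]
      refine h.congr_fderiv ?_
      ext y
      simp only [linForm_apply, _root_.add_apply, _root_.smul_apply,
        smul_eq_mul, Finset.mul_sum, ← Finset.sum_add_distrib]
      refine Finset.sum_congr rfl fun j _ => ?_
      rw [evalR_dWord_cons]
      ring
  induction p with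
  | nil =>
    have : (linForm fun j : Fin 7 => evalR (v x) (deriv j [])) = 0 := by
      ext y; simp [linForm_apply, deriv, evalR]
    rw [this]
    simpa [evalR_nil] using hasFDerivAt_const (0 : ℝ) x
  | cons m p ih =>
    have h := ((hw m.2).const_mul (m.1 : ℝ)).add ih
    simp only [evalR_cons]
    refine h.congr_fderiv ?_
    ext y
    simp only [linForm_apply, _root_.add_apply, _root_.smul_apply,
      smul_eq_mul, Finset.mul_sum, ← Finset.sum_add_distrib]
    refine Finset.sum_congr rfl fun j _ => ?_
    rw [evalR_deriv_cons]
    ring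

/-! ### Polynomials in one variable, packed into one integer -/

/-- The value at `x` of the polynomial with the given coefficients, and the value of its
derivative. -/
def polyPair {R : Type*} [Add R] [Mul R] (c : ℤ → R) (x : R) (l : List ℤ) : R × R :=
  l.foldr (fun n a => (c n + x * a.1, a.1 + x * a.2)) (c 0, c 0)

/-- The real polynomial function with coefficients `l`. -/
def polyFun (l : List ℤ) (t : ℝ) : ℝ := (polyPair (fun n : ℤ => (n : ℝ)) t l).1

/-- The derivative of `polyFun l`. -/
def polyDer (l : List ℤ) (t : ℝ) : ℝ := (polyPair (fun n : ℤ => (n : ℝ)) t l).2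

lemma polyFun_cons (n : ℤ) (l : List ℤ) (t : ℝ) : polyFun (n :: l) t = n + t * polyFun l t := rfl

lemma polyDer_cons (n : ℤ) (l : List ℤ) (t : ℝ) :
    polyDer (n :: l) t = polyFun l t + t * polyDer l t := rfl

lemma hasDerivAt_polyFun (l : List ℤ) (t : ℝ) : HasDerivAt (polyFun l) (polyDer l t) t := by
  induction l with
  | nil =>
    have h1 : polyFun [] = fun _ => 0 := by ext t; simp [polyFun, polyPair]
    have h2 : polyDer [] t = 0 := by simp [polyDer, polyPair]
    rw [h1, h2]
    exact hasDerivAt_const t 0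
  | cons n l ih =>
    have h := ((hasDerivAt_id t).mul ih).const_add (n : ℝ)
    exact h.congr_deriv (by simp [polyDer_cons])

/-- The sum of the absolute values of the coefficients. -/
def absSum (l : List ℤ) : ℕ := (l.map Int.natAbs).sum

lemma abs_polyFun_le (l : List ℤ) {t : ℝ} (ht : |t| ≤ 1) : |polyFun l t| ≤ absSum l := by
  induction l with
  | nil => simp [polyFun, polyPair, absSum]
  | cons n l ih =>
    have h1 : |t * polyFun l t| ≤ absSum l := by
      rw [abs_mul]
      exact (mul_le_of_le_one_left (abs_nonneg _) ht).trans ih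
    have h2 : ((absSum (n :: l) : ℕ) : ℝ) = |(n : ℝ)| + absSum l := by
      simp [absSum, Nat.cast_natAbs]
    rw [polyFun_cons, h2]
    exact (abs_add_le _ _).trans (by linarith)

/-- The base of the packing. -/
@[irreducible] def base : ℕ := 2 ^ 2048

lemma base_pos : 0 < base := by
  unfold base
  exact Nat.two_pow_pos _

/-- A polynomial `Q / 2 ^ sc` with `Q ∈ ℤ[X]`: the value of `Q` at `base`, and a bound for the sum of
the absolute values of the coefficients of `Q`. -/
structure Packed where
  val : ℤ
  bd : ℕ
  sc : ℕ

namespace Packed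

open Polynomial

/-- The number `x` is the value at `t` of the packed polynomial. -/
def Rep (t x : ℝ) (a : Packed) : Prop :=
  ∃ Q Q' : ℤ[X], Q.eval (base : ℤ) = a.val ∧ (∀ i, |Q.coeff i| ≤ Q'.coeff i) ∧
    Q'.eval 1 ≤ a.bd ∧ aeval t Q = 2 ^ a.sc * x

instance : Mul Packed := ⟨fun a b => ⟨a.val * b.val, a.bd * b.bd, a.sc + b.sc⟩⟩

instance : Add Packed := ⟨fun a b => bif a.sc.ble b.sc then
    ⟨((2 ^ (b.sc - a.sc) : ℕ) : ℤ) * a.val + b.val, 2 ^ (b.sc - a.sc) * a.bd + b.bd, b.sc⟩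
  else ⟨a.val + ((2 ^ (a.sc - b.sc) : ℕ) : ℤ) * b.val, a.bd + 2 ^ (a.sc - b.sc) * b.bd, a.sc⟩⟩

/-- A constant. -/
def const (n : ℤ) : Packed := ⟨n, n.natAbs, 0⟩

lemma rep_const (t : ℝ) (n : ℤ) : Rep t n (const n) := by
  refine ⟨C n, C |n|, by simp [const], fun i => ?_, by simp [const], by simp [const]⟩
  rw [coeff_C, coeff_C]
  split <;> simp

/-- A coefficient of a product is a sum of products, so the majorants multiply, and evaluation at
`1` is multiplicative. The bounds thus propagate without unpacking any coefficient. -/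
lemma Rep.mul {t x y : ℝ} {a b : Packed} (ha : Rep t x a) (hb : Rep t y b) :
    Rep t (x * y) (a * b) := by
  obtain ⟨P, P', h1, h2, h3, h4⟩ := ha
  obtain ⟨Q, Q', k1, k2, k3, k4⟩ := hb
  have e0 : ∀ {P : ℤ[X]} {P' : ℤ[X]}, (∀ i, |P.coeff i| ≤ P'.coeff i) → 0 ≤ P'.eval 1 := by
    intro P P' h
    rw [eval_eq_sum_range]
    exact Finset.sum_nonneg fun i _ => by simpa using (abs_nonneg _).trans (h i)
  refine ⟨P * Q, P' * Q', by rw [eval_mul, h1, k1]; rfl, fun i => ?_, ?_, ?_⟩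
  · rw [coeff_mul, coeff_mul]
    refine (Finset.abs_sum_le_sum_abs _ _).trans (Finset.sum_le_sum fun p _ => ?_)
    rw [abs_mul]
    exact mul_le_mul (h2 _) (k2 _) (abs_nonneg _) ((abs_nonneg _).trans (h2 _))
  · rw [eval_mul]
    exact (mul_le_mul h3 k3 (e0 k2) (by positivity)).trans (by exact_mod_cast le_rfl)
  · rw [map_mul, h4, k4]
    change _ = 2 ^ (a.sc + b.sc) * _
    ring

/-- The number is multiplied by `1 = 2 ^ n / 2 ^ n`, which brings two summands to a common
denominator. -/
lemma Rep.scale {t x : ℝ} {a : Packed} (ha : Rep t x a) (n : ℕ) :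
    Rep t x ⟨((2 ^ n : ℕ) : ℤ) * a.val, 2 ^ n * a.bd, n + a.sc⟩ := by
  have h := Rep.mul (a := ⟨2 ^ n, 2 ^ n, n⟩) (x := 1) (t := t)
    ⟨C (2 ^ n), C (2 ^ n), by simp, fun i => by rw [coeff_C]; split <;> simp, by simp,
      by simp [map_ofNat]⟩ ha
  rw [one_mul] at h
  exact_mod_cast h

lemma Rep.add_of_eq {t x y : ℝ} {a b : Packed} (ha : Rep t x a) (hb : Rep t y b)
    (h : a.sc = b.sc) : Rep t (x + y) ⟨a.val + b.val, a.bd + b.bd, b.sc⟩ := by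
  obtain ⟨P, P', h1, h2, h3, h4⟩ := ha
  obtain ⟨Q, Q', k1, k2, k3, k4⟩ := hb
  refine ⟨P + Q, P' + Q', by rw [eval_add, h1, k1], fun i => ?_, ?_, ?_⟩
  · rw [coeff_add, coeff_add]
    exact (abs_add_le _ _).trans (add_le_add (h2 _) (k2 _))
  · rw [eval_add]
    push_cast
    exact add_le_add h3 k3
  · rw [map_add, h4, k4, h]
    ring

lemma Rep.add {t x y : ℝ} {a b : Packed} (ha : Rep t x a) (hb : Rep t y b) :
    Rep t (x + y) (a + b) := by
  change Rep t (x + y) (bif a.sc.ble b.sc then _ else _)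
  by_cases h : a.sc ≤ b.sc
  · rw [show a.sc.ble b.sc = true by simpa using h, cond_true]
    exact (ha.scale (b.sc - a.sc)).add_of_eq hb (by dsimp only; omega)
  · rw [show a.sc.ble b.sc = false by rw [← Bool.not_eq_true, Nat.ble_eq]; exact h, cond_false]
    have h' := ha.add_of_eq (hb.scale (a.sc - b.sc)) (by dsimp only; omega)
    dsimp only at h'
    rwa [show a.sc - b.sc + b.sc = a.sc by omega] at h'

/-- The packed polynomial with coefficients `l / 2 ^ k`, and its derivative. -/
def ofList (k : ℕ) (l : List ℤ) : Packed × Packed :=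
  l.foldr (fun n a => (⟨n + base * a.1.val, n.natAbs + a.1.bd, k⟩,
    ⟨a.1.val + base * a.2.val, a.1.bd + a.2.bd, k⟩)) (⟨0, 0, k⟩, ⟨0, 0, k⟩)

lemma ofList_cons (k : ℕ) (n : ℤ) (l : List ℤ) : ofList k (n :: l) =
    (⟨n + base * (ofList k l).1.val, n.natAbs + (ofList k l).1.bd, k⟩,
    ⟨(ofList k l).1.val + base * (ofList k l).2.val, (ofList k l).1.bd + (ofList k l).2.bd, k⟩) := rfl

lemma ofList_nil (k : ℕ) : ofList k [] = (⟨0, 0, k⟩, ⟨0, 0, k⟩) := rfl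

lemma rep_ofList (k : ℕ) (l : List ℤ) (t : ℝ) :
    Rep t (polyFun l t / 2 ^ k) (ofList k l).1 ∧ Rep t (polyDer l t / 2 ^ k) (ofList k l).2 := by
  -- Both components have scale `k` whatever the list is. Once this denominator is split off, the
  -- induction concerns integer polynomials only.
  suffices h : (∃ Q Q' : ℤ[X], Q.eval (base : ℤ) = (ofList k l).1.val ∧
        (∀ i, |Q.coeff i| ≤ Q'.coeff i) ∧ Q'.eval 1 ≤ (ofList k l).1.bd ∧
        aeval t Q = polyFun l t) ∧
      (∃ Q Q' : ℤ[X], Q.eval (base : ℤ) = (ofList k l).2.val ∧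
        (∀ i, |Q.coeff i| ≤ Q'.coeff i) ∧ Q'.eval 1 ≤ (ofList k l).2.bd ∧
        aeval t Q = polyDer l t) by
    have hs : (ofList k l).1.sc = k ∧ (ofList k l).2.sc = k := by cases l <;> exact ⟨rfl, rfl⟩
    obtain ⟨⟨P, P', h1, h2, h3, h4⟩, Q, Q', k1, k2, k3, k4⟩ := h
    refine ⟨⟨P, P', h1, h2, h3, ?_⟩, Q, Q', k1, k2, k3, ?_⟩
    · rw [h4, hs.1, mul_div_cancel₀ _ (by positivity)]
    · rw [k4, hs.2, mul_div_cancel₀ _ (by positivity)]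
  induction l with
  | nil =>
    refine ⟨⟨0, 0, by simp [ofList_nil], by simp, by simp [ofList_nil], ?_⟩,
      ⟨0, 0, by simp [ofList_nil], by simp, by simp [ofList_nil], ?_⟩⟩ <;>
      simp [polyFun, polyDer, polyPair]
  | cons n l ih =>
    obtain ⟨⟨P, P', h1, h2, h3, h4⟩, Q, Q', k1, k2, k3, k4⟩ := ih
    have hX : ∀ {P P' : ℤ[X]}, (∀ i, |P.coeff i| ≤ P'.coeff i) →
        ∀ i, |(X * P).coeff i| ≤ (X * P').coeff i := by
      intro P P' h i
      cases i with
      | zero => simp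
      | succ i => simpa using h i
    refine ⟨⟨C n + X * P, C |n| + X * P', ?_, fun i => ?_, ?_, ?_⟩,
      ⟨P + X * Q, P' + X * Q', ?_, fun i => ?_, ?_, ?_⟩⟩
    · simp [h1, ofList_cons]
    · rw [coeff_add, coeff_add]
      refine (abs_add_le _ _).trans (add_le_add ?_ (hX h2 i))
      rw [coeff_C, coeff_C]
      split <;> simp
    · have : (ofList k (n :: l)).1.bd = n.natAbs + (ofList k l).1.bd := rfl
      rw [this]
      push_cast
      simpa using h3
    · simp [h4, polyFun_cons]
    · simp [h1, k1, ofList_cons]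
    · rw [coeff_add, coeff_add]
      exact (abs_add_le _ _).trans (add_le_add (h2 i) (hX k2 i))
    · have : (ofList k (n :: l)).2.bd = (ofList k l).1.bd + (ofList k l).2.bd := rfl
      rw [this]
      push_cast
      simpa using add_le_add h3 k3
    · simp [h4, k4, polyDer_cons]

/-- The sum of the absolute values of the at most `2 ^ d` balanced digits in b `b`; at least
`b` if there are more digits. -/
def digitSum (b : ℕ) : ℕ → ℕ → ℕ
  | 0, N => bif (2 * N).blt b then N else b
  | d + 1, N => bif (2 * N).blt b then N else
      bif (2 * (N % b ^ (2 ^ d))).blt (b ^ (2 ^ d)) then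
        digitSum b d (N % b ^ (2 ^ d)) + digitSum b d (N / b ^ (2 ^ d))
      else digitSum b d (b ^ (2 ^ d) - N % b ^ (2 ^ d)) + digitSum b d (N / b ^ (2 ^ d) + 1)

/-- If `Q(b) = 0`, then `b` divides the constant coefficient, which is smaller than `b` in absolute
value and so vanishes. Division by `X` lowers the degree. This is the uniqueness of digits. -/
lemma eq_zero_of_eval_packed {b : ℕ} (hb : 0 < b) (Q : ℤ[X]) (hQ : ∀ i, |Q.coeff i| < b)
    (h0 : Q.eval (b : ℤ) = 0) : Q = 0 := by
  suffices h : ∀ (m : ℕ) (Q : ℤ[X]), Q.natDegree ≤ m → (∀ i, |Q.coeff i| < b) →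
      Q.eval (b : ℤ) = 0 → Q = 0 from h _ Q le_rfl hQ h0
  intro m
  induction m with
  | zero =>
    intro Q hd _ h0
    rw [eq_C_of_natDegree_le_zero hd] at h0 ⊢
    simpa using h0
  | succ m ih =>
    intro Q hd hc h0
    rw [← divX_mul_X_add Q, eval_add, eval_mul, eval_X, eval_C] at h0
    have h1 : (b : ℤ) ∣ Q.coeff 0 := ⟨-Q.divX.eval (b : ℤ), by linarith⟩
    have h2 : Q.coeff 0 = 0 := Int.eq_zero_of_abs_lt_dvd h1 (hc 0)
    have h3 : Q.divX = 0 := by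
      refine ih _ (by rw [natDegree_divX_eq_natDegree_tsub_one]; omega) (fun i => ?_) ?_
      · rw [coeff_divX]; exact hc _
      · rw [h2, add_zero] at h0
        exact (mul_eq_zero.1 h0).resolve_right (by exact_mod_cast hb.ne')
    rw [← divX_mul_X_add Q, h2, h3]
    simp

/-- Cutting off the terms below `X ^ m` leaves a low part with `|P(b)| < b ^ m / 2`: a balanced
digit satisfies `2 |c| + 1 ≤ b`, so each further digit preserves this bound. Consequently the
residue of `Q(b)` modulo `b ^ m` determines `P(b)`. -/
lemma exists_split {b : ℕ} (hb : 0 < b) (Q : ℤ[X]) (hQ : ∀ i, 2 * |Q.coeff i| < b) (m : ℕ) :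
    ∃ P R : ℤ[X], Q = P + X ^ m * R ∧ (∀ i, P.coeff i = if i < m then Q.coeff i else 0) ∧
      (∀ i, R.coeff i = Q.coeff (i + m)) ∧ 2 * |P.eval (b : ℤ)| < b ^ m := by
  induction m with
  | zero => exact ⟨0, Q, by simp, by simp, by simp, by simp⟩
  | succ m ih =>
    obtain ⟨P, R, h1, h2, h3, h4⟩ := ih
    refine ⟨P + C (R.coeff 0) * X ^ m, R.divX, ?_, fun i => ?_, fun i => ?_, ?_⟩
    · conv_lhs => rw [h1, ← divX_mul_X_add R]
      ring
    · rw [coeff_add, coeff_C_mul, coeff_X_pow, h2, h3]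
      rcases lt_trichotomy i m with h | h | h
      · simp [h, h.ne, h.trans (Nat.lt_succ_self m)]
      · simp [h]
      · simp [h.ne', not_lt.2 h.le, not_lt.2 (Nat.succ_le_of_lt h)]
    · rw [coeff_divX, h3, add_assoc, add_comm 1]
    · rw [eval_add, eval_mul, eval_C, eval_pow, eval_X, pow_succ]
      have h5 : 2 * |R.coeff 0| + 1 ≤ b := by rw [h3]; exact hQ _
      have h6 : (0 : ℤ) < b ^ m := pow_pos (by exact_mod_cast hb) _
      have h7 := abs_add_le (P.eval (b : ℤ)) (R.coeff 0 * b ^ m)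
      rw [abs_mul, abs_of_pos h6] at h7
      nlinarith

/-- The coefficients of `Q` are the balanced digits of `N` in base `b`, and their absolute sum
bounds `Q` on `[-1, 1]`. Digits are found by bisection: modulo `b ^ (2 ^ d)` the balanced residue is
the value of the low half, and the quotient, with a possible carry, is the value of the high half.
-/
lemma abs_le_digitSum {b : ℕ} (hb : 0 < b) {t : ℝ} (ht : |t| ≤ 1) (d N : ℕ) (Q : ℤ[X])
    (hQ : ∀ i, 2 * |Q.coeff i| < b) (hN : Q.eval (b : ℤ) = N)
    (h : digitSum b d N < b) : |aeval t Q| ≤ digitSum b d N := by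
  -- A value below `b / 2` is a single digit: `Q - N` has coefficients smaller than `b` and vanishes
  -- at `b`, so `Q` is constant.
  have small : ∀ (N : ℕ) (Q : ℤ[X]), (∀ i, 2 * |Q.coeff i| < b) → Q.eval (b : ℤ) = N →
      2 * N < b → |aeval t Q| ≤ N := by
    intro N Q hQ hN hlt
    have h1 : Q - C (N : ℤ) = 0 := by
      refine eq_zero_of_eval_packed hb _ (fun i => ?_) (by simp [hN])
      rw [coeff_sub, coeff_C]
      have h2 := hQ i
      have h3 := abs_sub (Q.coeff i) (if i = 0 then (N : ℤ) else 0)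
      have h4 : |if i = 0 then (N : ℤ) else 0| ≤ N := by split <;> simp
      have h5 : 2 * (N : ℤ) < b := by exact_mod_cast hlt
      linarith
    rw [sub_eq_zero.1 h1]
    simp
  induction d generalizing N Q with
  | zero =>
    rw [digitSum] at h ⊢
    by_cases hlt : 2 * N < b
    · rw [show Nat.blt (2 * N) b = true by simpa [Nat.blt_eq] using hlt, cond_true]
      exact small N Q hQ hN hlt
    · rw [show Nat.blt (2 * N) b = false by
        rw [← Bool.not_eq_true]; simpa [Nat.blt_eq] using hlt] at h
      exact absurd h (lt_irrefl _)
  | succ d ih =>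
    rw [digitSum] at h ⊢
    by_cases hlt : 2 * N < b
    · rw [show Nat.blt (2 * N) b = true by simpa [Nat.blt_eq] using hlt, cond_true]
      exact small N Q hQ hN hlt
    rw [show Nat.blt (2 * N) b = false by
      rw [← Bool.not_eq_true]; simpa [Nat.blt_eq] using hlt, cond_false] at h ⊢
    obtain ⟨P, R, h1, h2, h3, h4⟩ := exists_split hb Q hQ (2 ^ d)
    have hP : ∀ i, 2 * |P.coeff i| < b := by
      intro i
      rw [h2]
      split
      · exact hQ i
      · simpa using hb
    have hR : ∀ i, 2 * |R.coeff i| < b := fun i => by rw [h3]; exact hQ _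
    have habs : |aeval t Q| ≤ |aeval t P| + |aeval t R| := by
      rw [h1, map_add, map_mul, map_pow, aeval_X]
      refine (abs_add_le _ _).trans (add_le_add_right ?_ _)
      rw [abs_mul, abs_pow]
      exact mul_le_of_le_one_left (abs_nonneg _) (pow_le_one₀ (abs_nonneg _) ht)
    rw [h1, eval_add, eval_mul, eval_pow, eval_X] at hN
    have hM : 0 < b ^ (2 ^ d) := Nat.pow_pos hb
    have hdm := Nat.div_add_mod N (b ^ (2 ^ d))
    have hr := Nat.mod_lt N hM
    have hMc : ((b ^ (2 ^ d) : ℕ) : ℤ) = (b : ℤ) ^ (2 ^ d) := by push_cast; rfl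
    rw [← hMc] at hN h4
    generalize b ^ (2 ^ d) = M at *
    generalize N / M = q at *
    generalize N % M = r at *
    have hMZ : (0 : ℤ) < M := by exact_mod_cast hM
    have hrZ : (r : ℤ) < M := by exact_mod_cast hr
    have h4' := abs_lt.1 (show |2 * P.eval (b : ℤ)| < M by rwa [abs_mul, abs_two])
    -- `P(b)` and `r` are congruent modulo `M`, with `|P(b)| < M / 2` and `0 ≤ r < M`. So the high
    -- part `R(b)` is `q` or `q + 1`, according to whether `r` lies below or above `M / 2`.
    have hN2 : (M : ℤ) * (R.eval (b : ℤ) - q) = r - P.eval (b : ℤ) := by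
      have : (N : ℤ) = M * q + r := by exact_mod_cast hdm.symm
      rw [this] at hN
      linarith
    by_cases hlt2 : 2 * r < M
    · have e : Nat.blt (2 * r) M = true := by simpa [Nat.blt_eq] using hlt2
      rw [e, cond_true] at h ⊢
      have hlt2Z : 2 * (r : ℤ) < M := by exact_mod_cast hlt2
      have hd : R.eval (b : ℤ) - q = 0 := by
        have h1 : (M : ℤ) * (R.eval (b : ℤ) - q) < M * 1 := by rw [hN2]; omega
        have h2 : (M : ℤ) * (-1) < M * (R.eval (b : ℤ) - q) := by rw [hN2]; omega
        have := lt_of_mul_lt_mul_left h1 hMZ.le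
        have := lt_of_mul_lt_mul_left h2 hMZ.le
        omega
      rw [hd, mul_zero] at hN2
      have k1 := ih r P hP (by omega) (by omega)
      have k2 := ih q R hR (by omega) (by omega)
      push_cast
      linarith
    · have e : Nat.blt (2 * r) M = false := by
        rw [← Bool.not_eq_true]; simpa [Nat.blt_eq] using hlt2
      rw [e, cond_false] at h ⊢
      have hlt2Z : (M : ℤ) ≤ 2 * (r : ℤ) := by exact_mod_cast not_lt.1 hlt2
      have hd : R.eval (b : ℤ) - q = 1 := by
        have h1 : (M : ℤ) * (R.eval (b : ℤ) - q) < M * 2 := by rw [hN2]; omega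
        have h2 : (M : ℤ) * 0 < M * (R.eval (b : ℤ) - q) := by rw [hN2]; omega
        have := lt_of_mul_lt_mul_left h1 hMZ.le
        have := lt_of_mul_lt_mul_left h2 hMZ.le
        omega
      rw [hd, mul_one] at hN2
      -- Here `P(b) = r - M` is not positive, while the recursion handles natural numbers; `-P` is
      -- passed on, and the quotient receives the carry `1`.
      have k1 := ih (M - r) (-P) (by simpa using hP)
        (by rw [eval_neg]; push_cast [hr.le]; omega) (by omega)
      have k2 := ih (q + 1) R hR (by push_cast; omega) (by omega)
      rw [map_neg, abs_neg] at k1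
      push_cast
      linarith

/-- A bound for `2 ^ sc` times the packed polynomial on `[-1, 1]`, if it is less than `base`. -/
def sup (a : Packed) : ℕ :=
  bif (2 * a.bd).blt base then digitSum base 10 a.val.natAbs else base

/-- Two bounds play different roles. The a priori bound `bd` ignores all cancellation and is only
needed to know that the coefficients are below `b / 2`, so that they can be read off as digits. The
sum of these digits then sees the cancellation, which is what makes the defects small. Depth `10`
allows `1024` digits. -/
lemma Rep.abs_le {t x : ℝ} (ht : |t| ≤ 1) {a : Packed} (ha : Rep t x a) (h : a.sup < base) :
    |x| ≤ a.sup / 2 ^ a.sc := by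
  obtain ⟨Q, Q', h1, h2, h3, h4⟩ := ha
  unfold sup at h ⊢
  have hb := base_pos
  generalize base = b at *
  have hlt : 2 * a.bd < b := by
    by_contra hn
    rw [show Nat.blt (2 * a.bd) b = false by
      rw [← Bool.not_eq_true]; simpa [Nat.blt_eq] using hn, cond_false] at h
    exact absurd h (lt_irrefl b)
  rw [show Nat.blt (2 * a.bd) b = true by simpa [Nat.blt_eq] using hlt, cond_true] at h ⊢
  have hQ : ∀ i, 2 * |Q.coeff i| < b := by
    intro i
    -- The majorant has nonnegative coefficients, so each of them is at most their sum.
    have h5 : Q'.coeff i ≤ Q'.eval 1 := by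
      rw [eval_eq_sum_range]
      simp only [one_pow, mul_one]
      have h0 : ∀ j, 0 ≤ Q'.coeff j := fun j => (abs_nonneg _).trans (h2 j)
      by_cases hi : i ∈ Finset.range (Q'.natDegree + 1)
      · exact Finset.single_le_sum (f := fun j => Q'.coeff j) (fun j _ => h0 j) hi
      · rw [coeff_eq_zero_of_natDegree_lt (by simpa using hi)]
        exact Finset.sum_nonneg fun j _ => h0 j
    have := h2 i
    have : 2 * (a.bd : ℤ) < b := by exact_mod_cast hlt
    linarith
  have key : |aeval t Q| ≤ digitSum b 10 a.val.natAbs := by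
    rcases Int.natAbs_eq a.val with h5 | h5
    · exact abs_le_digitSum hb ht _ _ Q hQ (h1.trans h5) h
    · have := abs_le_digitSum hb ht _ _ (-Q) (by simpa using hQ) (by rw [eval_neg, h1]; omega) h
      simpa using this
  rw [h4, abs_mul, abs_of_pos (by positivity)] at key
  rwa [le_div_iff₀ (by positivity), mul_comm]

end Packed

/-! ### The vector field -/

/-- The Hamiltonian at energy `-1`. -/
def hamPoly : WPoly :=
  [(1, [1, 1, 2, 2, 3, 3]), (1, [0, 0, 2, 2, 4, 4]), (1, [0, 0, 1, 1, 5, 5]),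
    (-2, [0, 0, 1, 1, 2, 2, 7]), (-2, [0, 0, 1, 1, 2, 2, 8]), (-2, [0, 0, 1, 1, 2, 2, 9]),
    (-2, [0, 0, 1, 1, 2, 2, 10]), (-2, [1, 1, 2, 2]), (-2, [0, 0, 2, 2]), (-2, [0, 0, 1, 1]),
    (1, [0, 0, 1, 1, 2, 2])]

/-- The partial derivatives of `hamPoly`. -/
def gradTable : List WPoly := [
  [(2, [0, 1, 1, 2, 2]), (-4, [0, 1, 1]), (-4, [0, 2, 2]), (-4, [0, 1, 1, 2, 2, 10]),
   (4, [0, 0, 0, 0, 0, 1, 1, 2, 2, 9, 9, 9]), (-4, [0, 1, 1, 2, 2, 9]),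
   (4, [0, 0, 0, 0, 0, 1, 1, 2, 2, 8, 8, 8]), (-4, [0, 1, 1, 2, 2, 8]),
   (4, [0, 0, 0, 0, 0, 1, 1, 2, 2, 7, 7, 7]), (-4, [0, 1, 1, 2, 2, 7]), (2, [0, 1, 1, 5, 5]),
   (2, [0, 2, 2, 4, 4])],
  [(2, [0, 0, 1, 2, 2]), (-4, [0, 0, 1]), (-4, [1, 2, 2]),
   (4, [0, 0, 1, 1, 1, 1, 1, 2, 2, 10, 10, 10]), (-4, [0, 0, 1, 2, 2, 10]),
   (-4, [0, 0, 1, 2, 2, 9]), (4, [0, 0, 1, 1, 1, 1, 1, 2, 2, 8, 8, 8]), (-4, [0, 0, 1, 2, 2, 8]),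
   (4, [0, 0, 1, 1, 1, 1, 1, 2, 2, 7, 7, 7]), (-4, [0, 0, 1, 2, 2, 7]), (2, [0, 0, 1, 5, 5]),
   (2, [1, 2, 2, 3, 3])],
  [(2, [0, 0, 1, 1, 2]), (-4, [0, 0, 2]), (-4, [1, 1, 2]),
   (4, [0, 0, 1, 1, 2, 2, 2, 2, 2, 10, 10, 10]), (-4, [0, 0, 1, 1, 2, 10]),
   (4, [0, 0, 1, 1, 2, 2, 2, 2, 2, 9, 9, 9]), (-4, [0, 0, 1, 1, 2, 9]), (-4, [0, 0, 1, 1, 2, 8]),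
   (4, [0, 0, 1, 1, 2, 2, 2, 2, 2, 7, 7, 7]), (-4, [0, 0, 1, 1, 2, 7]), (2, [0, 0, 2, 4, 4]),
   (2, [1, 1, 2, 3, 3])],
  [(2, [1, 1, 2, 2, 3])],
  [(2, [0, 0, 2, 2, 4])],
  [(2, [0, 0, 1, 1, 5])]]

/-- The components of `1024` times the vector field `σ / 1024 · J ∇Γ`. -/
def fieldPoly (i : ℕ) : WPoly :=
  bif i.blt 3 then (gradTable.getD (i + 3) []).mulVar 1 6
  else bif i.blt 6 then (gradTable.getD (i - 3) []).mulVar (-1) 6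
  else []

/-- The partial derivatives of `fieldPoly`. -/
def jacTable : List (List WPoly) := [
  [
    [],
    [(4, [1, 2, 2, 3, 6])],
    [(4, [1, 1, 2, 3, 6])],
    [(2, [1, 1, 2, 2, 6])],
    [],
    [],
    [(2, [1, 1, 2, 2, 3])]],
  [
    [(4, [0, 2, 2, 4, 6])],
    [],
    [(4, [0, 0, 2, 4, 6])],
    [],
    [(2, [0, 0, 2, 2, 6])],
    [],
    [(2, [0, 0, 2, 2, 4])]],
  [
    [(4, [0, 1, 1, 5, 6])],
    [(4, [0, 0, 1, 5, 6])],
    [],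
    [],
    [],
    [(2, [0, 0, 1, 1, 6])],
    [(2, [0, 0, 1, 1, 5])]],
  [
    [(-2, [2, 2, 4, 4, 6]), (-2, [1, 1, 5, 5, 6]), (-28, [0, 0, 0, 0, 1, 1, 2, 2, 6, 7, 7, 7]),
     (4, [1, 1, 2, 2, 6, 7]), (24, [0, 0, 0, 0, 0, 0, 0, 0, 1, 1, 2, 2, 6, 7, 7, 7, 7, 7]),
     (-28, [0, 0, 0, 0, 1, 1, 2, 2, 6, 8, 8, 8]), (4, [1, 1, 2, 2, 6, 8]),
     (24, [0, 0, 0, 0, 0, 0, 0, 0, 1, 1, 2, 2, 6, 8, 8, 8, 8, 8]),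
     (-28, [0, 0, 0, 0, 1, 1, 2, 2, 6, 9, 9, 9]), (4, [1, 1, 2, 2, 6, 9]),
     (24, [0, 0, 0, 0, 0, 0, 0, 0, 1, 1, 2, 2, 6, 9, 9, 9, 9, 9]), (4, [1, 1, 2, 2, 6, 10]),
     (4, [2, 2, 6]), (4, [1, 1, 6]), (-2, [1, 1, 2, 2, 6])],
    [(-4, [0, 1, 5, 5, 6]), (-8, [0, 1, 1, 1, 1, 1, 2, 2, 6, 7, 7, 7]), (8, [0, 1, 2, 2, 6, 7]),
     (24, [0, 0, 0, 0, 0, 1, 1, 1, 1, 1, 2, 2, 6, 7, 7, 7, 7, 7]),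
     (-8, [0, 0, 0, 0, 0, 1, 2, 2, 6, 7, 7, 7]), (-8, [0, 1, 1, 1, 1, 1, 2, 2, 6, 8, 8, 8]),
     (8, [0, 1, 2, 2, 6, 8]), (24, [0, 0, 0, 0, 0, 1, 1, 1, 1, 1, 2, 2, 6, 8, 8, 8, 8, 8]),
     (-8, [0, 0, 0, 0, 0, 1, 2, 2, 6, 8, 8, 8]), (8, [0, 1, 2, 2, 6, 9]),
     (-8, [0, 0, 0, 0, 0, 1, 2, 2, 6, 9, 9, 9]), (-8, [0, 1, 1, 1, 1, 1, 2, 2, 6, 10, 10, 10]),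
     (8, [0, 1, 2, 2, 6, 10]), (8, [0, 1, 6]), (-4, [0, 1, 2, 2, 6])],
    [(-4, [0, 2, 4, 4, 6]), (-8, [0, 1, 1, 2, 2, 2, 2, 2, 6, 7, 7, 7]), (8, [0, 1, 1, 2, 6, 7]),
     (24, [0, 0, 0, 0, 0, 1, 1, 2, 2, 2, 2, 2, 6, 7, 7, 7, 7, 7]),
     (-8, [0, 0, 0, 0, 0, 1, 1, 2, 6, 7, 7, 7]), (8, [0, 1, 1, 2, 6, 8]),
     (-8, [0, 0, 0, 0, 0, 1, 1, 2, 6, 8, 8, 8]), (-8, [0, 1, 1, 2, 2, 2, 2, 2, 6, 9, 9, 9]),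
     (8, [0, 1, 1, 2, 6, 9]), (24, [0, 0, 0, 0, 0, 1, 1, 2, 2, 2, 2, 2, 6, 9, 9, 9, 9, 9]),
     (-8, [0, 0, 0, 0, 0, 1, 1, 2, 6, 9, 9, 9]), (-8, [0, 1, 1, 2, 2, 2, 2, 2, 6, 10, 10, 10]),
     (8, [0, 1, 1, 2, 6, 10]), (8, [0, 2, 6]), (-4, [0, 1, 1, 2, 6])],
    [],
    [(-4, [0, 2, 2, 4, 6])],
    [(-4, [0, 1, 1, 5, 6])],
    [(-2, [0, 2, 2, 4, 4]), (-2, [0, 1, 1, 5, 5]), (4, [0, 1, 1, 2, 2, 7]),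
     (-4, [0, 0, 0, 0, 0, 1, 1, 2, 2, 7, 7, 7]), (4, [0, 1, 1, 2, 2, 8]),
     (-4, [0, 0, 0, 0, 0, 1, 1, 2, 2, 8, 8, 8]), (4, [0, 1, 1, 2, 2, 9]),
     (-4, [0, 0, 0, 0, 0, 1, 1, 2, 2, 9, 9, 9]), (4, [0, 1, 1, 2, 2, 10]), (4, [0, 2, 2]),
     (4, [0, 1, 1]), (-2, [0, 1, 1, 2, 2])]],
  [
    [(-4, [0, 1, 5, 5, 6]), (-8, [0, 0, 0, 0, 0, 1, 2, 2, 6, 7, 7, 7]), (8, [0, 1, 2, 2, 6, 7]),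
     (24, [0, 0, 0, 0, 0, 1, 1, 1, 1, 1, 2, 2, 6, 7, 7, 7, 7, 7]),
     (-8, [0, 1, 1, 1, 1, 1, 2, 2, 6, 7, 7, 7]), (-8, [0, 0, 0, 0, 0, 1, 2, 2, 6, 8, 8, 8]),
     (8, [0, 1, 2, 2, 6, 8]), (24, [0, 0, 0, 0, 0, 1, 1, 1, 1, 1, 2, 2, 6, 8, 8, 8, 8, 8]),
     (-8, [0, 1, 1, 1, 1, 1, 2, 2, 6, 8, 8, 8]), (-8, [0, 0, 0, 0, 0, 1, 2, 2, 6, 9, 9, 9]),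
     (8, [0, 1, 2, 2, 6, 9]), (8, [0, 1, 2, 2, 6, 10]),
     (-8, [0, 1, 1, 1, 1, 1, 2, 2, 6, 10, 10, 10]), (8, [0, 1, 6]), (-4, [0, 1, 2, 2, 6])],
    [(-2, [2, 2, 3, 3, 6]), (-2, [0, 0, 5, 5, 6]), (-28, [0, 0, 1, 1, 1, 1, 2, 2, 6, 7, 7, 7]),
     (4, [0, 0, 2, 2, 6, 7]), (24, [0, 0, 1, 1, 1, 1, 1, 1, 1, 1, 2, 2, 6, 7, 7, 7, 7, 7]),
     (-28, [0, 0, 1, 1, 1, 1, 2, 2, 6, 8, 8, 8]), (4, [0, 0, 2, 2, 6, 8]),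
     (24, [0, 0, 1, 1, 1, 1, 1, 1, 1, 1, 2, 2, 6, 8, 8, 8, 8, 8]), (4, [0, 0, 2, 2, 6, 9]),
     (-28, [0, 0, 1, 1, 1, 1, 2, 2, 6, 10, 10, 10]), (4, [0, 0, 2, 2, 6, 10]),
     (24, [0, 0, 1, 1, 1, 1, 1, 1, 1, 1, 2, 2, 6, 10, 10, 10, 10, 10]), (4, [2, 2, 6]),
     (4, [0, 0, 6]), (-2, [0, 0, 2, 2, 6])],
    [(-4, [1, 2, 3, 3, 6]), (-8, [0, 0, 1, 2, 2, 2, 2, 2, 6, 7, 7, 7]), (8, [0, 0, 1, 2, 6, 7]),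
     (24, [0, 0, 1, 1, 1, 1, 1, 2, 2, 2, 2, 2, 6, 7, 7, 7, 7, 7]),
     (-8, [0, 0, 1, 1, 1, 1, 1, 2, 6, 7, 7, 7]), (8, [0, 0, 1, 2, 6, 8]),
     (-8, [0, 0, 1, 1, 1, 1, 1, 2, 6, 8, 8, 8]), (-8, [0, 0, 1, 2, 2, 2, 2, 2, 6, 9, 9, 9]),
     (8, [0, 0, 1, 2, 6, 9]), (-8, [0, 0, 1, 2, 2, 2, 2, 2, 6, 10, 10, 10]),
     (8, [0, 0, 1, 2, 6, 10]), (24, [0, 0, 1, 1, 1, 1, 1, 2, 2, 2, 2, 2, 6, 10, 10, 10, 10, 10]),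
     (-8, [0, 0, 1, 1, 1, 1, 1, 2, 6, 10, 10, 10]), (8, [1, 2, 6]), (-4, [0, 0, 1, 2, 6])],
    [(-4, [1, 2, 2, 3, 6])],
    [],
    [(-4, [0, 0, 1, 5, 6])],
    [(-2, [1, 2, 2, 3, 3]), (-2, [0, 0, 1, 5, 5]), (4, [0, 0, 1, 2, 2, 7]),
     (-4, [0, 0, 1, 1, 1, 1, 1, 2, 2, 7, 7, 7]), (4, [0, 0, 1, 2, 2, 8]),
     (-4, [0, 0, 1, 1, 1, 1, 1, 2, 2, 8, 8, 8]), (4, [0, 0, 1, 2, 2, 9]), (4, [0, 0, 1, 2, 2, 10]),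
     (-4, [0, 0, 1, 1, 1, 1, 1, 2, 2, 10, 10, 10]), (4, [1, 2, 2]), (4, [0, 0, 1]),
     (-2, [0, 0, 1, 2, 2])]],
  [
    [(-4, [0, 2, 4, 4, 6]), (-8, [0, 0, 0, 0, 0, 1, 1, 2, 6, 7, 7, 7]), (8, [0, 1, 1, 2, 6, 7]),
     (24, [0, 0, 0, 0, 0, 1, 1, 2, 2, 2, 2, 2, 6, 7, 7, 7, 7, 7]),
     (-8, [0, 1, 1, 2, 2, 2, 2, 2, 6, 7, 7, 7]), (-8, [0, 0, 0, 0, 0, 1, 1, 2, 6, 8, 8, 8]),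
     (8, [0, 1, 1, 2, 6, 8]), (-8, [0, 0, 0, 0, 0, 1, 1, 2, 6, 9, 9, 9]), (8, [0, 1, 1, 2, 6, 9]),
     (24, [0, 0, 0, 0, 0, 1, 1, 2, 2, 2, 2, 2, 6, 9, 9, 9, 9, 9]),
     (-8, [0, 1, 1, 2, 2, 2, 2, 2, 6, 9, 9, 9]), (8, [0, 1, 1, 2, 6, 10]),
     (-8, [0, 1, 1, 2, 2, 2, 2, 2, 6, 10, 10, 10]), (8, [0, 2, 6]), (-4, [0, 1, 1, 2, 6])],
    [(-4, [1, 2, 3, 3, 6]), (-8, [0, 0, 1, 1, 1, 1, 1, 2, 6, 7, 7, 7]), (8, [0, 0, 1, 2, 6, 7]),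
     (24, [0, 0, 1, 1, 1, 1, 1, 2, 2, 2, 2, 2, 6, 7, 7, 7, 7, 7]),
     (-8, [0, 0, 1, 2, 2, 2, 2, 2, 6, 7, 7, 7]), (-8, [0, 0, 1, 1, 1, 1, 1, 2, 6, 8, 8, 8]),
     (8, [0, 0, 1, 2, 6, 8]), (8, [0, 0, 1, 2, 6, 9]), (-8, [0, 0, 1, 2, 2, 2, 2, 2, 6, 9, 9, 9]),
     (-8, [0, 0, 1, 1, 1, 1, 1, 2, 6, 10, 10, 10]), (8, [0, 0, 1, 2, 6, 10]),
     (24, [0, 0, 1, 1, 1, 1, 1, 2, 2, 2, 2, 2, 6, 10, 10, 10, 10, 10]),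
     (-8, [0, 0, 1, 2, 2, 2, 2, 2, 6, 10, 10, 10]), (8, [1, 2, 6]), (-4, [0, 0, 1, 2, 6])],
    [(-2, [1, 1, 3, 3, 6]), (-2, [0, 0, 4, 4, 6]), (-28, [0, 0, 1, 1, 2, 2, 2, 2, 6, 7, 7, 7]),
     (4, [0, 0, 1, 1, 6, 7]), (24, [0, 0, 1, 1, 2, 2, 2, 2, 2, 2, 2, 2, 6, 7, 7, 7, 7, 7]),
     (4, [0, 0, 1, 1, 6, 8]), (-28, [0, 0, 1, 1, 2, 2, 2, 2, 6, 9, 9, 9]), (4, [0, 0, 1, 1, 6, 9]),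
     (24, [0, 0, 1, 1, 2, 2, 2, 2, 2, 2, 2, 2, 6, 9, 9, 9, 9, 9]),
     (-28, [0, 0, 1, 1, 2, 2, 2, 2, 6, 10, 10, 10]), (4, [0, 0, 1, 1, 6, 10]),
     (24, [0, 0, 1, 1, 2, 2, 2, 2, 2, 2, 2, 2, 6, 10, 10, 10, 10, 10]), (4, [1, 1, 6]),
     (4, [0, 0, 6]), (-2, [0, 0, 1, 1, 6])],
    [(-4, [1, 1, 2, 3, 6])],
    [(-4, [0, 0, 2, 4, 6])],
    [],
    [(-2, [1, 1, 2, 3, 3]), (-2, [0, 0, 2, 4, 4]), (4, [0, 0, 1, 1, 2, 7]),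
     (-4, [0, 0, 1, 1, 2, 2, 2, 2, 2, 7, 7, 7]), (4, [0, 0, 1, 1, 2, 8]), (4, [0, 0, 1, 1, 2, 9]),
     (-4, [0, 0, 1, 1, 2, 2, 2, 2, 2, 9, 9, 9]), (4, [0, 0, 1, 1, 2, 10]),
     (-4, [0, 0, 1, 1, 2, 2, 2, 2, 2, 10, 10, 10]), (4, [1, 1, 2]), (4, [0, 0, 2]),
     (-2, [0, 0, 1, 1, 2])]]]

-- The literal tables are compared with the normal forms of the formal derivatives. Thus the
-- expressions evaluated in the numerical checks are the true partial derivatives.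
set_option maxRecDepth 100000 in
lemma gradTable_eq : ∀ i < 6, gradTable.getD i [] = (WPoly.deriv i hamPoly).norm := by
  decide +kernel

set_option maxRecDepth 100000 in
lemma jacTable_eq : ∀ i < 7, ∀ j < 7,
    (jacTable.getD i []).getD j [] = (WPoly.deriv j (fieldPoly i)).norm := by
  decide +kernel

/-- The fourth powers sums under the square roots of `regHam`. -/
def quartic (k : ℕ) (x : Fin 7 → ℝ) : ℝ :=
  match k with
  | 7 => x 0 ^ 4 + x 1 ^ 4 + x 2 ^ 4
  | 8 => x 0 ^ 4 + x 1 ^ 4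
  | 9 => x 0 ^ 4 + x 2 ^ 4
  | 10 => x 1 ^ 4 + x 2 ^ 4
  | _ => 1

/-- The values of the eleven variables. -/
def atoms (x : Fin 7 → ℝ) (k : ℕ) : ℝ := if h : k < 7 then x ⟨k, h⟩ else (√(quartic k x))⁻¹

lemma hasFDerivAt_quartic {k : ℕ} (x : Fin 7 → ℝ) :
    HasFDerivAt (quartic k)
      (linForm fun j => if 7 ≤ k ∧ dependsOn k j then 4 * x j ^ 3 else 0) x := by
  have hp : ∀ i : Fin 7, HasFDerivAt (fun y : Fin 7 → ℝ => y i ^ 4)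
      ((4 * x i ^ 3) • ContinuousLinearMap.proj (R := ℝ) (φ := fun _ : Fin 7 => ℝ) i) x := by
    intro i
    have := ((ContinuousLinearMap.proj (R := ℝ) (φ := fun _ : Fin 7 => ℝ) i).hasFDerivAt
      (x := x)).pow 4
    simpa [nsmul_eq_mul] using this
  have aux : ∀ {f : (Fin 7 → ℝ) → ℝ} {f' g' : (Fin 7 → ℝ) →L[ℝ] ℝ}, HasFDerivAt f f' x →
      (∀ y, f' y = g' y) → HasFDerivAt f g' x := fun h e =>
    h.congr_fderiv (ContinuousLinearMap.ext e)
  unfold quartic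
  split
  · refine aux (((hp 0).add (hp 1)).add (hp 2)) fun y => ?_
    simp [linForm_apply, Fin.sum_univ_seven, dependsOn]
  · refine aux ((hp 0).add (hp 1)) fun y => ?_
    simp [linForm_apply, Fin.sum_univ_seven, dependsOn]
  · refine aux ((hp 0).add (hp 2)) fun y => ?_
    simp [linForm_apply, Fin.sum_univ_seven, dependsOn]
  · refine aux ((hp 1).add (hp 2)) fun y => ?_
    simp [linForm_apply, Fin.sum_univ_seven, dependsOn]
  · refine aux (hasFDerivAt_const _ x) fun y => ?_
    simp only [linForm_apply, dependsOn]
    simp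

/-- The points where the variables are smooth. -/
def Smooth (x : Fin 7 → ℝ) : Prop := ∀ k, 0 < quartic k x

/-- For `R = S ^ (-1/2)` with `S` a sum of fourth powers, `∂R = -(1/2) R³ · 4 x³ = -2 x³ R³`. The
derivatives of the reciprocal distances therefore stay polynomial in the eleven variables. -/
lemma hasFDerivAt_atoms {x : Fin 7 → ℝ} (hx : Smooth x) (k : ℕ) :
    HasFDerivAt (fun y => atoms y k)
      (linForm fun j => WPoly.evalR (atoms x) (dVar j k)) x := by
  by_cases hk : k < 7
  · have h1 : (fun y : Fin 7 → ℝ => atoms y k) =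
        ContinuousLinearMap.proj (R := ℝ) (φ := fun _ : Fin 7 => ℝ) ⟨k, hk⟩ := by
      ext y; simp [atoms, hk]
    rw [h1]
    refine (ContinuousLinearMap.hasFDerivAt _).congr_fderiv (ContinuousLinearMap.ext fun y => ?_)
    rw [linForm_apply, Finset.sum_eq_single ⟨k, hk⟩]
    · simp [dVar, show k.ble 6 = true by simp; omega, WPoly.evalR]
    · intro j _ hj
      have : (k == (j : ℕ)) = false := by
        simp only [beq_eq_false_iff_ne]
        exact fun h => hj (Fin.ext h.symm)
      simp [dVar, show k.ble 6 = true by simp; omega, this, WPoly.evalR]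
    · simp
  · have h1 : (fun y : Fin 7 → ℝ => atoms y k) = fun y => (√(quartic k y))⁻¹ := by
      ext y; simp [atoms, hk]
    rw [h1]
    have hS := hx k
    have hs : 0 < √(quartic k x) := Real.sqrt_pos.2 hS
    have h2 := (hasDerivAt_inv hs.ne').comp_hasFDerivAt x
      ((hasFDerivAt_quartic (k := k) x).sqrt hS.ne')
    refine h2.congr_fderiv (ContinuousLinearMap.ext fun y => ?_)
    simp only [_root_.smul_apply, linForm_apply, smul_eq_mul, Finset.mul_sum]
    refine Finset.sum_congr rfl fun j _ => ?_
    have hk6 : k.ble 6 = false := by rw [← Bool.not_eq_true]; simp; omega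
    have hj : atoms x j = x j := by simp [atoms]
    have hR : atoms x k = (√(quartic k x))⁻¹ := by simp [atoms, hk]
    rw [dVar, hk6, cond_false]
    cases hd : dependsOn k j
    · simp [WPoly.evalR]
    · simp only [cond_true, WPoly.evalR, List.map_cons, List.map_nil, List.prod_cons,
        List.prod_nil, List.sum_cons, List.sum_nil, hj, hR]
      simp only [show 7 ≤ k by omega, and_self, if_true]
      field_simp
      push_cast
      ring

/-- The linear map with the given matrix. -/
def linMap (A : Fin 7 → Fin 7 → ℝ) : (Fin 7 → ℝ) →L[ℝ] (Fin 7 → ℝ) :=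
  ContinuousLinearMap.pi fun i => linForm (A i)

lemma linMap_apply (A : Fin 7 → Fin 7 → ℝ) (y : Fin 7 → ℝ) (i : Fin 7) :
    linMap A y i = ∑ j, A i j * y j := by
  simp [linMap, linForm_apply]

lemma linMap_sub (A B : Fin 7 → Fin 7 → ℝ) : linMap A - linMap B = linMap (A - B) := by
  ext y i
  simp only [_root_.sub_apply, Pi.sub_apply, linMap_apply, sub_mul, Finset.sum_sub_distrib]

lemma abs_sum_mul_le {K : ℝ} {g : Fin 7 → ℝ} (h : ∑ j, |g j| ≤ K) (y : Fin 7 → ℝ) :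
    |∑ j, g j * y j| ≤ K * ‖y‖ := by
  refine (Finset.abs_sum_le_sum_abs _ _).trans ?_
  refine (Finset.sum_le_sum fun j _ => ?_).trans
    ((Finset.sum_mul _ _ _).symm.trans_le (mul_le_mul_of_nonneg_right h (norm_nonneg y)))
  rw [abs_mul]
  exact mul_le_mul_of_nonneg_left (norm_le_pi_norm y j) (abs_nonneg _)

lemma norm_linForm_le {K : ℝ} {g : Fin 7 → ℝ} (h : ∑ j, |g j| ≤ K) : ‖linForm g‖ ≤ K := by
  refine ContinuousLinearMap.opNorm_le_bound _
    ((Finset.sum_nonneg fun j _ => abs_nonneg (g j)).trans h) fun y => ?_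
  rw [linForm_apply, Real.norm_eq_abs]
  exact abs_sum_mul_le h y

/-- Operator norms are taken with respect to the sup norm, for which absolute row sums are the
natural bound; this is why later estimates are organised by rows. -/
lemma norm_linMap_le {K : ℝ} {A : Fin 7 → Fin 7 → ℝ} (h : ∀ i, ∑ j, |A i j| ≤ K) :
    ‖linMap A‖ ≤ K := by
  have hK : 0 ≤ K := (Finset.sum_nonneg fun j _ => abs_nonneg (A 0 j)).trans (h 0)
  refine ContinuousLinearMap.opNorm_le_bound _ hK fun y => ?_
  rw [pi_norm_le_iff_of_nonneg (by positivity)]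
  intro i
  rw [linMap_apply, Real.norm_eq_abs]
  exact abs_sum_mul_le (h i) y

/-- The polynomial vector field in the variables `atoms`: `σ / 1024` times the Hamiltonian vector
field, with `σ' = 0`. -/
def vf (x : Fin 7 → ℝ) (i : Fin 7) : ℝ := WPoly.evalR (atoms x) (fieldPoly i) / 1024

/-- The derivative of the vector field, as a matrix. -/
def vfJac (v : ℕ → ℝ) (i j : Fin 7) : ℝ :=
  WPoly.evalR v ((jacTable.getD i []).getD j []) / 1024

/-- The derivative of the vector field. -/
def dvf (x : Fin 7 → ℝ) : (Fin 7 → ℝ) →L[ℝ] (Fin 7 → ℝ) := linMap (vfJac (atoms x))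

lemma dvf_apply (x y : Fin 7 → ℝ) (i : Fin 7) : dvf x y i = ∑ j, vfJac (atoms x) i j * y j :=
  linMap_apply _ _ _

lemma evalR_deriv_field (v : ℕ → ℝ) (i j : Fin 7) :
    WPoly.evalR v (WPoly.deriv j (fieldPoly i)) / 1024 = vfJac v i j := by
  rw [vfJac, jacTable_eq i i.2 j j.2, WPoly.evalR_norm]

lemma hasFDerivAt_vf {x : Fin 7 → ℝ} (hx : Smooth x) : HasFDerivAt vf (dvf x) x := by
  rw [hasFDerivAt_pi']
  intro i
  have h := (WPoly.hasFDerivAt_evalR (hasFDerivAt_atoms hx) (fieldPoly i)).mul_const (1 / 1024 : ℝ)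
  have e : (fun y => vf y i) = fun y => WPoly.evalR (atoms y) (fieldPoly i) * (1 / 1024) := by
    ext y; simp [vf, div_eq_mul_inv]
  rw [e]
  refine h.congr_fderiv (ContinuousLinearMap.ext fun y => ?_)
  simp only [_root_.smul_apply, linForm_apply, smul_eq_mul, Finset.mul_sum,
    ContinuousLinearMap.comp_apply, ContinuousLinearMap.proj_apply, dvf_apply]
  refine Finset.sum_congr rfl fun j _ => ?_
  rw [← evalR_deriv_field]
  ring

/-! ### Bounds and Lipschitz constants on a box -/

/-- A bound and a Lipschitz constant. -/
structure BoundLip where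
  bd : ℚ
  lip : ℚ

namespace BoundLip

instance : Mul BoundLip := ⟨fun a b => ⟨a.bd * b.bd, a.bd * b.lip + b.bd * a.lip⟩⟩

instance : Add BoundLip := ⟨fun a b => ⟨a.bd + b.bd, a.lip + b.lip⟩⟩

/-- A constant. -/
def const (n : ℤ) : BoundLip := ⟨(n.natAbs : ℕ), 0⟩

/-- Two numbers are bounded and their difference is at most `lip * δ`. -/
def Rep (δ x x' : ℝ) (a : BoundLip) : Prop := |x| ≤ a.bd ∧ |x'| ≤ a.bd ∧ |x - x'| ≤ a.lip * δ

lemma rep_const (δ : ℝ) (n : ℤ) : Rep δ n n (const n) := by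
  simp [Rep, const, Nat.cast_natAbs]

lemma Rep.add (δ x x' y y' : ℝ) (a b : BoundLip) (ha : Rep δ x x' a) (hb : Rep δ y y' b) :
    Rep δ (x + y) (x' + y') (a + b) := by
  have e1 : ((a + b).bd : ℝ) = a.bd + b.bd := Rat.cast_add _ _
  have e2 : ((a + b).lip : ℝ) = a.lip + b.lip := Rat.cast_add _ _
  refine ⟨?_, ?_, ?_⟩
  · rw [e1]; exact (abs_add_le _ _).trans (add_le_add ha.1 hb.1)
  · rw [e1]; exact (abs_add_le _ _).trans (add_le_add ha.2.1 hb.2.1)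
  · rw [e2, add_mul, add_sub_add_comm]
    exact (abs_add_le _ _).trans (add_le_add ha.2.2 hb.2.2)

lemma Rep.mul (δ x x' y y' : ℝ) (a b : BoundLip) (ha : Rep δ x x' a) (hb : Rep δ y y' b) :
    Rep δ (x * y) (x' * y') (a * b) := by
  have e1 : ((a * b).bd : ℝ) = a.bd * b.bd := Rat.cast_mul _ _
  have e2 : ((a * b).lip : ℝ) = a.bd * b.lip + b.bd * a.lip := by
    change ((a.bd * b.lip + b.bd * a.lip : ℚ) : ℝ) = _
    push_cast; rfl
  have h0 : (0 : ℝ) ≤ a.bd := (abs_nonneg _).trans ha.1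
  have h0' : (0 : ℝ) ≤ b.bd := (abs_nonneg _).trans hb.1
  refine ⟨?_, ?_, ?_⟩
  · rw [e1, abs_mul]; exact mul_le_mul ha.1 hb.1 (abs_nonneg _) h0
  · rw [e1, abs_mul]; exact mul_le_mul ha.2.1 hb.2.1 (abs_nonneg _) h0
  · rw [e2, show x * y - x' * y' = x * (y - y') + y' * (x - x') by ring]
    refine (abs_add_le _ _).trans ?_
    rw [abs_mul, abs_mul, add_mul, mul_assoc, mul_assoc]
    exact add_le_add (mul_le_mul ha.1 hb.2.2 (abs_nonneg _) h0)
      (mul_le_mul hb.2.1 ha.2.2 (abs_nonneg _) h0')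

lemma rep_eval {δ : ℝ} {v v' : ℕ → ℝ} {V : ℕ → BoundLip} {n : ℕ}
    (hv : ∀ k < n, Rep δ (v k) (v' k) (V k)) (p : WPoly)
    (hp : p.all fun m => m.2.all fun k => k.blt n) :
    Rep δ (p.evalR v) (p.evalR v') (p.eval const V) :=
  WPoly.rel_eval (Rep δ) (rep_const δ) (Rep.add δ) (Rep.mul δ) hv p hp

end BoundLip

lemma fieldPoly_vars : ∀ i < 7, ((fieldPoly i).all fun m => m.2.all fun k => k.blt 11) = true := by
  decide +kernel

lemma jacTable_vars : ∀ i < 7, ∀ j < 7,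
    (((jacTable.getD i []).getD j []).all fun m => m.2.all fun k => k.blt 11) = true := by
  decide +kernel

/-- Lower bounds for the coordinates. -/
def boxLo : Fin 7 → ℝ := ![-1 / 10, 5 / 2, 5 / 2, 1, -27 / 20, -1 / 10, 1]

/-- Upper bounds for the coordinates. -/
def boxHi : Fin 7 → ℝ := ![27 / 10, 16 / 5, 33 / 10, 3 / 2, -1 / 2, 3 / 4, 7 / 5]

/-- A box around the first twelfth of the orbit. -/
def box : Set (Fin 7 → ℝ) := Set.Icc boxLo boxHi

lemma convex_box : Convex ℝ box := convex_Icc _ _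

lemma mem_box {x : Fin 7 → ℝ} : x ∈ box ↔
    (-1 / 10 ≤ x 0 ∧ x 0 ≤ 27 / 10) ∧ (5 / 2 ≤ x 1 ∧ x 1 ≤ 16 / 5) ∧
    (5 / 2 ≤ x 2 ∧ x 2 ≤ 33 / 10) ∧ (1 ≤ x 3 ∧ x 3 ≤ 3 / 2) ∧ (-27 / 20 ≤ x 4 ∧ x 4 ≤ -1 / 2) ∧
    (-1 / 10 ≤ x 5 ∧ x 5 ≤ 3 / 4) ∧ (1 ≤ x 6 ∧ x 6 ≤ 7 / 5) := by
  simp only [box, Set.mem_Icc, Pi.le_def, Fin.forall_fin_succ, boxLo, boxHi]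
  simp [Fin.succ_zero_eq_one]
  tauto

/-- Bounds for the absolute values of the variables on the box. -/
def boxBound : List ℚ :=
  [27 / 10, 16 / 5, 33 / 10, 3 / 2, 27 / 20, 3 / 4, 7 / 5, 4 / 25, 4 / 25, 4 / 25, 4 / 25]

lemma abs_coord_le {x : Fin 7 → ℝ} (hx : x ∈ box) (i : Fin 7) : |x i| ≤ (boxBound.getD i 0 : ℚ) := by
  obtain ⟨h0, h1, h2, h3, h4, h5, h6⟩ := mem_box.1 hx
  rw [abs_le]
  fin_cases i <;> simp [boxBound] <;> constructor <;> linarith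

/-- Each of the four sums contains `x₁⁴` or `x₂⁴` (indices from `0`), which is at least `(5/2)⁴ =
(25/4)²`. The coordinate `x₀` may vanish, as it does at the collision. The reciprocals are therefore
at most `4/25`. -/
lemma quartic_ge {x : Fin 7 → ℝ} (hx : x ∈ box) {k : ℕ} (hk : 7 ≤ k ∧ k ≤ 10) :
    (25 / 4) ^ 2 ≤ quartic k x := by
  obtain ⟨h0, h1, h2, -⟩ := mem_box.1 hx
  have e1 : (25 / 4 : ℝ) ^ 2 ≤ x 1 ^ 4 := by
    have := pow_le_pow_left₀ (by norm_num) h1.1 4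
    norm_num at this ⊢
    linarith
  have e2 : (25 / 4 : ℝ) ^ 2 ≤ x 2 ^ 4 := by
    have := pow_le_pow_left₀ (by norm_num) h2.1 4
    norm_num at this ⊢
    linarith
  have p0 : 0 ≤ x 0 ^ 4 := by positivity
  have p1 : 0 ≤ x 1 ^ 4 := by positivity
  have p2 : 0 ≤ x 2 ^ 4 := by positivity
  obtain ⟨hk1, hk2⟩ := hk
  interval_cases k <;> simp only [quartic] <;> linarith

lemma smooth_of_mem_box {x : Fin 7 → ℝ} (hx : x ∈ box) : Smooth x := by
  intro k
  by_cases hk : 7 ≤ k ∧ k ≤ 10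
  · exact lt_of_lt_of_le (by norm_num) (quartic_ge hx hk)
  · unfold quartic
    split <;> first | (exfalso; omega) | norm_num

lemma atoms_pos {x : Fin 7 → ℝ} (hx : Smooth x) {k : ℕ} (hk : 7 ≤ k) : 0 < atoms x k := by
  rw [atoms, dif_neg (by omega)]
  exact inv_pos.2 (Real.sqrt_pos.2 (hx k))

lemma atoms_le {x : Fin 7 → ℝ} (hx : x ∈ box) {k : ℕ} (hk : 7 ≤ k ∧ k ≤ 10) :
    atoms x k ≤ 4 / 25 := by
  rw [atoms, dif_neg (by omega)]
  have h : 25 / 4 ≤ √(quartic k x) := Real.le_sqrt_of_sq_le (quartic_ge hx hk)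
  calc (√(quartic k x))⁻¹ ≤ (25 / 4)⁻¹ := inv_anti₀ (by norm_num) h
    _ = 4 / 25 := by norm_num

lemma abs_atoms_le {x : Fin 7 → ℝ} (hx : x ∈ box) {k : ℕ} (hk : k < 11) :
    |atoms x k| ≤ (boxBound.getD k 0 : ℚ) := by
  by_cases h : k < 7
  · simpa [atoms, h] using abs_coord_le hx ⟨k, h⟩
  · have h1 := atoms_pos (smooth_of_mem_box hx) (not_lt.1 h)
    have h2 := atoms_le hx (k := k) ⟨by omega, by omega⟩
    rw [abs_of_pos h1]
    refine h2.trans ?_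
    have : 7 ≤ k := not_lt.1 h
    interval_cases k <;> norm_num [boxBound]

/-- By the mean value inequality on the convex box it suffices to bound the gradient of a reciprocal
distance, whose components are `-2 x³ R³` or `0`. The largest coordinates and `R ≤ 4/25` give an
absolute sum of about `0.724`, hence `3/4`. -/
lemma abs_atoms_sub_le {x y : Fin 7 → ℝ} (hx : x ∈ box) (hy : y ∈ box) {k : ℕ} (hk : k < 11) :
    |atoms x k - atoms y k| ≤ (if k < 7 then 1 else 3 / 4) * ‖x - y‖ := by
  by_cases h : k < 7
  · simpa [atoms, h] using norm_le_pi_norm (x - y) ⟨k, h⟩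
  · rw [if_neg h]
    have hk7 : 7 ≤ k := not_lt.1 h
    refine convex_box.norm_image_sub_le_of_norm_hasFDerivWithin_le (f := fun z => atoms z k)
      (fun z hz => (hasFDerivAt_atoms (smooth_of_mem_box hz) k).hasFDerivWithinAt)
      (fun z hz => norm_linForm_le ?_) hy hx
    obtain ⟨h0, h1, h2, -⟩ := mem_box.1 hz
    have hpos := atoms_pos (smooth_of_mem_box hz) hk7
    have hle := atoms_le hz (k := k) ⟨hk7, by omega⟩
    have hr : atoms z k ^ 3 ≤ 64 / 15625 := by
      have := pow_le_pow_left₀ hpos.le hle 3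
      norm_num at this ⊢
      linarith
    have hr0 : 0 ≤ atoms z k ^ 3 := by positivity
    have hj : ∀ j : Fin 7, atoms z j = z j := fun j => by simp [atoms]
    have c0 : |z 0| ^ 3 ≤ 19683 / 1000 := by
      have := pow_le_pow_left₀ (abs_nonneg _) (abs_coord_le hz 0) 3
      norm_num [boxBound] at this ⊢
      linarith
    have c1 : |z 1| ^ 3 ≤ 4096 / 125 := by
      have := pow_le_pow_left₀ (abs_nonneg _) (abs_coord_le hz 1) 3
      norm_num [boxBound] at this ⊢
      linarith
    have c2 : |z 2| ^ 3 ≤ 35937 / 1000 := by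
      have := pow_le_pow_left₀ (abs_nonneg _) (abs_coord_le hz 2) 3
      norm_num [boxBound] at this ⊢
      linarith
    have key : ∀ j : Fin 7, |WPoly.evalR (atoms z) (dVar j k)| ≤
        if (j : ℕ) ≤ 2 then 2 * |z j| ^ 3 * atoms z k ^ 3 else 0 := by
      intro j
      have hk6 : k.ble 6 = false := by rw [← Bool.not_eq_true]; simp; omega
      rw [dVar, hk6, cond_false]
      cases hd : dependsOn k j
      · simp only [cond_false, WPoly.evalR_nil, abs_zero]
        split <;> positivity
      · have hj2 : (j : ℕ) ≤ 2 := by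
          unfold dependsOn at hd
          split at hd <;> simp at hd <;> omega
        simp only [cond_true, WPoly.evalR, List.map_cons, List.map_nil, List.prod_cons,
          List.prod_nil, List.sum_cons, List.sum_nil, hj, if_pos hj2]
        rw [show ((-2 : ℤ) : ℝ) * (z j * (z j * (z j * (atoms z k * (atoms z k * (atoms z k * 1)))))) + 0
          = -(2 * z j ^ 3 * atoms z k ^ 3) by push_cast; ring, abs_neg, abs_mul, abs_mul, abs_pow,
          abs_of_nonneg hr0, abs_two]
    refine (Finset.sum_le_sum fun j _ => key j).trans ?_
    simp only [Fin.sum_univ_seven, Fin.isValue, Fin.val_zero, Fin.val_one, Fin.val_two]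
    norm_num
    nlinarith

/-- Bounds and Lipschitz constants for the variables on the box. -/
def boxVars (k : ℕ) : BoundLip := ⟨boxBound.getD k 0, if k < 7 then 1 else 3 / 4⟩

/-- The same for variables with unchanged coordinates and perturbed reciprocal distances. -/
def boxVars' (k : ℕ) : BoundLip := ⟨boxBound.getD k 0 + 1 / 100, if k < 7 then 0 else 1⟩

/-- The sum of the bounds and of the Lipschitz constants in a row of the derivative. -/
def jacRow (V : ℕ → BoundLip) (i : ℕ) : BoundLip :=
  (List.range 7).foldr (fun j a => ((jacTable.getD i []).getD j []).eval BoundLip.const V + a) ⟨0, 0⟩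

/-- `800` becomes the Lipschitz constant of the derivative on the box, and `2000` the sensitivity of
the derivative and of the field to errors in the reciprocal distances alone. The factor `1024`
appears because the word polynomials describe `1024` times the field. -/
lemma jacRow_le : ∀ i < 7,
    (jacRow boxVars i).bd ≤ 40 * 1024 ∧ (jacRow boxVars i).lip ≤ 800 * 1024 ∧
      (jacRow boxVars' i).lip ≤ 2000 * 1024 ∧
      ((fieldPoly i).eval BoundLip.const boxVars').lip ≤ 2000 * 1024 := by
  decide +kernel

lemma sum_fin_seven (f : ℕ → ℝ) : ∑ j : Fin 7, f j = ((List.range 7).map f).sum := by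
  simp [Fin.sum_univ_seven, List.range_succ]
  ring

lemma sum_abs_vfJac_le {δ : ℝ} {v v' : ℕ → ℝ} {V : ℕ → BoundLip}
    (hv : ∀ k < 11, BoundLip.Rep δ (v k) (v' k) (V k)) (i : Fin 7) :
    ∑ j, |vfJac v i j| ≤ (jacRow V i).bd / 1024 ∧
      ∑ j, |vfJac v i j - vfJac v' i j| ≤ (jacRow V i).lip / 1024 * δ := by
  have key : ∀ l : List ℕ, (∀ j ∈ l, j < 7) →
      (l.map fun j => |WPoly.evalR v ((jacTable.getD i []).getD j []) / 1024|).sum ≤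
        ((l.foldr (fun j a => ((jacTable.getD i []).getD j []).eval BoundLip.const V + a)
          ⟨0, 0⟩).bd : ℝ) / 1024 ∧
      (l.map fun j => |WPoly.evalR v ((jacTable.getD i []).getD j []) / 1024 -
        WPoly.evalR v' ((jacTable.getD i []).getD j []) / 1024|).sum ≤
        ((l.foldr (fun j a => ((jacTable.getD i []).getD j []).eval BoundLip.const V + a)
          ⟨0, 0⟩).lip : ℝ) / 1024 * δ := by
    intro l hl
    induction l with
    | nil => simp
    | cons j l ih =>
      obtain ⟨ih1, ih2⟩ := ih fun j' hj' => hl j' (by simp [hj'])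
      obtain ⟨h1, -, h3⟩ := BoundLip.rep_eval hv _ (jacTable_vars i i.2 j (hl j (by simp)))
      rw [List.foldr_cons, List.map_cons, List.sum_cons, List.map_cons, List.sum_cons]
      generalize List.foldr _ _ l = a at ih1 ih2 ⊢
      generalize WPoly.eval BoundLip.const V _ = b at h1 h3 ⊢
      have e1 : ((b + a).bd : ℝ) = b.bd + a.bd := Rat.cast_add _ _
      have e2 : ((b + a).lip : ℝ) = b.lip + a.lip := Rat.cast_add _ _
      constructor
      · rw [e1, abs_div, abs_of_pos (by norm_num : (0 : ℝ) < 1024), add_div]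
        exact add_le_add (by gcongr) ih1
      · rw [e2, ← sub_div, abs_div, abs_of_pos (by norm_num : (0 : ℝ) < 1024), add_div, add_mul,
          div_mul_eq_mul_div]
        exact add_le_add (by gcongr) ih2
  obtain ⟨h1, h2⟩ := key (List.range 7) (by simp)
  rw [← sum_fin_seven] at h1 h2
  exact ⟨h1, h2⟩

lemma rep_atoms {x y : Fin 7 → ℝ} (hx : x ∈ box) (hy : y ∈ box) :
    ∀ k < 11, BoundLip.Rep ‖x - y‖ (atoms x k) (atoms y k) (boxVars k) := by
  intro k hk
  refine ⟨abs_atoms_le hx hk, abs_atoms_le hy hk, ?_⟩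
  have := abs_atoms_sub_le hx hy hk
  convert this using 2
  simp only [boxVars]
  split <;> norm_num

lemma norm_dvf_sub_le {x y : Fin 7 → ℝ} (hx : x ∈ box) (hy : y ∈ box) :
    ‖dvf x - dvf y‖ ≤ 800 * ‖x - y‖ := by
  rw [dvf, dvf, linMap_sub]
  refine norm_linMap_le fun i => ?_
  refine (sum_abs_vfJac_le (rep_atoms hx hy) i).2.trans ?_
  have h2 : (((jacRow boxVars i).lip : ℚ) : ℝ) ≤ ((800 * 1024 : ℚ) : ℝ) := by
    exact_mod_cast (jacRow_le i i.2).2.1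
  push_cast at h2
  exact mul_le_mul_of_nonneg_right (by linarith) (norm_nonneg _)

/-- The mean value inequality is applied to `vf` minus its linearization at `z`, on the convex
intersection of the box with a ball of radius `ρ`, where the derivative varies by at most `800 ρ`.
-/
lemma norm_vf_sub_sub_le {x y z : Fin 7 → ℝ} {ρ : ℝ} (hx : x ∈ box) (hy : y ∈ box) (hz : z ∈ box)
    (hxz : ‖x - z‖ ≤ ρ) (hyz : ‖y - z‖ ≤ ρ) :
    ‖vf x - vf y - dvf z (x - y)‖ ≤ 800 * ρ * ‖x - y‖ := by
  have hc : Convex ℝ (box ∩ Metric.closedBall z ρ) := convex_box.inter (convex_closedBall _ _)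
  refine hc.norm_image_sub_le_of_norm_hasFDerivWithin_le'
    (fun w hw => (hasFDerivAt_vf (smooth_of_mem_box hw.1)).hasFDerivWithinAt)
    (fun w hw => (norm_dvf_sub_le hw.1 hz).trans ?_) ⟨hy, ?_⟩ ⟨hx, ?_⟩
  · have := mem_closedBall_iff_norm.1 hw.2
    linarith
  · exact mem_closedBall_iff_norm.2 hyz
  · exact mem_closedBall_iff_norm.2 hxz

/-! ### Approximate solutions on a piece of the orbit -/

/-- Approximate values of the eleven variables and of five variations on a piece of the orbit, as
lists of coefficients of polynomials in the local time, scaled by `2 ^ 104`. -/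
structure PieceData where
  orbit : List (List ℤ)
  variations : List (List (List ℤ))

/-- The number of binary digits in `PieceData`. -/
abbrev prec : ℕ := 104

namespace PieceData

variable (D : PieceData)

/-- The coefficients of a variation. -/
def varCoeff (c i : ℕ) : List ℤ := (D.variations.getD c []).getD i []

/-- The approximate values of the variables. -/
def approx (t : ℝ) (k : ℕ) : ℝ := polyFun (D.orbit.getD k []) t / 2 ^ prec

/-- The approximate orbit. -/
def curve (t : ℝ) (i : Fin 7) : ℝ := D.approx t i

/-- The derivative of the approximate orbit. -/
def curveDer (t : ℝ) (i : Fin 7) : ℝ := polyDer (D.orbit.getD i []) t / 2 ^ prec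

/-- The approximate variations. -/
def variation (c : ℕ) (t : ℝ) (i : Fin 7) : ℝ := polyFun (D.varCoeff c i) t / 2 ^ prec

/-- The derivatives of the approximate variations. -/
def variationDer (c : ℕ) (t : ℝ) (i : Fin 7) : ℝ := polyDer (D.varCoeff c i) t / 2 ^ prec

lemma hasDerivAt_curve (t : ℝ) : HasDerivAt D.curve (D.curveDer t) t :=
  hasDerivAt_pi.2 fun _ => (hasDerivAt_polyFun _ t).div_const _

lemma hasDerivAt_variation (c : ℕ) (t : ℝ) :
    HasDerivAt (D.variation c) (D.variationDer c t) t :=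
  hasDerivAt_pi.2 fun _ => (hasDerivAt_polyFun _ t).div_const _

/-- The packed variables. -/
def packed (k : ℕ) : Packed := (Packed.ofList prec (D.orbit.getD k [])).1

/-- The packed derivative. -/
def jac (i j : ℕ) : Packed := ((jacTable.getD i []).getD j []).eval Packed.const D.packed

/-- The defect of the differential equation. -/
def fieldDefect (i : ℕ) : Packed := (fieldPoly i).eval Packed.const D.packed +
  Packed.const (-1024) * (Packed.ofList prec (D.orbit.getD i [])).2

/-- The defect of the variational equation. -/
def varDefect (c i : ℕ) : Packed :=
  (List.range 7).foldr (fun j a => D.jac i j * (Packed.ofList prec (D.varCoeff c j)).1 + a)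
    (Packed.const (-1024) * (Packed.ofList prec (D.varCoeff c i)).2)

/-- `R² S - 1` for the reciprocal distances. -/
def recipPoly (k : ℕ) : WPoly :=
  match k with
  | 7 => [(1, [0, 0, 0, 0, 7, 7]), (1, [1, 1, 1, 1, 7, 7]), (1, [2, 2, 2, 2, 7, 7]), (-1, [])]
  | 8 => [(1, [0, 0, 0, 0, 8, 8]), (1, [1, 1, 1, 1, 8, 8]), (-1, [])]
  | 9 => [(1, [0, 0, 0, 0, 9, 9]), (1, [2, 2, 2, 2, 9, 9]), (-1, [])]
  | 10 => [(1, [1, 1, 1, 1, 10, 10]), (1, [2, 2, 2, 2, 10, 10]), (-1, [])]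
  | _ => []

/-- Whether the packed polynomial is at most `2⁻ᵉ` on `[-1, 1]`. -/
def small (e : ℕ) (a : Packed) : Bool := a.sup.blt base && (a.sup * 2 ^ e).ble (2 ^ a.sc)

/-- Lower bounds for twenty times the coordinates. -/
def lower : List ℤ := [-2, 50, 50, 20, -27, -2, 20]

/-- Upper bounds for twenty times the coordinates. -/
def upper : List ℤ := [54, 64, 66, 30, -10, 15, 28]

/-- The least value of a polynomial on `[-1, 1]`, estimated by its coefficients. -/
def minVal (l : List ℤ) : ℤ := l.headD 0 - absSum l.tail

/-- The greatest value of a polynomial on `[-1, 1]`, estimated by its coefficients. -/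
def maxVal (l : List ℤ) : ℤ := l.headD 0 + absSum l.tail

/-- The reciprocal distances are accurate. -/
def checkRecip : Bool := [7, 8, 9, 10].all fun k =>
  small 92 ((recipPoly k).eval Packed.const D.packed) &&
    Int.ble' 0 (minVal (D.orbit.getD k []))

/-- The approximate orbit stays in the box, with a margin of `2⁻³⁰`. -/
def checkBox : Bool := (List.range 7).all fun i =>
  Int.ble' (lower.getD i 0 * 2 ^ prec + 20 * 2 ^ 74) (20 * minVal (D.orbit.getD i [])) &&
    Int.ble' (20 * maxVal (D.orbit.getD i []) + 20 * 2 ^ 74) (upper.getD i 0 * 2 ^ prec)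

/-- The defect of the differential equation is small. -/
def checkField : Bool := (List.range 7).all fun i => small 72 (D.fieldDefect i)

/-- The entries of the derivative, scaled by `2 ^ 2000`. -/
def jacSup (i j : ℕ) : ℕ := (D.jac i j).sup * 2 ^ (2000 - (D.jac i j).sc)

/-- The derivative has norm at most `1.043`, the approximate variations are bounded and the defect of
the variational equation is small. -/
def checkRow (i : ℕ) : Bool :=
  ((List.range 7).all fun j => (D.jac i j).sup.blt base && (D.jac i j).sc.ble 2000) &&
    (1000 * ((List.range 7).map (D.jacSup i)).sum).ble (1043 * 1024 * 2 ^ 2000) &&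
    ((List.range 5).all fun c => small 72 (D.varDefect c i) &&
      (absSum (D.varCoeff c i)).ble (4 * 2 ^ prec))

end PieceData

/-- An approximate solution with approximate variations on `[-1, 1]`. -/
structure IsApprox (y y' : ℝ → Fin 7 → ℝ) (z z' : ℕ → ℝ → Fin 7 → ℝ) : Prop where
  deriv : ∀ t, HasDerivAt y (y' t) t
  derivVar : ∀ c t, HasDerivAt (z c) (z' c t) t
  mem_box : ∀ t, |t| ≤ 1 → ∀ x, ‖x - y t‖ ≤ 1 / 2 ^ 30 → x ∈ box
  field : ∀ t, |t| ≤ 1 → ‖y' t - vf (y t)‖ ≤ 1 / 2 ^ 80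
  jac : ∀ t, |t| ≤ 1 → ‖dvf (y t)‖ ≤ 1.044
  var : ∀ c < 5, ∀ t, |t| ≤ 1 → ‖z' c t - dvf (y t) (z c t)‖ ≤ 1 / 2 ^ 80
  bound : ∀ c < 5, ∀ t, |t| ≤ 1 → ‖z c t‖ ≤ 4

namespace PieceData

variable {D : PieceData}

lemma rep_packed (t : ℝ) (k : ℕ) : Packed.Rep t (D.approx t k) (D.packed k) :=
  (Packed.rep_ofList prec _ t).1

lemma rep_eval (t : ℝ) (p : WPoly) (hp : p.all fun m => m.2.all fun k => k.blt 11) :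
    Packed.Rep t (p.evalR (D.approx t)) (p.eval Packed.const D.packed) :=
  WPoly.rel_eval (v' := D.approx t) (fun x _ a => Packed.Rep t x a) (Packed.rep_const t)
    (fun _ _ _ _ _ _ h h' => h.add h') (fun _ _ _ _ _ _ h h' => h.mul h')
    (fun k _ => rep_packed t k) p hp

lemma abs_le_of_small {t x : ℝ} (ht : |t| ≤ 1) {a : Packed} (ha : Packed.Rep t x a) {e : ℕ}
    (h : small e a = true) : |x| ≤ 1 / 2 ^ e := by
  rw [small, Bool.and_eq_true, Nat.blt_eq, Nat.ble_eq] at h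
  refine (ha.abs_le ht h.1).trans ?_
  rw [div_le_div_iff₀ (by positivity) (by positivity), one_mul]
  exact_mod_cast h.2

lemma polyFun_mem (l : List ℤ) {t : ℝ} (ht : |t| ≤ 1) :
    (minVal l : ℝ) ≤ polyFun l t ∧ polyFun l t ≤ maxVal l := by
  cases l with
  | nil => simp [polyFun, polyPair, minVal, maxVal, absSum]
  | cons n l =>
    have h : |t * polyFun l t| ≤ absSum l := by
      rw [abs_mul]
      exact (mul_le_of_le_one_left (abs_nonneg _) ht).trans (abs_polyFun_le l ht)
    rw [abs_le] at h
    simp only [minVal, maxVal, List.headD_cons, List.tail_cons, polyFun_cons]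
    push_cast
    constructor <;> linarith

lemma mem_box_of_check (h : D.checkBox = true) {t : ℝ} (ht : |t| ≤ 1) {x : Fin 7 → ℝ}
    (hx : ‖x - D.curve t‖ ≤ 1 / 2 ^ 30) : x ∈ box := by
  have key : ∀ i : Fin 7, ((lower.getD i 0 : ℤ) : ℝ) / 20 ≤ x i ∧
      x i ≤ ((upper.getD i 0 : ℤ) : ℝ) / 20 := by
    intro i
    have h1 := List.all_eq_true.1 h i (by simp)
    rw [Bool.and_eq_true, Int.ble'_eq_true, Int.ble'_eq_true] at h1
    obtain ⟨h1, h2⟩ := h1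
    have h3 := (norm_le_pi_norm (x - D.curve t) i).trans hx
    rw [Pi.sub_apply, Real.norm_eq_abs, abs_le] at h3
    obtain ⟨h4, h5⟩ := polyFun_mem (D.orbit.getD i []) ht
    have h6 : D.curve t i * 2 ^ prec = polyFun (D.orbit.getD i []) t :=
      div_mul_cancel₀ _ (by positivity)
    have h1' : ((lower.getD i 0 : ℤ) : ℝ) * 2 ^ prec + 20 * 2 ^ 74 ≤
        20 * (minVal (D.orbit.getD i []) : ℝ) := by exact_mod_cast h1
    have h2' : 20 * (maxVal (D.orbit.getD i []) : ℝ) + 20 * 2 ^ 74 ≤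
        ((upper.getD i 0 : ℤ) : ℝ) * 2 ^ prec := by exact_mod_cast h2
    have hp : (2 : ℝ) ^ 74 = 1 / 2 ^ 30 * 2 ^ prec := by norm_num
    rw [hp] at h1' h2'
    have hpos : (0 : ℝ) < 2 ^ prec := by positivity
    generalize (2 : ℝ) ^ prec = a at *
    have h7 := mul_le_mul_of_nonneg_right h3.1 hpos.le
    have h8 := mul_le_mul_of_nonneg_right h3.2 hpos.le
    rw [sub_mul, h6] at h7 h8
    constructor
    · rw [div_le_iff₀ (by norm_num)]
      refine le_of_mul_le_mul_right ?_ hpos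
      linarith
    · rw [le_div_iff₀ (by norm_num)]
      refine le_of_mul_le_mul_right ?_ hpos
      linarith
  have k0 := key 0; have k1 := key 1; have k2 := key 2; have k3 := key 3
  have k4 := key 4; have k5 := key 5; have k6 := key 6
  norm_num [lower, upper] at k0 k1 k2 k3 k4 k5 k6
  rw [mem_box]
  refine ⟨⟨?_, ?_⟩, ⟨?_, ?_⟩, ⟨?_, ?_⟩, ⟨?_, ?_⟩, ⟨?_, ?_⟩, ⟨?_, ?_⟩, ⟨?_, ?_⟩⟩ <;> linarith

/-- The error of the reciprocal distances. -/
lemma abs_approx_sub_le (h : D.checkRecip = true) {t : ℝ} (ht : |t| ≤ 1)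
    (hb : D.curve t ∈ box) {k : ℕ} (hk : 7 ≤ k ∧ k ≤ 10) :
    |D.approx t k - atoms (D.curve t) k| ≤ 1 / 2 ^ 94 := by
  have h1 := List.all_eq_true.1 h k (by
    obtain ⟨h1, h2⟩ := hk
    interval_cases k <;> simp)
  rw [Bool.and_eq_true, Int.ble'_eq_true] at h1
  have h2 := abs_le_of_small ht (rep_eval t (recipPoly k) (by
    obtain ⟨h1, h2⟩ := hk
    interval_cases k <;> decide)) h1.1
  have h3 : (recipPoly k).evalR (D.approx t) =
      D.approx t k ^ 2 * quartic k (D.curve t) - 1 := by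
    obtain ⟨h1, h2⟩ := hk
    interval_cases k <;>
      simp only [recipPoly, quartic, WPoly.evalR, curve, List.map_cons, List.map_nil,
        List.prod_cons, List.prod_nil, List.sum_cons, List.sum_nil, Fin.val_zero, Fin.val_one,
        Fin.val_two] <;> push_cast <;> ring
  rw [h3] at h2
  have h0 : 0 ≤ D.approx t k := by
    have h4 := (polyFun_mem (D.orbit.getD k []) ht).1
    have h5 : (0 : ℝ) ≤ minVal (D.orbit.getD k []) := by exact_mod_cast h1.2
    exact div_nonneg (h5.trans h4) (by positivity)
  have hS := smooth_of_mem_box hb k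
  have hs := Real.sqrt_pos.2 hS
  have hle := atoms_le hb hk
  have hpos := atoms_pos (smooth_of_mem_box hb) hk.1
  have ha : atoms (D.curve t) k * √(quartic k (D.curve t)) = 1 := by
    rw [atoms, dif_neg (by omega)]
    exact inv_mul_cancel₀ hs.ne'
  have hsq := Real.sq_sqrt hS.le
  generalize atoms (D.curve t) k = r at *
  generalize √(quartic k (D.curve t)) = s at *
  generalize D.approx t k = q at *
  rw [← hsq] at h2
  -- The check controls `q² s² - 1` only. Since `q` is nonnegative, the factor `q s + 1` is at least
  -- `1`, and the bound passes to `q s - 1`.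
  have h6 : q ^ 2 * s ^ 2 - 1 = (q * s - 1) * (q * s + 1) := by ring
  rw [h6, abs_mul] at h2
  have h7 : 1 ≤ |q * s + 1| := by
    rw [abs_of_nonneg (by positivity)]
    have : 0 ≤ q * s := by positivity
    linarith
  have h8 : |q * s - 1| ≤ 1 / 2 ^ 92 := (le_mul_of_one_le_right (abs_nonneg _) h7).trans h2
  -- This uses `r s = 1`. The factor `r ≤ 4/25 < 1/4` gains two more binary digits.
  have h9 : q - r = r * (q * s - 1) := by linear_combination (-q) * ha
  rw [h9, abs_mul, abs_of_pos hpos]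
  calc r * |q * s - 1| ≤ 4 / 25 * (1 / 2 ^ 92) := by gcongr
    _ ≤ 1 / 2 ^ 94 := by norm_num

/-- The first seven variables of the approximation are exact coordinates of `curve`; only the
reciprocal distances carry an error, and the extra `1/100` in `boxVars'` covers it. -/
lemma rep_atoms_approx (h : D.checkRecip = true) {t : ℝ} (ht : |t| ≤ 1)
    (hb : D.curve t ∈ box) : ∀ k < 11,
    BoundLip.Rep (1 / 2 ^ 94) (D.approx t k) (atoms (D.curve t) k) (boxVars' k) := by
  intro k hk
  have h1 := abs_atoms_le hb hk
  have e : ((boxVars' k).bd : ℝ) = (boxBound.getD k 0 : ℚ) + 1 / 100 := by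
    simp [boxVars']
  by_cases hk7 : k < 7
  · have h2 : D.approx t k = atoms (D.curve t) k := by simp [atoms, hk7, curve]
    have h3 : |atoms (D.curve t) k| ≤ (boxVars' k).bd := by rw [e]; linarith
    refine ⟨h2 ▸ h3, h3, ?_⟩
    simp [h2, boxVars', hk7]
  · have h2 := abs_approx_sub_le h ht hb (k := k) ⟨by omega, by omega⟩
    refine ⟨?_, by rw [e]; linarith, by simpa [boxVars', hk7] using h2⟩
    have h3 := abs_le.1 h1
    have h4 := abs_le.1 h2
    have h5 : (1 : ℝ) / 2 ^ 94 ≤ 1 / 100 := by norm_num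
    rw [e, abs_le]
    constructor <;> linarith

/-- The checks concern polynomials with approximate reciprocal distances. Passing to the true ones
changes the field and the derivative by at most `2000 · 2⁻⁹⁴ ≤ 2⁻⁸³`. The checked defect, divided by
`1024`, is at most `2⁻⁸²`, so the total stays below `2⁻⁸⁰`, even after the variations, of norm at
most `4`, enlarge the error of the derivative. -/
lemma isApprox_of_check (h1 : D.checkRecip = true) (h2 : D.checkBox = true)
    (h3 : D.checkField = true) (h4 : (List.range 7).all D.checkRow = true) :
    IsApprox D.curve D.curveDer D.variation D.variationDer := by
  have hbox : ∀ t, |t| ≤ 1 → D.curve t ∈ box := fun t ht =>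
    mem_box_of_check h2 ht (by rw [sub_self, norm_zero]; positivity)
  have hrow : ∀ i : Fin 7, D.checkRow i = true := fun i => List.all_eq_true.1 h4 i (by simp)
  -- The entries of a row are packed with different scales; they are compared over the common
  -- denominator `2 ^ 2000`.
  have hjac : ∀ t, |t| ≤ 1 → ∀ i, ∑ j, |vfJac (D.approx t) i j| ≤ 1.043 := by
    intro t ht i
    have hr := hrow i
    rw [checkRow, Bool.and_eq_true, Bool.and_eq_true, Nat.ble_eq] at hr
    obtain ⟨⟨hr1, hr2⟩, -⟩ := hr
    have key : ∀ j < 7, |WPoly.evalR (D.approx t) ((jacTable.getD i []).getD j []) / 1024| ≤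
        (D.jacSup i j : ℝ) / (1024 * 2 ^ 2000) := by
      intro j hj
      have hr3 := List.all_eq_true.1 hr1 j (by simpa using hj)
      rw [Bool.and_eq_true, Nat.blt_eq, Nat.ble_eq] at hr3
      have h5 := (rep_eval (D := D) t _ (jacTable_vars i i.2 j hj)).abs_le ht hr3.1
      change _ ≤ ((D.jac i j).sup : ℝ) / 2 ^ (D.jac i j).sc at h5
      rw [abs_div, abs_of_pos (by norm_num : (0 : ℝ) < 1024), div_le_div_iff₀ (by norm_num)
        (by positivity)]
      refine (mul_le_mul_of_nonneg_right h5 (by positivity)).trans (le_of_eq ?_)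
      have h6 : (2 : ℝ) ^ 2000 = 2 ^ (2000 - (D.jac i j).sc) * 2 ^ (D.jac i j).sc := by
        rw [← pow_add, Nat.sub_add_cancel hr3.2]
      rw [jacSup, h6]
      push_cast
      have h7 : (0 : ℝ) < 2 ^ (D.jac i j).sc := by positivity
      generalize (2 : ℝ) ^ (D.jac i j).sc = a at *
      field_simp
    have h5 : ∑ j, |vfJac (D.approx t) i j| ≤ ∑ j : Fin 7, (D.jacSup i j : ℝ) / (1024 * 2 ^ 2000) :=
      Finset.sum_le_sum fun j _ => key j j.2
    refine h5.trans ?_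
    rw [← Finset.sum_div, sum_fin_seven fun j => (D.jacSup i j : ℝ)]
    have h6 : (1000 : ℝ) * ((List.range 7).map fun j => (D.jacSup i j : ℝ)).sum ≤
        1043 * 1024 * 2 ^ 2000 := by
      have : ((List.range 7).map fun j => (D.jacSup i j : ℝ)) =
          ((List.range 7).map (D.jacSup i)).map (fun n : ℕ => (n : ℝ)) := by simp
      rw [this]
      have h7 : (((List.range 7).map (D.jacSup i)).map (fun n : ℕ => (n : ℝ))).sum =
          ((((List.range 7).map (D.jacSup i)).sum : ℕ) : ℝ) := by
        push_cast; rfl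
      rw [h7]
      exact_mod_cast hr2
    rw [div_le_iff₀ (by positivity)]
    generalize (2 : ℝ) ^ 2000 = a at *
    linarith
  -- This is the effect on a row of the derivative of replacing the approximate reciprocal distances
  -- by the true ones.
  have herr : ∀ t, |t| ≤ 1 → ∀ i,
      ∑ j, |vfJac (D.approx t) i j - vfJac (atoms (D.curve t)) i j| ≤ 1 / 2 ^ 83 := by
    intro t ht i
    refine (sum_abs_vfJac_le (rep_atoms_approx h1 ht (hbox t ht)) i).2.trans ?_
    have h5 : (((jacRow boxVars' i).lip : ℚ) : ℝ) ≤ ((2000 * 1024 : ℚ) : ℝ) := by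
      exact_mod_cast (jacRow_le i i.2).2.2.1
    push_cast at h5
    calc ((jacRow boxVars' i).lip : ℝ) / 1024 * (1 / 2 ^ 94)
        ≤ 2000 * 1024 / 1024 * (1 / 2 ^ 94) := by gcongr
      _ ≤ 1 / 2 ^ 83 := by norm_num
  have hbd : ∀ c < 5, ∀ t, |t| ≤ 1 → ‖D.variation c t‖ ≤ 4 := by
    intro c hc t ht
    rw [pi_norm_le_iff_of_nonneg (by norm_num)]
    intro i
    have hr := hrow i
    rw [checkRow, Bool.and_eq_true] at hr
    have hr3 := List.all_eq_true.1 hr.2 c (by simpa using hc)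
    rw [Bool.and_eq_true, Nat.ble_eq] at hr3
    rw [Real.norm_eq_abs, variation, abs_div, abs_of_pos (by positivity : (0 : ℝ) < 2 ^ prec),
      div_le_iff₀ (by positivity)]
    exact (abs_polyFun_le _ ht).trans (by exact_mod_cast hr3.2)
  refine ⟨D.hasDerivAt_curve, D.hasDerivAt_variation, fun t ht x hx => mem_box_of_check h2 ht hx,
    fun t ht => ?_, fun t ht => ?_, fun c hc t ht => ?_, hbd⟩
  · rw [pi_norm_le_iff_of_nonneg (by positivity)]
    intro i
    have h5 := abs_le_of_small ht (Packed.Rep.add (rep_eval t _ (fieldPoly_vars i i.2))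
      (Packed.Rep.mul (Packed.rep_const t (-1024))
        (Packed.rep_ofList prec (D.orbit.getD i []) t).2)) (List.all_eq_true.1 h3 i (by simp))
    have h6 := (BoundLip.rep_eval (rep_atoms_approx h1 ht (hbox t ht)) _
      (fieldPoly_vars i i.2)).2.2
    have h7 : ((((fieldPoly i).eval BoundLip.const boxVars').lip : ℚ) : ℝ) ≤
        ((2000 * 1024 : ℚ) : ℝ) := by
      exact_mod_cast (jacRow_le i i.2).2.2.2
    push_cast at h5 h7
    have h8 : |(fieldPoly i).evalR (D.approx t) - (fieldPoly i).evalR (atoms (D.curve t))| ≤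
        2000 * 1024 * (1 / 2 ^ 94) := h6.trans (by gcongr)
    rw [Real.norm_eq_abs, Pi.sub_apply, vf, curveDer]
    rw [abs_le] at h5 h8 ⊢
    norm_num at h5 h8 ⊢
    constructor <;> linarith
  · refine norm_linMap_le fun i => ?_
    have h5 : ∑ j, |vfJac (atoms (D.curve t)) i j| ≤ ∑ j, (|vfJac (D.approx t) i j| +
        |vfJac (D.approx t) i j - vfJac (atoms (D.curve t)) i j|) := by
      refine Finset.sum_le_sum fun j _ => ?_
      have := abs_sub_abs_le_abs_sub (vfJac (atoms (D.curve t)) i j) (vfJac (D.approx t) i j)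
      rw [abs_sub_comm] at this
      linarith
    rw [Finset.sum_add_distrib] at h5
    have h6 := hjac t ht i
    have h7 := herr t ht i
    norm_num at h6 h7 ⊢
    linarith
  · rw [pi_norm_le_iff_of_nonneg (by positivity)]
    intro i
    have hr := hrow i
    rw [checkRow, Bool.and_eq_true] at hr
    have hr3 := List.all_eq_true.1 hr.2 c (by simpa using hc)
    rw [Bool.and_eq_true] at hr3
    -- The defect of the variational equation is a fold over the seven columns; it is treated for an
    -- arbitrary list of columns and an arbitrary last term.
    have hrep : ∀ l : List ℕ, (∀ j ∈ l, j < 7) → ∀ {y : ℝ} {b : Packed}, Packed.Rep t y b →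
        Packed.Rep t ((l.map fun j => ((jacTable.getD i []).getD j []).evalR (D.approx t) *
          (polyFun (D.varCoeff c j) t / 2 ^ prec)).sum + y)
        (l.foldr (fun j a => D.jac i j * (Packed.ofList prec (D.varCoeff c j)).1 + a) b) := by
      intro l hl y b hb
      induction l with
      | nil => simpa using hb
      | cons j l ih =>
        rw [List.map_cons, List.sum_cons, List.foldr_cons, add_assoc]
        exact ((rep_eval t _ (jacTable_vars i i.2 j (hl j (by simp)))).mul
          (Packed.rep_ofList prec _ t).1).add (ih fun j' hj' => hl j' (by simp [hj']))
    have h5 := abs_le_of_small ht (hrep (List.range 7) (by simp)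
      ((Packed.rep_const t (-1024)).mul (Packed.rep_ofList prec (D.varCoeff c i) t).2)) hr3.1
    rw [← sum_fin_seven fun j => ((jacTable.getD i []).getD j []).evalR (D.approx t) *
          (polyFun (D.varCoeff c j) t / 2 ^ prec)] at h5
    have h6 : ∑ j : Fin 7, ((jacTable.getD i []).getD j []).evalR (D.approx t) *
          (polyFun (D.varCoeff c j) t / 2 ^ prec) =
        1024 * ∑ j, vfJac (D.approx t) i j * D.variation c t j := by
      rw [Finset.mul_sum]
      refine Finset.sum_congr rfl fun j _ => ?_
      rw [vfJac, variation]
      ring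
    rw [h6] at h5
    have h7 : |∑ j, (vfJac (D.approx t) i j - vfJac (atoms (D.curve t)) i j) *
        D.variation c t j| ≤ 1 / 2 ^ 83 * 4 :=
      (abs_sum_mul_le (herr t ht i) _).trans (by gcongr; exact hbd c hc t ht)
    simp only [sub_mul, Finset.sum_sub_distrib] at h7
    rw [Real.norm_eq_abs, Pi.sub_apply, dvf_apply, variationDer]
    push_cast at h5
    rw [abs_le] at h5 h7 ⊢
    norm_num at h5 h7 ⊢
    constructor <;> linarith

end PieceData

/-! ### Numerical data on the four pieces -/

namespace PieceData

/-- The approximate orbit and its variations on the piece with index 0. -/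
def piece0 : PieceData where
  orbit := [
    [6893811967550729795648840340254, 6898222610206059276711130469481,
     6590388640152377124144565940, 2136511780174725799668091992, -76154935369153158101198777,
     -46239234081859432104676688, -15576529207329151988635552, -2269859402335668756033287,
     -10251917954306040633469, 2760055800256770210898, 1374446694401512761966,
     216726723249269906693, 22112464243500576800, 1314937819328541602, -117633553114800687,
     -20594412523561757, -2874184928811377, -308130909295079, -21444520880073, -382033926376,
     230570691499, 46380047999, 7063587273, 761318219, 40509337, -4270434, -1438397, -205646,
     -17468, -178, 206, 37, 4],
    [62880314627176529313328067098629, -39212239382603196615727506341,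
     -39397048465145672287281655919, -13432126655535320793365723523, -291608292493005454638028706,
     -111817973325178347352574666, -17877809977446955607580770, 7919006495341381243320,
     26548626317036160435344, 9096623264032252704197, 1460194180132265726812,
     194167928663043195257, 15641535087611684827, -460798351229962079, -157862805312279439,
     -27675096852900056, -3475063495438973, -268801690344672, -2600491856325, 3139192319788,
     552809882790, 65025829137, 5137237380, 87608656, -54222247, -10829881, -1285484, -102171,
     -1941, 975, 211, 26, 2],
    [62906378476849361464927155200690, 38999363023880441420524840358,
     38864655895623733517736271240, 12721811186255308375633010216, -241788969559408050805474280,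
     -102156160075277530869068426, -18139056849899099438083600, -108772513545381356269270,
     -3848632438276389334739, 5295416069745392835970, 1283298928401176436973,
     155993739582039553158, 10503178288457045787, -655539897292338111, -87913818125480177,
     -13631127459212899, -1583540304060369, -138750722518386, -7813090738477, 457838291842,
     126370452200, 33138875556, 4975735330, 444260113, 6148498, -5918083, -1138450, -125963, -5764,
     726, 190, 21, 1],
    [28711247443907429784261028773374, 55069164852623014426711777376,
     27200759448720618333556153592, -568761556984313914770655929, -436359310598072920740648535,
     -177099137658687292327413278, -29869231680559696264431921, -3932930756607544515308,
     93469280618978823072431, 32755672747363704474819, 3924290853999031596501,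
     132660759773200926916, -7645832933775998016, -4433350567567000506, -346202192587097443,
     -777707851388779, 1141248637918799, 34584585439350, -48162777238253, -7648854447930,
     29397856380, 175305581851, 33930830063, 2831230861, -148287866, -73551467, -10257383, -525459,
     82312, 21141, 2118, 9, -31, -5],
    [-13578351501464557038355451695265, -93779962923725872924253019212,
     -93799764296965691676787704761, -31272581215345997555460724178, 24774689329025449546620481,
     33107382122519835052581852, 13634210558268204375132844, 2124596247924350017218660,
     189091473501453903788291, 19830821593402311461669, -1009473275038412501282,
     -301329036828056857747, -36789656608103680673, -4473497163584469386, -207532792637357255,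
     18885345952305291, 5805292088166269, 908068202284326, 72645296485479, 2209134845878,
     -484818716734, -141005883400, -16445699809, -1207120240, -12357075, 16346394, 2738765, 301552,
     18384, -1045, -374, -57, -5],
    [13515834663450617622131300873026, -93807502048984706065011070467,
     -93868677269363463287780919778, -31364641804094104547399973246, -44590963695447229836367658,
     4952599028322199184792510, 8566625225857018134552991, 1876142646456429137339349,
     103739827794836515994589, 2246389475634261345740, -2404510638673387161022,
     -133889033434425804183, 5958591797095783950, 2252139473896589499, 240549451372380570,
     -16534709429319444, -5633793621736188, -749931228002937, -6271210878504, 12278865626583,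
     2011719746325, 127946001741, -13595207222, -4088587500, -429591090, -1949281, 6496433,
     1000817, 49265, -8425, -2027, -168, 7, 4],
    [26985723744949242954258739696321],
    [1491483705404838032198011852719, -211523847528216564461905696, -313754700678983964721240162,
     -203249351153303438608659769, -44830375077451315026085665, 3662398153750715709702287,
     670576542709543537251118, 24883717448678632319076, 2469406404817278207199,
     -271930281643372840344, -56493656545460390719, -8070516548150044288, -679301631323820143,
     13209271597590852, 6582484632158129, 1288248511545654, 124865479697286, 5177914080947,
     -578719867153, -184121393715, -20530149637, -1375393130, 22947845, 20533229, 2834586, 231758,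
     3393, -1808, -290, -25, -1],
    [2110074873243340033026188841498, 2021321559455747735299152934, 1728003632670775674137742487,
     288663149325019085760065815, -136758710994062015980940448, 4953965992218817925329128,
     439044982895789303423448, -48048712354226418210175, 17047226690434109468878,
     -146929695881252085707, 15150084132145338830, 1012513009969731816, -3018131911603834084,
     -78836466128861598, -15670329551820162, -226136683988910, 497268497334759, 34458565875856,
     5117798862230, 157807423046, -73164137010, -8146599258, -1255339526, -64527861, 8506708,
     1479754, 258951, 18557, -381, -201, -47, -4],
    [2108326963108533151210055689705, -3222248826752859678760072738, -3513666538327100221473186998,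
     -1452534658944002321594612663, -127021644172500017483936191, 12084781172945366024373991,
     2986578389136303632897566, 279306187194712787113470, -1014862064570068223228,
     -4507489681640036245753, -644329746852405466715, -34227561523897119371, 5145944286415608237,
     1261914085804932125, 108911689317742552, -2799276245929204, -2144297249790405,
     -268422228134133, -7012741388332, 3205104710798, 592952747115, 37249915739, -3810487306,
     -1182362934, -117227124, 1314092, 2091850, 298352, 11514, -3074, -656, -50, 3, 1],
    [1491537528601977744246807092523, 3895445674973849150088302, 9742221071083829363379388,
     12997772860823519244412831, 9759924666309784053423150, 3914543749443016204413442,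
     658239078876844948643737, 1379469422623177146930, -577709907056917030095,
     -292343519594962925614, -50148660962129943667, -5538682388052868601, -379967120055081564,
     25930604242035203, 4537887540126627, 603945982474131, 56953110513839, 2645010332867,
     -90128238711, -49760072167, -6093155934, -687586870, -68559627, -3703680, 319996, 127635,
     20072, 1909, 44, -20, -4]]
  variations := [
   [
    [8854204670423678791553574367032, 8782817194489518717145653521107,
     -107296057633283221128618663633, -36247109024925573520573700501, -577218765507568009837860278,
     -330331209949091878398398632, -106198744939635583985189743, -14199888882596610646458274,
     439239629941100086527143, 93568693288476862790201, 15555182878267198818825,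
     2337789016952631165155, 204751239721934274228, 4754559017251189349, -2845684145670531582,
     -367110942985993199, -39247382106236682, -3923371118097148, -200719121855099, 13656407023342,
     6160097737906, 1039273482133, 144134163563, 13718156566, 226149050, -201506425, -43268608,
     -5046139, -287074, 25043, 8581, 1126, 73, -2, -1],
    [20240362005096899016774735298430, -126325319170004204534982359535,
     -126942989235455926623020926017, -43459523618195379574570986977,
     -1258667973983831764795205229, -568188836625501070190695714, -101842336973586548789162454,
     2405436206500276325494073, 550517700762906187770893, 91784557486846688655216,
     14963634082253962173051, 1917984718570642165866, 121494685177562249716, -14844909935649888097,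
     -2931209750292838444, -409683747983561743, -47481822583889045, -2813015336164745,
     195203142729876, 78121901927910, 11125447068613, 1115222852319, 65470274677, -3794879103,
     -1747415025, -271232858, -27139988, -1571530, 84909, 38534, 6288, 656, 37, -2, -1],
    [20324240340722811207255948457370, 125024800652376870493283559104,
     123694331262879821142468887483, 39134260972175872079955749200, -1975567424390222857127737087,
     -715313181664023717645130618, -104690747835725922109713424, 1300536245212733152390776,
     287271788944247818095729, 60834130312416034483696, 13863127112239936119687,
     1564266886880061352806, 67778136462551234190, -14427236954101252957, -1543357142757361940,
     -178476904198075253, -21844798692689161, -1857687836771776, -74874851543567, 15239938984036,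
     3451029081545, 780274269282, 109730086938, 7519848343, -434526329, -211330292, -31684592,
     -2688313, 197, 38775, 6271, 488, -2, -5, -1],
    [-480867518305927880990916516194, -962718416162284647341698729289,
     -483997284920962101789144765220, -3975530057016012798535441151, -2654861761266348658645858976,
     -980467754891809417570918322, -148552827881548409067384834, 7798698936486327877973854,
     1874223399182602837775160, 302552476117157921737464, 30520270048819573073113,
     -629262619503437388806, -338932424144055399965, -62580231055135881566, -2974067645631521023,
     389968216057058340, 42353037317229153, -1093211018779205, -1207435442979243, -148186253774317,
     9081110471258, 4988271057756, 750870239525, 35037153681, -9336461589, -2271580497, -228138499,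
     886717, 4246953, 678633, 40258, -4691, -1416, -142, 1, 2],
    [-90496286875604324762185782757, -271061880015575433829928996360,
     -269935597463808301556426871296, -88345168523656444520956441640, 1414870398858333454265820316,
     466622683706323637580747554, 89604713110015313454497194, 14067663168651450082035726,
     1161487529085567822761146, 95977147731580271031623, -17951682130441848384610,
     -3815383762440555181991, -377583279385563747730, -39457577786149423201, -410623502759813281,
     546699028981012918, 99289136643849909, 12600166564550231, 697331096311712, -38802275140200,
     -15263319686980, -2842518146479, -260126136322, -8875402439, 1607249655, 495510943, 60673657,
     4690273, 47870, -69015, -11734, -1269, -71, 7, 2],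
    [-90522861698458542096281048457, -271221317928576783405788233509,
     -270334218470991184541496965819, -88876958051790996279090572226, 1015062563251210584212548229,
     304901788053383408845794298, 60491536375044969272132971, 12331506294742723090442812,
     452538134409914118476542, -55055104746967458742582, -25214067249432528127347,
     -813927313987027149803, 224228699457752612809, 35782889587679548387, 1790909357130015349,
     -574722299289271058, -117382639476116870, -10042301922339540, 792246373565411,
     335968524177896, 39816343973487, 676474026393, -614065554602, -110506468812, -7321121139,
     718380457, 240113307, 25147654, -151244, -451653, -67136, -2623, 750, 162, 12, -1],
    []],
   [
    [-18426862055949300353382142605, -55289568005218180320028730536,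
     -55313773131385801030439968764, -18474099426813546603488266488, -32571474768450232549495471,
     -11294398870283184561188369, -1618925871221700171773340, 320701949564050370855286,
     207804477335482400614313, 23317759843140920704581, -98934849247923277131,
     -93972101590990078390, -26204384671855965527, -3772427999800610368, -297660308688618160,
     8346881819553298, 6092965109579583, 574063655772477, 26591160729122, -1431985780829,
     -526865361862, -38396232613, 1228812595, 508337191, -14419756, -18084464, -2563862, -70901,
     38530, 8606, 820, -9, -16, -2],
    [-19473230750597234372601879634, -58362618863224446385794169180,
     -58225055203535436599109928807, -19234546794726221357507101673, 119599045822370015731201775,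
     17101256896192954653957741, -460942645521737703242668, 1063799873907480781674757,
     151606092825037514362285, 4179400959827593715860, -239132146952427504713,
     -75772646988086706784, -15980916025613437274, -2616692803958860920, -183479523262278848,
     11628751734084990, 2558643821900625, 382119624456575, 47826474548084, 2578488944319,
     -199336312078, -72596583977, -9264083605, -747608567, -33189109, 5712318, 1527456, 182056,
     14406, 275, -134, -29, -4],
    [19465372655989798808129221025, 58315913315477595845471610167, 58110064057071208217118678232,
     19085363736945785317009318887, -225273955809169239724860176, -53151562832797206163098712,
     -1392900457418800799150538, 723105305378795392683141, 75105793673923347365483,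
     -3658248167032795726793, -90386171690127056820, -80717016663354866289, -18043123152191148066,
     -1743059476510516093, 59516270487062520, 33117941645804583, 2606676486326824, 68768741351203,
     -17733735166131, -3178474579928, -137014378873, 38879186494, 8155821803, 176875742,
     -138795997, -26094699, -1870894, 152922, 59543, 7646, 272, -81, -17, -1],
    [-230107413215781338632298698018, -460360224850830667107177528326,
     -230466406035305137821026816045, -274262134895639347164229614, -47474320220326357910780976,
     21128499436859941640885043, 10579570542249003434907618, 3013618470164835181838455,
     360592222536141773632695, -12475145377258853952289, -4852628384658482178488,
     -1005851514452855417319, -85128564022595187095, 4079858231656659212, 1850217081781783788,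
     301469042789899920, 11489667006827896, -2951718303967175, -592245547089516, -52319052329420,
     2801021899414, 1240466478247, 133103684783, -266587048, -2560889569, -376130591, -11557123,
     4859929, 1017214, 72894, -6789, -2394, -272, -1, 5, 1],
    [-20273899749832957403093302348925, 25749426045733813592680856969,
     26305450244187105489715399303, 9522420279554967677946823772, 580812847313587363397446380,
     127878914411304862855950184, 3238141510969498434501246, -471826973904425588987907,
     -113253618896575063871178, -12357441899359955255464, -906311210181009466001,
     -142758627032760897884, 23954061362373099012, 3390551668783533449, 197485335160104151,
     26536143631570841, -4026681244692049, -724337853101789, -86564757961658, -8159560022923,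
     886243703731, 179109548644, 24622268273, 2460967386, -101195157, -38608691, -6573666, -684707,
     -2356, 6533, 1460, 176, 7, -1],
    [20290910877068326654802331647148, 25697978426841848035740005002,
     26176959845731661873433390002, 9351365157582099839108070965, 452842331463268316185447566,
     76889983398039257275804251, -5265393988880021038461585, -587915213793193641865529,
     -194043092049906045567139, -30544954899011572843538, -648949990718883967982,
     495420670280119628903, 101993210150540229470, 6224318192947671265, -717734788544765389,
     -227547706695069271, -25273576679806658, 110621189919046, 476192063429270, 76236994819798,
     3536908486985, -814336446820, -192978869844, -16698699972, 756740457, 417406345, 53615404,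
     1248472, -742424, -139552, -9217, 963, 312, 33, 0, -1],
    []],
   [
    [5184688683532420472286014414948, 5194595326252858271867734272080,
     14724035145198089143172244589, 4588440908455542848273044396, -402718040832912068519879930,
     -244010231587256001384728231, -82185855805292828368165245, -12003791295021702798813307,
     -42972482928774087821919, 29000376501538926517682, 12122115135288141222892,
     1991240668453040208213, 212284100165368386587, 11610172592437506636, -1469964331283442550,
     -266744411204971882, -38500733951037261, -4227156307768109, -295573351700341, -1989652726146,
     4197970266512, 848839427620, 129958197286, 13891438062, 650480238, -108349697, -32281696,
     -4540829, -371506, 749, 5508, 959, 89, 3, -1],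
    [-29471831408014557437046278877, -88693298410140635788312676912,
     -89508136048015802053306387804, -31163357607303102044386213897, -1296899254568484112659882158,
     -500832225089381888645628731, -80579868581298310005088533, 201294458214241628372809,
     221164120513508055294527, 72507802072575853425624, 12580084784942980994009,
     1746371702850605003547, 136571358278112209336, -6163445769610576118, -1973098752342589354,
     -353797712542979388, -45224121935836019, -3469704165813212, 9647359065869, 53138602014304,
     9336152049277, 1111283616967, 86459463532, 536389151, -1181572527, -228613207, -27193714,
     -2114215, -19598, 25994, 5355, 655, 50, 1, -1],
    [29311834012971301797736294897, 87733010886358061381369070380, 87106231365754228140971895113,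
     27958142297667981430008776117, -1110813901721664954496619550, -465701354346241641108255640,
     -82371919569173179506467409, -595413233363684983266444, 12679217602339779113669,
     45465451897033230031468, 10934936043459651626123, 1384419986776290778832,
     88324853524696140565, -7330191772716723974, -1078738480354654097, -172719839219281918,
     -20815806061761850, -1878541882963070, -99163332917088, 8437689468653, 2422644183605,
     605323733547, 89954346843, 7790721612, -291699, -133447508, -24803243, -2677474, -105467,
     20108, 4767, 511, 21, -2, -1],
    [41389861121696548392026636233, 82277921036903218670489158285, 39605620173223583105809355496,
     -2594306469081508072570165570, -1977403305697555388037953482, -800234464907601962117211646,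
     -134718578182182467720136341, 541318544175721188848015, 783582231196849177837290,
     251066695584238635810207, 30591665111438913304520, 1027823742169329369916,
     -112276343973097129519, -46960119917522656550, -3651634961861065955, 4956306552995270,
     14166051625245548, -209689791561503, -760811017487927, -108786468718633, 3208852208847,
     3327996338414, 609994167479, 46267908100, -4056895843, -1582473032, -211108287, -8930981,
     2193023, 508547, 47976, -522, -859, -123, -5, 1],
    [-70484810361637118674145782068, -211484196420579995244841491196,
     -211512592326959925307847158644, -70438723863687454209389067463, 198899576064564598395071383,
     185901824682323844367719343, 72662545460091691849078872, 12314858340851340874258607,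
     1271109038472435585833411, 126556031804240544838986, -10078439085341082849728,
     -2823072813932700874975, -375521799364724620286, -45893252558993079064, -1970823801556648391,
     282724669376866891, 81414447269843171, 12585335265748226, 1014347997516088, 24259462103863,
     -9513347098235, -2497505963826, -292799310243, -21090085268, 84246619, 360667518, 59639124,
     6506323, 364107, -31209, -9750, -1450, -128, -2, 1],
    [-70505508706580728567124006540, -211608484437335786831626107386,
     -211823759596503786164311415618, -70854841740029293795292245619, -115446062523269808157206166,
     57243749902218466983439530, 48502670459893663068147888, 10494497295131498180121949,
     638960411905641492798403, -2876816429514137197330, -19179185853374824341255,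
     -1053196107239405921213, 75746710075991460209, 24536288895527024727, 2344738254772833197,
     -254161306267054716, -77331539715409937, -9666834474433070, 90504885606611, 205586672068317,
     32259523731352, 1794643701532, -295477185463, -78427496897, -7785739734, 90323444, 147260037,
     21346475, 853133, -229335, -49616, -3726, 276, 107, 12],
    [20282409603651670423947251286016]],
   [
    [-2139729339663024602220257672, -8564111134346638241795280735, -12861707657578466744597613840,
     -8600236194345233288099654331, -2175509528946190565933742115, -14760299201450643624925074,
     -1856935426123240727182505, 437213349353119044402686, 167011387490570228294062,
     37908931494986843538918, 3970830310492333835561, 15476375604013580498, -15039561115347488657,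
     -5020026593492674451, -802447032072481705, -86363957306602012, -4084639318890723,
     486110410291611, 109535035720457, 17333345488451, 1897748663799, 124935916539, -2787483533,
     -2280094933, -393050022, -49679301, -4122956, -67737, 49398, 10663, 1349, 108, 1, -1],
    [-19502991001274962660202224876, -58499530351854540080430950788,
     -58463368044156805195789087171, -19414040361475596412905737569, 88166926132475758833954047,
     45407467679436547388295954, 10980989964858749371132521, 1217743235413154191297022,
     298045577195539138110330, 32281351973420438074935, -255031011230190887975,
     -150836785355824923327, -38526676330384091538, -6120996036850686342, -751704930647640271,
     -42915056606535952, 3387870229882465, 903383145933663, 152649537552916, 17939408719350,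
     1279359374689, -21203090391, -21784490336, -3685368595, -439745644, -33750143, -188088,
     451861, 88479, 10706, 859, 14, -9, -2],
    [-19519165434929426087058461153, -58596608029650470036889056055,
     -58706186443567159237153579285, -19738087626918255599961203848, -155301444909185035754132469,
     -52410366583440911106583703, -5605208003353860113452133, 1100778599570885314219292,
     287382621445305037594839, 34538013703838736829217, 445841474434719194251,
     -16784792411853357608, -25267911213616567643, -5524019744494074671, -675245136566833949,
     -39974180709051542, 2141047562285454, 549829973116927, 103311656300999, 12864813163379,
     1030224483050, 16605767137, -10249056246, -2015523999, -302665646, -30782857, -1533176,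
     161869, 53920, 8041, 805, 36, -5, -1],
    [-17112762300597114516277793, -85490007216136343972475443, -170627713861447146388215025,
     -169640654492679278516525072, -83020248991775567077075892, -14368665862236504719551094,
     1916639492053062299995792, 848270735692485894518073, 218283627013652540712535,
     25372576029030683700246, -8425071495744287686, -169554300877704458603, -49264347390286499981,
     -6389729354477508304, -492404370069598022, -7651305521376738, 6375489143225518,
     909445133888275, 108506844957986, 11183735942994, 897781810838, 35757406850, -11276576480,
     -3610761953, -634175399, -67341010, -1833829, 882513, 199706, 22600, 915, -189, -45, -5],
    [-20273979189998010166346420333862, 25373071588766751563016631378,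
     25615373549452934186432064732, 8936992847082954395773977900, 393229015628088970438898978,
     154035994658578414623755616, 24962506589997551703477837, -202134557735484978558940,
     -103938901977865101852660, -27058886730402604749547, -4026100166776520109069,
     -516522636333897063917, -37614922857685137416, 2832124006646785420, 768018306502930965,
     122193493578407251, 14195411209380515, 904353140904880, -38858432409149, -21408626760173,
     -3405504463836, -354578943210, -21118825171, 1124772387, 541003797, 84801581, 8516669, 441333,
     -37762, -13193, -1999, -190, -8, 1],
    [-20290789782667796678751407786492, -25071581119961443523306126523,
     -24861326871202345126398011120, -7930883622845945995514946725, 362344544416516171237707846,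
     149054756890758199542426978, 25967862297634908320248514, 234933631688629548186913,
     8451746076998150550299, -12983185662233271338387, -3357105455356078794341,
     -373187630975255016021, -20373173142980022927, 2542948444239419597, 262035592404244324,
     33500696825538947, 3456107765743626, 312442681262010, 36337481273659, 2053146267111,
     -58611596803, -136412179751, -27643016632, -2808778134, -42595922, 41585438, 7781270, 718348,
     -508, -10437, -1531, -77, 10, 2],
    []],
   [
    [-1382680623874319419695051139, -5534086681412301117020580311, -8311212507730578788565262880,
     -5557577247715206056219446011, -1406080571464858670852515787, -9874654781118386601915670,
     -1480699703494614140245509, 121970638990840540878218, 47741838806276092039045,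
     11244626406983620597759, 1364938388733391812335, 86251681822599468306, 14969449298774920618,
     1294371499755098522, -121986484707269282, -59452642692374993, -8870726760866734,
     -863372052913074, -15961115042419, 12291875940933, 2486227888460, 275747563356, 9206244488,
     -2111419266, -463223204, -49478047, -1797799, 258179, 51337, 3581, -65, -15, 4, 1],
    [-20290827372076625050155077780388, -25297156896564186668344879541,
     -25425406952108541888716074240, -8683265186170854471212910994, -202238270235808417413905286,
     -76896721292608848231638597, -11568036062735472511527420, 456551251006960593567116,
     141404046783545655211153, 23602827819525078097036, 1733764566709908928014,
     104478436843680868611, -2884602003716994720, -3490216460586063336, -577484409051526439,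
     -55060851060982950, -3122147087496487, 160505028991652, 78875962629808, 13509734178052,
     1548851994046, 87206554577, -3799035445, -1939208647, -343634572, -36837763, -2287785, 94401,
     50629, 8079, 862, 49, -3, -1],
    [20274016789613273954402294292441, -25147403925271119139745504140,
     -25050925765065292396028473121, -8183752804373677719225283361, 172642607507194347080433249,
     73205932294805636710753638, 13435429647621268743531511, 351220789380435548513333,
     64209604868063436534237, 878102611762565779096, -1176621305546952864496,
     -34541827322719962110, 955005671517952928, 517110183965499486, -141313757623146071,
     -29964694833626496, -3206296086275426, -180920998855416, 46450105249579, 11315845531335,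
     1328603807213, 40463084902, -12519897815, -2483740537, -231114155, -1157771, 2629300, 352976,
     8280, -3819, -532, 2, 11, 2],
    [-11088291320680075034945942, -55514363603796507851111526, -111343896633271564723638557,
     -112153933086763580570743389, -57447941470391661797663680, -13085779899375527873819575,
     -1293008434644074342710184, -531646872670443507003136, -122552829938119398462590,
     -7640316761831215327667, 3032134732137272141198, 828131893111347757517, 129338054279783392183,
     4843741271482239707, -1948584415141338910, -406617129748847620, -46480620049207140,
     -186310901990689, 786552285695780, 129817413978191, 10003026844726, -656398896944,
     -257824983264, -29037816877, -582924689, 396016230, 65934880, 3251324, -580395, -143720,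
     -11025, 852, 323, 36, 0, -1],
    [-13006477209250619447374738237, -38971345364987358339819756649,
     -38817061688716823385378484771, -12661758302967067347365231781, 303426389805298461681744140,
     144429660702461436284213889, 34184337795690651637341652, 2805608357827467424669489,
     55044790987228228947896, -9307239354192835620096, -5396491866996263520048,
     -874571025774557828004, -62710378365946231469, -3655171210324473609, 555084332866597595,
     153220623100026389, 18202491908903459, 2100920059800643, 42878258200925, -18870582206884,
     -3672469824231, -573317288350, -39394151894, 129359212, 552286170, 122886421, 12173982,
     664719, -48846, -21654, -2820, -237, -3, 3, 1],
    [13038686011045430395119700302, 39164667887385789086188788758, 39300657168805080402626283140,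
     13307261189215424395562612373, 181840254555700930601181247, 50936473584282900182570192,
     -646776198773106614600897, -2273997859127885501579646, 77517300346346804973391,
     27417234258252814993995, 4911714213665383459010, 38456204972762284902, -92818835575932442944,
     -14817854253360749158, -1105413414024717885, 135245895484592671, 40845235834491014,
     4429683895648497, -11786930864901, -81781661955325, -12530832639918, -606921168593,
     124859838130, 30063006807, 2547982439, -122923722, -64196542, -7899268, -123746, 118969,
     20976, 1237, -170, -48, -5],
    []]]

/-- The approximate orbit and its variations on the piece with index 1. -/
def piece1 : PieceData where
  orbit := [
    [20729726000891161396124000122586, 6940084551434258572080106723215,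
     8636808880820951175112072074, -4056197729638518600811228846, -2078349280059394112233985093,
     -402906534244155100477292883, -37405350810720671219947971, 1022410833860650995887184,
     748543559267017898182223, 111234908228126517388946, 8730287660181142581822,
     -324254642674536212627, -213039665747705200891, -34476917714798043481, -2880892844155205578,
     53227695706955632, 64823122810075082, 12228940352187703, 1210668612061953, -453826119643,
     -24702892874879, -4920730509035, -471463120078, 6119366160, 10358238082, 1845641569,
     152789790, -5423900, -3805380, -621974, -50228, 1593, 1252, 222, 21],
    [62527471270626958164169997230807, -379633707562137782952742509244,
     -140106523610648740808723123906, -22965179106501336854577048322,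
     -2384457008495397675637466020, -276787916440242468774166556, -306569967878142368614857,
     4375748423945501486772810, 747184017705307297756173, 78053709589051591636579,
     1450880664745761784449, -1210184195715410215228, -261858712295363317189,
     -27930993338072531454, -552388686089228715, 418016647137109414, 92469222930231558,
     10077386714957289, 203546602908719, -152117887114937, -33568987175807, -3649280783346,
     -70087726408, 56270505017, 12335878584, 1329770581, 22961463, -21033039, -4545068, -483559,
     -7288, 7826, 1665, 175, 2, -3, -1],
    [63233301268030821561035690970305, 327695348039902843006173177923,
     96830863926137331641291198751, 3786854575396136236771583030, -2340324925915446855908580149,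
     -304350673485901883950109713, -9558517169798331915016754, 2768650363753971335855591,
     549366753948066508311970, 63042744519150218610941, 2111563786635538438315,
     -672594526861468459811, -154925314412572145482, -18031988610127981662, -930770307852230968,
     137655129576125161, 47311380033534417, 7189433764516788, 528199695067536, -40489873226804,
     -19131188739527, -2966664912791, -194624338293, 20478770786, 7536074962, 1031730852, 56825560,
     -7647819, -2466961, -345866, -24288, 1613, 835, 145, 13],
    [28911122579267948378882552637410, 123371285473224460274214411366,
     -7657597118997308515205142155, -15517824097641810645184929381, -3708446146169738679901719377,
     -394969011104152539668318889, 16014281981360251004329566, 9845353567940551953442702,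
     1255597230722895639701179, 54165218551029156283891, -10936616673941104894193,
     -2496876934011528686204, -266949157963073352257, -16279613510465434419, 467730973720738644,
     499584944172707800, 131396197242432410, 18437365552841437, 383154642982181, -416166399788462,
     -89456986122874, -6445544268696, 862468834137, 276541838583, 26697141090, -1120589312,
     -635218840, -69818851, 553871, 1035020, 105605, -671, -644, 71, 15, -3, -1],
    [-14388634044794527291750595064463, -837009426591737988713401194759,
     -273085257397043656030659745039, -25967146990533246812011413767, 2027837985137653823204445695,
     477547655347545629829227893, 66843081143279697748347511, 4018427455259333395072244,
     -499915693915092964011453, -174070774204003603654655, -23187321440795590834462,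
     -1023687956092311291838, 239613170428496230530, 64854916437289288997, 7597099560423093310,
     181327539905063153, -109741818209117693, -23686990516819599, -2304310808754666,
     19796910321648, 46567891600751, 8118790395836, 611876505548, -38922285851, -18198663177,
     -2540912819, -121088555, 24389734, 6412639, 674755, 2663, -11240, -1901, -118, 13, 4],
    [12702086270783948062603541803433, -844105439533333402010643749770,
     -279248138718996229039025779212, -28945130038648518713974535432, 1133251631896302970835629028,
     294478836507176001828759314, 38830503915130359876153148, 1276538155208045099272188,
     -317993127810913360027329, -40123874099319014689782, -216043944912307835137,
     52216691346257509197, -88372334784320579958, -15146082780815459699, 823457174569238658,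
     620900057410858790, 81452574531891219, -2189262560678155, -2166680821543354, -269043830896086,
     5482444097895, 5701230842456, 595607933578, -29144094804, -12453932595, -563205127, 180497592,
     24035309, -2409395, -881499, -42542, 17117, 3359, 54, -68, -10],
    [26985723744949242954258739696321],
    [1487626072898341279277763665248, -4905709272582905732403175748, -2136273660614943680752252608,
     -292479399325373408113712709, 39494853870499437775094802, 13610794157109487440874794,
     775798832268393498292339, -81617908985096160249671, -25347986665881032546928,
     -3212377210311559914105, -96754502237489274764, 40643301716336644361, 8778708244293173722,
     789955393675633979, -17052796870912849, -16503332541666407, -2517990191118881,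
     -147178414866253, 17000890152782, 5244192386643, 603358847152, 18243815170, -6275327029,
     -1336644287, -133975342, -3320495, 1434616, 319766, 38720, 2230, -262, -99, -15, -1],
    [2121335465482627153073029039379, 8497230117363661039125872586, 677025999592273998283017058,
     -534246127395773538730711931, -56006521997857516753189249, 13336429543315663423182976,
     1439673939068057933981880, 134928715691693297533962, -9619555996201581429387,
     -5866649176919266369811, -830136370454809720803, -36936617387688159322, 12416969833367424197,
     3159729323042160360, 322991574416482813, -7096151843593585, -8230859027189159,
     -1357673850347032, -77769362892828, 13627622689955, 4042937912533, 454320265953, 876791319,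
     -8909774712, -1621350490, -114548848, 11697647, 4406862, 561912, 12735, -9090, -1904, -158,
     11, 5, 1],
    [2074785516331568004357163148090, -37121593720127878912322147138,
     -13436532383595088839174761325, -1387433666356437335461388288, 223007103189585364702828758,
     56650696248006048028734920, 1717438387921557976763704, -890345686493030416403587,
     -141855740829493705912844, 181673468843447862341, 2744976876888860158713,
     310986268195910407158, -17669380769457390633, -7887026640618984710, -495421487867490618,
     103740767484852019, 20893237706808999, 64328437934708, -434534716626519, -49132726038210,
     3908421752998, 1516527405955, 90568002345, -22300925108, -4567023946, -57922206, 90386591,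
     11728627, -550557, -309553, -23645, 3839, 931, 23, -17, -2],
    [1492011637113445716964323780743, 949727059547375539286668353, 790899670433886031370404491,
     350108130411697475762689145, 86020387932553675487437713, 10490031926852075729649959,
     154782721775877209838787, -130777467033323868032804, -22545362351172337810195,
     -2312055454108232780265, -51688751058652183139, 27693199852826538514, 5556049400971642030,
     539900004829079045, 11786370106275477, -6125633353832961, -1322342595969563, -147302242661436,
     -5489890632960, 1547837574839, 397971223522, 47432308455, 1558024784, -579772074, -132164979,
     -13164085, -40977, 207744, 35610, 2847, -34, -46, -8, -1]]
  variations := [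
   [
    [25672439436900759223467617126329, 7847794631451555232607158844557,
     -398612048199004718457065326746, -77372602755014649656592160783,
     -13028028055790931068617572620, -2199711568859192146765267026, -96499700932223034665926825,
     37123460518844029823220744, 8798255009732117481247356, 952348906548973834484854,
     21972203338043496514498, -15552148529001843912649, -3641342101687449288255,
     -426135564591473051159, -14423386390726773794, 5758598581118067626, 1556255800417512028,
     211999338964520521, 10899213018239823, -2469444941152095, -768381801177974, -104513135960171,
     -4458626185821, 1349963788545, 359771220911, 42559547374, 1056977312, -627241674, -141688915,
     -15727651, -415785, 220639, 54023, 6870, 318, -82, -24, -3],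
    [19087939965009832616473456269608, -1258944983675690811204204662886,
     -484548821260614204941814014139, -89407179850002249808101394485,
     -11103365414618344956107403425, -976491825200737072499884853, 134005838983613820923957649,
     48113094489683385281291240, 6715029413616295643331102, 468480388990795810395221,
     -53549566208052354716632, -22468919364752692180491, -3502614321675268567865,
     -236059517535870737513, 26199617963225834885, 10506820237287351743, 1615500248776363806,
     108022890987629462, -12128454285313468, -4756997041378999, -717092155583337, -46671463520834,
     5479334597574, 2087390172437, 310044082049, 19629712070, -2428093505, -894960030, -130822882,
     -8065523, 1042981, 373680, 53990, 3302, -424, -152, -22, -1],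
    [21321230729759975842466005851032, 949975652233445424090609999043,
     230609768871988041883979067532, -20182372351069502046332555544,
     -14225543819058744859632646530, -1453227985280942511087578101, 55248985428890687840232545,
     35223908285709945159262953, 5349104042824944259961481, 439074610227941237513710,
     -23118800943142631324361, -13492756455442570292440, -2211133067556391280944,
     -193639743795091435906, 2494031197036588221, 4727057095688099505, 1015969413973973161,
     117324580090775507, 2007802698382450, -2292489219288245, -526561520365731, -56746321837394,
     327460088, 1182002481847, 228765708841, 20886771232, -339178124, -457940377, -84648215,
     -8590727, -136921, 151189, 36824, 4733, 178, -72, -19, -2],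
    [-4455796897154956700426958013042, -3132081667163809151623892006860,
     -675363489492883303753153007709, -78464824693155434407456389337,
     -15554033045567540690655513799, -487479048182358942025291404, 432239582427760317436634090,
     91340270043355256882536439, 6536705074843775732511008, -580510296619173461710637,
     -220654138869796613225930, -27697908669920700137891, -1587325627220524153530,
     52944828765055031063, 37902666870583014086, 11442758983626018568, 2290303681086793570,
     191368571016582064, -32554185386033383, -12710258123640975, -1582455638876451, 36625779428137,
     44578293802857, 6594698555029, 95058256382, -118983888053, -19064257135, -487767795,
     253567738, 36654518, 161880, -431793, -15603, 7723, 490, -249, -49, 1, 1],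
    [-2373700135820733452367319062228, -2303569827144555775937862415732,
     -695583147934699363157590818801, -34038958715366479321760845650,
     16621562899217172425036709612, 3131042524939550871212090747, 335662627569593036056489110,
     -3235913454856405815112165, -9127368758698892377109853, -1841761363225192261745216,
     -163245890799673280724225, 8827444569051072281631, 5335234581800380368735,
     875905160472305834699, 57339874895604684981, -7642097891810277584, -2697802965929367091,
     -360203198073542238, -13158835090483375, 4879229485925836, 1190404788766941, 125536189983983,
     -302015577593, -2532813392882, -459055578373, -34493025003, 2580016296, 1111223587, 146461665,
     4734188, -1865824, -393128, -30090, 2230, 866, 86, -4, -2],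
    [-2393808897571367511658387431545, -2344862954206629131200045930452,
     -731772927752921923866013654959, -51847394724475736529557786609,
     11098763281413971313572592249, 1964422554930540282586422095, 170030884401243709986382678,
     -8151552983077936630954835, -3438667578471875666991641, -176210555248263515947281,
     16313548455648897016850, -4090649226670940872695, -1913828979938741877215,
     -115212069790242127110, 53386620898035786461, 13224547445737977590, 708382847265196912,
     -232239843766962054, -53113146834106476, -2548677489783649, 775280421755961, 151909503139497,
     3429036571102, -2419833595773, -293010833621, 21856888520, 7958534741, 138934069, -199242510,
     -27234114, 1924809, 978395, 85707, -11946, -3598, -206, 51, 11],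
    []],
   [
    [-498934311257805679133125181801, -500082774269890047933122972995,
     -167543082265252922413617285323, -18777857282795589280623951914, 163678852971941181988558881,
     128637577268177642807827966, 37572986283598031262547021, 5264904797960321245683307,
     100301779238206651001766, -92205161056269413927000, -17021438231030658359137,
     -1254117483342247591377, 89428568124943161854, 38432948853741912920, 4948693473673687326,
     205360851814999050, -40269006590467602, -10163771781788417, -1379591374686699,
     -125498510916994, 450873898275, 3540742701757, 851814582084, 95455603346, -2000555210,
     -2711181778, -459691141, -23438316, 5335523, 1326562, 114940, -4392, -2352, -265, -9, 1],
    [-520367110968865584532553974268, -516331802098312186307036279033,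
     -168505111994098574909209816065, -16787118333129394349049944365, 737945141477729216801104108,
     170507194527857410421875862, 30700501336630139363066752, 2733760641708954007983257,
     -160804056011298916073908, -76008383208960105886170, -11134318283740332878961,
     -711602791678081389312, 89841008434847290557, 31895532703976682088, 4210285164448609454,
     163626260953498094, -51552781463773423, -13060077692148846, -1471996110832091,
     -22527577643735, 24566482533038, 5120372025436, 500049122660, -3878863475, -10479814975,
     -1940041139, -170035305, 4811405, 4205673, 716083, 57141, -2621, -1573, -251, -19, 1, 1],
    [515935554203290107460077156239, 508442744926860053625490766689,
     163228153285451357008408543548, 15446884776366124766651696363, -575901425810413801291538121,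
     11813964945843643139500203, 11888905436428808030216437, 331892776332947310437044,
     -281342640513702322457067, -56970610132249086245059, -5305830578637827695810,
     134270123665077288728, 131435830328733494438, 19427039193218370037, 1097865914855486560,
     -64357312495304433, -20147476645598963, -3511898518926002, -717658145181956, -109943447879615,
     -3242288042418, 2920865362179, 727059873444, 67601922987, -4957743405, -2404949256,
     -308491348, -4108261, 4887696, 810694, 46715, -3472, -862, -90, -16, -4],
    [-2073829605223771252632752811393, -1381661773400974241987671725476,
     -226496515310921705198977360694, 4027080950029758496333126021, 1881694274304090158971175471,
     464267757850784541263640711, 51622059948523599439587718, -3418918382171495436063281,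
     -1996925968266176003249625, -237265175322938211628887, 9572866357072056247442,
     6843289504287014715045, 823883079402405292256, -24844664108986829756, -19469299777655406928,
     -1978138943119770763, 107444308357834180, 40948622005387634, 1214961178876581,
     -628039536893768, -40286505894405, 18220797506191, 3350127936113, -162580366638,
     -128815974165, -14602216774, 1349780762, 582109506, 51398464, -6614469, -2120297, -141666,
     27430, 6576, 257, -103, -17],
    [-20027504167263124939632215707924, 274317042988809068485824038539,
     107797770122748797393459887856, 19252482687373564397471581849, 1731402966217721181660625234,
     43691607872940270291070749, -27189444827876782344873300, -4621523526436640007863280,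
     -324613553450453833194040, 27518190681949297316585, 10899939624728009912986,
     1180641660144437658618, -61033212653378082024, -38247705363444157537, -5137627484777575116,
     9260494106122020, 130231514569987724, 24272757516225803, 1402484508193288, -316454728589898,
     -92641657977015, -10054525291650, 237906982829, 272034845269, 45331952432, 2373301093,
     -561393098, -156241545, -16632144, 339704, 426950, 71733, 3950, -842, -243, -27, 0, 1],
    [20531054797085564927948733051018, 261725881574663467451042626872,
     97171172079527497340780697729, 14389286582287197672451346877, 426600160021319232154821317,
     -163994502799604817698038546, -44499242281113219558843606, -3619513767780447523333479,
     482600278795156263207480, 179393158574208152676589, 13816814966703496156550,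
     -2508674025575726307563, -631933289026309948965, -15366309341487889818, 13284309922161881263,
     1915076416108788138, -104042734070057400, -61243410448817251, -5102503480285825,
     874036864391668, 238081202562419, 9730955158038, -4348529782701, -770981450794, 3363766560,
     17661222625, 2013044461, -159231264, -63259520, -3600541, 1036351, 202463, -613, -4821, -562,
     45, 19, 1],
    []],
   [
    [15648456074761787841869254904682, 5255100462334001265645980217278,
     -14454849793229935761495302747, -27890879460666364899659308214,
     -10790685428175437470626589903, -2020166253463757938568593808, -152545392384051428652316518,
     18881579824586729703452684, 6758134839739734705920016, 949285114185858669603610,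
     57574247654248618267682, -8445124609937185308110, -2932039830008383439347,
     -427807514987734410517, -28513554879141924639, 2938691132473039868, 1248288080603337391,
     205387685964469761, 16359402375627357, -1120479140914860, -604332613311020, -101053752262809,
     -7478361949727, 666320401351, 290883991377, 43636746117, 2655544177, -350317663, -120753502,
     -16954380, -1021210, 127448, 46645, 7103, 514, -44, -20, -3],
    [-855995536258611738284240392876, -917154343909332655920364924030,
     -365952694717392259490956134710, -73287562387176179302854608780,
     -10289107898583182490692686776, -1044313405753233268310742616, 67682353465678833880149006,
     36499583165596949269798354, 6076609516321773403283798, 560699301659837121065465,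
     -19111080616234138738511, -17090536286671913513539, -3180471081567426907116,
     -290344649736240945454, 8325679550675910939, 8048689387701294721, 1498275784811961381,
     137021601584787507, -3763160344389160, -3686120350469458, -677403363703526, -61075350125062,
     1759291088801, 1640290621168, 297477794592, 26332422008, -831776822, -713775695, -127269218,
     -11032828, 382673, 302471, 53094, 4540, -162, -124, -22, -2],
    [738885271743042876214315391617, 682962254964839840048439942916,
     171171444315408400155773163625, -12569221467598311794375964601,
     -10467171198508365563482963338, -1273061309253061690130342572, 594179084071467262656901,
     24476047704342198485485988, 4582557802935223218457316, 474056470433544549096930,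
     -811711694728818231940, -9752620672479602918221, -1925857527086396103610,
     -205568154976678293918, -5138150403026047534, 3258757427555012520, 844527717596425727,
     113298220009839784, 5411257173150181, -1440947384581536, -428052712145403, -56478941304585,
     -2156108697216, 761826351307, 194096825048, 22717542209, 644864271, -310947929, -74532416,
     -9181544, -434884, 97801, 30865, 4588, 295, -42, -15, -2],
    [278176746595352736977094223584, 58192985004058673736479228243,
     -116479322657962423508229332333, -68436603580787674745918996421,
     -15601906691757673448215622314, -1267635753013404609466600969, 227612451194242845116292599,
     74447117714150621926641331, 8648814902008020956887958, 119796015074253003442879,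
     -144128721194683838647738, -27866100343046945817701, -2884853802869821028613,
     -144299461040716037245, 21818549444887066936, 10372644118959713352, 2286845025039811767,
     251128027354481279, -12645407798284739, -9977145208472576, -1649914182601006, -58950433076682,
     28602579906937, 6225226057680, 418404845086, -58295277153, -16663686598, -1381875456,
     79335027, 29703146, 2334283, -62081, -10195, 2878, 98, -188, -39, -1, 1],
    [-1887283238282091374514611181146, -1860596024411669989776718302400,
     -586152183557927379285008769224, -40261126856423860866592020571,
     11480330217971001560983105288, 2698922732627092230550096665, 364859724437232495003006333,
     12124035191808764908678545, -6538326660550680809322996, -1700307008540900753104785,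
     -199665641355830432005364, -1980079332632675986885, 4062160269795160581219,
     873500979118314514171, 86072324306989170104, -1914841243463898046, -2227664824933872941,
     -396175916369611463, -30326346419912089, 2382726346485529, 1084436539395423, 158495769571612,
     8098950977877, -1657661135205, -471504618200, -54842380958, -881424222, 899801205, 179073852,
     14887312, -725591, -399060, -54482, -1908, 650, 135, 9, -1],
    [-1903283280644622651015316720036, -1893721418762628536269262318760,
     -615560407769110602479203664405, -55044292273872358056413550057, 6726942088672567558308787238,
     1631976731988929134872524708, 195257826969878874986119921, 980032388774110091294335,
     -2726262767066125034352199, -276284470569298620157391, -328665159688283707286,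
     -1959430736768746153119, -1241012105379935000000, -121994745241722071412,
     29664739229369001105, 9938545909734918528, 895595478112818130, -115910075122535186,
     -40838630525679148, -3594806525084519, 352368892359519, 119531080295076, 8337047077020,
     -1177751686061, -256396127680, -989111, 4990456869, 335636634, -108345453, -22091176, 237190,
     641140, 84823, -3861, -2534, -256, 21, 8, 1],
    [20282409603651670423947251286016]],
   [
    [-174793891142921743328705299127, -233893449571934054531145376936,
     -117490082055702364651675973630, -26086198461121790896820223111,
     -1923005766030290343039089577, 179127434526897700582166354, 59177066416812866770803790,
     11032565628801952675761987, 1034624787046269422147945, -40093690821323513455200,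
     -30731262878108724176347, -5359786186045059395180, -467881692518358227377,
     15231260070017646171, 13146002143354406678, 2403281569916335383, 223222664254159681,
     -3845334684967605, -5512139363057713, -1076071186016139, -108268363409972, 338398689966,
     2387428115605, 489586342158, 50558206069, 40050983, -1057726407, -216968236, -22172669,
     -14422, 454315, 92614, 9510, 36, -188, -39, -4],
    [-521853446122806412498190319556, -515838444928270846929853790742,
     -165073466910225673484152126864, -13762899673067925305829374498, 1988279367008231138280205240,
     464799869910366628476372626, 75772930141620265754412113, 7596222721922789777843372,
     -70489185271877346057294, -189404312850365657978008, -37251345135057264626689,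
     -3913726982059882238778, -45278644439674624530, 76445966406407802378, 17150206514455025056,
     1954586794503254149, 43525562916513492, -32441769294264493, -7705136859751220,
     -915778595771713, -26861661641086, 13781035690100, 3415848634453, 415375408575, 13889236253,
     -5847942910, -1491821799, -183946656, -6607834, 2471501, 642003, 79849, 3013, -1033, -272,
     -34, -1],
    [-533730102079975283613981870831, -539648983322777584602702175541,
     -184984366827375188085674305772, -22655528125728230658123253802, -247084928655773685510539823,
     169114202328889251727544573, 63165647354383039394304636, 9435671812493812645820508,
     397809032844488465877592, -113333447086714635273157, -29509604172896813139716,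
     -3721348627762420653934, -164526625420635776937, 43924128835441355923, 12250274975249235932,
     1604198500636534124, 82015373999533220, -15823077754680791, -5018985128050502,
     -720566861423901, -45142408297916, 5792939713495, 2164307213072, 327150547505, 22025045670,
     -2324394150, -934667848, -142844611, -9904772, 908999, 388782, 61071, 4568, -319, -161, -27,
     -2],
    [-3716352962399324421449209883, -5583386665474133485978924400, -2801732440480194331082639518,
     -114338176707147415748011861, 456276289486840483411755009, 216209138524493481436314122,
     48127198881915532686914928, 4977223354800130017837527, -265319876132993221057175,
     -186920610083707554042423, -32604178859892793220257, -2639611064809426033752,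
     152035534417742339913, 88438481207184268093, 15452530829357436690, 1433489393873880426,
     -24772808842468699, -38286452740332716, -8025511063200759, -867885456192232, 3637632783169,
     21412315282121, 4351752081890, 392806846609, -18305975567, -11889830768, -1876829555,
     -114414753, 14987749, 4937108, 648708, 33265, -5521, -1761, -257, -17, 2, 1],
    [-20036528822902011872967568537454, 264491076854137409135973556414,
     106479334404408609870564101808, 21707149460901566377826324720, 3070816431815455954069916696,
     286176115404765026037404593, -29426081589261376608523033, -12366220155702394433873588,
     -1879951384196965709859352, -144884130791229398641356, 12365297818036945672992,
     6071758162477054424320, 1005490928584131521389, 74834942427445234649, -6498472424559724307,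
     -2983554319426795474, -475062876813865825, -32938868083795775, 3456946771050241,
     1398926214549125, 209350828851602, 12774943600828, -1799845940455, -622910589484,
     -86690900059, -4431118193, 884977342, 263072461, 33771494, 1359743, -401432, -104332, -12362,
     -376, 163, 38, 4],
    [-20491574784408714337779717347227, -191119981663194253337188428722,
     -45530516070184796690090863885, 5093231180106895165835497073, 3371725303012280617634674793,
     419095237323367933566785460, 4361837191699719524951097, -6730663605996120435070745,
     -1284022035866688557477018, -133696951940976792918871, -860945733886398438603,
     2239066495490982243089, 436322987033980356967, 48336188304362849128, 2232976828042763432,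
     -516592598784539687, -173815439470347870, -27448821597752003, -1879145416612490,
     249443763047323, 93353433552298, 12808018169756, 496946552983, -156820140628, -37107432330,
     -3902512742, -101697591, 41236429, 9931206, 1525329, 160653, -26, -4655, -1071, -107, 5, 3],
    []],
   [
    [-113029131852673924526176681725, -151400907911894278650784757972,
     -76309363362115109645993034096, -17197389189706677110184545741, -1436721748320167318079299275,
     41754902441552844657758645, 19824069991475928753318995, 4575265405347949876760768,
     672078908304141786928186, 55386335970833628424540, -3130126965964795834283,
     -2253387746347284406092, -466475233426424924530, -47247418705362878100, 1706089730984263616,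
     1506797619249679370, 263910303229324374, 18376740716465416, -2081609826440894,
     -769752392687027, -103425075381714, -4735121281352, 1022090682133, 283782727128, 37613868440,
     2353165027, -262526385, -110794229, -18885355, -1552302, 114736, 60076, 9476, 535, -97, -29,
     -3],
    [-20518917636716971265278777309537, -245628962563003042680823903551,
     -90615926859137820586829423629, -14562818131133764167722608754, -1258602227887306863949546068,
     -51578737181682571643797377, 32358386773204216772129529, 7526989596880250914282727,
     691524352875571840019104, -18130002358571724448494, -18620619989019316204185,
     -3525944785172622247654, -332865263025575604017, 8503725250301216811, 9012770528035965923,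
     1677566114243761286, 152942104731381190, -4496678829019372, -4208223622031809,
     -766766379245367, -67194408814533, 2529225909144, 1927288285057, 337261070094, 27930177803,
     -1371840509, -852975167, -143035011, -11196411, 679446, 364059, 59025, 4426, -308, -151, -24,
     -2],
    [20064073567861393653759404648912, -209376767073131112206559854468,
     -60588377031692008163830637600, -1427686667580395494462551240, 1867410417721577763824894104,
     283963186763291132799864221, 21630584443575315504121988, 146418746917560538651703,
     -208697108655866392628941, -44489753486325488196643, -6464252263035096528246,
     -1006358503882055481570, -115374659849450614815, 3420882572251563982, 4435320857362463295,
     893034054264394271, 75735197739225845, -5323567169771804, -2599797833936752, -372572188167946,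
     -19786544356856, 2726633067553, 802754938707, 111665011404, 10724756195, 370206312,
     -185893540, -61568606, -9895875, -558154, 137299, 41169, 4807, 14, -93, -17, -1],
    [-2983402465709416687591797809, -5333522741369103310777085575, -4065682261195420608457659566,
     -1765315640597877634355865450, -492343423087169702286011169, -83507001591484541793413656,
     713625754183260371335890, 5780078291878914247378034, 1795441474364305848015480,
     227061640715616870095969, -12628826404371209186603, -9916674414988883408579,
     -1559584943356629544680, -18631416078194814006, 35946364220871008141, 6440274341561683694,
     236195523716261674, -97966672474649665, -18988719799898982, -855910940950399, 205814128621618,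
     36864905679566, 991083754573, -311788635738, -7615817936, 7452767505, 203270755, -331833254,
     -61065089, 920272, 1947503, 279127, -7430, -7871, -950, 45, 27, 2],
    [-335486256444132084630154780190, -317100550889693802271410001241,
     -85896876920481506263865916382, 2504917794355480243451971385, 4490893541092667322101594618,
     720524150649384609096738911, 38817683543166334222686656, -8803027297824406329798587,
     -2570484641821485184891406, -340243080334967478563248, -12971494091814505397834,
     4904982835774406596823, 1260232395491597816393, 147076873087993521392, 2283229333677018291,
     -2707671754267161630, -582352721104942223, -56428615928369018, 1354186090866249,
     1445361866308254, 247960177430882, 17115366348641, -1868330009091, -695748585939,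
     -90856345251, -2759437681, 1292741536, 286191885, 25919100, -917410, -652094, -95176, -4036,
     1088, 255, 22, -1, -1],
    [359274164150852924248185579659, 364970295067968505313892353597,
     126214032569454780273982139481, 15770756122581993667469046019, 263116817709867837741078640,
     -31648670175083213365530026, 2868762043095798966548257, 3892042777765308205388665,
     229714629673529554144502, -150983916718172827558575, -31554336894208147475791,
     -418642082388898509351, 816797593975127625454, 131574854685191638752, -1095255578096281197,
     -3190330557453269192, -388309874635511815, 21274737353616376, 10684105780872001,
     713338589564043, -158265282071657, -32737188795239, 249883987833, 831632377846, 92098311383,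
     -9395624463, -3455537547, -215471441, 53818678, 11766075, 255240, -228227, -32562, 1182, 838,
     67, -11, -3],
    []]]

/-- The approximate orbit and its variations on the piece with index 2. -/
def piece2 : PieceData where
  orbit := [
    [34563838746797762660332745466318, 6821550428966668240377028586877,
     -104178846026959091349982519644, -40187451784470175853451970488,
     -6716606136519059622777249508, -180268866246687373179952593, 138693058489147901021489732,
     25997569769844653752338390, 674633733888862094936840, -536786292922130801095643,
     -106211496086575728811041, -3936319062515637285647, 2149998702702174379274,
     475839711665471891014, 23474679512673821833, -9088506912867782957, -2228984451247388497,
     -130749619341837960, 40067495127826397, 10565170164015721, 687601141683947, -178611795581616,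
     -49904036604958, -3561360926438, 786054388776, 235422887881, 18623157163, -3396950583,
     -1115563350, -98260671, 14452784, 5312561, 518554, -60325, -25343, -2729, 243, 121, 14, -1, -1],
    [60977817238494149273940090243061, -1311255210161056073719386060910,
     -352741195310894620950274689950, -49018028465399624538279316988,
     -2867522382032384170418751174, 521125156771914130405365129, 164068968632995818551390071,
     14012542247328663330438407, -1776670622864828968765327, -667066442036918435361784,
     -67465687360709846430947, 6431007238722719242900, 2932526533915516771671,
     326113250209712579308, -24613446840879185522, -13202533444749375482, -1583753506195479779,
     94331565739928933, 60242067945792744, 7730170322247253, -351256262736755, -276683617998407,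
     -37889981139950, 1214951185535, 1273879244276, 186432706472, -3518500242, -5863765800,
     -920911684, 5126495, 26942700, 4567770, 36146, -123463, -22749, -488, 564, 114, 4, -3, -1],
    [64259041389843982602691055326771, 661333957406906434314185566201,
     39869527985245540392689095859, -25784148373385089511309099101, -4338969348168479303627377587,
     162307975195889148559621469, 117346065262278925157870456, 13451864313867929926841838,
     -610979852724511727467537, -424055765856725206781388, -56110017143340486743177,
     1297420069747593282022, 1695344899090712039994, 262232832758891480953, -122023088054440378,
     -7302277311499113119, -1282249478638870609, -19019687709602143, 32883371519232036,
     6260049012468369, 159792444969751, -148818919752565, -30407346809405, -1099799976221,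
     668797142459, 148631898358, 7082985577, -3004848880, -733640907, -43017629, 13564243, 3634395,
     248831, -61157, -17962, -1398, 273, 89, 8, -1],
    [28933734802406646215076790891173, -234936084998316188785993391451,
     -208621650912326087196495611955, -50673482082936961007723811321,
     -2605009849708940645522175331, 1105028104962311627332611645, 240913667972035885356819138,
     7543905166054816318469713, -4749194664072230806981945, -933289261399516612985451,
     -36492191955173214735025, 17782073283563165879808, 4146838878089016457418,
     242365685834729321734, -78104757454836662483, -20732512358615378063, -1165778432660795310,
     415362088005937284, 98392761080691289, 3509126721008087, -2135939119144156, -410230542498529,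
     -5829871853578, 9475308232998, 1569708561174, 7339433613, -37243446147, -6113218840,
     -71834226, 141050259, 25296241, 653192, -528138, -104161, -4524, 1721, 408, 34, -3, -2],
    [-17310453165496879628359726588936, -2124260518266246188199883151358,
     -325238203377642152280243369743, 20122791688259438162217858918, 10383450904581795745910284332,
     877372020454256792601201453, -109814053155437385391956820, -41093765445723050075746660,
     -3697668863064406530741278, 508469603922068869306246, 180038020863637827628761,
     15000940151788957849477, -2422945279327533717781, -781597651568626101628,
     -58993643065280617989, 11345188417153072358, 3328278254867050912, 225096415479721202,
     -51116481834577554, -13780240312476761, -844633525787111, 217285491889368, 55127587240449,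
     3228523204740, -846739708344, -211930639196, -13450429321, 2843947498, 781302769, 65565316,
     -6725196, -2783489, -374507, -3938, 9888, 2333, 194, -38, -15, -2],
    [9695423182740852744529572710389, -2241011135516872199398766457182,
     -392748598586811549949634712964, -1971225508018610207981826540, 6232936540190571431486389299,
     633411265739623195585933162, -11755430094048239329251426, -11786022035588168206863502,
     -1547410153623898403456336, -73597280303976454245445, 21174271334519864359816,
     7769935640803501328453, 925491775205457339363, -100597515323905356791, -46926167755531798853,
     -4147713959758532677, 716570321893186332, 211728130889350248, 12284693170207853,
     -3227189157386731, -769982112884093, -52302437871755, 8849257439769, 3102698474723,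
     385795790821, -19212350935, -16566227746, -2458871800, 92652306, 90546878, 12099132, -602254,
     -428037, -53859, 2325, 1838, 266, -3, -8, -1],
    [26985723744949242954258739696321],
    [1468028283395393452708407430880, -14528614144434768658336311563,
     -1782568218600246872258961379, 585034672821889110086383932, 159690127473307417302605834,
     -287840350539864099531579, -4473076325978155028325411, -568623655062834791343906,
     29979702734389727717680, 18400036298293821200988, 1939484156231658871828,
     -170329263538843205940, -72202060193847993369, -6446697718100953691, 790700774198984448,
     271941599202814732, 21789334240974398, -3200906334072108, -1011574983870864, -80284493706919,
     11784780144465, 3842360902257, 332938537898, -41204565629, -15263630887, -1499501356,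
     143281728, 63459038, 6946197, -511362, -271648, -32121, 1873, 1177, 147, -7, -5, -1],
    [2136397821139394534506012177388, 4378420985831948306301987554, -2422938396224817308611346529,
     -203523443694632553745144317, 157325794735676784406671042, 20524160318261916247213868,
     -3469582878991036818444709, -1138117267401759081695808, -71466258650185904219918,
     26425156914769429546740, 6489212022894095314599, 183673484749122288502,
     -169690892169190802723, -31233403263536755514, 300909130326979316, 945728470129222685,
     129885511772313640, -7766495552515584, -4729254921272119, -458164016125784, 65011852863798,
     21558458929651, 1220040843338, -415345544128, -89310582776, -837769242, 2291024976, 325182187,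
     -19142060, -11261480, -932590, 186529, 49154, 1109, -1215, -184, 11, 7, 1],
    [1941040703012875385470832392342, -96045931121228207256908893867,
     -12278537350179242003737142692, 2236524524758707665409417169, 529933484521491505090741570,
     -33809368992362305583881282, -15450520612990287780110170, -126886913874633062451771,
     338524864258546699047289, 22277270015428686042564, -5660563123682667806350,
     -678208610853258791284, 79687622813922061630, 13030267510477913268, -1556599258430396251,
     -231354707512348971, 52148416750397023, 7329371958579902, -1579599405042751, -314714159003787,
     29168712836175, 10901781347947, -33142365671, -274406136594, -17239686837, 4900517028,
     611311867, -63748724, -11943571, 1062320, 177117, -41348, -5149, 1461, 255, -30, -9],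
    [1501573804232543189917173902800, 11849406397491519747623609017, 5694092476351914430556816446,
     1357720927477785968603182965, 130376050220389492311926187, -12278308866236974429449372,
     -5092946514650481271032971, -543029333942805219366476, 20626331602309514776605,
     14836955183087628419822, 1930031204511154757725, -16876386986150103283, -45058806571401659421,
     -6756211055556773430, -48441478168106556, 149234241504102804, 25011445954756412,
     414176882342904, -542576320573393, -97095677008954, -2174035411592, 2058337944163,
     386711439824, 11520279182, -7802176860, -1581491891, -66340036, 29285629, 6704012, 386527,
     -109954, -29373, -2170, 414, 131, 12, -2, -1]]
  variations := [
   [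
    [38877048569477773510344195078549, 4741134329066847127304986235404,
     -1330050741375291829503723098024, -244194728371246207901921378304,
     -17688729023344773622748191660, 4852000200010564846211156305, 1605003020198156306058744911,
     130944777933411887834355312, -27729136118604887175677060, -9127043127281717388914429,
     -808336237600589175736384, 136820533168162248423953, 50831042339034646993438,
     5115752378667636242457, -658862116571750449812, -283505788082222427178, -31288802711706054029,
     3209133272396885500, 1562867453801953560, 182396793550169001, -15550366857670064,
     -8402956878126422, -1030313044763373, 71481484526758, 44145458435312, 5764300282091,
     -300451148433, -228820798990, -32204724441, 1114146838, 1177194092, 179145530, -3239077,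
     -6007233, -989307, 2432, 30341, 5432, 69, -152, -30, -1, 1],
    [13724273203540872034436769888434, -4648833529542923588731054443497,
     -1288408376265639068322370985510, -156545915094485311678894118421,
     7923341502050314508304029654, 7171041695480705594601641535, 1164002683811965632195837545,
     -23530288566334009973526546, -42906137228458908403979959, -7320076771153030809850204,
     27101997327204643310736, 242484432511511263870736, 43868467653181633797775,
     321891709107080430112, -1329384149293108149782, -252329428962185577278, -4237874956603011038,
     7095313178567124291, 1415991090095130928, 36581759955681876, -37033013893939305,
     -7806727294150356, -273239163327359, 189362630579411, 42475357904772, 1894660550891,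
     -949164259624, -228811595554, -12547763089, 4663301583, 1223551577, 80441370, -22444742,
     -6507522, -502629, 105695, 34467, 3073, -486, -182, -18, 2, 1],
    [23717627232907100894408854084735, 1091294940472893229826077677713,
     -300435884028808339012596392498, -152818917586194160527371634754,
     -9025339490079800797873799365, 4605334737074853823000861896, 1016663779983782605879375142,
     29711774152538123642506764, -25625062611261680289351406, -5595711963835149426487812,
     -246658055803645356544616, 128485660170325600978997, 31939693717495769842343,
     1962323018147615640011, -646713701869533951109, -183797617170686890052, -13590808477996901370,
     3319227228442656379, 1036631094380921971, 85151886704638724, -16767639840957065,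
     -5681224356827317, -514960855416518, 81221213981423, 30646042363564, 3093759980218,
     -378748729819, -164588733412, -18380108291, 1722303706, 880025100, 107021308, -7602041,
     -4659799, -611686, 31588, 24391, 3457, -117, -127, -19, 0, 1],
    [-14273153170726513050972640273122, -7184043881143850650888836565111,
     -1387682684328376846988660451788, -98156546706183407063806080335,
     31832041028764994605845499074, 11482434785941438888682476107, 896034204623350738981693541,
     -232768520379379076431128193, -67806635815104054937774743, -4898904710093260044339963,
     1154389896779929257292524, 371268248587774787574426, 34847426549457139824583,
     -5622379382112321268906, -2256387473564620491692, -223004603764225296996,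
     36295167332334636248, 13406272065709503842, 1041802565132542599, -243300088444127995,
     -68501735981891344, -3620604587695432, 1330683093158126, 301955407716258, 12319278860528,
     -5820975795565, -1267025900910, -63134431355, 22101840455, 5556298412, 397374466, -78191575,
     -24569956, -2351400, 207269, 99408, 14402, 328, -371, -101, -10, 2, 1],
    [-9651676652400202994289488858766, -4663144554440031613740008949851,
     -197998149378389742420592873182, 248546782831817806271641081885,
     48703329311129235922217525836, -1138073977156265709112398901, -1885419372164474405549421427,
     -302479034171384903263522904, 10593626584881294614606988, 11917189148863391531599080,
     1707047747460381999242671, -88053182780899217229983, -68083158523722131398240,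
     -8707344793182932032999, 605304369437501261826, 359082891492663402293, 41430274389696122858,
     -3566398892633069573, -1761878107007112654, -187620399829831924, 18035027370700618,
     8034628187704266, 830299705266186, -74703747996080, -33737939891733, -3749676868262,
     201703528498, 127774305322, 18355139977, 325779193, -418477952, -101698933, -10338438,
     1070355, 628150, 102041, -1399, -4086, -773, -4, 27, 5],
    [-10176095026977845187869377560082, -5356748685064688153437908970889,
     -591021587031593771788516266805, 130942448268920225826745397411,
     33952203013261807171964984595, 1295132482668167898312065864, -520791497214887891311959580,
     -114110917070590723190241771, -10529977289022173479078323, 672813617361872896165302,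
     590585503962714417296311, 117881655694859575441745, -246387462248532629125,
     -4668923073973886467470, -768200644025707007601, 34099137630957009382, 28606916621763382066,
     3274686307151642116, -274058644859441043, -125279062195737609, -13845533668677420,
     634921716604408, 501154938340963, 89376519111736, 2603212833604, -2680912225392,
     -627409368157, -22962624713, 16918851806, 3597265854, 80076092, -92368465, -17613244, -404832,
     420198, 87811, 4247, -1847, -492, -35, 9, 3],
    []],
   [
    [-2309721969672669215651945844946, -1370694152231597270972181529990,
     -253897873969581258030558630669, -3968216253674539827258856666, 4667901830963360732293834767,
     733174792335333667037155001, 2172450600950866382823702, -20911905229426078238855391,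
     -3196294789855328070782332, 111444711392259132640069, 103882664416463156382813,
     12782607319709083985090, -823021330761152594147, -484103838316230961551,
     -57657455894249568280, 3909174415775535167, 2360268472346134491, 300916298906299901,
     -17964204761221889, -12337960145973356, -1609893740428132, 95545873388417, 64744494526817,
     8199394331823, -504124204383, -323629844538, -40954365076, 2176548923, 1551838732, 212751501,
     -6612863, -7403614, -1161676, 5947, 35862, 6453, 111, -175, -36, -1, 1],
    [-2341862246735437863912026491254, -1347824054216395853790982988861,
     -229445365072703228957608763583, 1504340920308693771973697736, 4411361474958088217983209883,
     456004223240035352560297086, -32915697946732177080328493, -17966886718888597656660978,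
     -1882268871136364108676400, 210208751490269259273628, 85632955517945580939416,
     7534766371112608491481, -1260153669922297313126, -418330260358453206297,
     -30628770025410035276, 7193660602581184547, 2064477074676220861, 130034809767607669,
     -38639475458612363, -10257107622327471, -601321831714961, 197196102707625, 51281365626597,
     3082328583875, -961624655636, -258053261382, -17321008615, 4482110267, 1308775514, 103607872,
     -19889075, -6706763, -638677, 83378, 34798, 3955, -325, -183, -24, 1, 1],
    [2301170092210419997106064433840, 1331224954244038378784250119914,
     245297561070522095113632566488, 12535087163434681984350182176, -237498472972549211399007925,
     -77033500044320821171153644, -56709090003607337788717705, -11166453432796583451098129,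
     -237443324238351230536286, 295750347198066380443209, 59440845663928902746836,
     2357028249488884819420, -1231101046229306870040, -298499727612363010761,
     -21795187525340217894, 4812201124466663461, 1650750524136999159, 168073027432752828,
     -21720675406563452, -9508743926980642, -1035795268991666, 113614289875131, 51896576034228,
     5636783355882, -565573047737, -266448939436, -30473220691, 2438998410, 1347258041, 171707964,
     -9391639, -6937013, -976916, 34691, 36049, 5424, -119, -185, -29, 0, 1],
    [-5663698774193846514464555856601, -2136036573471508395194426099130,
     -114265841482320021939080624766, 39646621089811183936894410896, 5960314820068988049958310134,
     -245595832116664902429019513, -220889479688722547180085979, -16459951134551887984736428,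
     5457745262273214101536790, 1141013266103832122558955, -31879079446059500191287,
     -36564406168103569675219, -3761953896263655080894, 432613262283161242401,
     153559397369211016193, 13799046482161314882, -1426417578030439898, -682430281805313714,
     -97321706003781373, 4804941217606368, 4495313223971857, 590535233807826, -62344812583024,
     -28021397490219, -1826631727612, 586603284097, 121047642568, -1679877873, -3257463225,
     -301515269, 46721310, 11533553, 4137, -271680, -25714, 4648, 1258, 8, -42, -6, 1],
    [-18866946307513013216505100958888, 987943399794805938618249532655,
     258422670002513644421003908169, 27675510023276668295022748871, -838859600134753808165300902,
     -660198020875243092046580045, -69964000950931076174037706, 4057968041670323863899790,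
     1340970386509018895804345, -56708613455884975446573, -40533465601010570486156,
     1093956738530316009843, 2151434398049844279435, 275263731072517566296, -44536494249967518298,
     -17652554695719761363, -1202953735600127168, 419232431079779665, 104373300234744460,
     2240428632457469, -2951211488908794, -497906509825048, 18640530582918, 17559997120376,
     1860152839126, -269222963118, -91000083094, -3964400038, 2205844110, 405478464, -14833602,
     -14456379, -1431753, 266949, 81577, 2572, -2273, -402, 16, 15, 2],
    [21556794026681176728164642478481, 814383763564304635022612373068,
     169254530635910154487848154548, 3967583139736017887583393872, -3621982219094035748636576537,
     -439101898733789532367516353, 60682035089270869454061738, 19394896110012147920527551,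
     288631141531784180586941, -429035643380786457839761, -32523285461973174897286,
     6115993064017239010769, 221809965277252541882, -217317379065708981609, 5083902111273121938,
     11993468712425154925, 826953290562079881, -377946094043494505, -67189736416978972,
     4523065333208173, 2293205174005059, 116023679164177, -38196069950868, -5595145336453,
     32178850426, 39784618207, 4484911934, 3178074712, 605265306, -76527729, -39462743, -2644947,
     981100, 207176, -1058, -5397, -668, 24, 16, 2],
    []],
   [
    [25635310218085825599973467654877, 4344056167204448566948160028308,
     -609673158300332553024512968693, -191578119566724311053861139379,
     -23579986508542195895078177185, 2449793392558935750896513652, 1309338390169224265199866657,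
     157060135217636218815924619, -14098706324527190221853313, -7622442537409415003697496,
     -961002301926876408633479, 64412238316720932940284, 42637814677511674688738,
     5884366980630988932571, -265308377382441260337, -236487500203144454712, -35157840963949585964,
     1039708509866289804, 1296435549777925502, 202554354991437731, -3759654132703967,
     -6944982597934631, -1132992524455014, 9331255598321, 36297035778297, 6243208922762,
     19251242825, -186318481023, -34185350346, -512320522, 944781312, 186139201, 4990686, -4734300,
     -1006598, -38873, 23389, 5412, 274, -114, -29, -2, 1],
    [-4927682414370412885377510536386, -3636731416534630697026059995749,
     -1082866594960388928387629044447, -153629989807941300931963375248,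
     1171018921299614868335816425, 5657798605551385504027907293, 1108496058279152736634821053,
     20308901223942705304956260, -33244187384769105848001698, -7047643796838213959308291,
     -241226411048039096536415, 185413660205486197445569, 42380853909579587324852,
     1891419050851055899427, -1003216357618447603047, -244072566485366327885,
     -13019081008788494690, 5280292011071206860, 1366948441960266121, 83989253599734946,
     -27115321207983714, -7499633313895619, -521503773312671, 135895930510084, 40493975617724,
     3159275530588, -663728009624, -215895940637, -18821650500, 3149249755, 1139636668, 110773664,
     -14441734, -5968908, -645540, 63450, 31070, 3729, -263, -161, -21, 1, 1],
    [2485285615406427368617319669981, 796715603596322021948733441777,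
     -230757927528935587755457909785, -123361117855469594545734020297,
     -9994880848355720224363259496, 3255862760454880148924860139, 883045930489443852044808866,
     52404294273911671335241908, -18016060153162545336910745, -4977082454372277086300804,
     -368089042525923453755083, 87179564280475955875972, 28101693891236798091399,
     2555797077231976231327, -412912118911527575167, -159424496593691107492, -16634861591853742084,
     1981338532526225728, 891849921937906262, 101405702285204600, -9342463671877589,
     -4862841634180612, -597849892829642, 41308006705819, 26027919762859, 3484847353574,
     -166476630030, -138174218829, -20127413475, 591601500, 729244139, 114603034, -1599675,
     -3811952, -642900, 102, 19683, 3568, 46, -101, -20, -1, 1],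
    [-882887179838195581692937353777, -1744573097668498784895360424276,
     -884890269107512657092014504180, -153416618873897748473901394598,
     12931737993566124132594819188, 9584788478322080569966479858, 1284870422445770394859693990,
     -103089487713483381398048641, -60121488145928713220806802, -7684495583441913872678380,
     460798659264945298476452, 334019921039366359923585, 49241555875844853391799,
     -1741135674216827734340, -1990535297409592772567, -303833365682995454321,
     12516599983534855974, 11962808798558539852, 1581689944929749383, -110425122328864942,
     -64481818885711157, -6956884571365500, 722588544221466, 305372004085355, 29004484376760,
     -3501064258882, -1348076378030, -131615065493, 13860161155, 5926268421, 646473315, -48292502,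
     -25619661, -3161472, 110764, 100405, 15815, 494, -334, -90, -10, 1, 1],
    [-7982947269369673989961153961395, -4041072515365199543999854195015,
     -262032933980217772968897925594, 201456305136560265193421096904,
     47702485095156753458370947653, 821074338695760884118444479, -1576225356876139493281392387,
     -327368261172276506163637097, -5035869408588244777341436, 10205290240573377321158666,
     1973268756104865806569226, 14756588564875839589674, -60037021055170199539470,
     -10740575917565876268294, 18773505412450122086, 328027392872039380657, 54404890665134680242,
     -581619646376010530, -1675476391802478190, -260269224961859609, 4451192041974898,
     7987251921390276, 1190596311849431, -20558251655252, -35184608393536, -5296375495938,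
     25720990614, 139924181503, 23587729624, 670887307, -475909238, -109890558, -9495714, 1165719,
     559553, 87615, 10, -3153, -672, -25, 19, 5],
    [-8421694783228656336307632494241, -4636228638421936812404169285993,
     -612601466592566787208320746711, 89248517181631135845548622105, 30640406907895892292630882358,
     2115291803509212824452453232, -363054302724136010217362684, -108529634994072785354673250,
     -11793439887361265503528795, 297886787313755427190949, 480337993322315411628513,
     105974381605221559027190, 3432594189458453703136, -3451787467718661007607,
     -727580378129879467913, -3675375929134061018, 22143585530805297649, 3536267934418050127,
     -64230412096675441, -103957098257857088, -15701928181884847, -93899270845995, 414501647972179,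
     88431158776074, 5154123083480, -1979647163000, -573220776163, -40149011456, 11817793952,
     3337642203, 202649207, -65506086, -16973977, -1038716, 301227, 84289, 6790, -1260, -451, -46,
     6, 3],
    [20282409603651670423947251286016]],
   [
    [-1340866815094642033781871332908, -1047048695588912333430913899179,
     -283070379376593025317885794473, -17751715610241229987635552716, 6833335946873193826456804768,
     1772093651566393149919586201, 113039588735521213989640267, -35835453063621289651473914,
     -10625038292531361513376767, -826299138298822619974530, 188005362170273156650555,
     61329297861086487194028, 5451893619885697922399, -924767878730165209846,
     -344031605908143123392, -34756859845208659915, 4375515604993427233, 1900550660689194372,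
     213677895625844990, -20087681456114587, -10355109272268734, -1272044226632735, 88891905663744,
     55610738135426, 7385940003809, -370297967757, -294563819331, -42134871257, 1384334507,
     1541667591, 237294359, -4081179, -7984014, -1322592, 3642, 40937, 7307, 79, -208, -40, -1, 1],
    [-2271579950248279761947378997355, -1223264679249241938900852192741,
     -140979373523699990366499285912, 35264127056749851412584739849, 11845487328928347117842597455,
     1225681785190731040031761040, -104998273938462795439610486, -60277751261628890185317013,
     -8369976294526162777691524, 333442078662446370575809, 330969065485241678953499,
     52015424644342685124617, -710911404691824610773, -1782267667395246001113,
     -310411813697702346865, -1602369465010977833, 9448268874897203343, 1795888545950013981,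
     35963490941865002, -49308573879300119, -10160799038452705, -331938078090301, 253536939486493,
     56507164318227, 2488608787793, -1284368377532, -309972911515, -16964275290, 6406522550,
     1681458664, 109475149, -31431523, -9036647, -681535, 151410, 48183, 4135, -714, -255, -25, 3,
     1],
    [-2527495183986661547495966639407, -1529522050262631494320620000382,
     -292070154822112520386846167348, -2977552641639402742153236987, 7322998917915334515533675376,
     1336559309248308677062597695, 22664258010164434871436695, -40129586945807598952282086,
     -7944455107572548106364746, -177405726073227663459027, 212794437006656055648451,
     44354919265745601973721, 1591259202074085826581, -1075469845325009918076,
     -247641859594798645869, -12499596104413406828, 5355326252125491448, 1376786172058999810,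
     88180563491131467, -26402958949999732, -7590133987432425, -578347746034490, 128346153160581,
     41381348395505, 3624421169386, -610947079796, -223321267700, -22052058341, 2832872553,
     1194962231, 131226217, -12718856, -6344069, -766616, 54640, 33413, 4410, -219, -175, -25, 1, 1],
    [-9269202688556209645176888952, 24316889381254293786112954785, 37899187296987956645432926411,
     20635617638425297987471036346, 5369174460918624257611176218, 438083850086022087066955908,
     -144035339967186388503467301, -50245080147668210003256086, -4974757996994898940628614,
     799162889528031963360258, 326939125371834566507968, 36433268101413193927834,
     -3826338137456478817694, -1927766261916709621283, -239685372772148377351,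
     17866653258296673717, 11078567122364968402, 1455361637719534510, -89699267299797403,
     -62018919064347200, -8206366282374446, 471388052789149, 333948781727161, 44080261387547,
     -2364619698159, -1733765719541, -232861228129, 10705377276, 8787354754, 1231511159, -42206620,
     -43825693, -6536415, 126608, 214965, 34861, -40, -1036, -188, -4, 5, 1],
    [-18853673440168946808945080354567, 1058764317004872875719179018687,
     314294402388499695158410678354, 42508539087496131756564214869, -1426540445660905215052592663,
     -1854473268297756392267197015, -319921985524800370919975110, 3761749471556585748223331,
     11593755604035030945416310, 2077936680438166656718665, 6921658891404485036078,
     -66871304868016077507607, -12545592767477020736825, -153198497749874931481,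
     368738010441922676094, 71141502986035942496, 1288650223851302946, -1960295753599595147,
     -387157397607257968, -8977516039646124, 10095505496491341, 2048294667869263, 59308254592929,
     -50423219549921, -10638656621144, -389345195328, 244163372207, 54712539915, 2570422069,
     -1145145960, -280836946, -16978192, 5196794, 1448729, 111018, -22802, -7547, -712, 97, 40, 4],
    [-20948805948394170866277242925014, -174467068819099082621973507646,
     93174949787497498806821967929, 42884083111231769265928476794, 4117614794573404241073162484,
     -820864119464737006864063600, -258628224795577942571279850, -20588954189420507917631135,
     3667444941901355583419174, 1237033016460061451634834, 118850509596044082901750,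
     -14339576475516015351118, -6200364977875383410811, -723788691604859458440,
     55516529363406702877, 32706441562292174385, 4290501515916666500, -226953958348115641,
     -172393543933507877, -24177172101977303, 851749839212256, 882415816573076, 134669728895239,
     -2048551480988, -4462073139344, -759223193699, -3196246993, 22755259992, 4275157101, 81547211,
     -116413605, -23630564, -728475, 587089, 128370, 5453, -2903, -693, -38, 14, 4],
    []],
   [
    [-878254143231888253872939364081, -699024649497031993775746288939,
     -201478786271434785276655691813, -19989112257996330257956912266, 2221783563213521684574017533,
     930854854873808155065051017, 121985052345592938698318150, -3823626512828834315589788,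
     -5103851963593517719560962, -928034777683130351535355, -7000076757747668715340,
     30924861684335799833690, 6084941395504894399235, 88207386036539374761, -183080097080259495763,
     -35559693119442276851, -542309647232171269, 1011070328816204370, 196271940555987222,
     3930979533150091, -5309552249315584, -1074039710204787, -30568150533132, 27466537367449,
     5886987976251, 215545577510, -141670277948, -31925158242, -1388141633, 719968959, 170175396,
     8674420, -3560203, -897402, -54361, 17132, 4725, 340, -81, -25, -2],
    [-21507755202362504704232170203085, -817138081494810854557069484413,
     -198675686525227659214307225113, -16620208146043386646414973770, 2552471303758333344228939133,
     972076156621220434020591428, 82347892171324580632841651, -20938781929325694020807047,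
     -6686529068259464191642855, -528604943921185121996775, 122390222811508182105264,
     39770202416542844508678, 3346808806475263836724, -662652080439488185642,
     -226929651816322609211, -20166030214217227613, 3489669916166741558, 1258882949413441856,
     117600691320532935, -17906559832488757, -6833811556890463, -671890971985048, 89207608372046,
     36444852891759, 3793201196825, -429084243113, -191584839447, -21276353097, 1976967607,
     995472632, 118933761, -8605728, -5123822, -663579, 34428, 26173, 3697, -118, -133, -21, 0, 1],
    [19431828295040248854125397692700, -382532201369347776129322317034,
     2983601027880861594744921621, 27651221153059208035748236860, 5497319014102400037285867239,
     287767964325774234145886323, -66358236795296948430621231, -20156763493281255730763604,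
     -2676516729537904245866506, -9521687124310939328184, 86054923904541809281526,
     19465467226375300694726, 1164680405798451049768, -422544179955189764681,
     -120726465623823795510, -9399228716160017572, 2033907682894218052, 673100816081896844,
     63757934160196400, -8716943747940000, -3637022354133970, -422604173667906, 33756214473480,
     19824706769302, 2685046872112, -124051125353, -107990035934, -16086329840, 414102443,
     575380442, 92390784, -829456, -2988586, -521453, -3855, 15300, 2924, 66, -78, -16, -1],
    [-53262994760168180991017289208, -60337423296405071322461202000,
     -25349510535095685618728153145, -2010918368066463318225539165, 2520904663923674327324639340,
     1168337740864444028276084867, 192103498184999809307685063, -14231505154962254577164783,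
     -11642964838556030210652942, -1501601963724766778123453, 198837666710820744537509,
     84462115298727877296183, 5876044833275754524834, -1826525082471494581445,
     -436930225332210677305, -9541383645333147937, 10731605674103020958, 1833539997053139461,
     -5463396348996954, -49531299544539886, -8093485933271089, -5677988796721, 236855291289693,
     41979730982274, -70344583666, -1303716119708, -206305634786, 6473605180, 6774560018,
     802506182, -60464239, -27890095, -2491825, 243763, 84419, 8649, 25, -174, -49, -7],
    [-1197796124468922403241795212335, -429158496861256127814554214276,
     91877011769810848128640001144, 62285204837997781893784081180, 7545599071158179496967697636,
     -1186102636155803769515633485, -475999145435299669883107994, -44829164869530650268056437,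
     7486686201424646957088891, 2711098248384861319855175, 230529646861481961418453,
     -44556435322613891821320, -14465354570622423054563, -1048017396582044612778,
     260537092285485739465, 73423151114573111112, 4224774300285272089, -1451186587758781554,
     -352615990364773687, -14830819687384276, 7521279164135801, 1591858305413977, 44915342174444,
     -35595871874008, -6738742671393, -132468188341, 149811779868, 26832286228, 644362011,
     -526563751, -102085786, -5854112, 1219167, 389606, 56622, 1726, -1657, -484, -47, 9, 4],
    [1724068442857361354267058878316, 1067004884539753109150697713334,
     227338566622868830794841215349, 18468419676202175837717475649, 554972799170698155964537613,
     -25538662731325588511814076, -64221672904371059268819397, -18416072848088963059682176,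
     -216149198186584641716452, 793356326827514282407761, 114830624954509323160800,
     -12821828297943575185802, -5014476507428087498970, -226436386081209289275,
     94229433951064301408, 14749557192181032289, 59884280717880631, -147487617926688651,
     -23783252610925371, -8007960566079438, -1243698711421705, 215115109449886, 98745340231624,
     7196602459007, -2390562723925, -568229167905, -10751303202, 13567396709, 2227104888, 27350265,
     -46077767, -9699702, -846624, 137204, 63826, 8041, -805, -419, -44, 6, 2],
    []]]

/-- The approximate orbit and its variations on the piece with index 3. -/
def piece3 : PieceData where
  orbit := [
    [47367488042843275329092381013685, 5730452092331463012014879082545,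
     -472547957159019986493671952220, -67483872073394714569844571262, 4508587539999272751808983816,
     2267398190089047395455739305, 12529635146439600704464837, -72205564253884003626435048,
     -5381943727436328865243687, 2047377883308770207946023, 331615348209719726282675,
     -46734257829655930343162, -15090345346499113552600, 535772907633921834859,
     579085284498344889507, 23983703558472615914, -19140140581776010853, -2304365950924024286,
     524704959351706473, 123662323095697331, -9933150140941058, -5295123363999550, -34048497900389,
     193028523695238, 15913283873207, -5951949378091, -1045579297953, 141894584314, 49903065490,
     -1480387791, -1984102500, -97123454, 67139915, 8841543, -1850191, -477307, 33056, 20653, 348,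
     -758, -72, 23, 5, -1],
    [56534448970257295702561627174779, -3326274581598394330672880856862,
     -631812868194993530109605136718, -24171123460390603304102113236,
     11219316019211785142003682329, 1504558006282319054788842648, -231451055408263440311434074,
     -66453594899735995671270050, 2720369080762365706972635, 2459997270046787953632050,
     90951943223798938757829, -79036013383546410506141, -9124545913619353863327,
     2124215568873371568056, 485389169389104751757, -39947937804073671114, -20535322113237599683,
     -97439472845052169, 740263609198220323, 59544258455110934, -22610031321667059,
     -3905407176506940, 535675216147915, 185110533008995, -5680302620486, -7304121802684,
     -349352479321, 245349809385, 31943910839, -6716248363, -1716462298, 119457885, 73834451,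
     1223418, -2692233, -255418, 82078, 16071, -1865, -756, 12, 30, 2, -1],
    [65479497011294960368458736860422, 412274682438229839112585587171,
     -172294066302023031730903384754, -31627621942735501733740105789, 5280679783768316108032792936,
     1384717103201977531947444154, -85418378632567746699204915, -49496596597424915166315632,
     -753501697389860935151889, 1573326835115191609214635, 142458038745486956117969,
     -43294621094229011464287, -8252478524503480239718, 904097045918476720439,
     364017625117851154703, -4861326629909464020, -13597193518977644466, -859986812726671626,
     433598965171019616, 64837571515140158, -11082117429223405, -3254882324703039, 162891079182983,
     133952851767947, 4201762342416, -4697749394147, -519563234624, 136726359813, 30130659057,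
     -2835975398, -1358295189, 2373065, 51676475, 3909945, -1660820, -277452, 41727, 13813, -520,
     -568, -24, 20, 2, -1],
    [27232375434751360452667122218368, -1629726627252010450962104525177,
     -436350038858776948912208301994, 2563917993994378207240950537, 16670953094958177008338378881,
     1214600038667719434951978486, -479700882944154469853660370, -74112981456178770779686640,
     10764444855537383360599553, 3256249240406874418908796, -128241853234445854083403,
     -120743490597411698361257, -4284280064194222128975, 3885353871507919087377,
     421032872718512537962, -106279708313723824071, -21884164015040077456, 2211556678304275990,
     907821743586503048, -15106693856168129, -32440944115223600, -1716340979818689,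
     1004910227466181, 131223770623482, -25602623703481, -6493197343764, 418095944647,
     262726312851, 5307812906, -9066819288, -910290241, 259616572, 54504802, -5248018, -2467601,
     -2867, 93311, 7686, -2948, -533, 71, 26, -1, -1],
    [-22517509545434598937277328391195, -2822401417191773311446693960233,
     58839899296643723935246393242, 96699728443263790382258772082, 1427162446753927193397702017,
     -3127790726565908656644337067, -235951087667449293458803726, 88507525739332713533751063,
     13831251855421763317883864, -2067915654957907174668667, -605939015504075674969887,
     29520589334578507836503, 22542750958188184066444, 532368397424197338768,
     -728525258289311820374, -68818481019721109993, 19887488503138264049, 3762602120395433805,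
     -403884678383070706, -158171392158179020, 1987496016333839, 5590428187179719, 362979254693786,
     -166137700473517, -25935071223945, 3789830449335, 1234048770528, -35395828019, -47826493287,
     -2657284078, 1552631915, 227670072, -39696789, -11878915, 544896, 498506, 19073, -17668,
     -2131, 515, 122, -10, -6],
    [3743977813931599973593667145421, -3594617126091590376406673057152,
     -217675666689886100562279247318, 62270221381538452317845472975, 7174758280951174588647477343,
     -927351423162004059711284034, -216612496872293821836848165, 7237334683572188619107930,
     6613560930023503693586198, 325312335702542645868032, -192208793866299301206686,
     -26889448653780596076944, 4797113053605638930715, 1330094666656670186199,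
     -76878745193490754102, -53477806722212732052, -1087465077087931811, 1837891711081488116,
     174596398674703995, -53029912629210090, -10342713086040691, 1134767478027207, 466528283407432,
     -5610656621937, -17718678096070, -1165050946865, 571324268175, 87711836225, -14661217222,
     -4422854962, 210698360, 182739185, 6149565, -6422093, -728805, 186619, 42071, -3818, -1894,
     -2, 72, 6, -2],
    [26985723744949242954258739696321],
    [1438726236907454709022921732840, -10585838584613131038938623043, 4232216407188095905515058930,
     983269393267497712513550099, -154041926947320810862801855, -48357883190398508360872817,
     2923833839732629585362141, 1777288719594526356652026, 11028294851282191030443,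
     -55357810502942497236283, -3774268208246604737422, 1492265006754233666779,
     212723100353917338071, -32994579008083046394, -8834462481260101145, 455492945354975582,
     310957892609391635, 6632602938906762, -9548640625250448, -881209354483312, 249919875519327,
     46775622500653, -4942264538029, -1918563911234, 27357021177, 66912341488, 3949814471,
     -2000392093, -282619578, 48292298, 13366367, -692599, -518573, -14291, 17185, 1791, -474, -99,
     9, 4],
    [2136642322072325115774109129878, -2237815683633852822050131738, 234422262480403114404667821,
     779093795840769105908284265, -72229252506592607239360350, -61366572602710905262098821,
     1113397536308747441982252, 2965034550356674967137340, 135602018971446935597199,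
     -111405107229215630760995, -12219638973871298791129, 3425534440774902693566,
     649177690597701010778, -83180582979541088715, -27200177313609491715, 1287516129914173613,
     971564615542478767, 9991710866694441, -30484245909729047, -1847830263651396, 849189549334907,
     95709608597373, -20980540494744, -3691444698436, 454716407354, 121028359228, -8471321426,
     -3542483228, 133757777, 95287196, -2038218, -2417892, 56281, 59701, -3092, -1493, 179, 40, -9,
     -1],
    [1724210135517981453205657276494, -106728207081647042164780559820,
     7992655834971405656091302107, 3202749861734514300431106613, -393420722307556780421070107,
     -88431306432949170954335478, 12854393974144438470626718, 2186232350431660121376148,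
     -324384679768979124259121, -52360958175624430558938, 6317879853779949634460,
     1246155563604650685361, -64699639828372425142, -29024001404513942785, -1912260308832215501,
     614304527939649932, 161893222268824948, -9090024169219243, -7287614523312944, -88444096248773,
     260568224022297, 16127091908812, -7891091733222, -943887902201, 197544404194, 42091394737,
     -3421333369, -1594780061, -10591561, 52272046, 4607026, -1433723, -278408, 28245, 12178, -34,
     -439, -34, 13, 2],
    [1560222993284497937511012314378, 52950646680810279578903425951, 14523074857170497198903826149,
     929574681282199432257999580, -349540232013873506291433578, -70995591906126691266014857,
     2173897768676911151943481, 2131533184718493179380264, 143485248388828910657580,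
     -42713787971507896206408, -7232719900847144622675, 576022963952245497167,
     235789304895505076833, -192975484996156776, -6784163985970729670, -425403655728196620,
     181267337020439483, 25312008711733062, -4140029886737391, -1117056359574951, 57550473815958,
     41499472593388, 1128625492059, -1318281418989, -137241593427, 34663830651, 7322723815,
     -643335782, -302483918, -347080, 10582334, 807822, -314419, -52380, 7323, 2432, -82, -94, -4,
     3]]
  variations := [
   [
    [41065191535366916108023012628333, -3371113949190872422939449483629,
     -2451866343086284098197007753129, 39254823926947555488214065024,
     97618821728909227678853602088, 7032128316708352079001148058, -3640384361018625120076357974,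
     -594964125157439341729821423, 107544255366103248378166290, 33577083688704469825215173,
     -1828131472049815075529267, -1544587743143778168710712, -47396653462808952911269,
     60117374700845823854520, 6740017820187724158392, -1935412389116502056048,
     -429661327221692017090, 45040310240799516390, 21068028309328730192, -164280425656722560,
     -867223958068020809, -61950534774000551, 30130635729553664, 4885520619780311,
     -826678904364838, -262221944581414, 12422615192748, 11524697441975, 417573699885,
     -429393792479, -50943308447, 13165515182, 3091954502, -281324738, -146359639, -398240,
     5832375, 481138, -195239, -34840, 5040, 1797, -59, -77, -4, 3],
    [-1565717816344931266222786007514, -10697882606286461039136776398225,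
     -1301430823857949018333284037256, 264830421720693302356023678803,
     79696902503809160258912147405, -4793047673099404746846550295, -3991765002478365968499983716,
     -129213777596669688870027232, 162290389807868172040171243, 18853788111737243749017286,
     -5346102979843521747702086, -1224078897935046370808796, 125241367500505376134003,
     60857897177778696716685, -332126149421881399205, -2531845201224026041241,
     -187479350375180712235, 88621145396110353775, 14679628542479767226, -2437794355332154001,
     -789368391023344226, 35969948007777106, 34780240749776968, 1316634174154756,
     -1297844229124995, -156518343789475, 39761095477202, 9470166679481, -842276233562,
     -447840865596, -1960122729, 17825292797, 1503908337, -595068008, -107921484, 15239898,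
     5546514, -167696, -235756, -12115, 8480, 1163, -247, -66, 5, 3],
    [23538472758284343781596276376209, -1694328350493545568796411075062,
     -870421832805851971146334081974, 67483343948486473236683017745, 60802525925927751902750984476,
     1041597746214387052648314471, -2725893811730441450869988501, -256280529796861767788810827,
     95149999470219913480380329, 18444386731370466273834441, -2471375154689539632914326,
     -970297916411728324453068, 23720741073439802896209, 42225708993336173688570,
     2437718694140108450933, -1549780677476880542037, -225363587253508690553, 45713370727142977819,
     12921828365626183653, -839678358475759025, -595787385111194436, -13314961517858592,
     23228310181852977, 2396540130516005, -753207150144929, -157423543888810, 17999576459494,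
     7815125082389, -105777780249, -324572703739, -21585967539, 11389165698, 1778311428,
     -317714803, -96974704, 5076800, 4308316, 138698, -162236, -18490, 5048, 1144, -112, -55, 0, 2],
    [-34090789330783375890343821288433, -11978025496193361386592268578183,
     -355203700351807623740540561440, 514879387415440266648976322330,
     70698720875424286029772298683, -17944283738636301080385177885, -4739128482408558840373691917,
     411072432627879800835044433, 234180246265678548410272433, 1224357997101870899622990,
     -9599617911557470593514467, -801473890709188310593210, 329976638202687844930974,
     57566878204525320229816, -8963046789393183615669, -2954654940051560137956,
     138314654008582224923, 125718607823825143909, 3774248784964622716, -4574648983669705858,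
     -483404709463076177, 138788975951910311, 29046609975917586, -3052343422190729,
     -1352296742046028, 8897089521517, 52845633750436, 4004290953028, -1724601461275,
     -301488781026, 42462413822, 15538715700, -370516278, -653016551, -40481299, 22905569, 3563375,
     -630158, -197002, 9333, 8771, 335, -329, -40, 10, 2],
    [-17188078887401967195480420599234, -1458539079167736450428481244823,
     1801021569777856576089630121863, 218145236788733361567604589070,
     -91409194317041061340013818578, -17142412414921696537254351059, 3056501880722867819449291533,
     979122566217381747467184394, -61485921959187475846023109, -45486731787436067354846644,
     -696146646704603658129027, 1793984543908918235439862, 156686335677225871920451,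
     -59559071751176001730153, -10524085989651193187115, 1527178142869635018595,
     522413539984896496244, -18290158857188642142, -21449748978644621884, -1017014711881967775,
     738017305099859606, 100043043537896835, -20003194741817238, -5570316745671183,
     299561704052063, 244167797219981, 9438213042489, -8878891154386, -1151182384063, 257406674630,
     68780856207, -4568621279, -3190802713, -81456270, 123726838, 13520053, -3959370, -872657,
     91716, 42871, -343, -1768, -125, 62, 10, -2, -1],
    [-21670950106860679848733213681255, -5115756248377600300315807608101,
     904823109903476479137633721310, 304181555882475586243488608001,
     -14646686668558087499541760764, -11606567525261987156393375165, -397134397516230093629605148,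
     388686190470925513463888630, 50555555746637232170126298, -11324476738108617745328646,
     -3129303040035354560024657, 222347603921841947901138, 151558680139273132710506,
     2375287987192860045810, -6138763597276473688745, -564460284143625736303,
     206458837124209842261, 38737965700114206801, -5251563232322202868, -1969849909866895889,
     52583358003016220, 83379274928662769, 4632055332403538, -2987509925087809, -428077235165759,
     86223347041983, 24189652133152, -1546529373266, -1098002988593, -25087164576, 42157610195,
     4358383499, -1345928439, -281905675, 31548360, 13812907, -164829, -566617, -38509, 19629,
     3104, -539, -167, 8, 7],
    []],
   [
    [-6003473773230356598974169708834, -2237219397336825257741698055749,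
     -124358103447092530578245718409, 48088449429860102021843748911, 4771297107654425823769695827,
     -1254267483486505218176964777, -202582243993962218411290917, 33983565942953702014758521,
     8592974433655172758846727, -849695607285939589578811, -357097169029534096582989,
     13638520660262681657035, 14344986420020340294823, 314390102430269232239,
     -539374187074470970056, -47083804331940052024, 18177377193894881003, 3114505149251742565,
     -505049433227110251, -160258208537850261, 8490747220648188, 7019358302458163, 186537718324767,
     -265740862378886, -27785348962112, 8443935339536, 1766422132740, -197894354127, -86127909335,
     1051419785, 3524205698, 240273656, -121653139, -19398387, 3309028, 1043489, -48548, -45732,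
     -1733, 1694, 206, -51, -12, 1, 1],
    [-5862769367941574287963358775158, -2085252211905449527635903641653,
     -99398730482675344235308879557, 38833451257371445481711924650, 1864959669150067234417047721,
     -1211973852641534388600393890, -111193078816723917400815875, 34995268626189450639811264,
     5448429440350825624133697, -972713384813142789944838, -235795912135867355689410,
     25440300536772633716193, 10013533783979243578009, -498396136838345184793,
     -417841821517247894166, -3414006425994803413, 16496133585273818425, 1166504727225348442,
     -588386973583574451, -87006470282747259, 17673085214249686, 4787656038834850,
     -362424656879807, -220746371982542, -2134288681557, 8765618475026, 768972860643,
     -294380922615, -54415806069, 7593473201, 2810414247, -82505263, -120482852, -6339671, 4371247,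
     608295, -128127, -34917, 2383, 1603, 32, -62, -6, 2],
    [6033915971851609051354659134425, 2433905531861133973977278990659,
     289088521805318514547557063112, -5821058985351421866783676531, -5973021325910397489303854177,
     -871821531308789005137916421, 64743500695165102449751424, 41013856355979868185354403,
     1661268586153173357911413, -1406553209880805782971704, -184827616530605966593007,
     38543224552449426693585, 10453553879964848994832, -634679390335361911934,
     -466542795614984428984, -13388522769188536739, 17513866322462259828, 1952775068975450332,
     -543625037825667560, -121169204355173231, 12155119661587857, 5786224004979077,
     -32278245589655, -232991093337480, -16878557692101, 7958834265769, 1292736045010,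
     -215914613701, -68342511821, 3253515833, 2976752078, 103576773, -110479880, -12794683,
     3398131, 776879, -74358, -36814, 66, 1473, 113, -50, -8, 1],
    [-10002535392183170173334854925385, -1988450448124799496202456737672,
     196457890875582150185353206686, 46653113641691072049300462676, -5766425441946767349553878130,
     -944123450802338545134044420, 272901573623558489508542090, 29771174420688541847093196,
     -13358802322831843658592923, -1595759229155793940467259, 534670999186119198439087,
     92823209003935006553705, -16622718776709310457824, -4756588362353602977946,
     325786673355404980181, 207446882192202069377, 2865440629216901898, -7646812924320084082,
     -681341805566100868, 231491812394112809, 42068188515807107, -5127438835897445,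
     -1863506316817581, 33728585683609, 65903853629103, 4290437023571, -1819013018214,
     -309784299295, 30624943033, 13845395616, 450907039, -461598764, -71882658, 10283475, 4165236,
     12849, -177978, -17873, 6024, 1300, -147, -67, 1, 3],
    [-15674186366523045669720626878657, 2263571160141006004835060040428,
     339326421177487490350022246376, -12584922799824902461498419879, -9445851613525322196453593027,
     -752432439192128899065943447, 93903588069476411947766006, 26477144639097803316876392,
     4068796483755203593539513, 167349799947809183590351, -225260487611974958829048,
     -53518699857814669371278, 4378071625784260581213, 3026228153061626893216,
     100857706557304091660, -115479526802971358546, -13090708237065163249, 3330580975576115436,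
     703750716901995846, -66507703334691309, -27575185803802012, 308059761052858, 841180680257044,
     44859813469053, -18523175634488, -2242799856327, 161742994580, 42821549589, 8911862998,
     1744030600, -518572702, -220145426, 9059878, 13438811, 652151, -616449, -77206, 22719, 5060,
     -640, -261, 9, 11],
    [23828516603611232720787667147865, 1407527907451558681027897665461,
     96931122916634658827600493349, -24046671456058539101675194909, -542871126225641466073546034,
     1089279998202908687070291979, 51899891844845387083376820, -37695559489981268294629070,
     -4742867073040047709337813, 662549895873420528230048, 216164342853121034603970,
     10815462281461649957745, -6203690843984251647441, -1438345823203156043054,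
     86319877380226611389, 72753814963043831446, 2891467971466156954, -2747123160552583582,
     -316624479516716394, 83937443108194956, 18101638706629936, -1872306852147225,
     -829657040666590, 7504318762159, 32633507446561, 2332665518245, -1093901530762, -180876977476,
     28871741270, 9510856578, -392334286, -409339993, -16732851, 14918921, 1840314, -445402,
     -108145, 9054, 5004, 40, -195, -17, 6, 1],
    []],
   [
    [30148964820988409320682207826113, -665328851709753813181858915898,
     -1775467248440838282114682033934, -57280141216267322910747201467,
     73200576514432681774633342387, 8916381360654881373869616630, -2602704013930417796800210110,
     -606409968609000534059600215, 64584237221674918274656330, 31296136512547657775950619,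
     -212239461431133393181682, -1339096063954852853587766, -99458037267903830914155,
     47888356387256967806311, 7986089147407414999552, -1340805457734219634663,
     -436273788570484205624, 20246994292743449260, 19460202609169221932, 720739503292218303,
     -734345691307832560, -87516839724061927, 22794851821018872, 5346180831224265,
     -495808246292896, -254862417173218, -275825339176, 10230864958386, 824327708241,
     -345428898546, -60577926222, 9040604074, 3149851278, -111668276, -135172340, -6295146,
     4914851, 643933, -145548, -37391, 2848, 1724, 23, -67, -6, 2],
    [-17500143746033306945372984165358, -9148188473642208902240443021337,
     -1331244485765814898134811951097, 181606672097872394056504361536,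
     73308436418112477011820854901, -1652127851730408059458157596, -3491120863851118138060277910,
     -235125707260575892650688214, 132839478596014558595455430, 21425505405343114814927442,
     -3890460625968814471183372, -1229507216607458260555533, 62990706389899180376610,
     56507330279145426658950, 1954841822498059468329, -2179013553013986894047,
     -255663834143641623031, 68858939647374895810, 15967041595253900741, -1528797557451130549,
     -771361388134686296, 361092052571782, 31257185142796545, 2482716377611870, -1063171547361579,
     -185032242862115, 28025539445244, 9684676432772, -352475986943, -417308337126, -19219488094,
     15213925704, 1988210523, -451243298, -115831210, 8826811, 5349181, 74010, -208431, -19627,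
     6781, 1328, -165, -66, 1, 3],
    [2169053103863798693503836996411, -1503076958586036632030588032861,
     -758187917696081129685915104673, 39816769457155081484071601079, 52302048161149270030822176452,
     2507340369696534710894540510, -2208076606890865383776341113, -292125209658743524411651961,
     69967421066088309850806810, 18137560398224891536242635, -1434879375914409801241969,
     -878955273632440773893441, -12594456911661026143067, 35646018738917455599268,
     3446682625791353721815, -1199403899518494828027, -240431259352553244206, 30074202751784224809,
     12347382126466594140, -240197553249072430, -526201147775265852, -32519607870114084,
     18902693421261581, 2846159176269523, -542100294614674, -159341915234098, 9269183062719,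
     7213249753532, 201394715184, -276201111542, -30239709681, 8755434115, 1921718567, -200110677,
     -93531508, 604569, 3817963, 280260, -131350, -21753, 3548, 1157, -50, -50, -2, 2],
    [-8574292213105006205506408591045, -5816334871771687707558490511877,
     -615451690699341215228441758548, 356616934647901066101654251605,
     82070577749310433821446742169, -10578315284338478084688687427, -4892707066661977735397837761,
     63147772218509736697749681, 218909809056366277337684637, 15279466505785697498661991,
     -7951654283809280879536784, -1268740558213408618683200, 227099654621429030257851,
     68974744429297141900449, -3957093943990109496711, -3040379802423566194520,
     -65367494307013811339, 114229333661314190655, 10771599330366664296, -3629284733307092730,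
     -677280532689779084, 89224436119960447, 32495368428912872, -964370623785482,
     -1315876697820334, -64815139207829, 45491031608330, 6113452444874, -1271662493864,
     -341299574638, 21817446627, 15225258287, 399745848, -571570300, -63585854, 17597917, 4020948,
     -375626, -193543, -739, 7781, 664, -262, -48, 7, 2],
    [-14849174143082715198848335993246, -1502175478135457365120270749632,
     1614713164886349048660952423860, 248072157658762026249125995477,
     -77988809568422518699521729069, -19202495575961053861697053870, 2195539001787666424155090593,
     1047804534113063647158103603, -14752865532081027851743944, -45867735631833962054656508,
     -2845778200449810934925574, 1667282518430595082243823, 239728521942131042122977,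
     -48459029886924066664801, -13096812085145385930728, 898250643877924775065,
     575685907117264504256, 9826965308045272154, -21275266959015501543, -2049612367843680189,
     647533689320413926, 130250236699249704, -14101947862401087, -6146761228357947, 30649119019260,
     240017212000103, 19087168328214, -7763764412662, -1411929370608, 187141427248, 72140881059,
     -1378662182, -3017158992, -197158349, 105720011, 16726195, -2923179, -917455, 44744, 40860,
     1440, -1543, -180, 48, 11, -1, -1],
    [-18911943339424258068731074867335, -4992169809810501713785385325206,
     655636252771840542772793496223, 291397381006076864873705417008, -2824704835164212302413732863,
     -10322805937515524510068583698, -710294145308355228346598577, 316438257596689740699071521,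
     55169654313462585754304882, -7911922752370651593229576, -3000810803731277649917021,
     80551408950239715405246, 134238345325331299268983, 7333424784788418859863,
     -5029295491499186341805, -694448666435133065981, 151303899464974705144, 40017549182204158190,
     -2938930045148137544, -1845584513379511093, -30096561774804419, 71909471256971386,
     7035185441939740, -2334299572494194, -472854346734096, 56260657502266, 23624196854458,
     -379841724081, -983355668941, -63146341666, 34554973231, 5293065049, -967093864, -289654233,
     15740200, 12877640, 395091, -484901, -54486, 15091, 3385, -335, -162, 0, 7, 1],
    [20282409603651670423947251286016]],
   [
    [-4543387887564937528702549405802, -2037356236706737190547229353441,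
     -99639070848637441099929403914, 87879175122367291374678641428, 11164929558208014822589011988,
     -3097081578228002417291244302, -741504994513631017059433648, 73515999292114372178150130,
     38230422353091812159300608, 56160084468435175778095, -1619734353931470420625120,
     -137218246470546074791662, 56486376898217138855236, 10386974084130724713130,
     -1489098086943042057199, -551542130778540123517, 16282001750085783069, 23982721209630896053,
     1280008654119124063, -876507874573625291, -122970875812764530, 25764414687705427,
     7067303535218539, -477664515481673, -324520952508526, -6662189245703, 12578257727977,
     1274144886375, -405421614280, -83695368294, 9643987816, 4136390074, -57950628, -170843137,
     -11288470, 5959460, 927853, -165154, -50366, 2609, 2226, 73, -83, -10, 3, 1],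
    [-4787147987556682002645950401939, -939730425472593602890948183082,
     378635963301193491956085553136, 121797857314089471045591153038, -1426913012280926399194235907,
     -4831732917941230389509873748, -347836064590990810025353255, 171802127354721728716992322,
     29584530281138157463762136, -4679749510590383640453497, -1639469028466508122369220,
     56504836024180335167565, 72850605639840650281865, 3728703501634993388108,
     -2696515944971121001168, -375246147312113172022, 79849404442886515827, 21863811974621249827,
     -1481365709438449455, -1010513327845550110, -21487409335825484, 39272013389896302,
     4033128022828491, -1264636079204798, -264512202413330, 29829730551053, 13055586199966,
     -156519914069, -538044939796, -36722445613, 18693706489, 2968566651, -513588289, -160143605,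
     7824292, 7046665, 248441, -262599, -30894, 8055, 1879, -173, -89, 0, 4],
    [-6624210617795108552675551725299, -2412899149313887956746367621674,
     -60290678352098632811972579172, 79870205597718975756886946002, 5517153808214625690808121250,
     -3056801465894598428998763701, -466959908045365082153434269, 93076132628128601237972516,
     27227839936241002629515148, -1678541522503220574647547, -1262179355998443186764997,
     -33129353626568987809420, 49163927391603927801525, 5348687671981167218790,
     -1579883631405838984395, -347085899255786581491, 36438587195995781064, 17128701198699427856,
     -99596438558497554, -706184109147168259, -53027203260253201, 24441088388900021,
     4126692308097469, -659510921369885, -220488243754767, 8979242156535, 9649212562812,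
     412177691702, -356972242302, -45300384813, 10777256818, 2691546944, -218876639, -125988010,
     -1269987, 4969877, 448605, -163999, -31141, 4101, 1578, -39, -66, -4, 2],
    [439833191603818735418653274609, 578855259569473755030672926741,
     256231886141915627283350276014, 30790734632927219509386899288, -10666441737986797095456459677,
     -3512882471606488067027289902, 86055418285176333540791439, 180036681766043730431772352,
     14901885096561945966638835, -6567870632601130617231745, -1260271686487953487282494,
     167416942404515717559775, 67642588046577079797313, -1230852953330552469975,
     -2890962378736898831557, -184555282170110193030, 102738886202546217224, 15548123669895740856,
     -2923148439762640611, -848835776496051139, 51766003149667791, 37818696553745569,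
     820834094379157, -1442995343307978, -142798009788763, 46510319786381, 9255409479681,
     -1140198931714, -457271441882, 9987438235, 19048389222, 1092784796, -676600527, -97185328,
     19439976, 5443809, -347599, -246467, -5700, 9456, 985, -302, -64, 7, 3],
    [-15237202671728428027187920606099, 2587980230690615379947023214707,
     340361907826372609041570448231, -64010230371292496433997683262,
     -20595267570787012490972616452, 1298942067927025072234988360, 1091281984024414412145109664,
     37305055247652881152588835, -45411249538014809590293615, -5562706564353613673399528,
     1459268526512617055375106, 355218899314973876782461, -31085648890742398607484,
     -17070590877408867592633, -113231581129302824387, 678937918469536864424, 58480118344317874984,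
     -22445026912291418193, -4092099721358595009, 566800890071270743, 206136758682297330,
     -6184365269970834, -8605667589676926, -430870582504005, 305160808897636, 40909202596277,
     -8826332826082, -2308682273948, 167569524796, 104621210551, 1591321838, -4031345465,
     -381263869, 130560627, 25520724, -3200202, -1273292, 27496, 53163, 3097, -1886, -273, 54, 15,
     -1, -1],
    [-20559905615248910422149720327184, 726933369424627708274856513672,
     320483665046394566744927608075, 3725781267044912352756865230, -16172070160740538606010788104,
     -1674291548835566047934489265, 496836390184532640801092934, 103299654611327023262417283,
     -10766847456820439670700766, -4786803756784395556131575, 47454958768379772754163,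
     191897786352220530248952, 13129753503761512812834, -6646118307168751865220,
     -1054006175416801513538, 184104886110281843620, 57212029577773502603, -2853400007677468165,
     -2535683030303902890, -88342243736344527, 95026862154626889, 11182884659338952,
     -2925436464154809, -684465685423787, 62722790258741, 32538696348749, 85882261063,
     -1300263954541, -107461709183, 43609842711, 7797424019, -1126817341, -402683075, 13037959,
     17179495, 847950, -620503, -83427, 18190, 4789, -346, -219, -4, 8, 1],
    []],
   [
    [-3171181923142622213490001862446, -1584461821263272492706839171582,
     -179215980029650122408583477266, 39980898164338983512095493267, 10072767913644428385842361072,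
     -845675216559964444539045740, -513714120002331062457696343, -12026772019022795596915416,
     21278243056815084217819286, 2405127897543129935315235, -713140558818095940074874,
     -161609635336661551566104, 17208391583276075217840, 8155272637312419661080,
     -77548499043218940152, -343708694128260824544, -23509818023797046718, 12257572490998970580,
     1910066966597830685, -350428557387868126, -104717042595485794, 6046212973990101,
     4702750164615253, 122559078179866, -179947488570923, -18995637971828, 5749335866086,
     1213757077612, -135555415407, -59354028438, 763982969, 2439507774, 161932258, -84939082,
     -13205896, 2356100, 715563, -37593, -31633, -1006, 1186, 135, -37, -8, 1],
    [-23996931009397110545741763411359, -1652378906028999713282456038020,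
     -165535823474277869196468263157, 32875418401596936552391138714, 5000199932508712735416482605,
     -1806358434554076444972098761, -428569265334036889914651313, 47563402312967899932339423,
     23423539662423914090538280, -129891078149672465496810, -1011020797748906385561664,
     -74915429415588157262611, 36401899242988574732502, 5961947117438748545467,
     -1040207330182116308210, -326281688557406617656, 17262523535442008929, 14665355893489180434,
     437940143831784278, -561152961879314528, -61451233655464625, 17878467367525395,
     3874744667139707, -416820771597944, -188477879812776, 1956205710841, 7718710045023,
     529030315779, -267717577032, -42328343924, 7378184593, 2278842410, -114892209, -100335501,
     -3363004, 3748867, 432462, -115656, -26504, 2520, 1261, -1, -50, -4, 2],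
    [18989683926346964444256442310181, 136270507193109160507077358250,
     291041372295425482775210482172, 58449192547262240102469880640, -2435736283099533155411248736,
     -2288285071560787907272395062, -184566069492944881745069175, 60758228562845412260980812,
     13771809255039712598289679, -918394620326267499776311, -653211863590639715593128,
     -26985481312480146443721, 24448420457586829695850, 3394093345973593198830,
     -703064674015273880160, -203189394960185324448, 11024742801681412489, 9325312372086977769,
     356056871928668528, -351855115074805076, -44664177752481660, 10603107923649988,
     2720158699504486, -204509785947001, -127962239764629, -2304536104723, 5013095731480,
     506811345864, -161755913549, -33793088191, 3787690966, 1675909353, -16681791, -69040621,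
     -4928430, 2385142, 391664, -64419, -20971, 900, 916, 38, -34, -4, 1],
    [-206599244812741098023145861197, 5367017446099708772371213602, 129942527281392812424368298255,
     65190628767297176325749792215, 8599784672565502833216405455, -2218016047692063346070744125,
     -698042089357329633895841971, 46189256331427698321881126, 35847941840631673273092445,
     270076538426784276939435, -1519200086648236775217248, -98264168451072696950830,
     55543097658459886993983, 6957137476317369442861, -1752584507874499034300,
     -365625921060067731987, 44935797273804276337, 16478003186590256390, -679603716519380296,
     -663692752005445258, -17039132539838496, 23992879823300118, 2255736936922753,
     -757481860762830, -138909807257572, 18979251504553, 6702924926724, -226446746681,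
     -275411565238, -12799389975, 9680688669, 1287024235, -274543411, -73832187, 4726038, 3356162,
     93469, -127816, -14545, 3982, 924, -86, -45, 0, 2],
    [-1140362888705724175991449210551, 735095254321287474179712378932,
     433753020690001599253361051845, 1980796709212276651580644204, -26652315269495649992583795096,
     -2642387754144902351413841493, 950352019872974833008915075, 182147933838924464170252079,
     -24506659221001326070268767, -8752855125094126927499466, 366209387972140417315932,
     358510474760178843598659, 9058370875894180155579, -13028482014322560441594,
     -1190282653257326735081, 412120092578573627517, 72219674388532944971, -10478362706775726347,
     -3413824731288368760, 148866565098161683, 137414933735541196, 4517842754491147,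
     -4779958528709331, -532552351312017, 138318290064610, 31082555887329, -2774233843558,
     -1421656192491, -9808444134, 54835730478, 4984591123, -1763478485, -347961544, 41946712,
     17593816, -247839, -737471, -50052, 26068, 4137, -734, -227, 12, 10],
    [4917196517356925162806964258282, 2195044231898606095557802257950,
     325538536479212352708879809763, 5862178224403479298673096461, -5336949312706999030195231063,
     -741126022875979176034511660, 140324773558928482697560891, 42975971611061081967564926,
     -4744689827265594649988421, -2395359145566533089816783, 64053966981943330825214,
     108567129689230043908589, 5564925417588822897734, -3837548872518574590386,
     -545623637666779180403, 97562762833211607845, 30324394412865863929, -906522850782244075,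
     -1298504743762018653, -85950662869980080, 45150251338258088, 7537299344856291,
     -1197060070110119, -408719425594804, 14668553776618, 17755625758421, 863617574126,
     -644254339173, -87464496430, 18728199680, 5048713974, -339304022, -230676146, -5190637,
     8848398, 927677, -280140, -59915, 6397, 2919, -21, -119, -9, 4, 1],
    []]]

-- Each of the four checks is a closed computation with integers, and together they are the whole
-- numerical input on this piece.
set_option maxRecDepth 100000 in
lemma isApprox_piece0 : IsApprox piece0.curve piece0.curveDer piece0.variation
    piece0.variationDer :=
  isApprox_of_check (by decide +kernel) (by decide +kernel) (by decide +kernel)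
    (by decide +kernel)

set_option maxRecDepth 100000 in
lemma isApprox_piece1 : IsApprox piece1.curve piece1.curveDer piece1.variation
    piece1.variationDer :=
  isApprox_of_check (by decide +kernel) (by decide +kernel) (by decide +kernel)
    (by decide +kernel)

set_option maxRecDepth 100000 in
lemma isApprox_piece2 : IsApprox piece2.curve piece2.curveDer piece2.variation
    piece2.variationDer :=
  isApprox_of_check (by decide +kernel) (by decide +kernel) (by decide +kernel)
    (by decide +kernel)

set_option maxRecDepth 100000 in
lemma isApprox_piece3 : IsApprox piece3.curve piece3.curveDer piece3.variation
    piece3.variationDer :=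
  isApprox_of_check (by decide +kernel) (by decide +kernel) (by decide +kernel)
    (by decide +kernel)

end PieceData

/-! ### Differential equations on `[-1, 1]` -/

-- This is Grönwall's inequality with constant `1.05` on an interval of length `2`. From `e^2.1 ≤
-- 8.4` the bound `δ e^2.1 + r (e^2.1 - 1) / 1.05` is at most `8.4 δ + 7.1 r`. The constant `1.05`
-- is chosen above the norm of the derivative of the field along the orbit.
open Set in
lemma norm_le_of_norm_deriv_le {E : Type*} [NormedAddCommGroup E] [NormedSpace ℝ E]
    {w w' : ℝ → E} {δ r : ℝ} (hδ : 0 ≤ δ) (hr : 0 ≤ r)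
    (hw : ∀ t ∈ Icc (-1 : ℝ) 1, HasDerivWithinAt w (w' t) (Icc (-1) 1) t) (h0 : ‖w (-1)‖ ≤ δ)
    (h : ∀ t ∈ Icc (-1 : ℝ) 1, ‖w' t‖ ≤ 1.05 * ‖w t‖ + r) {t : ℝ} (ht : t ∈ Icc (-1 : ℝ) 1) :
    ‖w t‖ ≤ 9 * δ + 8 * r := by
  have h1 := norm_le_gronwallBound_of_norm_deriv_right_le (δ := δ) (K := 1.05) (ε := r)
    (fun t ht => (hw t ht).continuousWithinAt)
    (fun t ht => (hw t (Ico_subset_Icc_self ht)).mono_of_mem_nhdsWithin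
      (Icc_mem_nhdsGE_of_mem ht)) h0 (fun t ht => h t (Ico_subset_Icc_self ht)) t ht
  refine h1.trans ?_
  rw [gronwallBound_of_K_ne_0 (by norm_num)]
  have h2 : Real.exp (1.05 * (t - -1)) ≤ 8.4 := by
    -- The exponent is split as `1 + 1 + 0.1`, for which decimal bounds of `e` and `e^0.1 ≤ 1 / (1 -
    -- 0.1)` are available.
    have h3 : Real.exp (1.05 * (t - -1)) ≤ Real.exp (1 + 1 + 0.1) :=
      Real.exp_le_exp.2 (by linarith [ht.2])
    have h4 : Real.exp 0.1 ≤ 10 / 9 := by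
      have := Real.exp_bound_div_one_sub_of_interval (x := 0.1) (by norm_num) (by norm_num)
      norm_num at this ⊢
      exact this
    have h5 := Real.exp_one_lt_d9
    rw [Real.exp_add, Real.exp_add] at h3
    calc _ ≤ _ := h3
      _ ≤ 2.7182818286 * 2.7182818286 * (10 / 9) := by gcongr
      _ ≤ 8.4 := by norm_num
  have h6 : δ * Real.exp (1.05 * (t - -1)) ≤ δ * 8.4 := by gcongr
  have h7 : r / 1.05 * (Real.exp (1.05 * (t - -1)) - 1) ≤ r / 1.05 * (8.4 - 1) := by gcongr
  norm_num at h6 h7 ⊢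
  linarith

/-- The truncation of the coordinates to `[-ρ, ρ]`. -/
def trunc (ρ : ℝ) (x : Fin 7 → ℝ) (i : Fin 7) : ℝ := max (-ρ) (min ρ (x i))

lemma norm_trunc_sub_le (ρ : ℝ) (x y : Fin 7 → ℝ) : ‖trunc ρ x - trunc ρ y‖ ≤ ‖x - y‖ := by
  rw [pi_norm_le_iff_of_nonneg (norm_nonneg _)]
  intro i
  refine le_trans ?_ (norm_le_pi_norm (x - y) i)
  rw [Real.norm_eq_abs, Real.norm_eq_abs, Pi.sub_apply, Pi.sub_apply, trunc, trunc]
  have h1 := abs_max_sub_max_le_max (-ρ) (min ρ (x i)) (-ρ) (min ρ (y i))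
  have h2 := abs_min_sub_min_le_max ρ (x i) ρ (y i)
  simp only [sub_self, abs_zero] at h1 h2
  exact h1.trans (max_le (abs_nonneg _) (h2.trans (max_le (abs_nonneg _) le_rfl)))

lemma norm_trunc_le {ρ : ℝ} (hρ : 0 ≤ ρ) (x : Fin 7 → ℝ) : ‖trunc ρ x‖ ≤ ρ := by
  rw [pi_norm_le_iff_of_nonneg hρ]
  intro i
  rw [Real.norm_eq_abs, abs_le]
  exact ⟨le_max_left _ _, max_le (by linarith) (min_le_left _ _)⟩

lemma trunc_eq {ρ : ℝ} {x : Fin 7 → ℝ} (hx : ‖x‖ ≤ ρ) : trunc ρ x = x := by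
  ext i
  have := abs_le.1 ((Real.norm_eq_abs _).symm.le.trans ((norm_le_pi_norm x i).trans hx))
  rw [trunc, min_eq_right this.2, max_eq_right this.1]

lemma continuous_trunc (ρ : ℝ) : Continuous (trunc ρ) :=
  (LipschitzWith.of_dist_le_mul (K := 1) fun x y => by
    simpa [dist_eq_norm] using norm_trunc_sub_le ρ x y).continuous

-- The field is known only in a tube of radius `ρ` about `y`. Truncating the deviation from `y`
-- extends it to a globally Lipschitz and bounded field, which has a solution on the whole interval.
-- Grönwall's inequality keeps this solution within `9 δ + 8 r ≤ ρ` of `y`, where the truncation has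
-- no effect.
open Set in
lemma exists_solution_near {y y' : ℝ → Fin 7 → ℝ} {f : ℝ → (Fin 7 → ℝ) → Fin 7 → ℝ}
    {ρ δ r : ℝ} (hδ : 0 ≤ δ) (hr : 0 ≤ r) (hρ : 9 * δ + 8 * r ≤ ρ)
    (hy : ∀ t, HasDerivAt y (y' t) t)
    (hlip : ∀ t ∈ Icc (-1 : ℝ) 1, ∀ x x', ‖x - y t‖ ≤ ρ → ‖x' - y t‖ ≤ ρ →
      ‖f t x - f t x'‖ ≤ 1.05 * ‖x - x'‖)
    (hcont : ∀ c : ℝ → Fin 7 → ℝ, ContinuousOn c (Icc (-1) 1) →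
      (∀ t ∈ Icc (-1 : ℝ) 1, ‖c t - y t‖ ≤ ρ) → ContinuousOn (fun t => f t (c t)) (Icc (-1) 1))
    (hdef : ∀ t ∈ Icc (-1 : ℝ) 1, ‖y' t - f t (y t)‖ ≤ r) {x₀ : Fin 7 → ℝ}
    (hx₀ : ‖x₀ - y (-1)‖ ≤ δ) :
    ∃ x : ℝ → Fin 7 → ℝ, x (-1) = x₀ ∧
      (∀ t ∈ Icc (-1 : ℝ) 1, HasDerivWithinAt x (f t (x t)) (Icc (-1) 1) t) ∧
      ∀ t ∈ Icc (-1 : ℝ) 1, ‖x t - y t‖ ≤ 9 * δ + 8 * r := by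
  have hρ0 : 0 ≤ ρ := by linarith
  have hyc : Continuous y := continuous_iff_continuousAt.2 fun t => (hy t).continuousAt
  set F : ℝ → (Fin 7 → ℝ) → Fin 7 → ℝ := fun t x => f t (y t + trunc ρ (x - y t)) with hF
  have hmem : ∀ t x, ‖y t + trunc ρ (x - y t) - y t‖ ≤ ρ := fun t x => by
    rw [add_sub_cancel_left]
    exact norm_trunc_le hρ0 _
  have hFlip : ∀ t ∈ Icc (-1 : ℝ) 1, ∀ x x', ‖F t x - F t x'‖ ≤ 1.05 * ‖x - x'‖ := by
    intro t ht x x'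
    refine (hlip t ht _ _ (hmem t x) (hmem t x')).trans ?_
    gcongr
    rw [add_sub_add_left_eq_sub]
    simpa using norm_trunc_sub_le ρ (x - y t) (x' - y t)
  have hFy : ∀ t, F t (y t) = f t (y t) := fun t => by
    simp only [hF]
    rw [sub_self, trunc_eq (by simpa using hρ0), add_zero]
  obtain ⟨L, hL⟩ : ∃ L, ∀ t ∈ Icc (-1 : ℝ) 1, ‖f t (y t)‖ ≤ L :=
    isCompact_Icc.exists_bound_of_continuousOn
      (hcont y hyc.continuousOn fun t _ => by simpa using hρ0)
  have hL0 : 0 ≤ L := (norm_nonneg _).trans (hL 0 (by norm_num))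
  have hFL : ∀ t ∈ Icc (-1 : ℝ) 1, ∀ x, ‖F t x‖ ≤ L + 1.05 * ρ := by
    intro t ht x
    have h1 := hlip t ht _ (y t) (hmem t x) (by simpa using hρ0)
    have h2 := norm_sub_norm_le (F t x) (f t (y t))
    have h3 := hL t ht
    have h4 := hmem t x
    change ‖F t x - _‖ ≤ _ at h1
    linarith
  -- The initial time is the left end `-1`, so a solution of speed at most `L + 1.05 ρ` can move by
  -- twice that amount; this is the radius of the ball.
  have hpl : IsPicardLindelof F (tmin := -1) (tmax := 1) ⟨-1, by norm_num⟩ x₀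
      (2 * (L + 1.05 * ρ)).toNNReal 0 (L + 1.05 * ρ).toNNReal (1.05 : ℝ).toNNReal := by
    have hpos : 0 ≤ L + 1.05 * ρ := by positivity
    refine ⟨fun t ht => ?_, fun x _ => ?_, fun t ht x _ => ?_, ?_⟩
    · refine LipschitzWith.lipschitzOnWith (LipschitzWith.of_dist_le_mul fun x x' => ?_)
      rw [dist_eq_norm, dist_eq_norm, Real.coe_toNNReal _ (by norm_num)]
      exact hFlip t ht x x'
    · refine hcont _ ?_ fun t _ => hmem t x
      exact (hyc.add ((continuous_trunc ρ).comp (continuous_const.sub hyc))).continuousOn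
    · rw [Real.coe_toNNReal _ hpos]
      exact hFL t ht x
    · rw [Real.coe_toNNReal _ hpos, Real.coe_toNNReal _ (by positivity)]
      norm_num
      linarith
  obtain ⟨x, hx0, hx⟩ := hpl.exists_eq_forall_mem_Icc_hasDerivWithinAt₀
  have hnear : ∀ t ∈ Icc (-1 : ℝ) 1, ‖x t - y t‖ ≤ 9 * δ + 8 * r := by
    intro t ht
    refine norm_le_of_norm_deriv_le (w := fun t => x t - y t) hδ hr
      (fun t ht => (hx t ht).sub (hy t).hasDerivWithinAt) ?_ (fun t ht => ?_) ht
    · change ‖x (-1) - _‖ ≤ δ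
      have : x (-1) = x₀ := hx0
      rwa [this]
    · have h1 := hFlip t ht (x t) (y t)
      have h2 := hdef t ht
      rw [hFy] at h1
      have h3 : F t (x t) - y' t = (F t (x t) - f t (y t)) - (y' t - f t (y t)) := by abel
      rw [h3]
      exact (norm_sub_le _ _).trans (add_le_add h1 h2)
  refine ⟨x, hx0, fun t ht => ?_, hnear⟩
  have h1 := hx t ht
  simp only [hF] at h1
  rwa [trunc_eq ((hnear t ht).trans hρ), add_sub_cancel] at h1

/-- Solutions on consecutive intervals can be concatenated. -/
lemma exists_chain {E : Type*} (Good : ℕ → E → Prop) (Q : ℕ → (ℝ → E) → Prop)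
    (h : ∀ k x, Good k x → ∃ y : ℝ → E, y (-1) = x ∧ Q k y ∧ Good (k + 1) (y 1)) {x : E}
    (hx : Good 0 x) :
    ∃ Y : ℕ → ℝ → E, Y 0 (-1) = x ∧ ∀ k, Q k (Y k) ∧ Y (k + 1) (-1) = Y k 1 := by
  choose! S hS using h
  let p : ℕ → E := fun k => Nat.rec x (fun k x => S k x 1) k
  have hp : ∀ k, Good k (p k) := by
    intro k
    induction k with
    | zero => exact hx
    | succ k ih => exact (hS k _ ih).2.2
  exact ⟨fun k => S k (p k), (hS 0 _ hx).1, fun k => ⟨(hS k _ (hp k)).2.1, (hS (k + 1) _ (hp _)).1⟩⟩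

/-! ### Joints, initial values and final values of the pieces -/

namespace PieceData

/-- The pieces of the approximate orbit. -/
def pieces : ℕ → PieceData
  | 0 => piece0
  | 1 => piece1
  | 2 => piece2
  | _ => piece3

lemma isApprox_pieces (k : ℕ) : IsApprox (pieces k).curve (pieces k).curveDer
    (pieces k).variation (pieces k).variationDer := by
  match k with
  | 0 => exact isApprox_piece0
  | 1 => exact isApprox_piece1
  | 2 => exact isApprox_piece2
  | _ + 3 => exact isApprox_piece3

/-- The value of a polynomial at an integer. -/
def intVal (t : ℤ) (l : List ℤ) : ℤ := l.foldr (fun n a => n + t * a) 0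

lemma polyFun_intCast (t : ℤ) (l : List ℤ) : polyFun l t = intVal t l := by
  induction l with
  | nil => simp [polyFun, polyPair, intVal]
  | cons n l ih => rw [polyFun_cons, ih]; simp [intVal]

/-- The two integers differ by at most `2 ^ 24`. -/
def close (m n : ℤ) : Bool := (m - n).natAbs.ble (2 ^ 24)

lemma abs_sub_le_of_close {m n : ℤ} (h : close m n = true) :
    |(m : ℝ) / 2 ^ prec - n / 2 ^ prec| ≤ 1 / 2 ^ 80 := by
  rw [close, Nat.ble_eq] at h
  have h1 : |(m : ℝ) - n| ≤ 2 ^ 24 := by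
    have : ((m - n).natAbs : ℝ) ≤ 2 ^ 24 := by exact_mod_cast h
    rwa [Nat.cast_natAbs, Int.cast_abs, Int.cast_sub] at this
  rw [← sub_div, abs_div, abs_of_pos (by positivity : (0 : ℝ) < 2 ^ prec),
    div_le_div_iff₀ (by positivity) (by positivity)]
  calc |(m : ℝ) - n| * 2 ^ 80 ≤ 2 ^ 24 * 2 ^ 80 := by gcongr
    _ = 1 * 2 ^ prec := by norm_num

/-- The pieces fit together. -/
def checkJoint (D D' : PieceData) : Bool := (List.range 7).all fun i =>
  close (intVal 1 (D.orbit.getD i [])) (intVal (-1) (D'.orbit.getD i [])) &&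
    (List.range 5).all fun c =>
      close (intVal 1 (D.varCoeff c i)) (intVal (-1) (D'.varCoeff c i))

lemma norm_joint_le {D D' : PieceData} (h : checkJoint D D' = true) :
    ‖D.curve 1 - D'.curve (-1)‖ ≤ 1 / 2 ^ 80 ∧
      ∀ c < 5, ‖D.variation c 1 - D'.variation c (-1)‖ ≤ 1 / 2 ^ 80 := by
  have h1 : ∀ l, polyFun l 1 = intVal 1 l := fun l => by simpa using polyFun_intCast 1 l
  have h2 : ∀ l, polyFun l (-1) = intVal (-1) l := fun l => by simpa using polyFun_intCast (-1) l
  refine ⟨?_, fun c hc => ?_⟩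
  all_goals
    rw [pi_norm_le_iff_of_nonneg (by positivity)]
    intro i
    have h3 := List.all_eq_true.1 h i (by simp)
    rw [Bool.and_eq_true] at h3
  · have h4 := abs_sub_le_of_close h3.1
    rwa [← h1, ← h2] at h4
  · have h4 := abs_sub_le_of_close (List.all_eq_true.1 h3.2 c (by simpa using hc))
    rwa [← h1, ← h2] at h4

lemma checkJoint_pieces (k : ℕ) (hk : k < 3) :
    checkJoint (pieces k) (pieces (k + 1)) = true := by
  interval_cases k <;> decide +kernel

/-- The approximate initial position. -/
def startCoeff : List ℤ :=
  [0, 62893364287435368627740416758224, 62893364287435368627740416758224,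
    28683658739090503638390752372458, -13547095376180963950524576033075,
    13547095376180963950524576033075, 26985723744949242954258739696321]

/-- The initial directions of the variations. -/
def direction (c i : ℕ) : ℤ :=
  (([[0, 1, 1, 0, 0, 0, 0], [0, 0, 0, 0, -1, 1, 0], [0, 0, 0, 0, 0, 0, 1],
    [0, 0, 0, 0, -1, -1, 0], [0, -1, 1, 0, 0, 0, 0]] : List (List ℤ)).getD c []).getD i 0

/-- The initial values are accurate. -/
def checkStart (D : PieceData) : Bool := (List.range 7).all fun i =>
  close (intVal (-1) (D.orbit.getD i [])) (startCoeff.getD i 0) &&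
    (List.range 5).all fun c =>
      close (intVal (-1) (D.varCoeff c i)) (direction c i * 2 ^ prec)

/-- The approximate final values of the variations. -/
def endTable : List (List ℤ) :=
  [[17444682425, -6522520475, 10403190992, -22610965993, -8249548873, -12623710605, 0],
    [-4098924705, -3948251689, 4311297410, -5795315887, -6455814621, 12478539882, 0],
    [13671891678, -13671891678, 0, -7189764020, -7189764020, -11325368562, 10000000000],
    [-3246688976, -2579997140, -4444944975, 636909110, -6109277917, -9627073270, 0],
    [-2409060233, -12710094974, 9599751583, -164968, 1119907, 3667088807, 0]]

/-- The final values are accurate. -/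
def checkEnd (D : PieceData) : Bool :=
  close (intVal 1 (D.orbit.getD 0 [])) (intVal 1 (D.orbit.getD 1 [])) &&
    close (intVal 1 (D.orbit.getD 3 [])) (-intVal 1 (D.orbit.getD 4 [])) &&
    close (intVal 1 (D.orbit.getD 5 [])) 0 &&
    (List.range 7).all fun i => (List.range 5).all fun c =>
      (intVal 1 (D.varCoeff c i) * 10 ^ 10 -
        (endTable.getD c []).getD i 0 * 2 ^ prec).natAbs.ble (2 ^ prec)

lemma checkStart_piece0 : checkStart piece0 = true := by decide +kernel

lemma checkEnd_piece3 : checkEnd piece3 = true := by decide +kernel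

/-- The initial direction of a variation. -/
def dir (c : ℕ) (i : Fin 7) : ℝ := direction c i

/-- The approximate initial position, with `√2` in place of the fourth coordinate. -/
def start (i : Fin 7) : ℝ := if i = 3 then √2 else startCoeff.getD i 0 / 2 ^ prec

/-- The exact start has `√2` as its fourth coordinate, which is not dyadic; its rounding to within
`2⁻⁸⁰` is added to the error of the stored polynomial. -/
lemma norm_start_le : ‖start - piece0.curve (-1)‖ ≤ 2 / 2 ^ 80 := by
  have h2 : ∀ l, polyFun l (-1) = intVal (-1) l := fun l => by simpa using polyFun_intCast (-1) l
  rw [pi_norm_le_iff_of_nonneg (by positivity)]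
  intro i
  have h3 := List.all_eq_true.1 checkStart_piece0 i (by simp)
  rw [Bool.and_eq_true] at h3
  have h4 := abs_sub_le_of_close h3.1
  rw [← h2, abs_sub_comm] at h4
  rw [Real.norm_eq_abs, Pi.sub_apply]
  by_cases hi : i = 3
  · have h5 : |√2 - (28683658739090503638390752372458 : ℝ) / 2 ^ prec| ≤ 1 / 2 ^ 80 := by
      have h6 : (28683658739090503638390752372458 : ℝ) / 2 ^ prec ≤ √2 := Real.le_sqrt_of_sq_le (by norm_num)
      have h7 : √2 ≤ (28683658739090503638390752372458 : ℝ) / 2 ^ prec + 1 / 2 ^ 80 :=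
        Real.sqrt_le_iff.2 ⟨by norm_num, by norm_num⟩
      rw [abs_le]
      constructor <;> linarith
    have h6 : startCoeff.getD i 0 = 28683658739090503638390752372458 := by rw [hi]; rfl
    rw [h6] at h4
    rw [start, if_pos hi]
    push_cast at h4
    refine (abs_sub_le _ _ _).trans ((add_le_add h5 h4).trans ?_)
    norm_num
  · rw [start, if_neg hi]
    refine h4.trans ?_
    norm_num

lemma norm_dir_le {c : ℕ} (hc : c < 5) : ‖dir c - piece0.variation c (-1)‖ ≤ 1 / 2 ^ 80 := by
  have h2 : ∀ l, polyFun l (-1) = intVal (-1) l := fun l => by simpa using polyFun_intCast (-1) l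
  rw [pi_norm_le_iff_of_nonneg (by positivity)]
  intro i
  have h3 := List.all_eq_true.1 checkStart_piece0 i (by simp)
  rw [Bool.and_eq_true] at h3
  have h4 := abs_sub_le_of_close (List.all_eq_true.1 h3.2 c (by simpa using hc))
  rw [← h2, abs_sub_comm] at h4
  push_cast at h4
  rwa [mul_div_cancel_right₀ _ (by positivity)] at h4

lemma abs_boundary_le : |piece3.curve 1 0 - piece3.curve 1 1| ≤ 1 / 2 ^ 80 ∧
    |piece3.curve 1 3 + piece3.curve 1 4| ≤ 1 / 2 ^ 80 ∧ |piece3.curve 1 5| ≤ 1 / 2 ^ 80 := by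
  have h1 : ∀ l, polyFun l 1 = intVal 1 l := fun l => by simpa using polyFun_intCast 1 l
  have h := checkEnd_piece3
  rw [checkEnd, Bool.and_eq_true, Bool.and_eq_true, Bool.and_eq_true] at h
  have h2 := abs_sub_le_of_close h.1.1.1
  have h3 := abs_sub_le_of_close h.1.1.2
  have h4 := abs_sub_le_of_close h.1.2
  rw [← h1, ← h1] at h2
  push_cast at h3 h4
  rw [← h1, ← h1, neg_div, sub_neg_eq_add] at h3
  rw [← h1, zero_div, sub_zero] at h4
  exact ⟨h2, h3, h4⟩

lemma abs_variation_sub_le {c : ℕ} (hc : c < 5) (i : Fin 7) :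
    |piece3.variation c 1 i - (endTable.getD c []).getD i 0 / 10 ^ 10| ≤ 1 / 10 ^ 10 := by
  have h1 : ∀ l, polyFun l 1 = intVal 1 l := fun l => by simpa using polyFun_intCast 1 l
  have h := checkEnd_piece3
  rw [checkEnd, Bool.and_eq_true] at h
  have h2 := List.all_eq_true.1 (List.all_eq_true.1 h.2 i (by simp)) c (by simpa using hc)
  rw [Nat.ble_eq] at h2
  rw [variation, h1]
  generalize intVal 1 (piece3.varCoeff c i) = m at *
  generalize (endTable.getD c []).getD i 0 = n at *
  have h3 : ((m * 10 ^ 10 - n * 2 ^ prec).natAbs : ℝ) ≤ 2 ^ prec := by exact_mod_cast h2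
  rw [Nat.cast_natAbs, Int.cast_abs] at h3
  push_cast at h3
  have hpos : (0 : ℝ) < 2 ^ prec := by positivity
  generalize (2 : ℝ) ^ prec = a at *
  rw [div_sub_div _ _ hpos.ne' (by positivity), abs_div, abs_of_pos (mul_pos hpos (by positivity)),
    div_le_div_iff₀ (by positivity) (by positivity), mul_comm a (n : ℝ)]
  have h4 := mul_le_mul_of_nonneg_right h3 (by positivity : (0 : ℝ) ≤ 10 ^ 10)
  norm_num at h4 ⊢
  linarith

end PieceData

/-! ### True solutions and variations near the approximate ones -/

section

open Set PieceData

/-- `y` solves `y' = f (t, y)` on `[-1, 1]`. -/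
def SolvesOn (f : ℝ → (Fin 7 → ℝ) → Fin 7 → ℝ) (y : ℝ → Fin 7 → ℝ) : Prop :=
  ∀ t ∈ Icc (-1 : ℝ) 1, HasDerivWithinAt y (f t (y t)) (Icc (-1) 1) t

lemma norm_sub_le_curve {k : ℕ} {t : ℝ} (ht : t ∈ Icc (-1 : ℝ) 1) {x : Fin 7 → ℝ}
    (hx : ‖x - (pieces k).curve t‖ ≤ 1 / 10 ^ 14) : x ∈ box :=
  (isApprox_pieces k).mem_box t (abs_le.2 ht) x (hx.trans (by norm_num))

lemma curve_mem_box {k : ℕ} {t : ℝ} (ht : t ∈ Icc (-1 : ℝ) 1) : (pieces k).curve t ∈ box :=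
  norm_sub_le_curve ht (by rw [sub_self, norm_zero]; positivity)

/-- The Lipschitz constant `800` changes the bound `1.044` on the approximate orbit by at most `800
· 10⁻¹⁴`. -/
lemma norm_dvf_near_le {k : ℕ} {t : ℝ} (ht : t ∈ Icc (-1 : ℝ) 1) {x : Fin 7 → ℝ}
    (hx : ‖x - (pieces k).curve t‖ ≤ 1 / 10 ^ 14) : ‖dvf x‖ ≤ 1.05 := by
  have h1 := norm_dvf_sub_le (norm_sub_le_curve ht hx) (curve_mem_box (k := k) ht)
  have h2 := (isApprox_pieces k).jac t (abs_le.2 ht)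
  have h3 := norm_le_norm_add_norm_sub' (dvf x) (dvf ((pieces k).curve t))
  norm_num at h1 h2 hx ⊢
  linarith

lemma continuousOn_vf : ContinuousOn vf box := fun _ hx =>
  (hasFDerivAt_vf (smooth_of_mem_box hx)).continuousAt.continuousWithinAt

lemma continuousOn_dvf : ContinuousOn dvf box :=
  (LipschitzOnWith.of_dist_le_mul (K := 800) fun x hx y hy => by
    simpa [dist_eq_norm] using norm_dvf_sub_le hx hy).continuousOn

/-- The solution of `x' = vf x` on four consecutive intervals that starts at `x₀`. -/
structure Tracks (δ : ℝ) (x₀ : Fin 7 → ℝ) (Y : ℕ → ℝ → Fin 7 → ℝ) : Prop where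
  initial : Y 0 (-1) = x₀
  joint : ∀ k, Y (k + 1) (-1) = Y k 1
  solves : ∀ k < 4, SolvesOn (fun _ => vf) (Y k)
  near : ∀ k < 4, ∀ t ∈ Icc (-1 : ℝ) 1, ‖Y k t - (pieces k).curve t‖ ≤ 9 ^ 4 * δ

/-- With `η = 2⁻⁸⁰`, the error at the start of piece `k` stays below `9 ^ k δ - 2 η`. Indeed a piece
turns it into `9 (9 ^ k δ - 2 η) + 8 η = 9 ^ (k + 1) δ - 10 η`, and the joint adds at most `η`. The
subtracted term absorbs all defects and keeps the bound geometric. -/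
lemma exists_tracks {δ : ℝ} (hδ : 4 / 2 ^ 80 ≤ δ) (hδ' : 9 ^ 4 * δ ≤ 1 / 10 ^ 14)
    {x₀ : Fin 7 → ℝ} (hx₀ : ‖x₀ - piece0.curve (-1)‖ ≤ δ - 2 / 2 ^ 80) :
    ∃ Y, Tracks δ x₀ Y := by
  have hpow : ∀ k < 4, (9 : ℝ) ^ (k + 1) * δ ≤ 9 ^ 4 * δ := by
    intro k hk
    have : (0 : ℝ) ≤ δ := le_trans (by positivity) hδ
    gcongr
    · norm_num
    · omega
  obtain ⟨Y, hY0, hY⟩ := exists_chain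
    (fun k x => k < 4 → ‖x - (pieces k).curve (-1)‖ ≤ 9 ^ k * δ - 2 / 2 ^ 80)
    (fun k y => k < 4 → SolvesOn (fun _ => vf) y ∧
      ∀ t ∈ Icc (-1 : ℝ) 1, ‖y t - (pieces k).curve t‖ ≤ 9 ^ 4 * δ)
    (fun k x hx => by
      by_cases hk : k < 4
      · have A := isApprox_pieces k
        have h1 := hpow k hk
        have hle : 9 * (9 ^ k * δ - 2 / 2 ^ 80) + 8 * (1 / 2 ^ 80) ≤ 9 ^ (k + 1) * δ - 10 / 2 ^ 80 :=
          le_of_eq (by rw [pow_succ]; ring)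
        have hle' : 9 * (9 ^ k * δ - 2 / 2 ^ 80) + 8 * (1 / 2 ^ 80) ≤ 1 / 10 ^ 14 := by
          have : (0 : ℝ) ≤ 10 / 2 ^ 80 := by positivity
          linarith
        have hnn : 0 ≤ 9 ^ k * δ - 2 / 2 ^ 80 := (norm_nonneg _).trans (hx hk)
        obtain ⟨y, hy0, hy1, hy2⟩ := exists_solution_near (f := fun _ => vf) hnn
          (by positivity) hle' A.deriv
          (fun t ht z z' hz hz' => by
            have hc : Convex ℝ (Metric.closedBall ((pieces k).curve t) (1 / 10 ^ 14)) :=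
              convex_closedBall _ _
            refine hc.norm_image_sub_le_of_norm_hasFDerivWithin_le
              (fun w hw => (hasFDerivAt_vf (smooth_of_mem_box
                (norm_sub_le_curve ht (mem_closedBall_iff_norm.1 hw)))).hasFDerivWithinAt)
              (fun w hw => norm_dvf_near_le ht (mem_closedBall_iff_norm.1 hw))
              (mem_closedBall_iff_norm.2 hz') (mem_closedBall_iff_norm.2 hz))
          (fun c hc hc' => continuousOn_vf.comp hc fun t ht => norm_sub_le_curve ht (hc' t ht))
          (fun t ht => A.field t (abs_le.2 ht)) (hx hk)
        have hy3 : ∀ t ∈ Icc (-1 : ℝ) 1, ‖y t - (pieces k).curve t‖ ≤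
            9 ^ (k + 1) * δ - 10 / 2 ^ 80 := fun t ht => (hy2 t ht).trans hle
        refine ⟨y, hy0, fun _ => ⟨hy1, fun t ht => (hy3 t ht).trans ?_⟩, fun hk' => ?_⟩
        · have : (0 : ℝ) ≤ 10 / 2 ^ 80 := by positivity
          linarith
        · have h2 := (norm_joint_le (checkJoint_pieces k (by omega))).1
          have h3 := hy3 1 (by norm_num)
          have h4 := norm_sub_le_norm_sub_add_norm_sub (y 1) ((pieces k).curve 1)
            ((pieces (k + 1)).curve (-1))
          refine h4.trans ((add_le_add h3 h2).trans ?_)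
          norm_num
          linarith
      -- Nothing is required after the fourth piece; a constant continues the chain.
      · exact ⟨fun _ => x, rfl, fun h => absurd h hk, fun h => absurd h (by omega)⟩)
    (x := x₀) (fun _ => by rw [pow_zero, one_mul]; exact hx₀)
  exact ⟨Y, hY0, fun k => (hY k).2, fun k hk => ((hY k).1 hk).1, fun k hk => ((hY k).1 hk).2⟩

/-- The same bookkeeping as for solutions: `(3 · 9 ^ k - 2) r` at the start of a piece becomes `9 (3
· 9 ^ k - 2) r + 8 r` at its end, and a joint adds `r`. After four pieces this is `(3 · 9⁴ - 10) r =
19673 r`. -/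
lemma chain_estimate {w w' : ℕ → ℝ → Fin 7 → ℝ} {r : ℝ} (hr : 0 ≤ r) (h0 : ‖w 0 (-1)‖ ≤ r)
    (hw : ∀ k < 4, ∀ t ∈ Icc (-1 : ℝ) 1, HasDerivWithinAt (w k) (w' k t) (Icc (-1) 1) t)
    (hle : ∀ k < 4, ∀ t ∈ Icc (-1 : ℝ) 1, ‖w' k t‖ ≤ 1.05 * ‖w k t‖ + r)
    (hj : ∀ k < 3, ‖w (k + 1) (-1) - w k 1‖ ≤ r) : ‖w 3 1‖ ≤ 20000 * r := by
  have key : ∀ k < 4, ‖w k (-1)‖ ≤ (3 * 9 ^ k - 2) * r ∧ ‖w k 1‖ ≤ (3 * 9 ^ (k + 1) - 10) * r := by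
    intro k
    induction k with
    | zero =>
      intro hk
      refine ⟨by norm_num; linarith, (norm_le_of_norm_deriv_le hr hr (hw 0 hk) h0 (hle 0 hk)
        (by norm_num)).trans (by norm_num; linarith)⟩
    | succ k ih =>
      intro hk
      have h1 := hj k (by omega)
      have h2 := (ih (by omega)).2
      have h3 := norm_le_norm_add_norm_sub' (w (k + 1) (-1)) (w k 1)
      have h4 : ‖w (k + 1) (-1)‖ ≤ (3 * 9 ^ (k + 1) - 2) * r := by linarith
      refine ⟨h4, (norm_le_of_norm_deriv_le ((norm_nonneg _).trans h4) hr (hw _ hk) h4 (hle _ hk)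
        (by norm_num)).trans ?_⟩
      rw [pow_succ 9 (k + 1)]
      linarith
  refine ((key 3 (by norm_num)).2).trans ?_
  gcongr
  norm_num

lemma norm_sum_smul_le {u : Fin 3 → ℝ} {z : Fin 3 → Fin 7 → ℝ} {b : ℝ} (hz : ∀ c, ‖z c‖ ≤ b) :
    ‖∑ c, u c • z c‖ ≤ 3 * b * ‖u‖ := by
  refine (norm_sum_le _ _).trans ?_
  have : ∀ c ∈ Finset.univ, ‖u c • z c‖ ≤ ‖u‖ * b := fun c _ => by
    rw [norm_smul]
    exact mul_le_mul (norm_le_pi_norm u c) (hz c) (norm_nonneg _) (norm_nonneg _)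
  refine (Finset.sum_le_card_nsmul _ _ _ this).trans (le_of_eq ?_)
  simp
  ring

/-- The final value depends on the initial value as predicted by the approximate variations. -/
lemma norm_final_sub_le {δ : ℝ} (hδ : 9 ^ 4 * δ ≤ 1 / 10 ^ 14) {p : Fin 7 → ℝ} {u u' : Fin 3 → ℝ}
    {Y Y' : ℕ → ℝ → Fin 7 → ℝ} (hY : Tracks δ (p + ∑ c, u c • dir c) Y)
    (hY' : Tracks δ (p + ∑ c, u' c • dir c) Y') :
    ‖Y 3 1 - Y' 3 1 - ∑ c : Fin 3, (u - u') c • (pieces 3).variation c 1‖ ≤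
      2 / 10 ^ 6 * ‖u - u'‖ := by
  have hm := norm_nonneg (u - u')
  have hη : (0 : ℝ) < 1 / 2 ^ 80 := by positivity
  have hη' : (1 : ℝ) / 2 ^ 80 ≤ 1 / 10 ^ 24 := by norm_num
  have hvar := fun k => (isApprox_pieces k).var
  have hjoint := fun k hk => (norm_joint_le (checkJoint_pieces k hk)).2
  have hdir := fun c (hc : c < 5) => norm_dir_le hc
  generalize (1 : ℝ) / 2 ^ 80 = η at *
  -- The forcing in the equation for the deviation has two sources: the remainder `800 · 10⁻¹⁴` of
  -- the linearization times the predicted difference, of norm at most `3 · 4 ‖u - u'‖`, which gives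
  -- `9600`; and three defects of variations. Multiplication by `20000` yields the claimed `2 ·
  -- 10⁻⁶`.
  have hr : (9600 * (1 / 10 ^ 14) + 3 * η) * ‖u - u'‖ ≤ 1 / 10 ^ 10 * ‖u - u'‖ := by
    gcongr
    norm_num at hη' ⊢
    linarith
  have h3η : 3 * η * ‖u - u'‖ ≤ 1 / 10 ^ 10 * ‖u - u'‖ :=
    le_trans (by gcongr; norm_num) hr
  refine (chain_estimate
    (w := fun k t => Y k t - Y' k t - ∑ c : Fin 3, (u - u') c • (pieces k).variation c t)
    (w' := fun k t => vf (Y k t) - vf (Y' k t) -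
      ∑ c : Fin 3, (u - u') c • (pieces k).variationDer c t) (r := 1 / 10 ^ 10 * ‖u - u'‖)
    (by positivity) ?_ (fun k hk t ht => ?_) (fun k hk t ht => ?_) (fun k hk => ?_)).trans
    (le_of_eq (by ring))
  · have e : Y 0 (-1) - Y' 0 (-1) - ∑ c : Fin 3, (u - u') c • (pieces 0).variation c (-1) =
        ∑ c : Fin 3, (u - u') c • (dir c - (pieces 0).variation c (-1)) := by
      rw [hY.initial, hY'.initial, add_sub_add_left_eq_sub, ← Finset.sum_sub_distrib,
        ← Finset.sum_sub_distrib]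
      refine Finset.sum_congr rfl fun c _ => ?_
      rw [smul_sub, Pi.sub_apply, sub_smul, sub_smul]
    change ‖Y 0 (-1) - Y' 0 (-1) - ∑ c : Fin 3, (u - u') c • (pieces 0).variation c (-1)‖ ≤ _
    rw [e]
    exact (norm_sum_smul_le fun c => hdir c (by omega)).trans h3η
  · exact ((hY.solves k hk t ht).sub (hY'.solves k hk t ht)).sub
      (HasDerivWithinAt.fun_sum fun c _ =>
        (((isApprox_pieces k).derivVar c t).const_smul ((u - u') c)).hasDerivWithinAt)
  -- The derivative of the deviation is the linearization error at the approximate orbit, plus the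
  -- linearized field applied to the deviation itself, minus the defects of the approximate
  -- variations. The part of the linearization error proportional to the deviation fits between
  -- `1.044` and `1.05`.
  · have e : vf (Y k t) - vf (Y' k t) - ∑ c : Fin 3, (u - u') c • (pieces k).variationDer c t =
        (vf (Y k t) - vf (Y' k t) - dvf ((pieces k).curve t) (Y k t - Y' k t)) +
        dvf ((pieces k).curve t) (Y k t - Y' k t - ∑ c : Fin 3, (u - u') c •
          (pieces k).variation c t) - ∑ c : Fin 3, (u - u') c •
          ((pieces k).variationDer c t - dvf ((pieces k).curve t) ((pieces k).variation c t)) := by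
      simp only [smul_sub, Finset.sum_sub_distrib, map_sub, map_sum, map_smul]
      abel
    have hy := (hY.near k hk t ht).trans hδ
    have hy' := (hY'.near k hk t ht).trans hδ
    have h1 := norm_vf_sub_sub_le (norm_sub_le_curve ht hy) (norm_sub_le_curve ht hy')
      (curve_mem_box ht) hy hy'
    have h2 := norm_sum_smul_le (u := u - u') fun c : Fin 3 =>
      hvar k c (by omega) t (abs_le.2 ht)
    have h3 := norm_sum_smul_le (u := u - u') fun c : Fin 3 =>
      (isApprox_pieces k).bound c (by omega) t (abs_le.2 ht)
    set S := ∑ c : Fin 3, (u - u') c • (pieces k).variation c t with hS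
    set w := Y k t - Y' k t - S with hw
    have h4 := (dvf ((pieces k).curve t)).le_of_opNorm_le
      ((isApprox_pieces k).jac t (abs_le.2 ht)) w
    have h5 : ‖Y k t - Y' k t‖ ≤ ‖w‖ + ‖S‖ := by
      have : Y k t - Y' k t = w + S := by rw [hw]; abel
      rw [this]
      exact norm_add_le _ _
    change ‖vf (Y k t) - vf (Y' k t) - ∑ c : Fin 3, (u - u') c •
      (pieces k).variationDer c t‖ ≤ 1.05 * ‖w‖ + _
    rw [e]
    refine (norm_sub_le _ _).trans ((add_le_add (norm_add_le _ _) le_rfl).trans ?_)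
    norm_num at h1 h2 h3 h4 h5 hr ⊢
    linarith [norm_nonneg w]
  · have e : Y (k + 1) (-1) - Y' (k + 1) (-1) - ∑ c : Fin 3, (u - u') c •
          (pieces (k + 1)).variation c (-1) - (Y k 1 - Y' k 1 -
          ∑ c : Fin 3, (u - u') c • (pieces k).variation c 1) =
        ∑ c : Fin 3, (u - u') c • ((pieces k).variation c 1 -
          (pieces (k + 1)).variation c (-1)) := by
      rw [hY.joint, hY'.joint]
      simp only [smul_sub, Finset.sum_sub_distrib]
      abel
    change ‖Y (k + 1) (-1) - Y' (k + 1) (-1) - ∑ c : Fin 3, (u - u') c •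
          (pieces (k + 1)).variation c (-1) - (Y k 1 - Y' k 1 -
          ∑ c : Fin 3, (u - u') c • (pieces k).variation c 1)‖ ≤ _
    rw [e]
    exact (norm_sum_smul_le fun c => hjoint k hk c (by omega)).trans h3η

/-- A solution of the variational equation along `Y`. -/
structure Varies (Y Z : ℕ → ℝ → Fin 7 → ℝ) : Prop where
  joint : ∀ k, Z (k + 1) (-1) = Z k 1
  solves : ∀ k < 4, SolvesOn (fun t => dvf (Y k t)) (Z k)

/-- The linear equation is solved piece by piece with the zero curve as reference. Its defect is
zero, and the tube is as wide as the initial value `x` requires, namely `9 ‖x‖`. -/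
lemma exists_varies {δ : ℝ} (hδ : 9 ^ 4 * δ ≤ 1 / 10 ^ 14) {x₀ : Fin 7 → ℝ}
    {Y : ℕ → ℝ → Fin 7 → ℝ} (hY : Tracks δ x₀ Y) (z₀ : Fin 7 → ℝ) :
    ∃ Z, Varies Y Z ∧ Z 0 (-1) = z₀ := by
  obtain ⟨Z, hZ0, hZ⟩ := exists_chain (fun _ _ => True)
    (fun k z => k < 4 → SolvesOn (fun t => dvf (Y k t)) z)
    (fun k x _ => by
      by_cases hk : k < 4
      · have hnear := fun t ht => (hY.near k hk t ht).trans hδ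
        obtain ⟨z, hz0, hz1, -⟩ := exists_solution_near (f := fun t => dvf (Y k t))
          (y := fun _ => 0) (y' := fun _ => 0) (δ := ‖x‖) (r := 0) (norm_nonneg x) le_rfl le_rfl
          (fun t => hasDerivAt_const t 0)
          (fun t ht z z' _ _ => by
            rw [← map_sub]
            exact (dvf (Y k t)).le_of_opNorm_le (norm_dvf_near_le ht (hnear t ht)) _)
          (fun c hc _ => (continuousOn_dvf.comp (fun t ht => (hY.solves k hk t ht).continuousWithinAt)
            fun t ht => norm_sub_le_curve ht (hnear t ht)).clm_apply hc)
          (fun t _ => by simp) (x₀ := x) (by simp)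
        exact ⟨z, hz0, fun _ => hz1, trivial⟩
      · exact ⟨fun _ => x, rfl, fun h => absurd h hk, trivial⟩)
    (x := z₀) trivial
  exact ⟨Z, ⟨fun k => (hZ k).2, fun k hk => (hZ k).1 hk⟩, hZ0⟩

/-- The true variations are close to the approximate variations. -/
lemma norm_variation_sub_le {δ : ℝ} (hδ : 9 ^ 4 * δ ≤ 1 / 10 ^ 14) {x₀ : Fin 7 → ℝ}
    {Y Z : ℕ → ℝ → Fin 7 → ℝ} (hY : Tracks δ x₀ Y) (hZ : Varies Y Z) {c : ℕ} (hc : c < 5)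
    (h0 : Z 0 (-1) = dir c) : ‖Z 3 1 - (pieces 3).variation c 1‖ ≤ 1 / 10 ^ 6 := by
  have hη : (0 : ℝ) < 1 / 2 ^ 80 := by positivity
  have hη' : (1 : ℝ) / 2 ^ 80 ≤ 1 / 10 ^ 24 := by norm_num
  have hvar := fun k => (isApprox_pieces k).var c hc
  have hjoint := fun k hk => (norm_joint_le (checkJoint_pieces k hk)).2 c hc
  have hdir := norm_dir_le hc
  generalize (1 : ℝ) / 2 ^ 80 = η at *
  have hsmall : η ≤ 5 / 10 ^ 11 := hη'.trans (by norm_num)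
  -- The true and the approximate variation satisfy equations whose coefficients differ by `800 ·
  -- 10⁻¹⁴`; applied to a vector of norm at most `4` and with the defect `η` added, this is below `5
  -- · 10⁻¹¹`, and `20000` times this is `10⁻⁶`.
  refine (chain_estimate (w := fun k t => Z k t - (pieces k).variation c t)
    (w' := fun k t => dvf (Y k t) (Z k t) - (pieces k).variationDer c t) (r := 5 / 10 ^ 11)
    (by positivity) ?_ (fun k hk t ht => ?_) (fun k hk t ht => ?_) (fun k hk => ?_)).trans
    (by norm_num)
  · change ‖Z 0 (-1) - _‖ ≤ _
    rw [h0]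
    exact hdir.trans hsmall
  · exact (hZ.solves k hk t ht).sub ((isApprox_pieces k).derivVar c t).hasDerivWithinAt
  · have hy := (hY.near k hk t ht).trans hδ
    have h1 := (dvf (Y k t)).le_of_opNorm_le (norm_dvf_near_le ht hy)
      (Z k t - (pieces k).variation c t)
    have h2 := (dvf (Y k t) - dvf ((pieces k).curve t)).le_of_opNorm_le
      ((norm_dvf_sub_le (norm_sub_le_curve ht hy) (curve_mem_box ht)).trans
        (mul_le_mul_of_nonneg_left hy (by norm_num))) ((pieces k).variation c t)
    have h3 := (isApprox_pieces k).bound c hc t (abs_le.2 ht)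
    have h4 := hvar k t (abs_le.2 ht)
    have e : dvf (Y k t) (Z k t) - (pieces k).variationDer c t =
        dvf (Y k t) (Z k t - (pieces k).variation c t) +
        (dvf (Y k t) - dvf ((pieces k).curve t)) ((pieces k).variation c t) -
        ((pieces k).variationDer c t - dvf ((pieces k).curve t) ((pieces k).variation c t)) := by
      rw [map_sub, _root_.sub_apply]
      abel
    change ‖dvf (Y k t) (Z k t) - (pieces k).variationDer c t‖ ≤
      1.05 * ‖Z k t - (pieces k).variation c t‖ + _
    rw [e]
    refine (norm_sub_le _ _).trans ((add_le_add (norm_add_le _ _) le_rfl).trans ?_)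
    norm_num at h1 h2 h3 h4 hη' ⊢
    linarith
  · have e : Z (k + 1) (-1) - (pieces (k + 1)).variation c (-1) -
        (Z k 1 - (pieces k).variation c 1) =
        (pieces k).variation c 1 - (pieces (k + 1)).variation c (-1) := by
      rw [hZ.joint]
      abel
    change ‖Z (k + 1) (-1) - (pieces (k + 1)).variation c (-1) -
        (Z k 1 - (pieces k).variation c 1)‖ ≤ _
    rw [e]
    exact (hjoint k hk).trans hsmall

end

/-! ### The shooting problem -/

section

open Set PieceData

lemma forall_fin_three {p : Fin 3 → Prop} : (∀ i, p i) ↔ p 0 ∧ p 1 ∧ p 2 := by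
  simp [Fin.forall_fin_succ]

lemma sum_smul_apply (u : Fin 3 → ℝ) (z : Fin 3 → Fin 7 → ℝ) (i : Fin 7) :
    (∑ c, u c • z c) i = u 0 * z 0 i + u 1 * z 1 i + u 2 * z 2 i := by
  simp [Fin.sum_univ_three]

/-- The stored variations at the final time are replaced by their tabulated decimals; the rounding
of three of them by `10⁻¹⁰` is absorbed in passing from `2 · 10⁻⁶` to `3 · 10⁻⁶`. -/
lemma abs_final_sub_le {δ : ℝ} (hδ : 9 ^ 4 * δ ≤ 1 / 10 ^ 14) {p : Fin 7 → ℝ} {u u' : Fin 3 → ℝ}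
    {Y Y' : ℕ → ℝ → Fin 7 → ℝ} (hY : Tracks δ (p + ∑ c, u c • dir c) Y)
    (hY' : Tracks δ (p + ∑ c, u' c • dir c) Y') (i : Fin 7) :
    |Y 3 1 i - Y' 3 1 i - ((u - u') 0 * ((endTable.getD 0 []).getD i 0 / 10 ^ 10) +
      (u - u') 1 * ((endTable.getD 1 []).getD i 0 / 10 ^ 10) +
      (u - u') 2 * ((endTable.getD 2 []).getD i 0 / 10 ^ 10))| ≤ 3 / 10 ^ 6 * ‖u - u'‖ := by
  have h := (norm_le_pi_norm _ i).trans (norm_final_sub_le hδ hY hY')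
  rw [Pi.sub_apply, Pi.sub_apply, sum_smul_apply, Real.norm_eq_abs] at h
  have key : ∀ c : Fin 3, |(u - u') c * ((pieces 3).variation c 1 i -
      (endTable.getD c []).getD i 0 / 10 ^ 10)| ≤ 1 / 10 ^ 10 * ‖u - u'‖ := fun c => by
    rw [abs_mul, mul_comm]
    exact mul_le_mul (abs_variation_sub_le (by omega) i) (norm_le_pi_norm (u - u') c)
      (abs_nonneg _) (by positivity)
  have k0 := key 0
  have k1 := key 1
  have k2 := key 2
  simp only [Fin.val_zero, Fin.val_one, Fin.val_two, mul_sub] at h k0 k1 k2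
  have hm := norm_nonneg (u - u')
  rw [abs_le] at h k0 k1 k2 ⊢
  norm_num at h k0 k1 k2 ⊢
  constructor <;> linarith

/-- The conditions that characterize the symmetric final positions. -/
def boundary (x : Fin 7 → ℝ) : Fin 3 → ℝ := ![x 0 - x 1, x 3 + x 4, x 5]

/-- The approximate inverse of the derivative of the shooting map. -/
def shootInv : Matrix (Fin 3) (Fin 3) ℝ :=
  !![-0.447675, -0.477671, -0.474372; 0.236348, -0.103753, 0.702367; 0.759409, 0.418114, 0.419664]

lemma shootInv_mulVec (x : Fin 3 → ℝ) : shootInv *ᵥ x =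
    ![-0.447675 * x 0 + -0.477671 * x 1 + -0.474372 * x 2,
      0.236348 * x 0 + -0.103753 * x 1 + 0.702367 * x 2,
      0.759409 * x 0 + 0.418114 * x 1 + 0.419664 * x 2] := by
  ext i
  fin_cases i <;> simp [shootInv, Matrix.mulVec, dotProduct, Fin.sum_univ_three]

/-- The difference of two values of the boundary map is nearly its tabulated derivative applied to
`u - u'`, and `shootInv` nearly inverts that derivative. The Newton step therefore almost
annihilates `u - u'`, and the constant `1/2` leaves much room. -/
lemma norm_newton_le {δ : ℝ} (hδ : 9 ^ 4 * δ ≤ 1 / 10 ^ 14) {p : Fin 7 → ℝ} {u u' : Fin 3 → ℝ}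
    {Y Y' : ℕ → ℝ → Fin 7 → ℝ} (hY : Tracks δ (p + ∑ c, u c • dir c) Y)
    (hY' : Tracks δ (p + ∑ c, u' c • dir c) Y') :
    ‖(u - shootInv *ᵥ boundary (Y 3 1)) - (u' - shootInv *ᵥ boundary (Y' 3 1))‖ ≤
      1 / 2 * ‖u - u'‖ := by
  have hm := norm_nonneg (u - u')
  have key := abs_final_sub_le hδ hY hY'
  have h0 := abs_le.1 (key 0)
  have h1 := abs_le.1 (key 1)
  have h3 := abs_le.1 (key 3)
  have h4 := abs_le.1 (key 4)
  have h5 := abs_le.1 (key 5)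
  have b0 := abs_le.1 (norm_le_pi_norm (u - u') 0)
  have b1 := abs_le.1 (norm_le_pi_norm (u - u') 1)
  have b2 := abs_le.1 (norm_le_pi_norm (u - u') 2)
  norm_num [endTable] at h0 h1 h3 h4 h5 b0 b1 b2
  rw [pi_norm_le_iff_of_nonneg (by positivity), shootInv_mulVec, shootInv_mulVec]
  rw [forall_fin_three]
  simp only [Real.norm_eq_abs, abs_le, boundary, Pi.sub_apply, Matrix.cons_val]
  norm_num
  refine ⟨⟨?_, ?_⟩, ⟨?_, ?_⟩, ⟨?_, ?_⟩⟩ <;> linarith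

/-- Only the invertibility of `shootInv` is used; that it is merely an approximate inverse affects
the rate of contraction and not the zeros. -/
lemma boundary_eq_zero {x : Fin 7 → ℝ} (h : shootInv *ᵥ boundary x = 0) :
    x 0 = x 1 ∧ x 3 = -x 4 ∧ x 5 = 0 := by
  rw [shootInv_mulVec] at h
  have h0 := congrFun h 0
  have h1 := congrFun h 1
  have h2 := congrFun h 2
  simp only [boundary, Matrix.cons_val, Pi.zero_apply] at h0 h1 h2
  refine ⟨?_, ?_, ?_⟩ <;> linarith

lemma norm_newton_zero_le {Y : ℕ → ℝ → Fin 7 → ℝ} {x₀ : Fin 7 → ℝ}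
    (hY : Tracks (4 / 2 ^ 80) x₀ Y) : ‖shootInv *ᵥ boundary (Y 3 1)‖ ≤ 1 / 10 ^ 19 := by
  -- The accumulated error is `9⁴ · 4 · 2⁻⁸⁰`, about `2.2 · 10⁻²⁰`.
  have key : ∀ i, |Y 3 1 i - piece3.curve 1 i| ≤ 1 / 10 ^ 19 / 4 := fun i =>
    ((norm_le_pi_norm _ i).trans (hY.near 3 (by norm_num) 1 (by norm_num))).trans (by norm_num)
  obtain ⟨c0, c1, c2⟩ := abs_boundary_le
  have h0 := abs_le.1 (key 0)
  have h1 := abs_le.1 (key 1)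
  have h3 := abs_le.1 (key 3)
  have h4 := abs_le.1 (key 4)
  have h5 := abs_le.1 (key 5)
  rw [abs_le] at c0 c1 c2
  have hη : (1 : ℝ) / 2 ^ 80 ≤ 1 / 10 ^ 24 := by norm_num
  generalize (1 : ℝ) / 2 ^ 80 = η at *
  norm_num at h0 h1 h3 h4 h5 c0 c1 c2 hη
  rw [pi_norm_le_iff_of_nonneg (by positivity), shootInv_mulVec]
  rw [forall_fin_three]
  simp only [Real.norm_eq_abs, abs_le, boundary, Matrix.cons_val]
  norm_num
  refine ⟨⟨?_, ?_⟩, ⟨?_, ?_⟩, ⟨?_, ?_⟩⟩ <;> linarith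

/-- There is a solution that starts near the approximate initial position and ends in a symmetric
position. -/
lemma exists_shooting : ∃ (u : Fin 3 → ℝ) (Y : ℕ → ℝ → Fin 7 → ℝ) (δ : ℝ),
    ‖u‖ ≤ 5 / 10 ^ 19 ∧ 9 ^ 4 * δ ≤ 1 / 10 ^ 14 ∧ Tracks δ (start + ∑ c, u c • dir c) Y ∧
    Y 3 1 0 = Y 3 1 1 ∧ Y 3 1 3 = -Y 3 1 4 ∧ Y 3 1 5 = 0 := by
  have hdir : ∀ c : Fin 3, ‖dir c‖ ≤ 1 := by
    intro c
    rw [pi_norm_le_iff_of_nonneg (by norm_num)]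
    intro i
    rw [Real.norm_eq_abs, dir]
    have : |direction c i| ≤ 1 := by
      revert c i
      decide
    exact_mod_cast this
  -- In `4 · 2⁻⁸⁰ + 3 ‖u‖`, half of the first term is the error of `start` and half is the slack
  -- required by `exists_tracks`; the second term is the displacement by three directions of norm at
  -- most `1`.
  have hex : ∀ u : Fin 3 → ℝ, ‖u‖ ≤ 5 / 10 ^ 19 →
      ∃ Y, Tracks (4 / 2 ^ 80 + 3 * ‖u‖) (start + ∑ c, u c • dir c) Y := by
    intro u hu
    have h0 := norm_nonneg u
    refine exists_tracks (by linarith) ?_ ?_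
    · norm_num at hu ⊢
      linarith
    · have h1 := norm_start_le
      have h2 := norm_sum_smul_le (u := u) hdir
      have h3 : start + ∑ c, u c • dir c - piece0.curve (-1) =
          (start - piece0.curve (-1)) + ∑ c : Fin 3, u c • dir c := by abel
      rw [h3]
      refine (norm_add_le _ _).trans ((add_le_add h1 h2).trans ?_)
      norm_num
      linarith
  choose! Y hY using hex
  -- The radius `5 · 10⁻¹⁹` is nearly the largest one for which all solutions stay in the tube of
  -- radius `10⁻¹⁴`. A common `δ` for the whole ball allows any two solutions to be compared.
  have hδ : (9 : ℝ) ^ 4 * (4 / 2 ^ 80 + 3 * (5 / 10 ^ 19)) ≤ 1 / 10 ^ 14 := by norm_num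
  have hY' : ∀ u : Fin 3 → ℝ, ‖u‖ ≤ 5 / 10 ^ 19 →
      Tracks (4 / 2 ^ 80 + 3 * (5 / 10 ^ 19)) (start + ∑ c, u c • dir c) (Y u) := fun u hu =>
    ⟨(hY u hu).initial, (hY u hu).joint, (hY u hu).solves,
      fun k hk t ht => ((hY u hu).near k hk t ht).trans (by gcongr)⟩
  set T : (Fin 3 → ℝ) → Fin 3 → ℝ := fun u => u - shootInv *ᵥ boundary (Y u 3 1) with hT
  have hcontr : ∀ u u' : Fin 3 → ℝ, ‖u‖ ≤ 5 / 10 ^ 19 → ‖u'‖ ≤ 5 / 10 ^ 19 →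
      ‖T u - T u'‖ ≤ 1 / 2 * ‖u - u'‖ := fun u u' hu hu' =>
    norm_newton_le hδ (hY' u hu) (hY' u' hu')
  have hz : ‖(0 : Fin 3 → ℝ)‖ ≤ 5 / 10 ^ 19 := by rw [norm_zero]; positivity
  have hT0 : ‖T 0‖ ≤ 1 / 10 ^ 19 := by
    have h1 := hY 0 hz
    rw [norm_zero, mul_zero, add_zero] at h1
    have h2 := norm_newton_zero_le h1
    change ‖0 - shootInv *ᵥ boundary (Y 0 3 1)‖ ≤ _
    rwa [zero_sub, norm_neg]
  -- The ball is mapped into itself because half of its radius plus `‖T 0‖ ≤ 10⁻¹⁹` is less than the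
  -- radius.
  have hmaps : MapsTo T (Metric.closedBall 0 (5 / 10 ^ 19)) (Metric.closedBall 0 (5 / 10 ^ 19)) := by
    intro u hu
    rw [mem_closedBall_zero_iff] at hu ⊢
    have h1 := hcontr u 0 hu hz
    rw [sub_zero] at h1
    have h2 := norm_le_norm_add_norm_sub' (T u) (T 0)
    norm_num at hu hT0 h1 ⊢
    linarith
  have hcw : ContractingWith (1 / 2) (hmaps.restrict T _ _) := by
    refine ⟨by norm_num, LipschitzWith.of_dist_le_mul fun u u' => ?_⟩
    rw [Subtype.dist_eq, Subtype.dist_eq, dist_eq_norm, dist_eq_norm]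
    have := hcontr u u' (mem_closedBall_zero_iff.1 u.2) (mem_closedBall_zero_iff.1 u'.2)
    simpa using this
  obtain ⟨u, hu, hfix, -⟩ := hcw.exists_fixedPoint' Metric.isClosed_closedBall.isComplete hmaps
    (mem_closedBall_zero_iff.2 hz) (edist_ne_top _ _)
  rw [mem_closedBall_zero_iff] at hu
  refine ⟨u, Y u, _, hu, hδ, hY' u hu, boundary_eq_zero ?_⟩
  -- At a fixed point the Newton correction vanishes.
  have h1 : u - shootInv *ᵥ boundary (Y u 3 1) = u := hfix
  simpa using h1

end

/-! ### The Hamiltonian in terms of words -/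

/-- The index of a coordinate among the seven variables. -/
def emb : Idx → Fin 7 := Sum.elim ![0, 1, 2] ![3, 4, 5]

/-- A point of phase space together with the value of the time scale. -/
def extend (x : Phase) (s : ℝ) : Fin 7 → ℝ :=
  ![x (Sum.inl 0), x (Sum.inl 1), x (Sum.inl 2), x (Sum.inr 0), x (Sum.inr 1), x (Sum.inr 2), s]

/-- The point of phase space. -/
def restrict (y : Fin 7 → ℝ) : Phase := fun i => y (emb i)

lemma restrict_extend (x : Phase) (s : ℝ) : restrict (extend x s) = x := by
  ext i
  rcases i with i | i <;> fin_cases i <;> rfl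

lemma extend_restrict (y : Fin 7 → ℝ) : extend (restrict y) (y 6) = y := by
  ext i
  fin_cases i <;> rfl

lemma forall_idx {p : Idx → Prop} : (∀ i, p i) ↔ (p (Sum.inl 0) ∧ p (Sum.inl 1) ∧ p (Sum.inl 2)) ∧
    p (Sum.inr 0) ∧ p (Sum.inr 1) ∧ p (Sum.inr 2) := by
  rw [Sum.forall, forall_fin_three, forall_fin_three]

lemma sum_idx {M : Type*} [AddCommMonoid M] (f : Idx → M) : ∑ i, f i =
    f (Sum.inl 0) + f (Sum.inl 1) + f (Sum.inl 2) +
      (f (Sum.inr 0) + f (Sum.inr 1) + f (Sum.inr 2)) := by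
  rw [Fintype.sum_sum_type, Fin.sum_univ_three, Fin.sum_univ_three]

lemma sum_extend (g : Fin 7 → ℝ) (x : Phase) : ∑ j, g j * extend x 0 j = ∑ i, g (emb i) * x i := by
  rw [Fin.sum_univ_seven, sum_idx]
  simp [extend, emb]
  ring

lemma regHam_eq_evalR (x : Phase) (s : ℝ) : regHam (-1) x = hamPoly.evalR (atoms (extend x s)) := by
  simp only [regHam, hamPoly, WPoly.evalR, List.map_cons, List.map_nil, List.prod_cons,
    List.prod_nil, List.sum_cons, List.sum_nil, atoms, quartic, extend, Matrix.cons_val]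
  norm_num
  ring

lemma smooth_extend {x : Phase} (hx : x ∈ regDomain) (s : ℝ) : Smooth (extend x s) := by
  have h : ∀ i j : Fin 3, i ≠ j → 0 < x (Sum.inl i) ^ 4 + x (Sum.inl j) ^ 4 := by
    intro i j hij
    rcases hx i j hij with h | h <;> positivity
  have h0 := h 0 1 (by decide)
  have h1 := h 0 2 (by decide)
  have h2 := h 1 2 (by decide)
  intro k
  unfold quartic
  split
  · change 0 < x (Sum.inl 0) ^ 4 + x (Sum.inl 1) ^ 4 + x (Sum.inl 2) ^ 4
    positivity
  · exact h0
  · exact h1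
  · exact h2
  · exact one_pos

lemma isOpen_regDomain : IsOpen regDomain := by
  have : regDomain = ⋂ i : Fin 3, ⋂ j : Fin 3, {x : Phase | i ≠ j →
      x (Sum.inl i) ≠ 0 ∨ x (Sum.inl j) ≠ 0} := by
    ext x
    simp [regDomain]
  rw [this]
  refine isOpen_iInter_of_finite fun i => isOpen_iInter_of_finite fun j => ?_
  by_cases hij : i = j
  · simp [hij]
  · simp only [ne_eq, hij, not_false_eq_true, forall_const]
    exact (isOpen_ne_fun (continuous_apply _) continuous_const).union
      (isOpen_ne_fun (continuous_apply _) continuous_const)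

/-- Chain rule for the affine embedding of phase space at a fixed time scale: a partial derivative
in phase space is the formal derivative in the corresponding variable. -/
lemma hasFDerivAt_evalR_extend {x : Phase} (hx : x ∈ regDomain) (s : ℝ) (p : WPoly) (j : Idx) :
    DifferentiableAt ℝ (fun y => p.evalR (atoms (extend y s))) x ∧
    fderiv ℝ (fun y => p.evalR (atoms (extend y s))) x (Pi.single j 1) =
      (p.deriv (emb j)).evalR (atoms (extend x s)) := by
  let L : Phase →L[ℝ] (Fin 7 → ℝ) := LinearMap.toContinuousLinearMap
    { toFun := fun y => extend y 0
      map_add' := fun y z => by ext i; fin_cases i <;> simp [extend]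
      map_smul' := fun c y => by ext i; fin_cases i <;> simp [extend] }
  have hL : HasFDerivAt (fun y => extend y s) L x := by
    have e : (fun y => extend y s) = fun y => L y + extend 0 s := by
      ext y i
      change _ = (extend y 0 + extend 0 s) i
      fin_cases i <;> simp [extend]
    rw [e]
    exact L.hasFDerivAt.add_const _
  have h := (WPoly.hasFDerivAt_evalR (hasFDerivAt_atoms (smooth_extend hx s)) p).comp x hL
  refine ⟨h.differentiableAt, ?_⟩
  change fderiv ℝ ((fun y => WPoly.evalR (atoms y) p) ∘ fun y => extend y s) x _ = _
  rw [h.fderiv, ContinuousLinearMap.comp_apply, linForm_apply]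
  change ∑ k, _ * extend (Pi.single j 1) 0 k = _
  rw [sum_extend, Finset.sum_eq_single j]
  · simp
  · intro i _ hij
    simp [Pi.single_eq_of_ne hij]
  · simp

lemma emb_lt (i : Idx) : (emb i : ℕ) < 6 := by
  revert i
  decide

lemma grad_regHam {x : Phase} (hx : x ∈ regDomain) (s : ℝ) (i : Idx) :
    grad (regHam (-1)) x i = (gradTable.getD (emb i) []).evalR (atoms (extend x s)) := by
  have e : regHam (-1) = fun x => hamPoly.evalR (atoms (extend x s)) :=
    funext fun x => regHam_eq_evalR x s
  rw [grad, e, (hasFDerivAt_evalR_extend hx s hamPoly i).2, gradTable_eq _ (emb_lt i),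
    WPoly.evalR_norm]

/-- The polynomial expression for the gradient is valid on an open set, so it holds near `x` and may
be differentiated again to give the Hessian. -/
lemma hasFDerivAt_grad {x : Phase} (hx : x ∈ regDomain) (s : ℝ) (i : Idx) :
    (fun y => grad (regHam (-1)) y i) =ᶠ[nhds x]
      fun y => (gradTable.getD (emb i) []).evalR (atoms (extend y s)) :=
  Filter.eventually_of_mem (isOpen_regDomain.mem_nhds hx) fun _ hy => grad_regHam hy s i

lemma hess_regHam {x : Phase} (hx : x ∈ regDomain) (s : ℝ) (i j : Idx) :
    hess (regHam (-1)) x i j =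
      ((gradTable.getD (emb i) []).deriv (emb j)).evalR (atoms (extend x s)) := by
  rw [hess, Matrix.of_apply, (hasFDerivAt_grad hx s i).fderiv_eq,
    (hasFDerivAt_evalR_extend hx s _ j).2]

lemma symJ_mulVec (x : Phase) : symJ *ᵥ x = Sum.elim (fun i => x (Sum.inr i))
    (fun i => -x (Sum.inl i)) := by
  ext i
  rcases i with i | i
  · simp [symJ, Matrix.mulVec, dotProduct, Matrix.one_apply]
  · simp [symJ, Matrix.mulVec, dotProduct, Matrix.one_apply]

lemma vf_extend {x : Phase} (hx : x ∈ regDomain) (s : ℝ) (i : Idx) :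
    vf (extend x s) (emb i) = s / 1024 * (symJ *ᵥ grad (regHam (-1)) x) i := by
  have h6 : atoms (extend x s) 6 = s := by simp [atoms, extend]
  rw [symJ_mulVec, vf]
  rcases i with i | i
  · have e : fieldPoly (emb (Sum.inl i)) = (gradTable.getD (emb (Sum.inr i)) []).mulVar 1 6 := by
      fin_cases i <;> rfl
    rw [e, WPoly.evalR_mulVar, h6, Sum.elim_inl, grad_regHam hx s]
    push_cast
    ring
  · have e : fieldPoly (emb (Sum.inr i)) = (gradTable.getD (emb (Sum.inl i)) []).mulVar (-1) 6 := by
      fin_cases i <;> rfl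
    rw [e, WPoly.evalR_mulVar, h6, Sum.elim_inr, grad_regHam hx s]
    push_cast
    ring

/-- On vectors without a component along `σ`, the column of derivatives with respect to `σ` drops
out. The numerical linearization is then the Hamiltonian one in the scaled time. -/
lemma dvf_extend {x : Phase} (hx : x ∈ regDomain) (s : ℝ) (c : Phase) (i : Idx) :
    dvf (extend x s) (extend c 0) (emb i) =
      s / 1024 * ((symJ * hess (regHam (-1)) x) *ᵥ c) i := by
  have h6 : atoms (extend x s) 6 = s := by simp [atoms, extend]
  have hv : ∀ j : Idx, dVar (emb j) 6 = [] := by decide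
  rw [dvf_apply, sum_extend, ← Matrix.mulVec_mulVec, symJ_mulVec]
  simp only [← evalR_deriv_field]
  rcases i with i | i
  · have e : fieldPoly (emb (Sum.inl i)) = (gradTable.getD (emb (Sum.inr i)) []).mulVar 1 6 := by
      fin_cases i <;> rfl
    rw [e, Sum.elim_inl, Matrix.mulVec, dotProduct, Finset.mul_sum]
    refine Finset.sum_congr rfl fun j _ => ?_
    rw [WPoly.evalR_deriv_mulVar _ _ _ _ _ (hv j), h6, hess_regHam hx s]
    push_cast
    ring
  · have e : fieldPoly (emb (Sum.inr i)) = (gradTable.getD (emb (Sum.inl i)) []).mulVar (-1) 6 := by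
      fin_cases i <;> rfl
    rw [e, Sum.elim_inr, Matrix.mulVec, dotProduct, ← Finset.sum_neg_distrib, Finset.mul_sum]
    refine Finset.sum_congr rfl fun j _ => ?_
    rw [WPoly.evalR_deriv_mulVar _ _ _ _ _ (hv j), h6, hess_regHam hx s]
    push_cast
    ring

lemma vf_last (y : Fin 7 → ℝ) : vf y 6 = 0 := by
  have e : fieldPoly 6 = [] := rfl
  simp [vf, e, WPoly.evalR]

lemma dvf_last (y c : Fin 7 → ℝ) : dvf y c 6 = 0 := by
  have e : fieldPoly 6 = [] := rfl
  rw [dvf_apply]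
  refine Finset.sum_eq_zero fun j _ => ?_
  rw [← evalR_deriv_field]
  simp [e, WPoly.evalR, WPoly.deriv]

/-! ### Symmetries -/

section

variable {H : Phase → ℝ} {S : Matrix Idx Idx ℝ}

lemma fderiv_apply_eq_sum {G : Phase → ℝ} (x v : Phase) :
    fderiv ℝ G x v = ∑ j, v j * fderiv ℝ G x (Pi.single j 1) := by
  have h : v = ∑ j, v j • (Pi.single j 1 : Phase) := by
    ext i
    simp [Finset.sum_apply, Pi.single_apply]
  conv_lhs => rw [h]
  simp

lemma fderiv_mulVec (hS : S * Sᵀ = 1) (G : Phase → ℝ) (x : Phase) (i : Idx) :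
    fderiv ℝ G (S *ᵥ x) (Pi.single i 1) =
      ∑ k, S i k * fderiv ℝ (fun y => G (S *ᵥ y)) x (Pi.single k 1) := by
  have hS' : Sᵀ * S = 1 := mul_eq_one_comm.1 hS
  let e : Phase ≃L[ℝ] Phase := (Matrix.toLin'OfInv hS' hS).toContinuousLinearEquiv
  have h := e.comp_right_fderiv (f := G) (x := x)
  have h1 : fderiv ℝ (fun y => G (S *ᵥ y)) x (Sᵀ *ᵥ Pi.single i 1) =
      fderiv ℝ G (S *ᵥ x) (S *ᵥ (Sᵀ *ᵥ Pi.single i 1)) := DFunLike.congr_fun h _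
  rw [Matrix.mulVec_mulVec, hS, Matrix.one_mulVec] at h1
  rw [← h1, fderiv_apply_eq_sum]
  refine Finset.sum_congr rfl fun k _ => ?_
  rw [Matrix.mulVec_single_one]
  rfl

/-- Differentiating `H(S x) = H(x)` gives `Sᵀ ∇H(S x) = ∇H(x)`, and `Sᵀ` is the inverse of `S`. -/
lemma grad_mulVec (hS : S * Sᵀ = 1) (hH : ∀ x, H (S *ᵥ x) = H x) (x : Phase) :
    grad H (S *ᵥ x) = S *ᵥ grad H x := by
  ext i
  rw [grad, fderiv_mulVec hS]
  simp only [hH]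
  rfl

lemma hess_mulVec (hS : S * Sᵀ = 1) (hH : ∀ x, H (S *ᵥ x) = H x) {x : Phase}
    (hd : ∀ k, DifferentiableAt ℝ (fun y => grad H y k) x) :
    hess H (S *ᵥ x) = S * hess H x * Sᵀ := by
  ext i j
  have h1 : ∀ l, fderiv ℝ (fun y => grad H (S *ᵥ y) i) x (Pi.single l 1) =
      (S * hess H x) i l := by
    intro l
    have e : (fun y => grad H (S *ᵥ y) i) = fun y => ∑ k, S i k * grad H y k := by
      ext y
      rw [grad_mulVec hS hH]
      rfl
    rw [e, fderiv_fun_sum fun k _ => (hd k).const_mul _, _root_.sum_apply, Matrix.mul_apply]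
    refine Finset.sum_congr rfl fun k _ => ?_
    rw [fderiv_const_mul (hd k)]
    rfl
  rw [hess, Matrix.of_apply, fderiv_mulVec hS (fun y => grad H y i)]
  simp only [h1]
  rw [Matrix.mul_apply]
  refine Finset.sum_congr rfl fun k _ => ?_
  rw [Matrix.transpose_apply, mul_comm]

end

lemma Sf_mulVec (x : Phase) : Sf *ᵥ x = point (x (Sum.inl 2)) (-x (Sum.inl 0)) (x (Sum.inl 1))
    (x (Sum.inr 2)) (-x (Sum.inr 0)) (x (Sum.inr 1)) := by
  ext i
  rcases i with i | i <;> fin_cases i <;>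
    simp [Sf, point, Matrix.mulVec, dotProduct, Fin.sum_univ_three]

lemma Sr_mulVec (x : Phase) : Sr *ᵥ x = point (x (Sum.inl 1)) (x (Sum.inl 0)) (x (Sum.inl 2))
    (-x (Sum.inr 1)) (-x (Sum.inr 0)) (-x (Sum.inr 2)) := by
  ext i
  rcases i with i | i <;> fin_cases i <;>
    simp [Sr, point, Matrix.mulVec, dotProduct, Fin.sum_univ_three]

lemma regHam_Sf (E : ℝ) (x : Phase) : regHam E (Sf *ᵥ x) = regHam E x := by
  have h1 := add_right_comm (x (Sum.inl 0) ^ 4) (x (Sum.inl 2) ^ 4) (x (Sum.inl 1) ^ 4)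
  have h2 : ∀ a : ℝ, (-a) ^ 4 = a ^ 4 := fun a => by ring
  simp only [Sf_mulVec, regHam, point, Sum.elim_inl, Sum.elim_inr, Matrix.cons_val, neg_sq, h2, h1,
    add_comm (x (Sum.inl 2) ^ 4) (x (Sum.inl 0) ^ 4),
    add_comm (x (Sum.inl 2) ^ 4) (x (Sum.inl 1) ^ 4)]
  ring

lemma regHam_Sr (E : ℝ) (x : Phase) : regHam E (Sr *ᵥ x) = regHam E x := by
  simp only [Sr_mulVec, regHam, point, Sum.elim_inl, Sum.elim_inr, Matrix.cons_val, neg_sq,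
    add_comm (x (Sum.inl 1) ^ 4) (x (Sum.inl 0) ^ 4)]
  ring

lemma Sf_mul_transpose : Sf * Sfᵀ = 1 := by
  rw [Sf, fromBlocks_transpose, fromBlocks_multiply, ← fromBlocks_one]
  congr 1 <;> ext i j <;> fin_cases i <;> fin_cases j <;>
    simp [Matrix.vecMul, dotProduct, Fin.sum_univ_three]

lemma Sr_transpose : Srᵀ = Sr := by
  rw [Sr, fromBlocks_transpose]
  congr 1 <;> ext i j <;> fin_cases i <;> fin_cases j <;> simp

lemma Sr_mul_self : Sr * Sr = 1 := by
  rw [Sr, fromBlocks_multiply, ← fromBlocks_one]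
  congr 1 <;> ext i j <;> fin_cases i <;> fin_cases j <;> simp

lemma symJ_mul_Sf : symJ * Sf = Sf * symJ := by
  simp [symJ, Sf, fromBlocks_multiply]

/-- `S_r` acts with opposite signs on positions and momenta. This antisymplectic sign makes it
reverse the Hamiltonian field, and with it time. -/
lemma symJ_mul_Sr : symJ * Sr = -(Sr * symJ) := by
  rw [symJ, Sr, fromBlocks_multiply, fromBlocks_multiply, fromBlocks_neg]
  congr 1 <;> ext i j <;> fin_cases i <;> fin_cases j <;> simp

lemma Sf_mem_regDomain {x : Phase} (hx : x ∈ regDomain) : Sf *ᵥ x ∈ regDomain := by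
  have h0 := hx 0 1 (by decide)
  have h1 := hx 0 2 (by decide)
  have h2 := hx 1 2 (by decide)
  intro i j
  rw [Sf_mulVec]
  fin_cases i <;> fin_cases j <;> simp [point] <;> tauto

lemma Sr_mem_regDomain {x : Phase} (hx : x ∈ regDomain) : Sr *ᵥ x ∈ regDomain := by
  have h0 := hx 0 1 (by decide)
  have h1 := hx 0 2 (by decide)
  have h2 := hx 1 2 (by decide)
  intro i j
  rw [Sr_mulVec]
  fin_cases i <;> fin_cases j <;> simp [point] <;> tauto

/-- The Hamiltonian vector field. -/
def hamVec (x : Phase) : Phase := symJ *ᵥ grad (regHam (-1)) x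

/-- The linearization of the Hamiltonian vector field. -/
def hamJac (x : Phase) : Matrix Idx Idx ℝ := symJ * hess (regHam (-1)) x

lemma differentiableAt_grad {x : Phase} (hx : x ∈ regDomain) (k : Idx) :
    DifferentiableAt ℝ (fun y => grad (regHam (-1)) y k) x :=
  ((hasFDerivAt_evalR_extend hx 0 _ k).1).congr_of_eventuallyEq (hasFDerivAt_grad hx 0 k)

lemma hamVec_Sf (x : Phase) : hamVec (Sf *ᵥ x) = Sf *ᵥ hamVec x := by
  rw [hamVec, hamVec, grad_mulVec Sf_mul_transpose (regHam_Sf _), Matrix.mulVec_mulVec, symJ_mul_Sf,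
    Matrix.mulVec_mulVec]

lemma hamVec_Sr (x : Phase) : hamVec (Sr *ᵥ x) = -(Sr *ᵥ hamVec x) := by
  rw [hamVec, hamVec, grad_mulVec (by rw [Sr_transpose, Sr_mul_self]) (regHam_Sr _),
    Matrix.mulVec_mulVec, symJ_mul_Sr, Matrix.neg_mulVec, Matrix.mulVec_mulVec]

lemma hamJac_Sf {x : Phase} (hx : x ∈ regDomain) : hamJac (Sf *ᵥ x) * Sf = Sf * hamJac x := by
  rw [hamJac, hamJac, hess_mulVec Sf_mul_transpose (regHam_Sf _) (differentiableAt_grad hx)]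
  have h : Sfᵀ * Sf = 1 := mul_eq_one_comm.1 Sf_mul_transpose
  rw [Matrix.mul_assoc symJ, Matrix.mul_assoc, h, Matrix.mul_one, ← Matrix.mul_assoc, symJ_mul_Sf,
    Matrix.mul_assoc]

lemma hamJac_Sr {x : Phase} (hx : x ∈ regDomain) : hamJac (Sr *ᵥ x) * Sr = -(Sr * hamJac x) := by
  rw [hamJac, hamJac, hess_mulVec (by rw [Sr_transpose, Sr_mul_self]) (regHam_Sr _)
    (differentiableAt_grad hx), Sr_transpose]
  rw [Matrix.mul_assoc symJ, Matrix.mul_assoc (Sr * _), Sr_mul_self, Matrix.mul_one,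
    ← Matrix.mul_assoc, symJ_mul_Sr, Matrix.neg_mul, Matrix.mul_assoc]

/-! ### Concatenation of solutions -/

section

open Set

/-- The function on `ℝ` that is given by `g m` on `[2 m, 2 m + 2]`, up to a translation. -/
def glue {E : Type*} (g : ℤ → ℝ → E) (t : ℝ) : E := g ⌊t / 2⌋ (t - 2 * ⌊t / 2⌋ - 1)

/-- The floor selects the half-open interval `[2 m, 2 m + 2)`. At `t = 1` the next function is used,
which agrees by the joint condition. -/
lemma glue_apply {E : Type*} {g : ℤ → ℝ → E} (h : ∀ m, g m 1 = g (m + 1) (-1)) (m : ℤ) {t : ℝ}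
    (ht : t ∈ Icc (-1 : ℝ) 1) : glue g (2 * m + 1 + t) = g m t := by
  rcases ht.2.lt_or_eq with h1 | rfl
  · have h2 : ⌊(2 * m + 1 + t) / 2⌋ = m := by
      rw [Int.floor_eq_iff]
      constructor <;> linarith [ht.1]
    rw [glue, h2]
    congr 1
    ring
  · have h2 : ⌊(2 * m + 1 + 1 : ℝ) / 2⌋ = m + 1 := by
      rw [Int.floor_eq_iff]
      push_cast
      constructor <;> linarith
    rw [glue, h2, h]
    congr 1
    push_cast
    ring

/-- At a joint the derivatives from both sides agree by `h'`, and the union of the two adjacent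
closed intervals is a neighbourhood of the joint. -/
lemma hasDerivAt_glue {E : Type*} [NormedAddCommGroup E] [NormedSpace ℝ E] {g g' : ℤ → ℝ → E} (h : ∀ m, g m 1 = g (m + 1) (-1))
    (h' : ∀ m, g' m 1 = g' (m + 1) (-1))
    (hg : ∀ m, ∀ t ∈ Icc (-1 : ℝ) 1, HasDerivWithinAt (g m) (g' m t) (Icc (-1) 1) t) (m : ℤ) {t : ℝ}
    (ht : t ∈ Icc (-1 : ℝ) 1) : HasDerivAt (glue g) (g' m t) (2 * m + 1 + t) := by
  have key : ∀ m : ℤ, ∀ t ∈ Icc (-1 : ℝ) 1,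
      HasDerivWithinAt (glue g) (g' m t) (Icc (2 * m) (2 * m + 2)) (2 * m + 1 + t) := by
    intro m t ht
    have h1 : HasDerivWithinAt (fun s : ℝ => s - (2 * m + 1)) 1 (Icc (2 * m : ℝ) (2 * m + 2))
        (2 * m + 1 + t) := (hasDerivWithinAt_id _ _).sub_const _
    have h2 : MapsTo (fun s : ℝ => s - (2 * m + 1)) (Icc (2 * m : ℝ) (2 * m + 2)) (Icc (-1) 1) :=
      fun s hs => ⟨by linarith [hs.1], by linarith [hs.2]⟩
    have h3 : 2 * m + 1 + t - (2 * m + 1) = t := by ring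
    have h4 := HasDerivWithinAt.scomp (2 * m + 1 + t) (by rw [h3]; exact hg m t ht) h1 h2
    rw [one_smul] at h4
    refine h4.congr_of_mem (fun s hs => ?_) ⟨by linarith [ht.1], by linarith [ht.2]⟩
    have h5 := glue_apply h m (h2 hs)
    rw [add_sub_cancel] at h5
    exact h5
  have side : ∀ m : ℤ, HasDerivAt (glue g) (g' m 1) (2 * m + 1 + 1) := by
    intro m
    have h1 := key m 1 (by norm_num)
    have h2 := key (m + 1) (-1) (by norm_num)
    rw [← h'] at h2
    have e : (2 : ℝ) * ((m + 1 : ℤ) : ℝ) = 2 * m + 2 := by push_cast; ring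
    have e' : (2 * m + 2 + 1 + -1 : ℝ) = 2 * m + 1 + 1 := by ring
    rw [e, e'] at h2
    refine (h1.union h2).hasDerivAt ?_
    rw [Icc_union_Icc_eq_Icc (by linarith) (by linarith)]
    exact Icc_mem_nhds (by linarith) (by linarith)
  rcases ht.2.lt_or_eq with h1 | rfl
  · rcases ht.1.lt_or_eq with h2 | rfl
    · exact (key m t ht).hasDerivAt (Icc_mem_nhds (by linarith) (by linarith))
    -- The left end of a piece is the right end of its predecessor.
    · have h3 := side (m - 1)
      rw [h', sub_add_cancel] at h3
      convert h3 using 1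
      push_cast
      ring
  · exact side m

end

/-! ### The first twelfth of the orbit and its fundamental matrix -/

section

open Set PieceData

/-- A solution of the Hamiltonian system together with a solution of its linearization, in the time
scaled by `θ`. -/
structure Segment (θ : ℝ) (q : ℝ → Phase) (X : ℝ → Matrix Idx Idx ℝ) : Prop where
  mem : ∀ t ∈ Icc (-1 : ℝ) 1, q t ∈ regDomain
  deriv : ∀ t ∈ Icc (-1 : ℝ) 1, HasDerivWithinAt q (θ • hamVec (q t)) (Icc (-1) 1) t
  derivMat : ∀ t ∈ Icc (-1 : ℝ) 1, ∀ i j, HasDerivWithinAt (fun s => X s i j)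
    ((θ • (hamJac (q t) * X t)) i j) (Icc (-1) 1) t

/-- One twelfth of the cubic orbit, in four parts, with the fundamental matrix of the
linearization. -/
structure TwelfthOrbit (α β θ : ℝ) (q : ℕ → ℝ → Phase) (X : ℕ → ℝ → Matrix Idx Idx ℝ) : Prop where
  segment : ∀ k < 4, Segment θ (q k) (X k)
  joint : ∀ k, q (k + 1) (-1) = q k 1
  jointMat : ∀ k, X (k + 1) (-1) = X k 1
  initial : q 0 (-1) = point 0 α α (√2) (-β) β
  initialMat : X 0 (-1) = 1
  final : Sr *ᵥ q 3 1 = q 3 1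
  pos_fst : ∀ k < 4, ∀ t ∈ Icc (-1 : ℝ) 1, (k = 0 ∧ t = -1) ∨ 0 < q k t (Sum.inl 0)
  pos_snd : ∀ k < 4, ∀ t ∈ Icc (-1 : ℝ) 1, 0 < q k t (Sum.inl 1)
  pos_trd : ∀ k < 4, ∀ t ∈ Icc (-1 : ℝ) 1, 0 < q k t (Sum.inl 2)

/-- A component with derivative zero is constant on every piece, by the Grönwall estimate with zero
data, and the joints carry it on. It is applied to the time scale `σ` and to its variation. -/
lemma last_eq {W W' : ℕ → ℝ → Fin 7 → ℝ} (hj : ∀ k, W (k + 1) (-1) = W k 1)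
    (hW : ∀ k < 4, ∀ t ∈ Icc (-1 : ℝ) 1, HasDerivWithinAt (W k) (W' k t) (Icc (-1) 1) t)
    (h6 : ∀ k t, W' k t 6 = 0) : ∀ k < 4, ∀ t ∈ Icc (-1 : ℝ) 1, W k t 6 = W 0 (-1) 6 := by
  have key : ∀ k < 4, ∀ t ∈ Icc (-1 : ℝ) 1, W k t 6 = W k (-1) 6 := by
    intro k hk t ht
    have h := norm_le_of_norm_deriv_le (w := fun t => W k t 6 - W k (-1) 6) (w' := fun _ => 0)
      le_rfl le_rfl (fun t ht => by
        have h1 := hasDerivWithinAt_pi.1 (hW k hk t ht) 6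
        rw [h6] at h1
        exact h1.sub_const _) (by simp) (fun t ht => by rw [norm_zero]; positivity) ht
    simp only [mul_zero, add_zero, norm_le_zero_iff] at h
    exact sub_eq_zero.1 h
  intro k
  induction k with
  | zero => exact fun hk => key 0 hk
  | succ k ih =>
    intro hk t ht
    rw [key _ hk t ht, hj]
    exact ih (by omega) 1 (by norm_num)

/-- On the box `Q₁' = 2 σ P₁ Q₂² Q₃² / 1024` has only positive factors. Hence `Q₁` increases
strictly from its zero at the initial collision. -/
lemma vf_zero_pos {y : Fin 7 → ℝ} (hy : y ∈ box) : 0 < vf y 0 := by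
  rw [mem_box] at hy
  obtain ⟨-, ⟨h1, -⟩, ⟨h2, -⟩, ⟨h3, -⟩, -, -, ⟨h6, -⟩⟩ := hy
  have e : fieldPoly 0 = [(2, [6, 1, 1, 2, 2, 3])] := by decide +kernel
  have : 0 < y 1 := by linarith
  have : 0 < y 2 := by linarith
  have : 0 < y 3 := by linarith
  have : 0 < y 6 := by linarith
  have e' : vf y 0 = 2 * (y 6 * (y 1 * (y 1 * (y 2 * (y 2 * y 3))))) / 1024 := by
    rw [vf, Fin.val_zero, e]
    simp only [WPoly.evalR, List.map_cons, List.map_nil, List.prod_cons, List.prod_nil,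
      List.sum_cons, List.sum_nil, atoms]
    norm_num
    rfl
  rw [e']
  positivity

lemma restrict_mem_regDomain {y : Fin 7 → ℝ} (hy : y ∈ box) : restrict y ∈ regDomain := by
  rw [mem_box] at hy
  obtain ⟨-, ⟨h1, -⟩, ⟨h2, -⟩, -⟩ := hy
  have h1' : restrict y (Sum.inl 1) ≠ 0 := ne_of_gt (lt_of_lt_of_le (by norm_num) h1)
  have h2' : restrict y (Sum.inl 2) ≠ 0 := ne_of_gt (lt_of_lt_of_le (by norm_num) h2)
  intro i j hij
  fin_cases i <;> fin_cases j <;> first | exact absurd rfl hij | simp [h1', h2']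

lemma sum_extend_single (x : Phase) :
    ∑ j, x j • extend (Pi.single j 1 : Phase) 0 = extend x 0 := by
  ext i
  rw [Finset.sum_apply, sum_idx]
  fin_cases i <;> simp [extend]

/-- The initial direction of a variation in phase space. -/
def phaseDir (c : ℕ) : Phase := restrict (dir c)

/-- The solution of the shooting problem, with the constant `θ = σ / 1024` as the ratio of true to
local time; four pieces of length `2` give `τ = 8 θ`. The columns of the fundamental matrix are the
variations that start at the unit vectors of phase space. -/
lemma exists_twelfthOrbit : ∃ (α β θ : ℝ) (q : ℕ → ℝ → Phase) (X : ℕ → ℝ → Matrix Idx Idx ℝ),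
    |α - 3.1008822| < 1 / 10 ^ 6 ∧ |β - 0.6679233| < 1 / 10 ^ 6 ∧
    |96 * θ - 0.1247342| < 1 / 10 ^ 6 ∧ TwelfthOrbit α β θ q X ∧
    ∀ c ∈ ({0, 1, 3, 4} : Finset ℕ), ∀ i, |(X 3 1 *ᵥ phaseDir c) i -
      (endTable.getD c []).getD (emb i) 0 / 10 ^ 10| ≤ 2 / 10 ^ 6 := by
  obtain ⟨u, Y, δ, hu, hδ, hY, hb0, hb3, hb5⟩ := exists_shooting
  choose Z hZ hZ0 using fun j : Idx => exists_varies hδ hY (extend (Pi.single j 1) 0)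
  have hbox : ∀ k < 4, ∀ t ∈ Icc (-1 : ℝ) 1, Y k t ∈ box := fun k hk t ht =>
    norm_sub_le_curve ht ((hY.near k hk t ht).trans hδ)
  have hY6 := last_eq hY.joint hY.solves fun k t => vf_last _
  have hZ6 : ∀ j, ∀ k < 4, ∀ t ∈ Icc (-1 : ℝ) 1, Z j k t 6 = 0 := fun j k hk t ht => by
    rw [last_eq (hZ j).joint (hZ j).solves (fun k t => dvf_last _ _) k hk t ht, hZ0]
    rfl
  have hext : ∀ k < 4, ∀ t ∈ Icc (-1 : ℝ) 1, Y k t = extend (restrict (Y k t)) (Y 0 (-1) 6) :=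
    fun k hk t ht => by rw [← hY6 k hk t ht, extend_restrict]
  have hinit : ∀ i, Y 0 (-1) i = start i + (u 0 * dir 0 i + u 1 * dir 1 i + u 2 * dir 2 i) := by
    intro i
    rw [hY.initial, Pi.add_apply, sum_smul_apply]
    rfl
  have i0 : Y 0 (-1) 0 = 0 := by rw [hinit]; simp [start, startCoeff, dir, direction]
  have i1 := hinit 1
  have i2 := hinit 2
  have i3 : Y 0 (-1) 3 = √2 := by rw [hinit]; simp [start, dir, direction]
  have i4 := hinit 4
  have i5 := hinit 5
  have i6 := hinit 6
  have u0 := abs_le.1 ((norm_le_pi_norm u 0).trans hu)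
  have u1 := abs_le.1 ((norm_le_pi_norm u 1).trans hu)
  have u2 := abs_le.1 ((norm_le_pi_norm u 2).trans hu)
  have n1 : (1 : Fin 7) ≠ 3 := by decide
  have n2 : (2 : Fin 7) ≠ 3 := by decide
  have n4 : (4 : Fin 7) ≠ 3 := by decide
  have n5 : (5 : Fin 7) ≠ 3 := by decide
  have n6 : (6 : Fin 7) ≠ 3 := by decide
  norm_num [start, startCoeff, dir, direction, n1, n2, n4, n5, n6] at i1 i2 i4 i5 i6 u0 u1 u2
  have hmono : ∀ k < 4, StrictMonoOn (fun t => Y k t 0) (Icc (-1) 1) := by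
    intro k hk
    have hd : ∀ t ∈ Icc (-1 : ℝ) 1, HasDerivWithinAt (fun t => Y k t 0) (vf (Y k t) 0)
      (Icc (-1) 1) t := fun t ht => hasDerivWithinAt_pi.1 (hY.solves k hk t ht) 0
    refine strictMonoOn_of_deriv_pos (convex_Icc _ _)
      (fun t ht => (hd t ht).continuousWithinAt) fun t ht => ?_
    rw [interior_Icc] at ht
    rw [((hd t (Ioo_subset_Icc_self ht)).hasDerivAt (Icc_mem_nhds ht.1 ht.2)).deriv]
    exact vf_zero_pos (hbox k hk t (Ioo_subset_Icc_self ht))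
  have hpos : ∀ k < 4, (k = 0 ∨ 0 < Y k (-1) 0) ∧ 0 < Y k 1 0 := by
    intro k
    induction k with
    | zero =>
      intro hk
      have h1 := hmono 0 hk (by norm_num) (by norm_num) (show (-1 : ℝ) < 1 by norm_num)
      simp only [i0] at h1
      exact ⟨Or.inl rfl, h1⟩
    | succ k ih =>
      intro hk
      have h1 := hmono (k + 1) hk (by norm_num) (by norm_num) (show (-1 : ℝ) < 1 by norm_num)
      have h2 := (ih (by omega)).2
      rw [← hY.joint] at h2
      exact ⟨Or.inr h2, h2.trans h1⟩
  refine ⟨Y 0 (-1) 1, Y 0 (-1) 5, Y 0 (-1) 6 / 1024, fun k t => restrict (Y k t),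
    fun k t => Matrix.of fun i j => Z j k t (emb i), ?_, ?_, ?_, ⟨fun k hk => ⟨fun t ht => ?_,
    fun t ht => ?_, fun t ht i j => ?_⟩, fun k => ?_, fun k => ?_, ?_, ?_, ?_, fun k hk t ht => ?_,
    fun k hk t ht => ?_, fun k hk t ht => ?_⟩, fun c hc i => ?_⟩
  · rw [abs_lt]
    norm_num
    constructor <;> linarith
  · rw [abs_lt]
    norm_num
    constructor <;> linarith
  · rw [abs_lt]
    norm_num
    constructor <;> linarith
  · exact restrict_mem_regDomain (hbox k hk t ht)
  · rw [hasDerivWithinAt_pi]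
    intro i
    have h1 := hasDerivWithinAt_pi.1 (hY.solves k hk t ht) (emb i)
    have h2 := vf_extend (restrict_mem_regDomain (hbox k hk t ht)) (Y 0 (-1) 6) i
    rw [← hext k hk t ht] at h2
    exact h1.congr_deriv h2
  · have h1 := hasDerivWithinAt_pi.1 ((hZ j).solves k hk t ht) (emb i)
    have h2 := dvf_extend (restrict_mem_regDomain (hbox k hk t ht)) (Y 0 (-1) 6)
      (restrict (Z j k t)) i
    have h3 := extend_restrict (Z j k t)
    rw [hZ6 j k hk t ht] at h3
    rw [← hext k hk t ht, h3] at h2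
    exact h1.congr_deriv h2
  · simp only [hY.joint]
  · ext i j
    change Z j (k + 1) (-1) (emb i) = _
    rw [(hZ j).joint]
    rfl
  · ext i
    revert i
    rw [forall_idx]
    refine ⟨⟨i0, rfl, ?_⟩, i3, ?_, rfl⟩
    · change Y 0 (-1) 2 = Y 0 (-1) 1
      linarith
    · change Y 0 (-1) 4 = -Y 0 (-1) 5
      linarith
  · ext i j
    change Z j 0 (-1) (emb i) = _
    rw [hZ0]
    change restrict (extend _ 0) i = _
    rw [restrict_extend, Pi.single_apply, Matrix.one_apply]
  · rw [Sr_mulVec]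
    ext i
    revert i
    rw [forall_idx]
    refine ⟨⟨hb0.symm, hb0, rfl⟩, ?_, ?_, ?_⟩
    · change -Y 3 1 4 = Y 3 1 3
      linarith
    · change -Y 3 1 3 = Y 3 1 4
      linarith
    · change -Y 3 1 5 = Y 3 1 5
      linarith
  · by_cases h : k = 0 ∧ t = -1
    · exact Or.inl h
    · refine Or.inr ?_
      change 0 < Y k t 0
      rcases ht.1.eq_or_lt with h1 | h1
      · rw [← h1]
        exact (hpos k hk).1.resolve_left fun h0 => h ⟨h0, h1.symm⟩
      · have h2 := hmono k hk (by norm_num) ht h1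
        refine lt_of_le_of_lt ?_ h2
        rcases (hpos k hk).1 with rfl | h3
        · exact i0.ge
        · exact h3.le
  · exact lt_of_lt_of_le (by norm_num) (mem_box.1 (hbox k hk t ht)).2.1.1
  · exact lt_of_lt_of_le (by norm_num) (mem_box.1 (hbox k hk t ht)).2.2.1.1
  · have hc5 : c < 5 := by
      fin_cases hc <;> norm_num
    -- The direction `c = 2` is that of `σ` and does not come from phase space, so it is not among
    -- the values of `c`.
    have hdir : extend (phaseDir c) 0 = dir c := by
      rw [← extend_restrict (dir c), phaseDir]
      congr 1
      fin_cases hc <;> simp [dir, direction]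
    -- By linearity this combination of columns is the variation starting at `dir c`, so it can be
    -- compared with the stored approximation.
    have hV : Varies Y fun k t => ∑ j, phaseDir c j • Z j k t := by
      refine ⟨fun k => ?_, fun k hk t ht => ?_⟩
      · simp only [(hZ _).joint]
      · simp only [map_sum, map_smul]
        exact HasDerivWithinAt.fun_sum fun j _ => ((hZ j).solves k hk t ht).const_smul (phaseDir c j)
    have h1 := norm_variation_sub_le hδ hY hV hc5 (by
      simp only [hZ0]
      rw [sum_extend_single, hdir])
    have h2 := (norm_le_pi_norm _ (emb i)).trans h1
    have h3 := abs_variation_sub_le hc5 (emb i)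
    have h4 : ((Matrix.of fun i j => Z j 3 1 (emb i)) *ᵥ phaseDir c) i =
        (∑ j, phaseDir c j • Z j 3 1) (emb i) := by
      rw [Finset.sum_apply, Matrix.mulVec, dotProduct]
      exact Finset.sum_congr rfl fun j _ => mul_comm _ _
    rw [h4]
    refine (abs_sub_le _ _ _).trans ((add_le_add h2 h3).trans (by norm_num))

end

/-! ### The symmetries acting on solutions, and the orbit on `[0, 2 τ]` -/

section

open Set

lemma hasDerivWithinAt_mulVec {q : ℝ → Phase} {q' : Phase} {s : Set ℝ} {t : ℝ}
    (h : HasDerivWithinAt q q' s t) (S : Matrix Idx Idx ℝ) :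
    HasDerivWithinAt (fun t => S *ᵥ q t) (S *ᵥ q') s t := by
  rw [hasDerivWithinAt_pi] at h ⊢
  simp only [Matrix.mulVec, dotProduct]
  exact fun i => HasDerivWithinAt.fun_sum fun j _ => (h j).const_mul _

lemma hasDerivWithinAt_mul {X : ℝ → Matrix Idx Idx ℝ} {X' : Matrix Idx Idx ℝ} {s : Set ℝ} {t : ℝ}
    (h : ∀ i j, HasDerivWithinAt (fun t => X t i j) (X' i j) s t) (S C : Matrix Idx Idx ℝ) (i j) :
    HasDerivWithinAt (fun t => (S * X t * C) i j) ((S * X' * C) i j) s t := by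
  simp only [Matrix.mul_apply]
  exact HasDerivWithinAt.fun_sum fun k _ =>
    (HasDerivWithinAt.fun_sum fun l _ => (h l k).const_mul _).mul_const _

namespace Segment

variable {θ : ℝ} {q : ℝ → Phase} {X : ℝ → Matrix Idx Idx ℝ}

lemma mul_right (h : Segment θ q X) (C : Matrix Idx Idx ℝ) : Segment θ q fun t => X t * C :=
  ⟨h.mem, h.deriv, fun t ht i j => by
    have h1 := hasDerivWithinAt_mul (h.derivMat t ht) 1 C i j
    simp only [Matrix.one_mul, Matrix.smul_mul, Matrix.mul_assoc] at h1
    exact h1⟩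

lemma symmetry (h : Segment θ q X) : Segment θ (fun t => Sf *ᵥ q t) fun t => Sf * X t :=
  ⟨fun t ht => Sf_mem_regDomain (h.mem t ht), fun t ht => by
    rw [hamVec_Sf, ← Matrix.mulVec_smul]
    exact hasDerivWithinAt_mulVec (h.deriv t ht) Sf, fun t ht i j => by
    have h1 := hasDerivWithinAt_mul (h.derivMat t ht) Sf 1 i j
    simp only [Matrix.mul_one, Matrix.mul_smul] at h1
    rwa [← Matrix.mul_assoc, ← hamJac_Sf (h.mem t ht), Matrix.mul_assoc] at h1⟩

lemma symmetry_pow (h : Segment θ q X) (n : ℕ) :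
    Segment θ (fun t => Sf ^ n *ᵥ q t) fun t => Sf ^ n * X t := by
  induction n with
  | zero => simpa using h
  | succ n ih => simpa [pow_succ', Matrix.mul_assoc, Matrix.mulVec_mulVec] using ih.symmetry

/-- The minus sign from `t ↦ -t` cancels the one by which `S_r` reverses the Hamiltonian field and
its linearization. -/
lemma reverse (h : Segment θ q X) :
    Segment θ (fun t => Sr *ᵥ q (-t)) fun t => Sr * X (-t) := by
  have hneg : ∀ t ∈ Icc (-1 : ℝ) 1, -t ∈ Icc (-1 : ℝ) 1 := fun t ht =>
    ⟨by linarith [ht.2], by linarith [ht.1]⟩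
  have hd : ∀ t, HasDerivWithinAt (fun t : ℝ => -t) (-1) (Icc (-1) 1) t := fun t =>
    (hasDerivAt_neg t).hasDerivWithinAt
  refine ⟨fun t ht => Sr_mem_regDomain (h.mem _ (hneg t ht)), fun t ht => ?_, fun t ht i j => ?_⟩
  · have h1 := hasDerivWithinAt_mulVec
      (HasDerivWithinAt.scomp t (h.deriv _ (hneg t ht)) (hd t) hneg) Sr
    rw [hamVec_Sr, smul_neg, ← Matrix.mulVec_smul, ← Matrix.mulVec_neg]
    rwa [neg_one_smul] at h1
  · have h1 := hasDerivWithinAt_mul (X := fun t => X (-t)) (fun i j =>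
      (HasDerivWithinAt.scomp t (h.derivMat _ (hneg t ht) i j) (hd t) hneg).congr_deriv
        (neg_one_smul ℝ _) ) Sr 1 i j (X' := -(θ • (hamJac (q (-t)) * X (-t))))
    simp only [Matrix.mul_one, Matrix.mul_smul, Matrix.mul_neg] at h1
    refine h1.congr_deriv ?_
    rw [← Matrix.mul_assoc (hamJac _), hamJac_Sr (h.mem _ (hneg t ht)), Matrix.neg_mul, smul_neg,
      Matrix.mul_assoc]

end Segment

lemma Sf_pow_three : Sf ^ 3 = -1 := by
  rw [pow_succ, pow_two, Sf, fromBlocks_multiply, fromBlocks_multiply, ← fromBlocks_one,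
    fromBlocks_neg]
  congr 1 <;> ext i j <;> fin_cases i <;> fin_cases j <;> simp

lemma Sf_pow_six : Sf ^ 6 = 1 := by
  rw [show 6 = 3 * 2 by norm_num, pow_mul, Sf_pow_three, neg_one_sq]

namespace TwelfthOrbit

variable {α β θ : ℝ} {q : ℕ → ℝ → Phase} {X : ℕ → ℝ → Matrix Idx Idx ℝ}

/-- `S_f` and `S_r` send the initial collision to the same point. Therefore the end of the reflected
orbit is the image of its beginning under `S_f`, and the orbit can be continued by symmetry. -/
lemma Sf_initial (h : TwelfthOrbit α β θ q X) : Sf *ᵥ q 0 (-1) = point α 0 α β (-√2) (-β) := by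
  rw [h.initial, Sf_mulVec]
  simp [point]

lemma Sr_initial (h : TwelfthOrbit α β θ q X) : Sr *ᵥ q 0 (-1) = point α 0 α β (-√2) (-β) := by
  rw [h.initial, Sr_mulVec]
  simp [point]

/-- The orbit on `[0, 2 τ]`, in eight parts. -/
def doubleCurve (q : ℕ → ℝ → Phase) (n : ℕ) (t : ℝ) : Phase :=
  if n < 4 then q n t else Sr *ᵥ q (7 - n) (-t)

/-- The fundamental matrix on `[0, 2 τ]`, in eight parts. -/
def doubleMat (X : ℕ → ℝ → Matrix Idx Idx ℝ) (n : ℕ) (t : ℝ) : Matrix Idx Idx ℝ :=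
  if n < 4 then X n t else Sr * X (7 - n) (-t) * ((X 3 1)⁻¹ * Sr * X 3 1)

/-- The fundamental matrix at `2 τ`, up to the symmetry. -/
def halfMat (X : ℕ → ℝ → Matrix Idx Idx ℝ) : Matrix Idx Idx ℝ :=
  Sfᵀ * (Sr * ((X 3 1)⁻¹ * Sr * X 3 1))

lemma segment_double (h : TwelfthOrbit α β θ q X) {n : ℕ} (hn : n < 8) :
    Segment θ (doubleCurve q n) (doubleMat X n) := by
  unfold doubleCurve doubleMat
  by_cases h4 : n < 4
  · simpa only [h4, if_true] using h.segment n h4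
  · simpa only [h4, if_false] using (h.segment (7 - n) (by omega)).reverse.mul_right _

/-- Away from the middle the joints are those of the first four pieces, traversed backwards after
the reflection. -/
lemma joint_double (h : TwelfthOrbit α β θ q X) (hX : IsUnit (X 3 1).det) {n : ℕ} (hn : n < 7) :
    doubleCurve q n 1 = doubleCurve q (n + 1) (-1) ∧
      doubleMat X n 1 = doubleMat X (n + 1) (-1) := by
  unfold doubleCurve doubleMat
  rcases lt_trichotomy n 3 with h3 | rfl | h3
  · rw [if_pos (by omega), if_pos (by omega), if_pos (by omega), if_pos (by omega), h.joint,
      h.jointMat]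
    exact ⟨rfl, rfl⟩
  -- At the middle the curve is continuous because its point is fixed by `S_r`. The right factor
  -- `X⁻¹ S_r X` in `doubleMat` is the one that makes the reflected matrix `S_r X (X⁻¹ S_r X)` equal
  -- to `X` there.
  · norm_num
    refine ⟨h.final.symm, ?_⟩
    rw [Matrix.mul_assoc, ← Matrix.mul_assoc (X 3 1), ← Matrix.mul_assoc (X 3 1),
      Matrix.mul_nonsing_inv _ hX, Matrix.one_mul, ← Matrix.mul_assoc, Sr_mul_self, Matrix.one_mul]
  · rw [if_neg (by omega), if_neg (by omega), if_neg (by omega), if_neg (by omega), neg_neg]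
    have e : 7 - n = (7 - (n + 1)) + 1 := by omega
    rw [e, h.joint, h.jointMat]
    exact ⟨rfl, rfl⟩

/-- At time `2 τ` the reflected matrix is `S_r X⁻¹ S_r X`, since `X` starts at the identity.
Splitting off `S_f` leaves `halfMat`, the factor gained in every period of the symmetry. -/
lemma last_double (h : TwelfthOrbit α β θ q X) :
    doubleCurve q 7 1 = Sf *ᵥ doubleCurve q 0 (-1) ∧ doubleMat X 7 1 = Sf * halfMat X := by
  unfold doubleCurve doubleMat halfMat
  norm_num
  rw [h.initialMat, Matrix.mul_one, ← Matrix.mul_assoc Sf, Sf_mul_transpose, Matrix.one_mul,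
    h.Sf_initial, h.Sr_initial]
  exact ⟨rfl, rfl⟩

end TwelfthOrbit

end

/-! ### Symplecticity of the linearized flow -/

section

open Set

lemma contDiffAt_regHam (E : ℝ) {x : Phase} (hx : x ∈ regDomain) :
    ContDiffAt ℝ 2 (regHam E) x := by
  have h : ∀ i j : Fin 3, i ≠ j → 0 < x (Sum.inl i) ^ 4 + x (Sum.inl j) ^ 4 := by
    intro i j hij
    rcases hx i j hij with h | h <;> positivity
  have h01 := h 0 1 (by decide)
  have h02 := h 0 2 (by decide)
  have h12 := h 1 2 (by decide)
  have h012 : 0 < x (Sum.inl 0) ^ 4 + x (Sum.inl 1) ^ 4 + x (Sum.inl 2) ^ 4 := by positivity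
  have hs1 := (Real.sqrt_pos.2 h01).ne'
  have hs2 := (Real.sqrt_pos.2 h02).ne'
  have hs3 := (Real.sqrt_pos.2 h12).ne'
  have hs4 := (Real.sqrt_pos.2 h012).ne'
  unfold regHam
  simp only
  fun_prop (disch := first | exact h01.ne' | exact h02.ne' | exact h12.ne' | exact h012.ne' |
    assumption)

lemma hess_symm {x : Phase} (hx : x ∈ regDomain) :
    (hess (regHam (-1)) x)ᵀ = hess (regHam (-1)) x := by
  have hc := contDiffAt_regHam (-1) hx
  have hs := hc.isSymmSndFDerivAt (by simp)
  have hd : DifferentiableAt ℝ (fderiv ℝ (regHam (-1))) x :=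
    (hc.fderiv_right (m := 1) (by norm_num)).differentiableAt (by norm_num)
  ext i j
  simp only [Matrix.transpose_apply, hess, Matrix.of_apply, grad]
  rw [fderiv_clm_apply hd (differentiableAt_const _), fderiv_clm_apply hd (differentiableAt_const _)]
  simpa using hs (Pi.single i 1) (Pi.single j 1)

lemma symJ_transpose : symJᵀ = -symJ := by
  simp [symJ, fromBlocks_transpose, fromBlocks_neg]

lemma symJ_mul_self : symJ * symJ = -1 := by
  simp [symJ, fromBlocks_multiply, ← fromBlocks_one, fromBlocks_neg]

/-- This is the infinitesimal symplectic condition for `J D²H`; it uses the symmetry of the Hessian,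
`Jᵀ = -J` and `J² = -1`. -/
lemma hamJac_symplectic {x : Phase} (hx : x ∈ regDomain) :
    (hamJac x)ᵀ * symJ + symJ * hamJac x = 0 := by
  rw [hamJac, Matrix.transpose_mul, hess_symm hx, symJ_transpose, Matrix.mul_assoc, Matrix.neg_mul,
    ← Matrix.mul_assoc symJ, symJ_mul_self]
  simp

/-- By the chain rule, the Hamiltonian field along a solution is itself a solution of the linearized
equation. -/
lemma hasDerivWithinAt_hamVec {q : ℝ → Phase} {q' : Phase} {s : Set ℝ} {t : ℝ}
    (hq : HasDerivWithinAt q q' s t) (hx : q t ∈ regDomain) :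
    HasDerivWithinAt (fun t => hamVec (q t)) (hamJac (q t) *ᵥ q') s t := by
  have h : HasDerivWithinAt (fun t => grad (regHam (-1)) (q t)) (hess (regHam (-1)) (q t) *ᵥ q')
      s t := by
    rw [hasDerivWithinAt_pi]
    intro i
    refine ((differentiableAt_grad hx i).hasFDerivAt.comp_hasDerivWithinAt t hq).congr_deriv ?_
    rw [fderiv_apply_eq_sum]
    exact Finset.sum_congr rfl fun j _ => mul_comm _ _
  rw [hamJac, ← Matrix.mulVec_mulVec]
  exact hasDerivWithinAt_mulVec h symJ

/-- Solutions of a linear Hamiltonian system have constant symplectic products. -/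
lemma transpose_mul_symJ_mul_eq {A X Y : ℝ → Matrix Idx Idx ℝ}
    (hA : ∀ t ∈ Icc (-1 : ℝ) 1, (A t)ᵀ * symJ + symJ * A t = 0)
    (hX : ∀ t ∈ Icc (-1 : ℝ) 1, ∀ i j,
      HasDerivWithinAt (fun t => X t i j) ((A t * X t) i j) (Icc (-1) 1) t)
    (hY : ∀ t ∈ Icc (-1 : ℝ) 1, ∀ i j,
      HasDerivWithinAt (fun t => Y t i j) ((A t * Y t) i j) (Icc (-1) 1) t)
    {t : ℝ} (ht : t ∈ Icc (-1) 1) : (X t)ᵀ * symJ * Y t = (X (-1))ᵀ * symJ * Y (-1) := by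
  ext i j
  have hd : ∀ t ∈ Icc (-1 : ℝ) 1, HasDerivWithinAt (fun t => ((X t)ᵀ * symJ * Y t) i j) 0
      (Icc (-1) 1) t := by
    intro t ht
    have h1 : ((A t * X t)ᵀ * symJ * Y t + (X t)ᵀ * symJ * (A t * Y t)) i j = 0 := by
      -- The two terms of the product rule combine to `Xᵀ (Aᵀ J + J A) Y`, which vanishes.
      have e : (A t * X t)ᵀ * symJ * Y t + (X t)ᵀ * symJ * (A t * Y t) =
          (X t)ᵀ * ((A t)ᵀ * symJ + symJ * A t) * Y t := by
        rw [Matrix.transpose_mul]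
        noncomm_ring
      rw [e, hA t ht]
      simp
    rw [← h1]
    simp only [Matrix.mul_apply, Matrix.add_apply, Matrix.transpose_apply]
    rw [← Finset.sum_add_distrib]
    refine HasDerivWithinAt.fun_sum fun k _ => ?_
    refine HasDerivWithinAt.fun_mul (HasDerivWithinAt.fun_sum fun l _ => ?_) ?_
    · simpa only [Matrix.mul_apply] using (hX t ht l i).mul_const (symJ l k)
    · simpa only [Matrix.mul_apply] using hY t ht k j
  have h := norm_le_of_norm_deriv_le
    (w := fun t => ((X t)ᵀ * symJ * Y t) i j - ((X (-1))ᵀ * symJ * Y (-1)) i j) (w' := fun _ => 0)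
    le_rfl le_rfl (fun t ht => (hd t ht).sub_const _) (by simp)
    (fun t ht => by rw [norm_zero]; positivity) ht
  simp only [mul_zero, add_zero, norm_le_zero_iff] at h
  exact sub_eq_zero.1 h

namespace Segment

variable {θ : ℝ} {q : ℝ → Phase} {X : ℝ → Matrix Idx Idx ℝ}

lemma smul_hamJac_symplectic (h : Segment θ q X) {t : ℝ} (ht : t ∈ Icc (-1) 1) :
    (θ • hamJac (q t))ᵀ * symJ + symJ * (θ • hamJac (q t)) = 0 := by
  rw [Matrix.transpose_smul, Matrix.smul_mul, Matrix.mul_smul, ← smul_add,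
    hamJac_symplectic (h.mem t ht), smul_zero]

lemma transpose_mul_symJ_mul_self (h : Segment θ q X) {t : ℝ} (ht : t ∈ Icc (-1) 1) :
    (X t)ᵀ * symJ * X t = (X (-1))ᵀ * symJ * X (-1) := by
  have hX : ∀ t ∈ Icc (-1 : ℝ) 1, ∀ i j, HasDerivWithinAt (fun t => X t i j)
      ((θ • hamJac (q t) * X t) i j) (Icc (-1) 1) t := by
    simpa only [Matrix.smul_mul] using h.derivMat
  exact transpose_mul_symJ_mul_eq (fun t ht => h.smul_hamJac_symplectic ht) hX hX ht

lemma transpose_mul_symJ_mulVec (h : Segment θ q X) {t : ℝ} (ht : t ∈ Icc (-1) 1) :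
    ((X t)ᵀ * symJ) *ᵥ hamVec (q t) = ((X (-1))ᵀ * symJ) *ᵥ hamVec (q (-1)) := by
  have hX : ∀ t ∈ Icc (-1 : ℝ) 1, ∀ i j, HasDerivWithinAt (fun t => X t i j)
      ((θ • hamJac (q t) * X t) i j) (Icc (-1) 1) t := by
    simpa only [Matrix.smul_mul] using h.derivMat
  -- The vector solution is repeated in every column, so that the conservation law for matrices
  -- applies.
  have hY : ∀ t ∈ Icc (-1 : ℝ) 1, ∀ i j : Idx, HasDerivWithinAt
      (fun t => (Matrix.of fun i (_ : Idx) => hamVec (q t) i) i j)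
      ((θ • hamJac (q t) * Matrix.of fun i (_ : Idx) => hamVec (q t) i) i j) (Icc (-1) 1) t := by
    intro t ht i j
    have h1 := hasDerivWithinAt_pi.1 (hasDerivWithinAt_hamVec (h.deriv t ht) (h.mem t ht)) i
    refine h1.congr_deriv ?_
    rw [Matrix.mulVec_smul, ← Matrix.smul_mulVec]
    rfl
  have h2 := transpose_mul_symJ_mul_eq (fun t ht => h.smul_hamJac_symplectic ht) hX hY ht
  ext i
  exact congrFun (congrFun h2 i) (Sum.inl 0)

end Segment

namespace TwelfthOrbit

variable {α β θ : ℝ} {q : ℕ → ℝ → Phase} {X : ℕ → ℝ → Matrix Idx Idx ℝ}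

/-- Conservation on each piece is traced back through the joints to the initial time, where the
fundamental matrix is the identity. -/
lemma symplectic_one (h : TwelfthOrbit α β θ q X) {k : ℕ} (hk : k < 4) :
    (X k 1)ᵀ * symJ * X k 1 = symJ ∧ ((X k 1)ᵀ * symJ) *ᵥ hamVec (q k 1) =
      symJ *ᵥ hamVec (q 0 (-1)) := by
  have h1 := (h.segment k hk).transpose_mul_symJ_mul_self (t := 1) (by norm_num)
  have h2 := (h.segment k hk).transpose_mul_symJ_mulVec (t := 1) (by norm_num)
  rw [h1, h2]
  cases k with
  | zero => simp [h.initialMat]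
  | succ k =>
    rw [h.joint, h.jointMat]
    exact h.symplectic_one (k := k) (by omega)

lemma inv_eq (h : TwelfthOrbit α β θ q X) : (X 3 1)⁻¹ = -(symJ * (X 3 1)ᵀ * symJ) := by
  refine Matrix.inv_eq_left_inv ?_
  rw [Matrix.neg_mul, Matrix.mul_assoc, Matrix.mul_assoc, ← Matrix.mul_assoc (X 3 1)ᵀ,
    (h.symplectic_one (by norm_num)).1, symJ_mul_self, neg_neg]

lemma isUnit_det (h : TwelfthOrbit α β θ q X) : IsUnit (X 3 1).det := by
  refine Matrix.isUnit_det_of_left_inverse (B := -(symJ * (X 3 1)ᵀ * symJ)) ?_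
  rw [Matrix.neg_mul, Matrix.mul_assoc, Matrix.mul_assoc, ← Matrix.mul_assoc (X 3 1)ᵀ,
    (h.symplectic_one (by norm_num)).1, symJ_mul_self, neg_neg]

/-- The linearized flow transports the flow direction. The conserved product `Xᵀ J f(γ(τ)) = J
f(γ(0))` is multiplied by `X J`, and `X J Xᵀ J = -1` for symplectic `X`. -/
lemma mulVec_hamVec (h : TwelfthOrbit α β θ q X) :
    X 3 1 *ᵥ hamVec (q 0 (-1)) = hamVec (q 3 1) := by
  have h2 := congrArg (fun v => (X 3 1) *ᵥ (symJ *ᵥ v)) (h.symplectic_one (k := 3) (by norm_num)).2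
  have h3 : X 3 1 * (symJ * ((X 3 1)ᵀ * symJ)) = -1 := by
    have := Matrix.mul_nonsing_inv _ h.isUnit_det
    rw [h.inv_eq, Matrix.mul_neg, neg_eq_iff_eq_neg] at this
    rwa [← Matrix.mul_assoc symJ]
  simp only [Matrix.mulVec_mulVec, symJ_mul_self, h3, Matrix.neg_mulVec, Matrix.one_mulVec,
    Matrix.mulVec_neg] at h2
  exact (neg_inj.1 h2).symm

end TwelfthOrbit

end

/-! ### The whole orbit -/

section

open Set

lemma isUnit_det_Sf : IsUnit Sf.det := Matrix.isUnit_det_of_right_inverse Sf_mul_transpose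

lemma isUnit_det_Sr : IsUnit Sr.det := Matrix.isUnit_det_of_right_inverse Sr_mul_self

/-- Because `S_f⁶ = 1`, integer powers reduce to natural ones, for which the invariance of solutions
is known by induction. -/
lemma exists_Sf_zpow_eq_pow (a : ℤ) : ∃ n : ℕ, Sf ^ a = Sf ^ n := by
  refine ⟨(a % 6).toNat, ?_⟩
  conv_lhs => rw [← Int.mul_ediv_add_emod a 6]
  rw [Matrix.zpow_add isUnit_det_Sf, Matrix.zpow_mul _ isUnit_det_Sf,
    show (6 : ℤ) = ((6 : ℕ) : ℤ) from rfl, zpow_natCast, Sf_pow_six, Matrix.one_zpow,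
    Matrix.one_mul, ← zpow_natCast, Int.toNat_of_nonneg (Int.emod_nonneg _ (by norm_num))]

namespace TwelfthOrbit

variable {α β θ : ℝ} {q : ℕ → ℝ → Phase} {X : ℕ → ℝ → Matrix Idx Idx ℝ}

/-- The parts of the whole orbit. -/
def partCurve (q : ℕ → ℝ → Phase) (m : ℤ) (t : ℝ) : Phase :=
  Sf ^ (m / 8) *ᵥ doubleCurve q (m % 8).toNat t

/-- The parts of the fundamental matrix along the whole orbit. -/
def partMat (X : ℕ → ℝ → Matrix Idx Idx ℝ) (m : ℤ) (t : ℝ) : Matrix Idx Idx ℝ :=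
  Sf ^ (m / 8) * doubleMat X (m % 8).toNat t * halfMat X ^ (m / 8)

lemma isUnit_det_halfMat (h : TwelfthOrbit α β θ q X) : IsUnit (halfMat X).det := by
  have hX := h.isUnit_det
  have hX' := Matrix.isUnit_nonsing_inv_det _ hX
  have hf : IsUnit Sfᵀ.det := by rw [Matrix.det_transpose]; exact isUnit_det_Sf
  rw [halfMat]
  simp only [Matrix.det_mul]
  exact hf.mul (isUnit_det_Sr.mul ((hX'.mul isUnit_det_Sr).mul hX))

lemma segment_part (h : TwelfthOrbit α β θ q X) (m : ℤ) :
    Segment θ (partCurve q m) (partMat X m) := by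
  obtain ⟨n, hn⟩ := exists_Sf_zpow_eq_pow (m / 8)
  have h1 := ((h.segment_double (n := (m % 8).toNat) (by omega)).symmetry_pow n).mul_right
    (halfMat X ^ (m / 8))
  rw [← hn] at h1
  exact h1

lemma joint_part (h : TwelfthOrbit α β θ q X) (m : ℤ) :
    partCurve q m 1 = partCurve q (m + 1) (-1) ∧ partMat X m 1 = partMat X (m + 1) (-1) := by
  unfold partCurve partMat
  -- Only the passage from one group of eight parts to the next involves the symmetry: there `S_f ^
  -- k (S_f halfMat) halfMat ^ k` equals `S_f ^ (k + 1) halfMat ^ (k + 1)`.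
  by_cases h7 : m % 8 = 7
  · have e1 : (m + 1) / 8 = m / 8 + 1 := by omega
    have e2 : (m + 1) % 8 = 0 := by omega
    have e3 : doubleMat X 0 (-1) = 1 := by simp [doubleMat, h.initialMat]
    have e4 : (7 : ℤ).toNat = 7 := rfl
    have e5 : halfMat X ^ (m / 8) * halfMat X = halfMat X * halfMat X ^ (m / 8) := by
      rw [← Matrix.zpow_add_one h.isUnit_det_halfMat, ← Matrix.zpow_one_add h.isUnit_det_halfMat,
        add_comm]
    rw [e1, e2, h7, Int.toNat_zero, e4, h.last_double.1, h.last_double.2, Matrix.mulVec_mulVec,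
      Matrix.zpow_add_one isUnit_det_Sf, Matrix.zpow_add_one h.isUnit_det_halfMat, e3,
      e5]
    refine ⟨rfl, ?_⟩
    noncomm_ring
  · have e1 : (m + 1) / 8 = m / 8 := by omega
    have e2 : ((m + 1) % 8).toNat = (m % 8).toNat + 1 := by omega
    obtain ⟨h1, h2⟩ := h.joint_double h.isUnit_det (n := (m % 8).toNat) (by omega)
    rw [e1, e2, h1, h2]
    exact ⟨rfl, rfl⟩

lemma partCurve_add_eight (q : ℕ → ℝ → Phase) (m : ℤ) (t : ℝ) :
    partCurve q (m + 8) t = Sf *ᵥ partCurve q m t := by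
  unfold partCurve
  have e1 : (m + 8) / 8 = 1 + m / 8 := by omega
  have e2 : (m + 8) % 8 = m % 8 := by omega
  rw [e1, e2, Matrix.zpow_one_add isUnit_det_Sf, Matrix.mulVec_mulVec]

/-- The whole orbit, in the time scaled by `θ`. -/
def wholeCurve (q : ℕ → ℝ → Phase) : ℝ → Phase := glue (partCurve q)

/-- The fundamental matrix along the whole orbit, in the time scaled by `θ`. -/
def wholeMat (X : ℕ → ℝ → Matrix Idx Idx ℝ) : ℝ → Matrix Idx Idx ℝ := glue (partMat X)

lemma exists_eq_part (q : ℕ → ℝ → Phase) (X : ℕ → ℝ → Matrix Idx Idx ℝ) (u : ℝ) : ∃ m : ℤ, ∃ t ∈ Icc (-1 : ℝ) 1,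
    u = 2 * m + 1 + t ∧ wholeCurve q u = partCurve q m t ∧ wholeMat X u = partMat X m t := by
  have h1 := Int.floor_le (u / 2)
  have h2 := Int.lt_floor_add_one (u / 2)
  have ht : u - 2 * ⌊u / 2⌋ - 1 ∈ Icc (-1 : ℝ) 1 := ⟨by linarith, by linarith⟩
  refine ⟨⌊u / 2⌋, u - 2 * ⌊u / 2⌋ - 1, ht, by ring, rfl, rfl⟩

lemma wholeCurve_add (q : ℕ → ℝ → Phase) (u : ℝ) :
    wholeCurve q (u + 16) = Sf *ᵥ wholeCurve q u := by
  have e : ⌊(u + 16) / 2⌋ = ⌊u / 2⌋ + 8 := by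
    rw [show (u + 16) / 2 = u / 2 + (8 : ℤ) by push_cast; ring, Int.floor_add_intCast]
  rw [wholeCurve, glue, glue, e, partCurve_add_eight]
  congr 2
  push_cast
  ring

/-- In the scaled time `2 τ` is `16`, so `48` is `6 τ`, three applications of `S_f`, and `S_f³ =
-1`. -/
lemma wholeCurve_add_half (q : ℕ → ℝ → Phase) (u : ℝ) :
    wholeCurve q (u + 48) = -wholeCurve q u := by
  rw [show u + 48 = u + 16 + 16 + 16 by ring, wholeCurve_add, wholeCurve_add, wholeCurve_add,
    Matrix.mulVec_mulVec, Matrix.mulVec_mulVec, ← pow_two, ← pow_succ,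
    Sf_pow_three, Matrix.neg_mulVec, Matrix.one_mulVec]

lemma hasDerivAt_whole (h : TwelfthOrbit α β θ q X) (u : ℝ) :
    wholeCurve q u ∈ regDomain ∧
    HasDerivAt (wholeCurve q) (θ • hamVec (wholeCurve q u)) u ∧
    ∀ i j, HasDerivAt (fun u => wholeMat X u i j)
      ((θ • (hamJac (wholeCurve q u) * wholeMat X u)) i j) u := by
  obtain ⟨m, t, ht, e, e1, e2⟩ := exists_eq_part q X u
  rw [e1, e2]
  refine ⟨(h.segment_part m).mem t ht, ?_, fun i j => ?_⟩
  · rw [e]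
    exact hasDerivAt_glue (g' := fun m t => θ • hamVec (partCurve q m t))
      (fun m => (h.joint_part m).1) (fun m => by rw [(h.joint_part m).1])
      (fun m t ht => (h.segment_part m).deriv t ht) m ht
  · rw [e]
    exact hasDerivAt_glue (g := fun m t => partMat X m t i j)
      (g' := fun m t => (θ • (hamJac (partCurve q m t) * partMat X m t)) i j)
      (fun m => by rw [(h.joint_part m).2])
      (fun m => by rw [(h.joint_part m).1, (h.joint_part m).2])
      (fun m t ht => (h.segment_part m).derivMat t ht i j) m ht

lemma wholeCurve_zero (h : TwelfthOrbit α β θ q X) :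
    wholeCurve q 0 = point 0 α α (√2) (-β) β := by
  rw [← h.initial, show (0 : ℝ) = 2 * (0 : ℤ) + 1 + -1 by norm_num, wholeCurve,
    glue_apply (fun m => (h.joint_part m).1) 0 (by norm_num)]
  simp [partCurve, doubleCurve]

/-- For `k = 6` the power of `S_f` disappears and the monodromy matrix is the sixth power of
`halfMat`. -/
lemma wholeMat_mul (h : TwelfthOrbit α β θ q X) (k : ℕ) :
    wholeMat X (16 * k) = Sf ^ k * halfMat X ^ k := by
  rw [show (16 * k : ℝ) = 2 * (8 * k : ℤ) + 1 + -1 by push_cast; ring, wholeMat,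
    glue_apply (fun m => (h.joint_part m).2) _ (by norm_num)]
  simp [partMat, doubleMat, h.initialMat]

lemma wholeMat_eight (h : TwelfthOrbit α β θ q X) : wholeMat X 8 = X 3 1 := by
  rw [show (8 : ℝ) = 2 * (3 : ℤ) + 1 + 1 by norm_num, wholeMat,
    glue_apply (fun m => (h.joint_part m).2) _ (by norm_num)]
  simp [partMat, doubleMat]

/-- On the first half of `[0, 16]` these are the signs on the twelfth orbit. On the second half
`S_r` exchanges `Q₁` and `Q₂`, so the zero of `Q₁` at the start becomes a zero of `Q₂` at the end.
-/
lemma wholeCurve_pos (h : TwelfthOrbit α β θ q X) {u : ℝ} (hu : u ∈ Icc 0 16) :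
    (u = 0 ∨ 0 < wholeCurve q u (Sum.inl 0)) ∧ (u = 16 ∨ 0 < wholeCurve q u (Sum.inl 1)) ∧
      0 < wholeCurve q u (Sum.inl 2) := by
  obtain ⟨n, hn, t, ht, e⟩ : ∃ n : ℕ, n < 8 ∧ ∃ t ∈ Icc (-1 : ℝ) 1,
      u = 2 * (n : ℤ) + 1 + t := by
    rcases eq_or_lt_of_le hu.2 with rfl | hu2
    · exact ⟨7, by norm_num, 1, by norm_num, by norm_num⟩
    · have h0 : 0 ≤ u / 2 := by linarith [hu.1]
      have h1 := Nat.floor_le h0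
      have h2 := Nat.lt_floor_add_one (u / 2)
      refine ⟨⌊u / 2⌋₊, (Nat.floor_lt h0).2 (by push_cast; linarith), u - 2 * ⌊u / 2⌋₊ - 1,
        ⟨by linarith, by linarith⟩, by push_cast; ring⟩
  have e1 : wholeCurve q u = doubleCurve q n t := by
    rw [e, wholeCurve, glue_apply (fun m => (h.joint_part m).1) _ ht, partCurve]
    have h1 : (n : ℤ) / 8 = 0 := by omega
    have h2 : ((n : ℤ) % 8).toNat = n := by omega
    rw [h1, h2, zpow_zero, Matrix.one_mulVec]
  rw [e1, doubleCurve]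
  split_ifs with h4
  · refine ⟨?_, Or.inr (h.pos_snd n h4 t ht), h.pos_trd n h4 t ht⟩
    refine (h.pos_fst n h4 t ht).imp_left ?_
    rintro ⟨rfl, rfl⟩
    rw [e]
    norm_num
  · have ht' : -t ∈ Icc (-1 : ℝ) 1 := ⟨by linarith [ht.2], by linarith [ht.1]⟩
    rw [Sr_mulVec]
    refine ⟨Or.inr (h.pos_snd _ (by omega) _ ht'), ?_, h.pos_trd _ (by omega) _ ht'⟩
    refine (h.pos_fst _ (by omega) _ ht').imp_left ?_
    rintro ⟨h7, h8⟩
    obtain rfl : n = 7 := by omega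
    obtain rfl : t = 1 := neg_inj.1 h8
    rw [e]
    norm_num

/-- By the action of `S_f`, the coordinate `Q₁` on `[16, 32]` is `Q₃` on `[0, 16]`, and on `[32,
48]` it is `Q₂` on `[0, 16]`. The latter vanishes only at the right end, which is time `48`. -/
lemma isLeast_whole (h : TwelfthOrbit α β θ q X) :
    IsLeast {u : ℝ | 0 < u ∧ wholeCurve q u (Sum.inl 0) = 0} 48 := by
  refine ⟨⟨by norm_num, ?_⟩, fun u hu => ?_⟩
  · have := wholeCurve_add_half q 0
    rw [zero_add, h.wholeCurve_zero] at this
    rw [this]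
    simp [point]
  · obtain ⟨h0, hu⟩ := hu
    by_contra! hlt
    rcases le_total u 16 with h1 | h1
    · rcases (h.wholeCurve_pos ⟨h0.le, h1⟩).1 with h2 | h2 <;> linarith
    · rcases le_total u 32 with h2 | h2
      · have h3 := (h.wholeCurve_pos (u := u - 16) ⟨by linarith, by linarith⟩).2.2
        have h4 := wholeCurve_add q (u - 16)
        rw [sub_add_cancel, Sf_mulVec] at h4
        rw [h4] at hu
        exact h3.ne' hu
      · have h3 := (h.wholeCurve_pos (u := u - 32) ⟨by linarith, by linarith⟩).2.1
        have h4 := wholeCurve_add q (u - 32)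
        have h5 := wholeCurve_add q (u - 32 + 16)
        rw [show u - 32 + 16 + 16 = u by ring, h4, Sf_mulVec, Sf_mulVec] at h5
        rw [h5] at hu
        rcases h3 with h3 | h3
        · linarith
        · exact h3.ne' hu

/-- A period `P` is a positive zero of `Q₁`, so `P ≥ 48`. If `P = 48`, then `γ(0) = -γ(0)`, against
`α > 0`. Otherwise `γ(P - 48) = -γ(0)` makes `P - 48` a positive zero of `Q₁` as well, so it is at
least `48`. -/
lemma le_period (h : TwelfthOrbit α β θ q X) (hα : 0 < α) {P : ℝ} (hP : 0 < P)
    (hper : ∀ u, wholeCurve q (u + P) = wholeCurve q u) : 96 ≤ P := by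
  by_contra! hlt
  have h0 : wholeCurve q P = wholeCurve q 0 := by rw [← hper 0, zero_add]
  have h1 := h.wholeCurve_zero
  have h2 : (48 : ℝ) ≤ P := h.isLeast_whole.2 ⟨hP, by rw [h0, h1]; rfl⟩
  have h3 := wholeCurve_add_half q (P - 48)
  rw [sub_add_cancel, h0] at h3
  rcases eq_or_lt_of_le h2 with rfl | h2
  · rw [sub_self, h1] at h3
    have := congrFun h3 (Sum.inl 1)
    simp only [point, Sum.elim_inl, Matrix.cons_val, Pi.neg_apply] at this
    linarith
  · have h4 : wholeCurve q (P - 48) (Sum.inl 0) = 0 := by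
      rw [← neg_eq_iff_eq_neg.2 h3, h1]
      simp [point]
    have := h.isLeast_whole.2 ⟨sub_pos.2 h2, h4⟩
    linarith

lemma exists_orbit (h : TwelfthOrbit α β θ q X) (hα : 0 < α) (hβ : 0 < β) (hθ : 0 < θ) :
    ∃ (γ : ℝ → Phase) (Y : ℝ → Matrix Idx Idx ℝ), IsCubicOrbit (-1) α β (8 * θ) γ ∧
      (∀ s, γ (s + 12 * (8 * θ)) = γ s) ∧
      (∀ T, 0 < T → (∀ s, γ (s + T) = γ s) → 12 * (8 * θ) ≤ T) ∧
      IsFundamentalSolution (regHam (-1)) γ Y ∧ Y (8 * θ) = X 3 1 ∧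
      Y (12 * (8 * θ)) = halfMat X ^ 6 := by
  -- The true time is `θ` times the scaled time; the factor `θ⁻¹` from this substitution removes the
  -- factor `θ` in the equations.
  have hd : ∀ s : ℝ, HasDerivAt (fun s => s / θ) θ⁻¹ s := fun s => by
    simpa using (hasDerivAt_id s).div_const θ
  have e0 : ∀ c : ℝ, c * θ / θ = c := fun c => mul_div_cancel_right₀ c hθ.ne'
  refine ⟨fun s => wholeCurve q (s / θ), fun s => wholeMat X (s / θ),
    ⟨hα, hβ, by positivity, fun s => ⟨(h.hasDerivAt_whole _).1, ?_⟩, ?_, ?_, ⟨⟨by positivity, ?_⟩, ?_⟩⟩,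
    fun s => ?_, fun T hT hper => ?_, ⟨?_, fun s i j => ?_⟩, ?_, ?_⟩
  · have h1 := HasDerivAt.scomp s (h.hasDerivAt_whole (s / θ)).2.1 (hd s)
    rw [smul_smul, inv_mul_cancel₀ hθ.ne', one_smul] at h1
    exact h1
  · change wholeCurve q (0 / θ) = _
    rw [zero_div, h.wholeCurve_zero]
  · change wholeCurve q (2 * (8 * θ) / θ) = _
    rw [← mul_assoc, e0]
    norm_num
    rw [← zero_add (16 : ℝ), wholeCurve_add, h.wholeCurve_zero, Sf_mulVec]
    simp [point]
  · change wholeCurve q (6 * (8 * θ) / θ) _ = _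
    rw [← mul_assoc, e0]
    norm_num
    exact h.isLeast_whole.1.2
  · rintro s ⟨hs, hs0⟩
    have := h.isLeast_whole.2 ⟨div_pos hs hθ, hs0⟩
    rw [le_div_iff₀ hθ] at this
    linarith
  · change wholeCurve q _ = _
    rw [add_div, ← mul_assoc, e0, show s / θ + 12 * 8 = s / θ + 48 + 48 by ring,
      wholeCurve_add_half, wholeCurve_add_half, neg_neg]
  · have h1 := h.le_period hα (div_pos hT hθ) fun u => by
      have := hper (u * θ)
      simpa only [add_div, e0] using this
    rw [le_div_iff₀ hθ] at h1
    linarith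
  · have := h.wholeMat_mul 0
    simpa using this
  · have h1 := HasDerivAt.scomp s ((h.hasDerivAt_whole (s / θ)).2.2 i j) (hd s)
    rw [Matrix.smul_apply, smul_smul, inv_mul_cancel₀ hθ.ne', one_smul] at h1
    exact h1
  · change wholeMat X _ = _
    rw [e0, h.wholeMat_eight]
  · have h1 := h.wholeMat_mul 6
    change wholeMat X _ = _
    rw [← mul_assoc, e0, show (12 * 8 : ℝ) = 16 * (6 : ℕ) by norm_num, h1, Sf_pow_six,
      Matrix.one_mul]

end TwelfthOrbit

end

/-! ### The symmetry reduction of the monodromy matrix -/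

lemma Y₀_symplectic : Y₀ᵀ * symJ * Y₀ = symJ := by
  have h2 : √2 / 2 * (√2 / 2) + √2 / 2 * (√2 / 2) = 1 := by
    have := Real.mul_self_sqrt (show (0 : ℝ) ≤ 2 by norm_num)
    linarith
  have h3 : -(√2 / 2 * (√2 / 2)) + -(√2 / 2 * (√2 / 2)) = -1 := by linarith
  rw [Y₀]
  generalize √2 / 2 = δ at *
  rw [symJ, fromBlocks_transpose, fromBlocks_multiply, fromBlocks_multiply]
  congr 1 <;> ext i j <;> fin_cases i <;> fin_cases j <;>
    simp [Matrix.mul_apply, Fin.sum_univ_three, h2, h3]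

/-- The diagonal matrix with blocks `-1` and `1`. -/
def signMat : Matrix Idx Idx ℝ := fromBlocks (-1) 0 0 1

lemma signMat_mul_self : signMat * signMat = 1 := by
  simp [signMat, fromBlocks_multiply]

/-- This is the reason for the choice of `Y₀`: its columns are eigenvectors of the involution `S_fᵀ
S_r`, the first three for the eigenvalue `-1` and the last three for `1`. -/
lemma Sf_transpose_mul_Sr_mul_Y₀ : Sfᵀ * Sr * Y₀ = Y₀ * signMat := by
  simp only [Y₀]
  generalize √2 / 2 = δ at *
  rw [Sf, Sr, signMat, fromBlocks_transpose, fromBlocks_multiply, fromBlocks_multiply,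
    fromBlocks_multiply]
  congr 1 <;> ext i j <;> fin_cases i <;> fin_cases j <;>
    simp [Matrix.mul_apply, Fin.sum_univ_three]

section

variable {B : Matrix Idx Idx ℝ}

lemma symplectic_inv_mul (hB : Bᵀ * symJ * B = symJ) : -(symJ * Bᵀ * symJ) * B = 1 := by
  rw [Matrix.neg_mul, Matrix.mul_assoc, Matrix.mul_assoc, ← Matrix.mul_assoc Bᵀ, hB, symJ_mul_self,
    neg_neg]

lemma symplectic_inv (hB : Bᵀ * symJ * B = symJ) : B⁻¹ = -(symJ * Bᵀ * symJ) :=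
  Matrix.inv_eq_left_inv (symplectic_inv_mul hB)

lemma symplectic_isUnit (hB : Bᵀ * symJ * B = symJ) : IsUnit B :=
  (Matrix.isUnit_iff_isUnit_det B).2
    (Matrix.isUnit_det_of_left_inverse (symplectic_inv_mul hB))

lemma isUnit_Y₀ : IsUnit Y₀ := symplectic_isUnit Y₀_symplectic

lemma conj_mul_self (hB : IsUnit B) : B⁻¹ * Sr * B * (B⁻¹ * Sr * B) = 1 := by
  have hd := (Matrix.isUnit_iff_isUnit_det B).1 hB
  rw [show B⁻¹ * Sr * B * (B⁻¹ * Sr * B) = B⁻¹ * Sr * (B * B⁻¹) * Sr * B by noncomm_ring,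
    Matrix.mul_nonsing_inv _ hd, Matrix.mul_one, Matrix.mul_assoc B⁻¹, Sr_mul_self, Matrix.mul_one,
    Matrix.nonsing_inv_mul _ hd]

lemma symJ_mul_conj (hB : Bᵀ * symJ * B = symJ) :
    symJ * (B⁻¹ * Sr * B) = Bᵀ * symJ * Sr * B := by
  rw [symplectic_inv hB, show symJ * (-(symJ * Bᵀ * symJ) * Sr * B) =
    -(symJ * symJ) * Bᵀ * symJ * Sr * B by noncomm_ring, symJ_mul_self, neg_neg, Matrix.one_mul]

/-- The matrix `B⁻¹ S_r B` is determined by one of its blocks and two symmetric blocks. -/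
lemma conj_eq_fromBlocks (hB : Bᵀ * symJ * B = symJ) :
    ∃ b c : Matrix (Fin 3) (Fin 3) ℝ, B⁻¹ * Sr * B =
      fromBlocks (-(Bᵀ * symJ * Sr * B).toBlocks₁₂ᵀ) b c (Bᵀ * symJ * Sr * B).toBlocks₁₂ := by
  have h1 := symJ_mul_conj hB
  -- `J S_r` is symmetric because `S_r` is symmetric and anticommutes with `J`. Multiplication of
  -- the conjugate by `J` therefore gives a symmetric matrix, which ties its diagonal blocks
  -- together.
  have hs : (Bᵀ * symJ * Sr * B)ᵀ = Bᵀ * symJ * Sr * B := by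
    simp only [Matrix.transpose_mul, Matrix.transpose_transpose, Sr_transpose, symJ_transpose]
    rw [show Bᵀ * (Sr * (-symJ * B)) = Bᵀ * -(Sr * symJ) * B by noncomm_ring, ← symJ_mul_Sr]
    noncomm_ring
  rw [← h1] at hs ⊢
  generalize B⁻¹ * Sr * B = M at *
  rw [← fromBlocks_toBlocks M, symJ, fromBlocks_multiply] at hs ⊢
  simp only [zero_mul, one_mul, zero_add, neg_mul, add_zero, toBlocks_fromBlocks₁₂,
    fromBlocks_transpose, fromBlocks_inj] at hs ⊢
  refine ⟨_, _, ?_, rfl, rfl, trivial⟩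
  rw [hs.2.2.1, neg_neg]

lemma reducedMatrix_eq (B : Matrix Idx Idx ℝ) : reducedMatrix B = signMat * (B⁻¹ * Sr * B) := by
  have hd := (Matrix.isUnit_iff_isUnit_det Y₀).1 isUnit_Y₀
  rw [reducedMatrix, show Y₀⁻¹ * Sfᵀ * Sr * Y₀ * B⁻¹ * Sr * B =
    Y₀⁻¹ * (Sfᵀ * Sr * Y₀) * (B⁻¹ * Sr * B) by noncomm_ring, Sf_transpose_mul_Sr_mul_Y₀,
    ← Matrix.mul_assoc Y₀⁻¹, Matrix.nonsing_inv_mul _ hd, Matrix.one_mul]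

/-- The matrix is a product `D C` of two involutions, so its inverse is `C D = D (D C) D`. -/
lemma reducedMatrix_inv (hB : IsUnit B) :
    (reducedMatrix B)⁻¹ = signMat * reducedMatrix B * signMat := by
  refine Matrix.inv_eq_right_inv ?_
  rw [reducedMatrix_eq, show signMat * (B⁻¹ * Sr * B) *
    (signMat * (signMat * (B⁻¹ * Sr * B)) * signMat) = signMat * (B⁻¹ * Sr * B *
      (signMat * signMat) * (B⁻¹ * Sr * B)) * signMat by noncomm_ring, signMat_mul_self,
    Matrix.mul_one, conj_mul_self hB, Matrix.mul_one, signMat_mul_self]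

lemma isUnit_reducedMatrix (hB : IsUnit B) : IsUnit (reducedMatrix B) := by
  rw [reducedMatrix_eq]
  exact (IsUnit.of_mul_eq_one _ signMat_mul_self).mul (IsUnit.of_mul_eq_one _ (conj_mul_self hB))

/-- Conjugation by `D` changes the sign of the off-diagonal blocks, so they cancel in the mean of
the matrix and its inverse, while the diagonal blocks remain. -/
lemma half_reducedMatrix_add_inv (hB : Bᵀ * symJ * B = symJ) :
    (1 / 2 : ℝ) • (reducedMatrix B + (reducedMatrix B)⁻¹) =
      fromBlocks (Bᵀ * symJ * Sr * B).toBlocks₁₂ᵀ 0 0 (Bᵀ * symJ * Sr * B).toBlocks₁₂ := by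
  obtain ⟨b, c, h⟩ := conj_eq_fromBlocks hB
  rw [reducedMatrix_inv (symplectic_isUnit hB), reducedMatrix_eq, h]
  simp only [signMat, fromBlocks_multiply, fromBlocks_add, fromBlocks_smul]
  simp [← two_smul ℝ, smul_smul]

/-- For `B = A Y₀` the factor `B⁻¹` contributes `Y₀⁻¹`, and the reduced matrix is the conjugate by
`Y₀` of the factor gained in time `2 τ`. -/
lemma Y₀_mul_reducedMatrix_pow_mul_inv (A : Matrix Idx Idx ℝ) (n : ℕ) :
    Y₀ * reducedMatrix (A * Y₀) ^ n * Y₀⁻¹ = (Sfᵀ * (Sr * (A⁻¹ * Sr * A))) ^ n := by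
  have hd := (Matrix.isUnit_iff_isUnit_det Y₀).1 isUnit_Y₀
  have e : reducedMatrix (A * Y₀) = Y₀⁻¹ * (Sfᵀ * (Sr * (A⁻¹ * Sr * A))) * Y₀ := by
    rw [reducedMatrix, Matrix.mul_inv_rev, show Y₀⁻¹ * Sfᵀ * Sr * Y₀ * (Y₀⁻¹ * A⁻¹) * Sr * (A * Y₀) =
      Y₀⁻¹ * Sfᵀ * Sr * (Y₀ * Y₀⁻¹) * A⁻¹ * Sr * A * Y₀ by noncomm_ring,
      Matrix.mul_nonsing_inv _ hd, Matrix.mul_one]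
    noncomm_ring
  rw [e]
  generalize Sfᵀ * (Sr * (A⁻¹ * Sr * A)) = G
  induction n with
  | zero => simp [Matrix.mul_nonsing_inv _ hd]
  | succ n ih =>
    rw [pow_succ, pow_succ, ← ih, show Y₀ * ((Y₀⁻¹ * G * Y₀) ^ n * (Y₀⁻¹ * G * Y₀)) * Y₀⁻¹ =
      Y₀ * (Y₀⁻¹ * G * Y₀) ^ n * Y₀⁻¹ * G * (Y₀ * Y₀⁻¹) by noncomm_ring,
      Matrix.mul_nonsing_inv _ hd, Matrix.mul_one]

end

/-! ### Linear stability from the reduced matrix -/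

section

open Polynomial

lemma fromBlocks_sub {R : Type*} [Ring R] (a b c d a' b' c' d' : Matrix (Fin 3) (Fin 3) R) :
    fromBlocks a b c d - fromBlocks a' b' c' d' =
      fromBlocks (a - a') (b - b') (c - c') (d - d') := by
  ext (i | i) (j | j) <;> rfl

/-- The matrix has first row `(r, 0, 0)`, and its lower right block has the characteristic
polynomial `(X - l) (X - m)`. -/
structure IsReducedBlock (A : Matrix (Fin 3) (Fin 3) ℝ) (r l m : ℝ) : Prop where
  zero_zero : A 0 0 = r
  zero_one : A 0 1 = 0
  zero_two : A 0 2 = 0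
  trace : A 1 1 + A 2 2 = l + m
  det : A 1 1 * A 2 2 - A 1 2 * A 2 1 = l * m

namespace IsReducedBlock

variable {A : Matrix (Fin 3) (Fin 3) ℝ} {r l m : ℝ}

lemma two_smul (h : IsReducedBlock A r l m) :
    IsReducedBlock ((2 : ℝ) • A) (2 * r) (2 * l) (2 * m) := by
  obtain ⟨h0, h1, h2, h3, h4⟩ := h
  constructor <;> simp only [Matrix.smul_apply, smul_eq_mul, h0, h1, h2, mul_zero]
  · linear_combination 2 * h3
  · linear_combination 4 * h4

/-- If `A` stands for `w + w⁻¹`, then `A² - 2` stands for `w² + w⁻²`. The block triangular shape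
survives, and the eigenvalues follow the same polynomial, expressed through trace and determinant.
-/
lemma sq_sub_two (h : IsReducedBlock A r l m) :
    IsReducedBlock (A * A - 2) (r ^ 2 - 2) (l ^ 2 - 2) (m ^ 2 - 2) := by
  obtain ⟨h0, h1, h2, h3, h4⟩ := h
  have e2 : (2 : Matrix (Fin 3) (Fin 3) ℝ) = diagonal fun _ => 2 := rfl
  have h3' : A 2 2 = l + m - A 1 1 := by linarith
  constructor <;> simp [Matrix.mul_apply, Fin.sum_univ_three, h0, h1, h2, e2, h3'] <;>
    rw [h3'] at h4
  · ring
  · linear_combination (-2) * h4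
  · linear_combination (A 1 1 * (l + m - A 1 1) - A 1 2 * A 2 1 + l * m + 4) * h4

/-- The analogous passage from `w + w⁻¹` to `w³ + w⁻³`. -/
lemma cube_sub (h : IsReducedBlock A r l m) :
    IsReducedBlock (A * A * A - 3 * A) (r ^ 3 - 3 * r) (l ^ 3 - 3 * l) (m ^ 3 - 3 * m) := by
  obtain ⟨h0, h1, h2, h3, h4⟩ := h
  have e3 : (3 : Matrix (Fin 3) (Fin 3) ℝ) * A = (3 : ℝ) • A := by
    ext i j
    rw [show (3 : Matrix (Fin 3) (Fin 3) ℝ) = diagonal fun _ => 3 from rfl, Matrix.diagonal_mul]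
    rfl
  have h3' : A 2 2 = l + m - A 1 1 := by linarith
  rw [e3]
  constructor <;> simp [Matrix.mul_apply, Fin.sum_univ_three, h0, h1, h2, h3'] <;>
    rw [h3'] at h4
  · ring
  · linear_combination (-3 * (l + m)) * h4
  · linear_combination ((A 1 1 * (l + m - A 1 1) - A 1 2 * A 2 1) ^ 2 +
      (A 1 1 * (l + m - A 1 1) - A 1 2 * A 2 1) * (l * m) + (l * m) ^ 2 - 3 * (l + m) ^ 2 +
      6 * (A 1 1 * (l + m - A 1 1) - A 1 2 * A 2 1 + l * m) + 9) * h4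

lemma det_quadratic (h : IsReducedBlock A r l m) :
    ((X ^ 2 + 1 : ℝ[X]) • (1 : Matrix (Fin 3) (Fin 3) ℝ[X]) - (X : ℝ[X]) • A.map C).det =
      (X ^ 2 - C r * X + 1) * ((X ^ 2 - C l * X + 1) * (X ^ 2 - C m * X + 1)) := by
  obtain ⟨h0, h1, h2, h3, h4⟩ := h
  have h3' := congrArg (C : ℝ → ℝ[X]) h3
  have h4' := congrArg (C : ℝ → ℝ[X]) h4
  simp only [map_add, map_sub, map_mul] at h3' h4'
  rw [Matrix.det_fin_three]
  simp [h0, h1, h2]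
  linear_combination (X ^ 2 - C r * X + 1) * X ^ 2 * h4' -
    (X ^ 2 - C r * X + 1) * X * (X ^ 2 + 1) * h3'

end IsReducedBlock

/-- The characteristic matrices multiply to `(X - V)(X - V') = X² + 1 - X (V + V')`, since `V V' =
1`. -/
lemma charpoly_mul_charpoly {V V' : Matrix Idx Idx ℝ} (h : V * V' = 1) :
    V.charpoly * V'.charpoly =
      ((X ^ 2 + 1 : ℝ[X]) • (1 : Matrix Idx Idx ℝ[X]) - (X : ℝ[X]) • (V + V').map C).det := by
  have h1 : V.map C * V'.map C = (1 : Matrix Idx Idx ℝ[X]) := by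
    rw [← Matrix.map_mul, h]
    simp
  rw [Matrix.charpoly, Matrix.charpoly, ← Matrix.det_mul, charmatrix, charmatrix]
  congr 1
  have e : Matrix.scalar Idx (X : ℝ[X]) = (X : ℝ[X]) • (1 : Matrix Idx Idx ℝ[X]) := by
    rw [Matrix.smul_one_eq_diagonal]
    rfl
  have e2 : (V + V').map C = V.map C + V'.map (C : ℝ → ℝ[X]) := by
    ext i j
    simp
  rw [e, e2, RingHom.mapMatrix_apply, RingHom.mapMatrix_apply, sub_mul, mul_sub, mul_sub, h1]
  simp only [Matrix.smul_mul, Matrix.mul_smul, Matrix.one_mul, Matrix.mul_one, smul_smul]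
  rw [add_smul, one_smul, smul_add, pow_two]
  abel

/-- `V` and `V'` are conjugate and so have the same characteristic polynomial; the blocks `Lᵀ` and
`L` contribute equal determinants. Hence the squares of both sides agree, and both sides are monic,
which excludes the opposite sign. -/
lemma charpoly_eq_of_isReducedBlock {V V' D : Matrix Idx Idx ℝ} {L : Matrix (Fin 3) (Fin 3) ℝ}
    {r l m : ℝ} (hV : V * V' = 1) (hD : D * D = 1) (hVD : V' = D * V * D)
    (hL : V + V' = fromBlocks Lᵀ 0 0 L) (h : IsReducedBlock L r l m) :
    V.charpoly = (X ^ 2 - C r * X + 1) * ((X ^ 2 - C l * X + 1) * (X ^ 2 - C m * X + 1)) := by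
  have h1 := charpoly_mul_charpoly hV
  have h2 : V'.charpoly = V.charpoly := by
    rw [hVD, Matrix.mul_assoc, Matrix.charpoly_mul_comm, Matrix.mul_assoc, hD, Matrix.mul_one]
  have h3 : (X ^ 2 + 1 : ℝ[X]) • (1 : Matrix Idx Idx ℝ[X]) - (X : ℝ[X]) • (V + V').map C =
      fromBlocks ((X ^ 2 + 1 : ℝ[X]) • (1 : Matrix (Fin 3) (Fin 3) ℝ[X]) - (X : ℝ[X]) • L.map C)ᵀ
        0 0 ((X ^ 2 + 1 : ℝ[X]) • (1 : Matrix (Fin 3) (Fin 3) ℝ[X]) - (X : ℝ[X]) • L.map C) := by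
    rw [hL, ← fromBlocks_one, fromBlocks_map, fromBlocks_smul, fromBlocks_smul, fromBlocks_sub]
    simp [Matrix.transpose_map]
  rw [h3, Matrix.det_fromBlocks_zero₂₁, Matrix.det_transpose, h.det_quadratic, h2] at h1
  have hq : ∀ c : ℝ, (X ^ 2 - C c * X + 1 : ℝ[X]).Monic := by
    intro c
    monicity!
  rcases mul_self_eq_mul_self_iff.1 h1 with h4 | h4
  · exact h4
  · have h5 := congrArg Polynomial.leadingCoeff h4
    rw [V.charpoly_monic.leadingCoeff, Polynomial.leadingCoeff_neg,
      ((hq r).mul ((hq l).mul (hq m))).leadingCoeff] at h5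
    norm_num at h5

/-- A root on the unit circle of `X ^ 2 - l X + 1`. -/
def unitRoot (l : ℝ) : ℂ := ⟨l / 2, √(1 - (l / 2) ^ 2)⟩

lemma norm_unitRoot {l : ℝ} (hl : |l| < 2) : ‖unitRoot l‖ = 1 := by
  have h1 : 0 ≤ 1 - (l / 2) ^ 2 := by nlinarith [abs_lt.1 hl]
  rw [Complex.norm_def, Complex.normSq_mk, unitRoot, Real.mul_self_sqrt h1]
  norm_num
  ring

lemma unitRoot_im_pos {l : ℝ} (hl : |l| < 2) : 0 < (unitRoot l).im :=
  Real.sqrt_pos.2 (by nlinarith [abs_lt.1 hl])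

lemma map_quadratic {l : ℝ} (hl : |l| < 2) :
    (X ^ 2 - C l * X + 1 : ℝ[X]).map (algebraMap ℝ ℂ) =
      (X - C (unitRoot l)) * (X - C (starRingEnd ℂ (unitRoot l))) := by
  have h1 : unitRoot l + starRingEnd ℂ (unitRoot l) = l := by
    rw [Complex.add_conj]
    simp [unitRoot]
    ring
  have h2 : unitRoot l * starRingEnd ℂ (unitRoot l) = 1 := by
    rw [Complex.mul_conj, Complex.normSq_eq_norm_sq, norm_unitRoot hl]
    simp
  have h1' := congrArg (C : ℂ → ℂ[X]) h1
  have h2' := congrArg (C : ℂ → ℂ[X]) h2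
  simp only [map_add, map_mul, map_one] at h1' h2'
  simp
  linear_combination X * h1' - h2'

/-- The complex roots are `1, 1` and two conjugate pairs on the unit circle. They are told apart by
the signs of the imaginary parts, which are not zero, and by the real parts `l / 2 ≠ m / 2`. -/
lemma linearlyStable_of_charpoly {V : Matrix Idx Idx ℝ} {l m : ℝ} (hl : |l| < 2) (hm : |m| < 2)
    (hlm : l ≠ m)
    (h : V.charpoly = (X ^ 2 - C 2 * X + 1) * ((X ^ 2 - C l * X + 1) * (X ^ 2 - C m * X + 1))) :
    LinearlyStable 1 V := by
  have h1 : (V.map (algebraMap ℝ ℂ)).charpoly = (({1, 1, unitRoot l, starRingEnd ℂ (unitRoot l),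
      unitRoot m, starRingEnd ℂ (unitRoot m)} : Multiset ℂ).map fun a => X - C a).prod := by
    have e := Matrix.charpoly_map V (algebraMap ℝ ℂ)
    rw [e, h, Polynomial.map_mul, Polynomial.map_mul, map_quadratic hl, map_quadratic hm]
    simp
    rw [show (C (2 : ℂ)) = 2 from rfl]
    ring
  have hpl := unitRoot_im_pos hl
  have hpm := unitRoot_im_pos hm
  have n1 : unitRoot l ≠ unitRoot m := fun e => hlm (by
    have := congrArg Complex.re e
    simp only [unitRoot] at this
    linarith)
  have n2 : unitRoot l ≠ starRingEnd ℂ (unitRoot l) := fun e => by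
    have := congrArg Complex.im e
    rw [Complex.conj_im] at this
    linarith
  have n3 : unitRoot m ≠ starRingEnd ℂ (unitRoot m) := fun e => by
    have := congrArg Complex.im e
    rw [Complex.conj_im] at this
    linarith
  have n4 : unitRoot l ≠ starRingEnd ℂ (unitRoot m) := fun e => by
    have := congrArg Complex.im e
    rw [Complex.conj_im] at this
    linarith
  have n5 : unitRoot m ≠ starRingEnd ℂ (unitRoot l) := fun e => by
    have := congrArg Complex.im e
    rw [Complex.conj_im] at this
    linarith
  have n6 : starRingEnd ℂ (unitRoot l) ≠ starRingEnd ℂ (unitRoot m) := fun e =>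
    n1 ((starRingEnd ℂ).injective e)
  have n7 : unitRoot l ≠ 1 := fun e => by
    rw [e] at hpl
    simp at hpl
  have n8 : unitRoot m ≠ 1 := fun e => by
    rw [e] at hpm
    simp at hpm
  have n9 : starRingEnd ℂ (unitRoot l) ≠ 1 := fun e => n7 (by simpa using congrArg (starRingEnd ℂ) e)
  have n10 : starRingEnd ℂ (unitRoot m) ≠ 1 := fun e =>
    n8 (by simpa using congrArg (starRingEnd ℂ) e)
  have hne : (V.map (algebraMap ℝ ℂ)).charpoly ≠ 0 := (Matrix.charpoly_monic _).ne_zero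
  have hr := congrArg Polynomial.roots h1
  rw [Polynomial.roots_multiset_prod_X_sub_C] at hr
  refine ⟨fun μ hμ => ?_, ?_⟩
  · rw [← Polynomial.mem_roots hne, hr] at hμ
    rw [← Polynomial.count_roots, hr]
    simp only [Multiset.insert_eq_cons, Multiset.mem_cons, Multiset.mem_singleton] at hμ
    rcases hμ with rfl | rfl | rfl | rfl | rfl | rfl
    · simp
    · simp
    · exact ⟨norm_unitRoot hl, fun _ => by
        simp [n1, n2, n4, n7]⟩
    · exact ⟨by rw [RCLike.norm_conj, norm_unitRoot hl], fun _ => by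
        simp [n2.symm, n5.symm, n6, n9]⟩
    · exact ⟨norm_unitRoot hm, fun _ => by
        simp [n1.symm, n3, n5, n8]⟩
    · exact ⟨by rw [RCLike.norm_conj, norm_unitRoot hm], fun _ => by
        simp [n3.symm, n4.symm, n6.symm, n10]⟩
  · rw [← Polynomial.count_roots, hr]
    simp [n7.symm, n8.symm, n9.symm, n10.symm]

/-- The reduction of the stability of `W ^ 6` to the eigenvalues of `(W + W⁻¹) / 2`. -/
lemma charpoly_pow_six {W D : Matrix Idx Idx ℝ} {K : Matrix (Fin 3) (Fin 3) ℝ} {l m : ℝ}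
    (hW : IsUnit W) (hD : D * D = 1) (hWD : W⁻¹ = D * W * D)
    (hK : (1 / 2 : ℝ) • (W + W⁻¹) = fromBlocks Kᵀ 0 0 K) (h : IsReducedBlock K 1 l m) :
    (W ^ 6).charpoly = (X ^ 2 - C 2 * X + 1) *
      ((X ^ 2 - C ((((2 * l) ^ 2 - 2) ^ 3 - 3 * ((2 * l) ^ 2 - 2))) * X + 1) *
        (X ^ 2 - C ((((2 * m) ^ 2 - 2) ^ 3 - 3 * ((2 * m) ^ 2 - 2))) * X + 1)) := by
  have hd := (Matrix.isUnit_iff_isUnit_det W).1 hW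
  have h1 := Matrix.mul_nonsing_inv W hd
  have hc : Commute W W⁻¹ := by rw [Commute, SemiconjBy, h1, Matrix.nonsing_inv_mul W hd]
  have h6 : W ^ 6 * W⁻¹ ^ 6 = 1 := by rw [← hc.mul_pow, h1, one_pow]
  have hD6 : ∀ n : ℕ, (D * W * D) ^ n = D * W ^ n * D := by
    intro n
    induction n with
    | zero => simp [hD]
    | succ n ih =>
      rw [pow_succ, ih, pow_succ, show D * W ^ n * D * (D * W * D) =
        D * W ^ n * (D * D) * W * D by noncomm_ring, hD, Matrix.mul_one, Matrix.mul_assoc D]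
  have hN : W + W⁻¹ = fromBlocks ((2 : ℝ) • K)ᵀ 0 0 ((2 : ℝ) • K) := by
    have := congrArg (fun M => (2 : ℝ) • M) hK
    simp only [smul_smul, fromBlocks_smul, smul_zero] at this
    norm_num at this
    rw [this, Matrix.transpose_smul]
  have h2 := h.two_smul.sq_sub_two
  have h3 := h2.cube_sub
  generalize (2 : ℝ) • K = N at hN h3
  -- The sixth power is reached by squaring and then cubing; the block form `diag(Nᵀ, N)` is
  -- preserved because transposition reverses products and only powers of one matrix occur.
  have hsq : W ^ 2 + W⁻¹ ^ 2 = fromBlocks (N * N - 2)ᵀ 0 0 (N * N - 2) := by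
    have e : W ^ 2 + W⁻¹ ^ 2 = (W + W⁻¹) * (W + W⁻¹) - W * W⁻¹ - W⁻¹ * W := by noncomm_ring
    have e2 : (2 : Matrix (Fin 3) (Fin 3) ℝ) = 1 + 1 := by norm_num
    rw [e, h1, Matrix.nonsing_inv_mul W hd, hN, fromBlocks_multiply, ← fromBlocks_one,
      fromBlocks_sub, fromBlocks_sub, e2]
    simp [Matrix.transpose_sub, Matrix.transpose_mul, sub_sub]
  have hcu : W ^ 6 + W⁻¹ ^ 6 = fromBlocks
      ((N * N - 2) * (N * N - 2) * (N * N - 2) - 3 * (N * N - 2))ᵀ 0 0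
      ((N * N - 2) * (N * N - 2) * (N * N - 2) - 3 * (N * N - 2)) := by
    generalize N * N - 2 = S at *
    have e1 : W ^ 2 * W⁻¹ ^ 2 = 1 := by rw [← hc.mul_pow, h1, one_pow]
    have e2 : W⁻¹ ^ 2 * W ^ 2 = 1 := by rw [← hc.symm.mul_pow, Matrix.nonsing_inv_mul W hd, one_pow]
    -- For mutually inverse `a` and `b`, the cube of `a + b` is `a³ + b³ + 3 (a + b)`.
    have key : ∀ a b : Matrix Idx Idx ℝ, a * b = 1 → b * a = 1 →
        a ^ 3 + b ^ 3 = (a + b) * (a + b) * (a + b) - (a + b) - (a + b) - (a + b) := by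
      intro a b hab hba
      have : (a + b) * (a + b) * (a + b) = a ^ 3 + b ^ 3 + a * (a * b) + (a * b) * a + (b * a) * a
        + b * (b * a) + (b * a) * b + (a * b) * b := by noncomm_ring
      rw [this, hab, hba]
      simp
      abel
    have e3 : (3 : Matrix (Fin 3) (Fin 3) ℝ) * S = S + S + S := by noncomm_ring
    rw [show 6 = 2 * 3 by norm_num, pow_mul, pow_mul, key _ _ e1 e2, hsq, fromBlocks_multiply,
      fromBlocks_multiply, fromBlocks_sub, fromBlocks_sub, fromBlocks_sub, e3]
    simp [Matrix.transpose_sub, Matrix.transpose_add, Matrix.transpose_mul, sub_sub,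
      Matrix.mul_assoc, add_assoc]
  have h5 := charpoly_eq_of_isReducedBlock h6 hD (by rw [hWD, hD6]) hcu h3
  rw [h5]
  norm_num

end

/-! ### The matrix `K` -/

section

open PieceData

/-- On `Q₁ = 0` the Hamiltonian is `(P₁² - 2) Q₂² Q₃²`. At `P₁ = √2` its derivatives with respect to
`Q₂, Q₃, P₂, P₃` vanish, and `Γ` is even in `Q₁`. Only the derivative with respect to `P₁` remains,
so the flow direction is the axis of `Q₁`. -/
lemma hamVec_collision {a : ℝ} (ha : 0 < a) (b : ℝ) :
    hamVec (point 0 a a (√2) (-b) b) = (2 * √2 * a ^ 4) • Pi.single (Sum.inl 0) 1 := by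
  set x := point 0 a a (√2) (-b) b with hx
  have h2 : √2 ^ 2 = 2 := Real.sq_sqrt (by norm_num)
  have hmem : x ∈ regDomain := by
    intro i j hij
    fin_cases i <;> fin_cases j <;> first | exact absurd rfl hij | simp [x, point, ha.ne']
  have hd : DifferentiableAt ℝ (regHam (-1)) x :=
    (contDiffAt_regHam (-1) hmem).differentiableAt (by norm_num)
  have hg : ∀ i, grad (regHam (-1)) x i =
      deriv (fun t : ℝ => regHam (-1) (x + t • Pi.single i 1)) 0 := fun i => by
    rw [grad, ← hd.lineDeriv_eq_fderiv]
    rfl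
  -- An even function has derivative zero at the origin.
  have hQ1 : grad (regHam (-1)) x (Sum.inl 0) = 0 := by
    rw [hg]
    have he : ∀ t : ℝ, regHam (-1) (x + (-t) • Pi.single (Sum.inl 0) 1) =
        regHam (-1) (x + t • Pi.single (Sum.inl 0) 1) := by
      intro t
      have h4 : (-t) ^ 4 = t ^ 4 := by ring
      simp [regHam, x, point, h4]
    have h1 := deriv_comp_neg (fun t : ℝ => regHam (-1) (x + t • Pi.single (Sum.inl 0) 1)) 0
    simp only [he, neg_zero] at h1
    linarith
  have hP1 : grad (regHam (-1)) x (Sum.inr 0) = 2 * √2 * a ^ 4 := by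
    rw [hg]
    have he : (fun t : ℝ => regHam (-1) (x + t • Pi.single (Sum.inr 0) 1)) =
        fun t => (√2 + t) ^ 2 * a ^ 4 - 2 * a ^ 4 := by
      ext t
      simp [regHam, x, point]
      ring
    rw [he]
    have h1 : HasDerivAt (fun t : ℝ => (√2 + t) ^ 2 * a ^ 4 - 2 * a ^ 4)
        (2 * (√2 + 0) ^ 1 * 1 * a ^ 4) 0 :=
      ((((hasDerivAt_id (0 : ℝ)).const_add (√2)).pow 2).mul_const _).sub_const _
    rw [h1.deriv]
    ring
  have h0 : ∀ i, i ≠ Sum.inl 0 → i ≠ Sum.inr 0 → grad (regHam (-1)) x i = 0 := by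
    intro i hi hi'
    rw [hg]
    have he : (fun t : ℝ => regHam (-1) (x + t • Pi.single i 1)) = fun t => 0 := by
      ext t
      rcases i with i | i <;> fin_cases i <;> first | exact absurd rfl hi | exact absurd rfl hi' |
        (simp [regHam, x, point, h2]; try ring)
    rw [he, deriv_const]
  rw [hamVec]
  ext i
  rcases i with i | i <;> fin_cases i <;>
    simp [symJ_mulVec, hQ1, hP1, h0]

lemma mulVec_dotProduct_symJ_mul_Sr (v w : Phase) : v ⬝ᵥ ((symJ * Sr) *ᵥ w) =
    -(v (Sum.inl 0) * w (Sum.inr 1) + v (Sum.inl 1) * w (Sum.inr 0) +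
      v (Sum.inl 2) * w (Sum.inr 2) + v (Sum.inr 0) * w (Sum.inl 1) +
      v (Sum.inr 1) * w (Sum.inl 0) + v (Sum.inr 2) * w (Sum.inl 2)) := by
  rw [← Matrix.mulVec_mulVec, Sr_mulVec, symJ_mulVec]
  simp [dotProduct, point, Fin.sum_univ_three]
  ring

lemma transpose_mul_symJ_mul_Sr_mul_apply (B : Matrix Idx Idx ℝ) (i j : Idx) :
    (Bᵀ * symJ * Sr * B) i j =
      (B *ᵥ Pi.single i 1) ⬝ᵥ ((symJ * Sr) *ᵥ (B *ᵥ Pi.single j 1)) := by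
  rw [Matrix.mulVec_single_one, Matrix.mulVec_single_one, Matrix.mul_assoc Bᵀ, Matrix.mul_assoc Bᵀ,
    Matrix.mul_apply]
  simp only [dotProduct, Matrix.mul_apply, Matrix.mulVec, Matrix.transpose_apply, Matrix.col_apply]

/-- Up to the factor `√2 / 2` four columns of `Y₀` are integer directions whose variations have been
approximated. The column of `P₁` is missing because no entry of the first column of `K` needs to be
computed. -/
lemma Y₀_mulVec :
    Y₀ *ᵥ Pi.single (Sum.inl 0) 1 = Pi.single (Sum.inl 0) 1 ∧
    Y₀ *ᵥ Pi.single (Sum.inl 1) 1 = (√2 / 2) • phaseDir 3 ∧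
    Y₀ *ᵥ Pi.single (Sum.inl 2) 1 = (√2 / 2) • phaseDir 4 ∧
    Y₀ *ᵥ Pi.single (Sum.inr 1) 1 = (√2 / 2) • phaseDir 0 ∧
    Y₀ *ᵥ Pi.single (Sum.inr 2) 1 = (√2 / 2) • phaseDir 1 := by
  simp only [Matrix.mulVec_single_one]
  refine ⟨?_, ?_, ?_, ?_, ?_⟩ <;> ext i <;> rcases i with i | i <;> fin_cases i <;>
    simp [Y₀, phaseDir, restrict, dir, direction, emb]

/-- The symmetric bilinear form of `J S_r`. -/
def form (v w : Phase) : ℝ :=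
  -(v (Sum.inl 0) * w (Sum.inr 1) + v (Sum.inl 1) * w (Sum.inr 0) +
    v (Sum.inl 2) * w (Sum.inr 2) + v (Sum.inr 0) * w (Sum.inl 1) +
    v (Sum.inr 1) * w (Sum.inl 0) + v (Sum.inr 2) * w (Sum.inl 2))

/-- The matrix `K` of the symmetry reduction, where `A` is the fundamental matrix at time `τ`. -/
def kMat (A : Matrix Idx Idx ℝ) : Matrix (Fin 3) (Fin 3) ℝ :=
  ((A * Y₀)ᵀ * symJ * Sr * (A * Y₀)).toBlocks₁₂

lemma kMat_apply (A : Matrix Idx Idx ℝ) {i j : Fin 3} {v w : Phase}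
    (hv : Y₀ *ᵥ Pi.single (Sum.inl i) 1 = (√2 / 2) • v)
    (hw : Y₀ *ᵥ Pi.single (Sum.inr j) 1 = (√2 / 2) • w) :
    kMat A i j = form (A *ᵥ v) (A *ᵥ w) / 2 := by
  have h2 : √2 * √2 = 2 := Real.mul_self_sqrt (by norm_num)
  rw [kMat, Matrix.toBlocks₁₂, Matrix.of_apply, transpose_mul_symJ_mul_Sr_mul_apply,
    ← Matrix.mulVec_mulVec _ A Y₀, ← Matrix.mulVec_mulVec _ A Y₀, hv, hw, Matrix.mulVec_smul, Matrix.mulVec_smul,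
    Matrix.mulVec_smul, smul_dotProduct, dotProduct_smul, mulVec_dotProduct_symJ_mul_Sr, smul_smul,
    form, show √2 / 2 * (√2 / 2) = 1 / 2 by linear_combination h2 / 4, smul_eq_mul]
  ring

lemma abs_mul_sub_mul_le {x y a b ε : ℝ} (hx : |x - a| ≤ ε) (hy : |y - b| ≤ ε) :
    |x * y - a * b| ≤ (|a| + |b|) * ε + ε * ε := by
  have e : x * y - a * b = (x - a) * (y - b) + a * (y - b) + (x - a) * b := by ring
  have hε : 0 ≤ ε := (abs_nonneg _).trans hx
  have h1 := mul_le_mul hx hy (abs_nonneg _) hε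
  have h2 := mul_le_mul_of_nonneg_left hy (abs_nonneg a)
  have h3 := mul_le_mul_of_nonneg_right hx (abs_nonneg b)
  rw [← abs_mul] at h1 h2 h3
  rw [e]
  refine (abs_add_three _ _ _).trans ?_
  linarith

lemma abs_form_sub_le {v w a b : Phase} (hv : ∀ i, |v i - a i| ≤ 2 / 10 ^ 6)
    (hw : ∀ i, |w i - b i| ≤ 2 / 10 ^ 6) (ha : ∀ i, |a i| ≤ 2.3) (hb : ∀ i, |b i| ≤ 2.3) :
    |form v w - form a b| ≤ 6 / 10 ^ 5 := by
  -- Each product has error at most `(2.3 + 2.3) · 2 · 10⁻⁶ + 4 · 10⁻¹²`, and `form` is a sum of six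
  -- products.
  have h : ∀ i j, |v i * w j - a i * b j| ≤ 1 / 10 ^ 5 := fun i j => by
    have h1 := abs_mul_sub_mul_le (hv i) (hw j)
    have h2 := ha i
    have h3 := hb j
    norm_num at h1 h2 h3 ⊢
    linarith
  simp only [abs_le] at h ⊢
  unfold form
  have h1 := h (Sum.inl 0) (Sum.inr 1)
  have h2 := h (Sum.inl 1) (Sum.inr 0)
  have h3 := h (Sum.inl 2) (Sum.inr 2)
  have h4 := h (Sum.inr 0) (Sum.inl 1)
  have h5 := h (Sum.inr 1) (Sum.inl 0)
  have h6 := h (Sum.inr 2) (Sum.inl 2)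
  constructor <;> linarith

/-- The approximate final value of a variation. -/
def endVec (c : ℕ) : Phase := fun i => (endTable.getD c []).getD (emb i) 0 / 10 ^ 10

lemma abs_endVec_le {c : ℕ} (hc : c ∈ ({0, 1, 3, 4} : Finset ℕ)) (i : Idx) :
    |endVec c i| ≤ 2.3 := by
  simp only [Finset.mem_insert, Finset.mem_singleton] at hc
  rcases hc with rfl | rfl | rfl | rfl <;> rcases i with i | i <;> fin_cases i <;>
    simp [endVec, endTable, emb, abs_of_pos, abs_div] <;> norm_num

/-- Numerical bounds for the lower right block of `K`. -/
structure KBounds (K : Matrix (Fin 3) (Fin 3) ℝ) : Prop where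
  one_one : |K 1 1 - 0.348246| ≤ 4 / 10 ^ 5
  one_two : |K 1 2 - 0.192664| ≤ 4 / 10 ^ 5
  two_one : |K 2 1 - -1.121234| ≤ 4 / 10 ^ 5
  two_two : |K 2 2 - -1.124042| ≤ 4 / 10 ^ 5

/-- An entry of `K` is half of a value of `form`, with error `3 · 10⁻⁵`; the remaining `10⁻⁵` covers
the rounding of the decimals in `KBounds`. -/
lemma kBounds_kMat {A : Matrix Idx Idx ℝ} (h : ∀ c ∈ ({0, 1, 3, 4} : Finset ℕ), ∀ i,
    |(A *ᵥ phaseDir c) i - (endTable.getD c []).getD (emb i) 0 / 10 ^ 10| ≤ 2 / 10 ^ 6) :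
    KBounds (kMat A) := by
  obtain ⟨-, y1, y2, y4, y5⟩ := Y₀_mulVec
  have key : ∀ c ∈ ({0, 1, 3, 4} : Finset ℕ), ∀ d ∈ ({0, 1, 3, 4} : Finset ℕ),
      |form (A *ᵥ phaseDir c) (A *ᵥ phaseDir d) - form (endVec c) (endVec d)| ≤ 6 / 10 ^ 5 :=
    fun c hc d hd => abs_form_sub_le (h c hc) (h d hd) (abs_endVec_le hc) (abs_endVec_le hd)
  constructor
  · have h1 := abs_le.1 (key 3 (by simp) 0 (by simp))
    have h2 : |form (endVec 3) (endVec 0) / 2 - 0.348246| ≤ 1 / 10 ^ 5 := by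
      rw [abs_le]
      simp [form, endVec, endTable, emb]
      norm_num
    rw [kMat_apply A y1 y4]
    rw [abs_le] at h2 ⊢
    constructor <;> linarith
  · have h1 := abs_le.1 (key 3 (by simp) 1 (by simp))
    have h2 : |form (endVec 3) (endVec 1) / 2 - 0.192664| ≤ 1 / 10 ^ 5 := by
      rw [abs_le]
      simp [form, endVec, endTable, emb]
      norm_num
    rw [kMat_apply A y1 y5]
    rw [abs_le] at h2 ⊢
    constructor <;> linarith
  · have h1 := abs_le.1 (key 4 (by simp) 0 (by simp))
    have h2 : |form (endVec 4) (endVec 0) / 2 - -1.121234| ≤ 1 / 10 ^ 5 := by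
      rw [abs_le]
      simp [form, endVec, endTable, emb]
      norm_num
    rw [kMat_apply A y2 y4]
    rw [abs_le] at h2 ⊢
    constructor <;> linarith
  · have h1 := abs_le.1 (key 4 (by simp) 1 (by simp))
    have h2 : |form (endVec 4) (endVec 1) / 2 - -1.124042| ≤ 1 / 10 ^ 5 := by
      rw [abs_le]
      simp [form, endVec, endTable, emb]
      norm_num
    rw [kMat_apply A y2 y5]
    rw [abs_le] at h2 ⊢
    constructor <;> linarith

/-- Trace and determinant lie in small intervals, where the discriminant is about `1.3035`; the
quadratic formula gives two real eigenvalues. -/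
lemma KBounds.exists_eigenvalues {K : Matrix (Fin 3) (Fin 3) ℝ} (h : KBounds K) :
    ∃ l m : ℝ, K 1 1 + K 2 2 = l + m ∧ K 1 1 * K 2 2 - K 1 2 * K 2 1 = l * m ∧
      0.1827 < l ∧ l < 0.1833 ∧ 0.9584 < -m ∧ -m < 0.9591 := by
  obtain ⟨h1, h2, h3, h4⟩ := h
  have h5 := abs_mul_sub_mul_le h1 h4
  have h6 := abs_mul_sub_mul_le h2 h3
  set t := K 1 1 + K 2 2 with ht
  set d := K 1 1 * K 2 2 - K 1 2 * K 2 1 with hd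
  rw [abs_le] at h1 h4
  have t1 : 0.7757 ≤ -t := by linarith [h1.2, h4.2]
  have t2 : -t ≤ 0.7759 := by linarith [h1.1, h4.1]
  have d1 : 0.1753 ≤ -d ∧ -d ≤ 0.17554 := by
    rw [abs_le] at h5 h6
    norm_num [abs_of_pos] at h5 h6
    constructor <;> linarith [h5.1, h5.2, h6.1, h6.2]
  have s1 : 1.3028 ≤ t ^ 2 - 4 * d := by nlinarith [d1.1]
  have s2 : t ^ 2 - 4 * d ≤ 1.3043 := by nlinarith [d1.2]
  have hs := Real.sq_sqrt (show 0 ≤ t ^ 2 - 4 * d by linarith)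
  have r1 : 1.1414 ≤ √(t ^ 2 - 4 * d) := Real.le_sqrt_of_sq_le (by norm_num; linarith)
  have r2 : √(t ^ 2 - 4 * d) ≤ 1.1421 := (Real.sqrt_le_left (by norm_num)).2 (by norm_num; linarith)
  generalize √(t ^ 2 - 4 * d) = r at hs r1 r2
  exact ⟨(t + r) / 2, (t - r) / 2, by ring, by linear_combination hs / 4, by linarith, by linarith,
    by linarith, by linarith⟩

/-- These are the two values of `2 cos 6φ`; they are near `-0.9` and `-0.3`, well inside `(-2, 2)`
and apart from each other. -/
lemma abs_lt_two_of_bounds {l m : ℝ} (h1 : 0.1827 < l) (h2 : l < 0.1833) (h3 : 0.9584 < -m)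
    (h4 : -m < 0.9591) :
    (|((2 * l) ^ 2 - 2) ^ 3 - 3 * ((2 * l) ^ 2 - 2)| < 2 ∧
      |((2 * m) ^ 2 - 2) ^ 3 - 3 * ((2 * m) ^ 2 - 2)| < 2) ∧
    ((2 * l) ^ 2 - 2) ^ 3 - 3 * ((2 * l) ^ 2 - 2) ≠
      ((2 * m) ^ 2 - 2) ^ 3 - 3 * ((2 * m) ^ 2 - 2) := by
  have u1 : 1.865 ≤ 2 - (2 * l) ^ 2 := by nlinarith
  have u2 : 2 - (2 * l) ^ 2 ≤ 1.867 := by nlinarith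
  have v1 : 1.674 ≤ (2 * m) ^ 2 - 2 := by nlinarith
  have v2 : (2 * m) ^ 2 - 2 ≤ 1.68 := by nlinarith
  have u3 := pow_le_pow_left₀ (by norm_num) u1 3
  have u4 := pow_le_pow_left₀ (by linarith) u2 3
  have v3 := pow_le_pow_left₀ (by norm_num) v1 3
  have v4 := pow_le_pow_left₀ (by linarith) v2 3
  have e : ((2 * l) ^ 2 - 2) ^ 3 = -(2 - (2 * l) ^ 2) ^ 3 := by ring
  rw [e]
  norm_num at u3 u4 v3 v4
  refine ⟨⟨abs_lt.2 ⟨by linarith, by linarith⟩, abs_lt.2 ⟨by linarith, by linarith⟩⟩, ?_⟩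
  intro h
  linarith

namespace TwelfthOrbit

variable {α β θ : ℝ} {q : ℕ → ℝ → Phase} {X : ℕ → ℝ → Matrix Idx Idx ℝ}

lemma symplectic_mul_Y₀ (h : TwelfthOrbit α β θ q X) :
    (X 3 1 * Y₀)ᵀ * symJ * (X 3 1 * Y₀) = symJ := by
  rw [Matrix.transpose_mul, show Y₀ᵀ * (X 3 1)ᵀ * symJ * (X 3 1 * Y₀) =
    Y₀ᵀ * ((X 3 1)ᵀ * symJ * X 3 1) * Y₀ by noncomm_ring, (h.symplectic_one (by norm_num)).1,
    Y₀_symplectic]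

/-- At time `τ` the orbit is at a point fixed by `S_r`, where `S_r` therefore reverses the flow
direction. This direction is transported from the initial collision, where it is a multiple of the
first column of `Y₀`. Hence `B⁻¹ S_r B` sends the first basis vector to its negative, and the first
column of its block `-Kᵀ` is known exactly. -/
lemma kMat_zero (h : TwelfthOrbit α β θ q X) (hα : 0 < α) (j : Fin 3) :
    kMat (X 3 1) 0 j = (1 : Matrix (Fin 3) (Fin 3) ℝ) 0 j := by
  have hB := h.symplectic_mul_Y₀
  have hd := (Matrix.isUnit_iff_isUnit_det _).1 (symplectic_isUnit hB)
  obtain ⟨b, c, hbc⟩ := conj_eq_fromBlocks hB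
  have h1 : Sr *ᵥ (X 3 1 *ᵥ Pi.single (Sum.inl 0) 1) = -(X 3 1 *ᵥ Pi.single (Sum.inl 0) 1) := by
    have h2 := h.mulVec_hamVec
    have h3 := hamVec_Sr (q 3 1)
    rw [h.final, ← h2, h.initial, hamVec_collision hα, Matrix.mulVec_smul, Matrix.mulVec_smul,
      ← smul_neg] at h3
    have hne : (2 * √2 * α ^ 4 : ℝ) ≠ 0 := by positivity
    rw [neg_eq_iff_eq_neg.1 (smul_right_injective _ hne h3).symm]
  have h4 : ((X 3 1 * Y₀)⁻¹ * Sr * (X 3 1 * Y₀)) *ᵥ Pi.single (Sum.inl 0) 1 =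
      -Pi.single (Sum.inl 0) 1 := by
    rw [← Matrix.mulVec_mulVec, ← Matrix.mulVec_mulVec, ← Matrix.mulVec_mulVec, Y₀_mulVec.1, h1]
    conv_lhs => rw [← Y₀_mulVec.1]
    rw [Matrix.mulVec_neg, Matrix.mulVec_mulVec, Matrix.mulVec_mulVec, Matrix.mul_assoc,
      Matrix.nonsing_inv_mul _ hd, Matrix.one_mulVec]
  rw [hbc, Matrix.mulVec_single_one] at h4
  have h5 := congrFun h4 (Sum.inl j)
  simp only [Matrix.col_apply, Matrix.fromBlocks_apply₁₁, Matrix.neg_apply,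
    Matrix.transpose_apply, Pi.neg_apply, neg_inj] at h5
  rw [kMat, h5]
  fin_cases j <;> rfl

end TwelfthOrbit

end

end CubicOrbit

end

/-! ### Assembly of the main theorem -/

theorem mainTheorem1 :
    ∃ (α β τ : ℝ) (γ : ℝ → CubicOrbit.Phase)
      (X : ℝ → Matrix CubicOrbit.Idx CubicOrbit.Idx ℝ)
      (W : Matrix CubicOrbit.Idx CubicOrbit.Idx ℝ)
      (K : Matrix (Fin 3) (Fin 3) ℝ) (ℓ₁ ℓ₂ : ℝ),
      -- the cubic orbit, with its initial data and its period
      |α - 3.100685| < 0.0005 ∧ |β - 0.668162| < 0.0005 ∧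
      |12 * τ - 0.124736| < 0.000005 ∧
      CubicOrbit.IsCubicOrbit (-1) α β τ γ ∧
      (∀ s : ℝ, γ (s + 12 * τ) = γ s) ∧
      (∀ T : ℝ, 0 < T → (∀ s : ℝ, γ (s + T) = γ s) → 12 * τ ≤ T) ∧
      -- the linearized flow and the linear stability of the orbit
      CubicOrbit.IsFundamentalSolution (CubicOrbit.regHam (-1)) γ X ∧
      CubicOrbit.LinearlyStable 1 (X (12 * τ)) ∧
      -- the reduction of the monodromy matrix to one twelfth of the orbit
      IsUnit CubicOrbit.Y₀ ∧ IsUnit (X τ * CubicOrbit.Y₀) ∧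
      W = CubicOrbit.reducedMatrix (X τ * CubicOrbit.Y₀) ∧
      X (12 * τ) = CubicOrbit.Y₀ * W ^ 6 * CubicOrbit.Y₀⁻¹ ∧
      (1 / 2 : ℝ) • (W + W⁻¹) = Matrix.fromBlocks K.transpose 0 0 K ∧
      K 0 0 = 1 ∧ K 0 1 = 0 ∧ K 0 2 = 0 ∧
      -- the eigenvalues of the lower right block of `K`
      (!![K 1 1, K 1 2; K 2 1, K 2 2]).charpoly =
        (Polynomial.X - Polynomial.C ℓ₁) * (Polynomial.X - Polynomial.C ℓ₂) ∧
      |ℓ₁ - 0.1836| < 0.001 ∧ |ℓ₂ - (-0.959)| < 0.001 := by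
  obtain ⟨α, β, θ, q, X, hα, hβ, hθ, h, hX⟩ := CubicOrbit.exists_twelfthOrbit
  rw [abs_lt] at hα hβ hθ
  have hα0 : 0 < α := by linarith [hα.1]
  have hθ0 : 0 < θ := by linarith [hθ.1]
  obtain ⟨γ, Y, h1, h2, h3, h4, h5, h6⟩ :=
    h.exists_orbit hα0 (by linarith [hβ.1]) hθ0
  obtain ⟨l, m, e1, e2, l1, l2, m1, m2⟩ := (CubicOrbit.kBounds_kMat hX).exists_eigenvalues
  have hB := h.symplectic_mul_Y₀
  have hBu := CubicOrbit.symplectic_isUnit hB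
  have hK := CubicOrbit.half_reducedMatrix_add_inv hB
  have k0 := h.kMat_zero hα0
  have hW := CubicOrbit.reducedMatrix_inv hBu
  have hWu : IsUnit (CubicOrbit.reducedMatrix (X 3 1 * CubicOrbit.Y₀)) :=
    CubicOrbit.isUnit_reducedMatrix hBu
  have hM := CubicOrbit.Y₀_mul_reducedMatrix_pow_mul_inv (X 3 1) 6
  have hc := CubicOrbit.charpoly_pow_six hWu CubicOrbit.signMat_mul_self hW hK
    (⟨k0 0, k0 1, k0 2, e1, e2⟩ : CubicOrbit.IsReducedBlock _ 1 l m)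
  obtain ⟨⟨b1, b2⟩, b3⟩ := CubicOrbit.abs_lt_two_of_bounds l1 l2 m1 m2
  -- A twelfth of the orbit consists of four pieces of length `2` in the scaled time, so `τ = 8 θ`.
  refine ⟨α, β, 8 * θ, γ, Y, _, CubicOrbit.kMat (X 3 1), l, m, ?_, ?_, ?_, h1, h2, h3, h4, ?_,
    CubicOrbit.isUnit_Y₀, ?_, rfl, ?_, ?_, k0 0, k0 1, k0 2, ?_, ?_, ?_⟩
  · exact abs_lt.2 ⟨by linarith [hα.1], by linarith [hα.2]⟩
  · exact abs_lt.2 ⟨by linarith [hβ.1], by linarith [hβ.2]⟩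
  · exact abs_lt.2 ⟨by linarith [hθ.1], by linarith [hθ.2]⟩
  · refine CubicOrbit.linearlyStable_of_charpoly b1 b2 b3 ?_
    -- The monodromy matrix is `Y₀ W⁶ Y₀⁻¹`, and conjugation does not change the characteristic
    -- polynomial.
    rw [← hc, h6, CubicOrbit.TwelfthOrbit.halfMat, ← hM, Matrix.mul_assoc,
      Matrix.charpoly_mul_comm, Matrix.mul_assoc, Matrix.nonsing_inv_mul _
      ((Matrix.isUnit_iff_isUnit_det _).1 CubicOrbit.isUnit_Y₀), Matrix.mul_one]
  · rwa [h5]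
  · rw [h5, hM, h6, CubicOrbit.TwelfthOrbit.halfMat]
  · rw [h5]
    exact hK
  · rw [Matrix.charpoly_fin_two, Matrix.trace_fin_two_of, Matrix.det_fin_two_of, e1, e2]
    simp only [map_add, map_mul]
    ring
  · exact abs_lt.2 ⟨by linarith, by linarith⟩
  · exact abs_lt.2 ⟨by linarith, by linarith⟩
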